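/- **Setting.** Let $k$ be a commutative $\mathbb Q$-algebra, $A$ a unital associative $\mathbb Z/2$-graded $k$-algebra, $\bar A=A/k\cdot 1$, and $D\in A$ an odd element. Write $\deg a$ for the parity of $a$ and $|a|=\deg a-1$; $\Sigma_{i}^{j}=|a_i|+\dots+|a_j|$ (zero if $i>j$). Put $C=\bigoplus_{n\ge 0}A\otimes\bar A^{\otimes n}$, with elements $(a_0,\dots,a_n)$ of parity $\deg\alpha=\deg a_0+\dots+\deg a_n+n$. All formulas are for homogeneous $a_i$ and extended linearly. Let $m(x,y)=(-1)^{\deg x}xy$ and $$b(a_0,\dots,a_n)=\sum_{j=0}^{n-1}(-1)^{\Sigma_0^{j-1}}(a_0,\dots,m(a_j,a_{j+1}),\dots,a_n)+(-1)^{|a_n|\Sigma_0^{n-1}}(m(a_n,a_0),a_1,\dots,a_{n-1})$$ (the last term is absent for $n=0$), and $$B(a_0,\dots,a_n)=\sum_{q=1}^{n+1}(-1)^{\Sigma_0^{q-1}\Sigma_q^n}(1,a_q,\dots,a_n,a_0,\dots,a_{q-1}).$$ **Cochains.** A cochain is a linear map $E:\bigoplus_d\bar A^{\otimes d}\to A$;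 all cochains below are even (map degree plus number of arguments is even). The product is $(E\smile E')(a_1,\dots,a_d)=\sum_i E(a_1,\dots,a_i)E'(a_{i+1},\dots,a_d)$. An element $x\in A$ is the cochain that is $x$ on the empty word and zero on the others. A string $(D_0,\dots,D_m)$ of even cochains acts on $C$ by $\alpha\bullet(D_0,\dots,D_m)=\alpha\bullet_1+\alpha\bullet_2+\alpha\bullet_3$, where for $\alpha=(a_0,\dots,a_n)$: * $\bullet_1$ is the sum of the terms $\pm(a_0D_0(a_1,\dots),\dots,D_1(\dots),\dots,D_m(\dots),\dots,a_n)$, in which $D_0,\dots,D_m$ take consecutive disjoint (possibly empty) strings of arguments, in this order, the string of $D_0$ starting with $a_1$ if it is non-empty; the sign has a factor $(-1)^{|a_i|}$ for every pair $(D_p,a_i)$, $p>0$, such that $D_p$ stands, or its string of arguments starts, at or to the left of $a_i$; * $\bullet_2$ (zero for $m=0$) is the sum of the terms $\pm(D_m(a_q,\dots,a_n,a_0,\dots,a_{i_0})D_0(a_{i_0+1},\dots),\dots,D_1(\dots),\dots,D_{m-1}(\dots),\dots,a_{q-1})$, $1\le q\le n+1$, with sign $(-1)^{\Sigma_0^{q-1}\Sigma_q^n}$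 times the sign of $\bullet_1$ for $D_0,\dots,D_{m-1}$ times $(-1)^{\deg\alpha+m}$; * $\bullet_3$ is the sum, over $1\le q\le n+1$ and $0\le p\le m$, of the terms $\pm(1,a_q,\dots,D_{p+1}(\dots),\dots,D_m(\dots),\dots,D_0(\dots),\dots,D_1(\dots),\dots,D_p(\dots),\dots,a_{q-1})$, where all the cochains $D_{p+1},\dots,D_m,D_0,\dots,D_p$ are inserted in this order into the rotated word $a_q,\dots,a_n,a_0,\dots,a_{q-1}$ so that $D_0(\dots)$ stands to the right of $a_0$ (where $a_0$ may be an argument of one of $D_{p+1},\dots,D_m$); the sign is $(-1)^{\Sigma_0^{q-1}\Sigma_q^n+(p+1)(m-p)+\deg\alpha}$ times a factor $(-1)^{|a_i|}$ for every pair $(D_r,a_i)$, $0\le r\le m$, such that $D_r$ stands, or its string of arguments starts, at or to the left of $a_i$. Put $$E\star(D_0,\dots,D_m)=(E\smile D_0,D_1,\dots,D_m)+\sum_{p=0}^m\sum_{r=0}^{m-p}(-1)^{(p+1)(m-p)+r}(1,D_{p+1},\dots,D_{p+r},E,D_{p+r+1},\dots,D_m,D_0,\dots,D_p)$$ and, for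 even cochains $D_1,\dots,D_m$, $$J(D_1\wedge\dots\wedge D_m)\,\alpha=\frac1{m!}\sum_{\sigma\in S_m}\alpha\bullet\bigl(D_{\sigma1}\star(D_{\sigma2}\star(\cdots\star (D_{\sigma m}\star(1))\cdots))\bigr).$$ **The Chern character.** Let $\mathrm{ad}\,D$ be the one-cochain $a\mapsto[D,a]=Da-(-1)^{\deg a}aD$, let $\nabla=\mathrm{ad}\,D-D^2$ and $$L_D(a_0,\dots,a_n)=\sum_{j=0}^n(a_0,\dots,a_j,D,a_{j+1},\dots,a_n).$$ Convergence is made explicit by a formal variable $t$: replacing $D$ by $tD$, put $\nabla_t=t\,\mathrm{ad}\,D-t^2D^2$ and $$\mathrm{ch}(tD)=X(\nabla_t)\,e^{tL_D}\in\mathrm{End}_k(C)[[t]],\qquad X(\nabla_t)=J(e^{-\nabla_t})=\sum_{m\ge0}\frac{(-1)^m}{m!}J(\nabla_t^{\wedge m}).$$ Let $\mathrm{ch}_N\in \mathrm{End}_k(C)$ be the coefficient of $t^N$, so that $\mathrm{ch}(D)=\sum_N\mathrm{ch}_N$ formally. **Theorem 9.1.** 1. $\mathrm{ch}(tD)$ is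 even (it preserves the parity of chains), and $[B+b,\mathrm{ch}(tD)]=0$ in $\mathrm{End}_k(C)[[t]]$; that is, $(B+b)\,\mathrm{ch}_N=\mathrm{ch}_N\,(B+b)$ for all $N$. 2. Consequently $[B+b,\mathrm{ch}(D)]=0$ wherever the series converges: let $F$ be a $k$-module with a Hausdorff topology, $d:F\to F$ a continuous linear map, and $u:C\to F$ a linear map with $u(B+b)=du$. If for some $\alpha\in C$ the series $\sum_Nu(\mathrm{ch}_N\alpha)$ and $\sum_Nu(\mathrm{ch}_N(B+b)\alpha)$ converge in $F$, with sums $s$ and $s'$, then $ds=s'$. 3. The component of $\mathrm{ch}(D)$ in $A$ is the JLO/Getzler–Szenes cochain (up to the sign $(-1)^n$, i.e. up to replacing $D$ by $-D$): for all $n$ and $a_0,\dots,a_n\in A$, $$\mathrm{ch}(D)(a_0,\dots,a_n)_{A}=(-1)^n\int_{t_0+\dots+t_n=1,\ t_i\ge0}a_0e^{-t_0D^2}[D,a_1]e^{-t_1D^2}\cdots[D,a_n]e^{-t_nD^2}\,dt_0\cdots dt_{n-1}.$$ This holds formally: for every $N$, the component in $A$ of $\mathrm{ch}_N(a_0,\dots,a_n)$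 is the part of order $N$ in $D$ of the right-hand side, $$(-1)^n\sum_{j_0,\dots,j_n\ge0,\ n+2(j_0+\dots+j_n)=N}\frac{(-1)^{j_0+\dots+j_n}}{(n+j_0+\dots+j_n)!}\,a_0D^{2j_0}[D,a_1]D^{2j_1}\cdots[D,a_n]D^{2j_n};$$ and it holds analytically: for every ring homomorphism $f$ from $A$ to a real Banach algebra, the series of the images under $f$ of the components in $A$ of $\mathrm{ch}_N(a_0,\dots,a_n)$ converges to $$(-1)^n\int_{t_0+\dots+t_n=1,\ t_i\ge0} f(a_0)e^{-t_0f(D)^2}f([D,a_1])e^{-t_1f(D)^2}\cdots f([D,a_n])e^{-t_nf(D)^2}\,dt_0\cdots dt_{n-1}.$$ -/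

import Mathlib

open scoped TensorProduct

set_option linter.unusedSectionVars false

noncomputable section

namespace BivariantJLO

/-! ### Words

A word `a₁ ⊗ ⋯ ⊗ aₙ` in letters from a module `V` is an element of the tensor algebra
`TensorAlgebra k V = ⨁ₙ V^{⊗ n}`, namely the product `ι a₁ * ⋯ * ι aₙ`.  In the comments
`w = u v` under a sum sign means: sum over all ways of cutting the word `w` into two consecutive
(possibly empty) pieces. -/

section Words

variable {k : Type*} [CommRing k]
variable {V : Type*} [AddCommGroup V] [Module k V]
variable {N : Type*} [AddCommGroup N] [Module k N]

/-- The right fold over words: `foldWord step n₀ (a₁ ⊗ ⋯ ⊗ aₙ) = step a₁ (⋯ (step aₙ n₀))`. -/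
def foldWord (step : V →ₗ[k] N →ₗ[k] N) (n₀ : N) : TensorAlgebra k V →ₗ[k] N :=
  LinearMap.applyₗ n₀ ∘ₗ
    (TensorAlgebra.lift k (A := Module.End k N) step).toLinearMap

@[simp] theorem foldWord_one (step : V →ₗ[k] N →ₗ[k] N) (n₀ : N) :
    foldWord step n₀ 1 = n₀ := by
  simp [foldWord]

@[simp] theorem foldWord_ι_mul (step : V →ₗ[k] N →ₗ[k] N) (n₀ : N) (a : V)
    (w : TensorAlgebra k V) :
    foldWord step n₀ (TensorAlgebra.ι k a * w) = step a (foldWord step n₀ w) := by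
  simp [foldWord]

/-- One step of the recursion `Δ (a w) = 1 ⊗ (a w) + (a ⊗ 1) Δ w`, on pairs `(w, Δ w)`. -/
def deconcatStep : V →ₗ[k]
    (TensorAlgebra k V × (TensorAlgebra k V ⊗[k] TensorAlgebra k V)) →ₗ[k]
    (TensorAlgebra k V × (TensorAlgebra k V ⊗[k] TensorAlgebra k V)) :=
  LinearMap.mk₂ k
    (fun a p => (TensorAlgebra.ι k a * p.1,
      1 ⊗ₜ[k] (TensorAlgebra.ι k a * p.1) + (TensorAlgebra.ι k a ⊗ₜ[k] 1) * p.2))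
    (fun a a' p => by
      simp only [map_add, add_mul, TensorProduct.tmul_add, TensorProduct.add_tmul, Prod.mk_add_mk]
      rw [add_add_add_comm])
    (fun c a p => by
      simp only [map_smul, smul_mul_assoc, TensorProduct.tmul_smul, Prod.smul_mk, smul_add,
        ← TensorProduct.smul_tmul'])
    (fun a p p' => by
      simp only [Prod.fst_add, Prod.snd_add, mul_add, TensorProduct.tmul_add, Prod.mk_add_mk]
      rw [add_add_add_comm])
    (fun c a p => by
      simp only [Prod.smul_fst, Prod.smul_snd, mul_smul_comm, TensorProduct.tmul_smul,
        Prod.smul_mk, smul_add])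

@[simp] theorem deconcatStep_apply (a : V)
    (p : TensorAlgebra k V × (TensorAlgebra k V ⊗[k] TensorAlgebra k V)) :
    deconcatStep a p = (TensorAlgebra.ι k a * p.1,
      1 ⊗ₜ[k] (TensorAlgebra.ι k a * p.1) + (TensorAlgebra.ι k a ⊗ₜ[k] 1) * p.2) :=
  rfl

/-- Deconcatenation `w ↦ ∑_{w = u v} u ⊗ v`. -/
def deconcat : TensorAlgebra k V →ₗ[k] TensorAlgebra k V ⊗[k] TensorAlgebra k V :=
  LinearMap.snd k _ _ ∘ₗ foldWord deconcatStep (1, 1 ⊗ₜ[k] 1)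

/-- The convolution `w ↦ ∑_{w = u v} f u * g v`. -/
def conv {R : Type*} [Ring R] [Algebra k R] (f g : TensorAlgebra k V →ₗ[k] R) :
    TensorAlgebra k V →ₗ[k] R :=
  LinearMap.mul' k R ∘ₗ TensorProduct.map f g ∘ₗ deconcat

/-- `w ↦ ∑ u ⊗ a` over `w = u a` with `a` the last letter of `w` (zero on the empty word). -/
def unsnoc : TensorAlgebra k V →ₗ[k] TensorAlgebra k V ⊗[k] V :=
  TensorProduct.map LinearMap.id TensorAlgebra.ιInv ∘ₗ deconcat

/-- `w ↦ ∑ a ⊗ u` over `w = a u` with `a` the first letter of `w` (zero on the empty word). -/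
def uncons : TensorAlgebra k V →ₗ[k] V ⊗[k] TensorAlgebra k V :=
  TensorProduct.map TensorAlgebra.ιInv LinearMap.id ∘ₗ deconcat

/-- The letterwise action on words of a linear map of the letters. -/
def mapWord {V' : Type*} [AddCommGroup V'] [Module k V'] (s : V →ₗ[k] V') :
    TensorAlgebra k V →ₗ[k] TensorAlgebra k V' :=
  (TensorAlgebra.lift k (TensorAlgebra.ι k ∘ₗ s)).toLinearMap

/-- `a ⊗ w ↦ ∑_{w = u v} (a ⊗ u) ⊗ v`. -/
def cut (M V : Type*) [AddCommGroup M] [Module k M] [AddCommGroup V] [Module k V] :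
    M ⊗[k] TensorAlgebra k V →ₗ[k] (M ⊗[k] TensorAlgebra k V) ⊗[k] TensorAlgebra k V :=
  (TensorProduct.assoc k M (TensorAlgebra k V) (TensorAlgebra k V)).symm.toLinearMap ∘ₗ
    LinearMap.lTensor M deconcat

variable [Algebra ℚ k]

/-- The projection to the even part (eigenvalue `1`) of the parity involution `s`. -/
def evenPart (s : N →ₗ[k] N) : N →ₗ[k] N :=
  algebraMap ℚ k (1 / 2) • (LinearMap.id + s)

/-- The projection to the odd part (eigenvalue `-1`) of the parity involution `s`. -/
def oddPart (s : N →ₗ[k] N) : N →ₗ[k] N :=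
  algebraMap ℚ k (1 / 2) • (LinearMap.id - s)

/-- The Koszul transposition `x ⊗ y ↦ (-1)^{|x||y|} y ⊗ x`, the parities `(-1)^{|x|}` and
`(-1)^{|y|}` being given by the involutions `s` and `s'`. -/
def koszulSwap {N' : Type*} [AddCommGroup N'] [Module k N'] (s : N →ₗ[k] N) (s' : N' →ₗ[k] N') :
    N ⊗[k] N' →ₗ[k] N' ⊗[k] N :=
  (TensorProduct.comm k N N').toLinearMap ∘ₗ
    (TensorProduct.map LinearMap.id (evenPart s') + TensorProduct.map s (oddPart s'))

/-- Signed cyclic rotations `a ⊗ w ↦ ∑_{w = u v} (-1)^{|v| (|a| + |u|)} v ⊗ (a ⊗ u)`; here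
`(-1)^{|a|}` is given by `sM` for the letter `a` in front and by `sV` for the letters of `w`. -/
def rotate {M : Type*} [AddCommGroup M] [Module k M] (sM : M →ₗ[k] M) (sV : V →ₗ[k] V) :
    M ⊗[k] TensorAlgebra k V →ₗ[k] TensorAlgebra k V ⊗[k] (M ⊗[k] TensorAlgebra k V) :=
  koszulSwap (TensorProduct.map sM (mapWord sV)) (mapWord sV) ∘ₗ cut M V

end Words

section WordLemmas

variable {k : Type*} [CommRing k]
variable {V : Type*} [AddCommGroup V] [Module k V]

theorem word_induction {P : TensorAlgebra k V → Prop} (h_one : P 1)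
    (h_add : ∀ x y, P x → P y → P (x + y)) (h_smul : ∀ (c : k) x, P x → P (c • x))
    (h_cons : ∀ a w, P w → P (TensorAlgebra.ι k a * w)) (w : TensorAlgebra k V) : P w := by
  suffices h : ∀ w x : TensorAlgebra k V, P x → P (w * x) by simpa using h w 1 h_one
  intro w
  induction w using TensorAlgebra.induction with
  | algebraMap r => intro x hx; rw [← Algebra.smul_def]; exact h_smul _ _ hx
  | ι a => intro x hx; exact h_cons _ _ hx
  | mul a b ha hb => intro x hx; rw [mul_assoc]; exact ha _ (hb _ hx)
  | add a b ha hb => intro x hx; rw [add_mul]; exact h_add _ _ (ha _ hx) (hb _ hx)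

theorem foldWord_deconcatStep_fst (w : TensorAlgebra k V) :
    (foldWord deconcatStep (1, 1 ⊗ₜ[k] 1) w).1 = w := by
  induction w using word_induction with
  | h_one => simp
  | h_add x y hx hy => rw [map_add, Prod.fst_add, hx, hy]
  | h_smul c x hx => rw [map_smul, Prod.smul_fst, hx]
  | h_cons a w hw => rw [foldWord_ι_mul, deconcatStep_apply, hw]

@[simp] theorem deconcat_one : deconcat (1 : TensorAlgebra k V) = 1 ⊗ₜ[k] 1 := by
  simp [deconcat]

theorem deconcat_ι_mul (a : V) (w : TensorAlgebra k V) :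
    deconcat (TensorAlgebra.ι k a * w) =
      1 ⊗ₜ[k] (TensorAlgebra.ι k a * w) + (TensorAlgebra.ι k a ⊗ₜ[k] 1) * deconcat w := by
  rw [deconcat, LinearMap.comp_apply, foldWord_ι_mul, deconcatStep_apply,
    foldWord_deconcatStep_fst]
  rfl

theorem conv_ι_mul {R : Type*} [Ring R] [Algebra k R] (f g : TensorAlgebra k V →ₗ[k] R)
    (a : V) (w : TensorAlgebra k V) :
    conv f g (TensorAlgebra.ι k a * w) =
      f 1 * g (TensorAlgebra.ι k a * w) +
        conv (f ∘ₗ LinearMap.mulLeft k (TensorAlgebra.ι k a)) g w := by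
  simp only [conv, LinearMap.comp_apply, deconcat_ι_mul, map_add, TensorProduct.map_tmul,
    LinearMap.mul'_apply]
  congr 1
  induction deconcat w using TensorProduct.induction_on with
  | zero => simp
  | tmul x y => simp
  | add x y hx hy => simp only [mul_add, map_add, hx, hy]

@[simp] theorem ιInv_one : TensorAlgebra.ιInv (1 : TensorAlgebra k V) = 0 := by
  let : Module kᵐᵒᵖ V := Module.compHom _ ((RingHom.id k).fromOpposite mul_comm)
  have : IsCentralScalar k V := ⟨fun r m => rfl⟩
  simp [TensorAlgebra.ιInv]

theorem ιInv_ι_mul (a : V) (w : TensorAlgebra k V) :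
    TensorAlgebra.ιInv (TensorAlgebra.ι k a * w) = TensorAlgebra.algebraMapInv w • a := by
  let : Module kᵐᵒᵖ V := Module.compHom _ ((RingHom.id k).fromOpposite mul_comm)
  have : IsCentralScalar k V := ⟨fun r m => rfl⟩
  have h : (TrivSqZeroExt.fstHom k k V).comp TensorAlgebra.toTrivSqZeroExt =
      (TensorAlgebra.algebraMapInv : TensorAlgebra k V →ₐ[k] k) := by
    ext x
    simp [TensorAlgebra.algebraMapInv]
  have h2 : (TensorAlgebra.toTrivSqZeroExt w).fst = TensorAlgebra.algebraMapInv w :=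
    DFunLike.congr_fun h w
  simp [TensorAlgebra.ιInv, h2]

theorem counit_deconcat (w : TensorAlgebra k V) :
    TensorProduct.lid k _ (TensorProduct.map TensorAlgebra.algebraMapInv.toLinearMap
      LinearMap.id (deconcat w)) = w := by
  induction w using word_induction with
  | h_one => simp
  | h_add x y hx hy => simp only [map_add, hx, hy]
  | h_smul c x hx => simp only [map_smul, hx]
  | h_cons a w hw =>
    rw [deconcat_ι_mul]
    simp only [map_add, TensorProduct.map_tmul, AlgHom.toLinearMap_apply, map_one,
      LinearMap.id_apply, TensorProduct.lid_tmul, one_smul, add_eq_left]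
    induction deconcat w using TensorProduct.induction_on with
    | zero => simp
    | tmul x y => simp [TensorAlgebra.algebraMapInv]
    | add x y hx hy => simp only [mul_add, map_add, hx, hy, add_zero]

@[simp] theorem uncons_one : uncons (1 : TensorAlgebra k V) = 0 := by
  simp [uncons]

theorem uncons_ι_mul (a : V) (w : TensorAlgebra k V) :
    uncons (TensorAlgebra.ι k a * w) = a ⊗ₜ[k] w := by
  conv_rhs => rw [← counit_deconcat w]
  simp only [uncons, LinearMap.comp_apply, deconcat_ι_mul, map_add, TensorProduct.map_tmul,
    ιInv_one, TensorProduct.zero_tmul, zero_add]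
  induction deconcat w using TensorProduct.induction_on with
  | zero => simp
  | tmul x y => simp [ιInv_ι_mul, TensorProduct.smul_tmul]
  | add x y hx hy => simp only [mul_add, map_add, hx, hy, TensorProduct.tmul_add]

@[simp] theorem unsnoc_one : unsnoc (1 : TensorAlgebra k V) = 0 := by
  simp [unsnoc]

theorem unsnoc_ι_mul (a : V) (w : TensorAlgebra k V) :
    unsnoc (TensorAlgebra.ι k a * w) = TensorAlgebra.algebraMapInv w • (1 ⊗ₜ[k] a) +
      LinearMap.rTensor V (LinearMap.mulLeft k (TensorAlgebra.ι k a)) (unsnoc w) := by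
  simp only [unsnoc, LinearMap.comp_apply, deconcat_ι_mul, map_add, TensorProduct.map_tmul,
    ιInv_ι_mul, LinearMap.id_apply, TensorProduct.tmul_smul]
  congr 1
  induction deconcat w using TensorProduct.induction_on with
  | zero => simp
  | tmul x y => simp
  | add x y hx hy => simp only [mul_add, map_add, hx, hy]

@[simp] theorem mapWord_one {V' : Type*} [AddCommGroup V'] [Module k V'] (s : V →ₗ[k] V') :
    mapWord s 1 = 1 := by
  simp [mapWord]

@[simp] theorem mapWord_ι_mul {V' : Type*} [AddCommGroup V'] [Module k V'] (s : V →ₗ[k] V')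
    (a : V) (w : TensorAlgebra k V) :
    mapWord s (TensorAlgebra.ι k a * w) = TensorAlgebra.ι k (s a) * mapWord s w := by
  simp [mapWord]

theorem mapWord_mul {V' : Type*} [AddCommGroup V'] [Module k V'] (s : V →ₗ[k] V')
    (v w : TensorAlgebra k V) :
    mapWord s (v * w) = mapWord s v * mapWord s w := by
  simp [mapWord]

end WordLemmas

/-! ### The superalgebra -/

section Algebra

variable (k : Type*) [CommRing k] (A : Type*) [Ring A] [Algebra k A]

/-- `Ā = A / k·1`. -/
abbrev Abar : Type _ := A ⧸ Submodule.span k {(1 : A)}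

/-- The projection `A → Ā`. -/
abbrev toBar : A →ₗ[k] Abar k A := (Submodule.span k {(1 : A)}).mkQ

/-- Words in `Ā`. -/
abbrev Words : Type _ := TensorAlgebra k (Abar k A)

/-- The normalized chains `⨁ₙ A ⊗ Ā^{⊗ n}`. -/
abbrev Chains : Type _ := A ⊗[k] Words k A

/-- Normalized Hochschild cochains `∏_d Hom (Ā^{⊗ d}, A)`. -/
abbrev Cochains : Type _ := Words k A →ₗ[k] A

/-- Chains `D₀ ⊗ D₁ ⊗ ⋯ ⊗ D_m` of the algebra of Hochschild cochains. -/
abbrev CochainChains : Type _ := Cochains k A ⊗[k] TensorAlgebra k (Cochains k A)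

variable {k A}

/-- The chain `(a₀, …, aₙ) = a₀ ⊗ ā₁ ⊗ ⋯ ⊗ āₙ`. -/
def chain {n : ℕ} (a₀ : A) (a : Fin n → A) : Chains k A :=
  a₀ ⊗ₜ[k] (List.ofFn fun i => TensorAlgebra.ι k (toBar k A (a i))).prod

/-- The component in `A` of a chain. -/
def degreeZero : Chains k A →ₗ[k] A :=
  (TensorProduct.rid k A).toLinearMap ∘ₗ
    LinearMap.lTensor A (TensorAlgebra.algebraMapInv (R := k) (M := Abar k A)).toLinearMap

variable (𝒜 : ZMod 2 → Submodule k A) [GradedAlgebra 𝒜]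

/-- The grading involution `a ↦ (-1)^{deg a} a`. -/
def parity : A →ₗ[k] A :=
  GradedAlgebra.proj 𝒜 0 - GradedAlgebra.proj 𝒜 1

theorem parity_one : parity 𝒜 1 = 1 := by
  have h1 : (1 : A) ∈ 𝒜 0 := SetLike.GradedOne.one_mem
  have h0 : (0 : ZMod 2) ≠ 1 := by decide
  rw [parity, LinearMap.sub_apply, GradedAlgebra.proj_apply, GradedAlgebra.proj_apply,
    DirectSum.decompose_of_mem_same 𝒜 h1, DirectSum.decompose_of_mem_ne 𝒜 h1 h0, sub_zero]

/-- The shifted parity `a ↦ (-1)^{|a|} a`, `|a| = deg a - 1`. -/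
def shift : A →ₗ[k] A := -parity 𝒜

/-- The shifted parity on `Ā`. -/
def shiftBar : Abar k A →ₗ[k] Abar k A :=
  Submodule.mapQ _ _ (shift 𝒜) (by
    rw [Submodule.span_le, Set.singleton_subset_iff]
    simp [shift, parity_one, Submodule.mem_span_singleton_self])

/-- The sign `(-1)^{|a₁| + ⋯ + |aₙ|}` on words in `Ā`. -/
abbrev sgn : Words k A →ₗ[k] Words k A := mapWord (shiftBar 𝒜)

/-- The sign `(-1)^{deg α}` on chains, `deg (a₀, …, aₙ) = deg a₀ + ⋯ + deg aₙ + n`. -/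
def chainParity : Chains k A →ₗ[k] Chains k A :=
  TensorProduct.map (parity 𝒜) (sgn 𝒜)

/-! ### Descent from words in `A` to words in `Ā` -/

/-- The span of the words in `A` with a letter `1`. -/
def degenerate (k A : Type*) [CommRing k] [Ring A] [Algebra k A] :
    Submodule k (TensorAlgebra k A) :=
  Submodule.span k {x | ∃ u v : TensorAlgebra k A, x = u * TensorAlgebra.ι k 1 * v}

theorem degenerate_le_comap (a : A) :
    degenerate k A ≤ (degenerate k A).comap (LinearMap.mulLeft k (TensorAlgebra.ι k a)) := by
  refine Submodule.span_le.2 ?_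
  rintro _ ⟨u, v, rfl⟩
  exact Submodule.subset_span ⟨TensorAlgebra.ι k a * u, v, by simp [mul_assoc]⟩

/-- Prepending a letter in `A`, modulo degenerate words. -/
def prependA : A →ₗ[k]
    (TensorAlgebra k A ⧸ degenerate k A) →ₗ[k] (TensorAlgebra k A ⧸ degenerate k A) where
  toFun a := Submodule.mapQ _ _ (LinearMap.mulLeft k (TensorAlgebra.ι k a)) (degenerate_le_comap a)
  map_add' a a' := by
    ext x
    simp [add_mul]
  map_smul' c a := by
    ext x
    simp

/-- Prepending a letter in `Ā`, modulo degenerate words. -/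
def prepend : Abar k A →ₗ[k]
    (TensorAlgebra k A ⧸ degenerate k A) →ₗ[k] (TensorAlgebra k A ⧸ degenerate k A) :=
  Submodule.liftQ _ prependA (by
    rw [Submodule.span_le, Set.singleton_subset_iff]
    change prependA (1 : A) = 0
    refine Submodule.linearMap_qext _ (LinearMap.ext fun x => ?_)
    change Submodule.Quotient.mk (TensorAlgebra.ι k (1 : A) * x) = 0
    rw [Submodule.Quotient.mk_eq_zero]
    exact Submodule.subset_span ⟨1, x, by simp⟩)

/-- Words in `Ā` are words in `A` modulo degenerate words. -/
def liftWord : Words k A →ₗ[k] TensorAlgebra k A ⧸ degenerate k A :=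
  foldWord prepend (Submodule.Quotient.mk 1)

theorem liftWord_mapWord (w : TensorAlgebra k A) :
    liftWord (mapWord (toBar k A) w) = Submodule.Quotient.mk w := by
  suffices h : ∀ w x : TensorAlgebra k A,
      liftWord (mapWord (toBar k A) x) = Submodule.Quotient.mk x →
      liftWord (mapWord (toBar k A) (w * x)) = Submodule.Quotient.mk (w * x) by
    simpa using h w 1 (by simp [mapWord, liftWord])
  intro w
  induction w using TensorAlgebra.induction with
  | algebraMap r =>
    intro x hx
    rw [← Algebra.smul_def, map_smul, map_smul, hx, Submodule.Quotient.mk_smul]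
  | ι a =>
    intro x hx
    have : mapWord (toBar k A) (TensorAlgebra.ι k a * x) =
        TensorAlgebra.ι k (toBar k A a) * mapWord (toBar k A) x := by
      simp [mapWord]
    rw [this, liftWord, foldWord_ι_mul]
    rw [liftWord] at hx
    rw [hx]
    simp [prepend, prependA]
  | mul a b ha hb =>
    intro x hx
    rw [mul_assoc]
    exact ha _ (hb _ hx)
  | add a b ha hb =>
    intro x hx
    rw [add_mul, map_add, map_add, ha x hx, hb x hx, Submodule.Quotient.mk_add]

variable {N : Type*} [AddCommGroup N] [Module k N]

/-- A linear map on `⨁ₙ A ⊗ A^{⊗ n}` that kills the chains with a letter `1` after `a₀`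
descends to the normalized chains. -/
def descend (f : A ⊗[k] TensorAlgebra k A →ₗ[k] N)
    (hf : ∀ (a : A) (u v : TensorAlgebra k A), f (a ⊗ₜ[k] (u * TensorAlgebra.ι k 1 * v)) = 0) :
    Chains k A →ₗ[k] N :=
  TensorProduct.lift (LinearMap.flip
    (Submodule.liftQ (degenerate k A) (LinearMap.flip (TensorProduct.curry f)) (by
      refine Submodule.span_le.2 ?_
      rintro _ ⟨u, v, rfl⟩
      exact LinearMap.ext fun a => hf a u v) ∘ₗ liftWord))

theorem descend_tmul (f : A ⊗[k] TensorAlgebra k A →ₗ[k] N)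
    (hf : ∀ (a : A) (u v : TensorAlgebra k A), f (a ⊗ₜ[k] (u * TensorAlgebra.ι k 1 * v)) = 0)
    (a : A) (w : TensorAlgebra k A) :
    descend f hf (a ⊗ₜ[k] mapWord (toBar k A) w) = f (a ⊗ₜ[k] w) := by
  simp only [descend, TensorProduct.lift.tmul, LinearMap.flip_apply, LinearMap.comp_apply,
    liftWord_mapWord]
  rfl

end Algebra

/-! ### The differentials `b` and `B` -/

section Differentials

variable {k : Type*} [CommRing k] [Algebra ℚ k] {A : Type*} [Ring A] [Algebra k A]
variable (𝒜 : ZMod 2 → Submodule k A) [GradedAlgebra 𝒜]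

/-- The cochain `m (a₁, a₂) = (-1)^{deg a₁} a₁ a₂`, zero on words of length `≠ 2`. -/
def mulCochain : TensorAlgebra k A →ₗ[k] A :=
  conv (parity 𝒜 ∘ₗ TensorAlgebra.ιInv) TensorAlgebra.ιInv

/-- `x ⊗ (y ⊗ u) ↦ m (x, y) ⊗ u`. -/
def mulFront : A ⊗[k] (A ⊗[k] TensorAlgebra k A) →ₗ[k] A ⊗[k] TensorAlgebra k A :=
  LinearMap.rTensor _ (LinearMap.mul' k A ∘ₗ LinearMap.rTensor A (parity 𝒜)) ∘ₗ
    (TensorProduct.assoc k A A (TensorAlgebra k A)).symm.toLinearMap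

/-- `(a₁, …, aₙ) ↦ ∑ⱼ (-1)^{|a₁| + ⋯ + |a_{j-1}|} (a₁, …, m (aⱼ, a_{j+1}), …, aₙ)`. -/
def barDiff : TensorAlgebra k A →ₗ[k] TensorAlgebra k A :=
  conv (mapWord (shift 𝒜)) (conv (TensorAlgebra.ι k ∘ₗ mulCochain 𝒜) LinearMap.id)

/-- `(a₀, …, aₙ) ↦ (-1)^{|aₙ| (|a₀| + ⋯ + |a_{n-1}|)} aₙ ⊗ (a₀, …, a_{n-1})`. -/
def lastToFront : A ⊗[k] TensorAlgebra k A →ₗ[k] A ⊗[k] (A ⊗[k] TensorAlgebra k A) :=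
  koszulSwap (TensorProduct.map (shift 𝒜) (mapWord (shift 𝒜))) (shift 𝒜) ∘ₗ
    (TensorProduct.assoc k A (TensorAlgebra k A) A).symm.toLinearMap ∘ₗ LinearMap.lTensor A unsnoc

/-- The Hochschild differential on `⨁ₙ A ⊗ A^{⊗ n}`,
`(a₀, …, aₙ) ↦ (m (a₀, a₁), a₂, …, aₙ)
  + ∑_{j ≥ 1} (-1)^{|a₀| + ⋯ + |a_{j-1}|} (a₀, …, m (aⱼ, a_{j+1}), …, aₙ)
  + (-1)^{|aₙ| (|a₀| + ⋯ + |a_{n-1}|)} (m (aₙ, a₀), a₁, …, a_{n-1})`. -/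
def bUnreduced : A ⊗[k] TensorAlgebra k A →ₗ[k] A ⊗[k] TensorAlgebra k A :=
  mulFront 𝒜 ∘ₗ LinearMap.lTensor A uncons
    + TensorProduct.map (shift 𝒜) (barDiff 𝒜)
    + mulFront 𝒜 ∘ₗ lastToFront 𝒜

/-- Reduction of the letters `a₁, …, aₙ` modulo `k·1`. -/
abbrev reduceChain (k A : Type*) [CommRing k] [Ring A] [Algebra k A] :
    A ⊗[k] TensorAlgebra k A →ₗ[k] Chains k A :=
  LinearMap.lTensor A (mapWord (toBar k A))

theorem toBar_one : toBar k A 1 = 0 := by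
  rw [toBar, Submodule.mkQ_apply, Submodule.Quotient.mk_eq_zero]
  exact Submodule.mem_span_singleton_self _

theorem mapWord_toBar_degenerate (u v : TensorAlgebra k A) :
    mapWord (toBar k A) (u * TensorAlgebra.ι k 1 * v) = 0 := by
  rw [mul_assoc, mapWord_mul, mapWord_ι_mul, toBar_one]
  simp

theorem mulCochain_one : mulCochain 𝒜 (1 : TensorAlgebra k A) = 0 := by
  simp [mulCochain, conv]

theorem mulCochain_ι_mul (a : A) (w : TensorAlgebra k A) :
    mulCochain 𝒜 (TensorAlgebra.ι k a * w) = parity 𝒜 a * TensorAlgebra.ιInv w := by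
  rw [mulCochain, conv_ι_mul]
  simp only [LinearMap.comp_apply, ιInv_one, map_zero, zero_mul, zero_add]
  conv_rhs => rw [← counit_deconcat w]
  simp only [conv, LinearMap.comp_apply]
  induction deconcat w using TensorProduct.induction_on with
  | zero => simp
  | tmul x y => simp [ιInv_ι_mul]
  | add x y hx hy => simp only [map_add, hx, hy, mul_add]

/-- `x ⊗ u ↦ (parity a * x) u`, as words. -/
def mulHead (a : A) : A ⊗[k] TensorAlgebra k A →ₗ[k] TensorAlgebra k A :=
  LinearMap.mul' k _ ∘ₗ TensorProduct.map
    (TensorAlgebra.ι k ∘ₗ LinearMap.mulLeft k (parity 𝒜 a)) LinearMap.id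

theorem barDiff_ι_mul (a : A) (w : TensorAlgebra k A) :
    barDiff 𝒜 (TensorAlgebra.ι k a * w) =
      mulHead 𝒜 a (uncons w) + TensorAlgebra.ι k (shift 𝒜 a) * barDiff 𝒜 w := by
  rw [barDiff, conv_ι_mul, mapWord_one, one_mul, conv_ι_mul]
  simp only [LinearMap.comp_apply, mulCochain_one, map_zero, zero_mul, zero_add]
  congr 1
  · simp only [mulHead, conv, uncons, LinearMap.comp_apply]
    induction deconcat w using TensorProduct.induction_on with
    | zero => simp
    | tmul x y => simp [mulCochain_ι_mul]
    | add x y hx hy => simp only [map_add, hx, hy]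
  · simp only [conv, LinearMap.comp_apply]
    induction deconcat w using TensorProduct.induction_on with
    | zero => simp
    | tmul x y => simp [mul_assoc]
    | add x y hx hy => simp only [map_add, hx, hy, mul_add]

theorem uncons_degenerate (u v : TensorAlgebra k A) :
    LinearMap.lTensor A (mapWord (toBar k A)) (uncons (u * TensorAlgebra.ι k 1 * v)) =
      TensorAlgebra.algebraMapInv u • (1 ⊗ₜ[k] mapWord (toBar k A) v) := by
  induction u using word_induction with
  | h_one => rw [one_mul, uncons_ι_mul]; simp
  | h_add x y hx hy => simp only [add_mul, map_add, hx, hy, add_smul]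
  | h_smul c x hx => simp only [smul_mul_assoc, map_smul, hx, smul_eq_mul, mul_smul]
  | h_cons a w _ =>
    rw [mul_assoc, mul_assoc, uncons_ι_mul, LinearMap.lTensor_tmul, ← mul_assoc w,
      mapWord_toBar_degenerate]
    simp [TensorAlgebra.algebraMapInv]

theorem toBar_uncons (w : TensorAlgebra k A) :
    LinearMap.mul' k _ (TensorProduct.map (TensorAlgebra.ι k ∘ₗ toBar k A) (mapWord (toBar k A))
      (uncons w)) =
      mapWord (toBar k A) w - algebraMap k _ (TensorAlgebra.algebraMapInv w) := by
  induction w using word_induction with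
  | h_one => simp
  | h_add x y hx hy => simp only [map_add, hx, hy]; abel
  | h_smul c x hx => simp only [map_smul, hx, smul_sub, smul_eq_mul, Algebra.algebraMap_eq_smul_one,
      mul_smul]
  | h_cons a w _ => rw [uncons_ι_mul]; simp [TensorAlgebra.algebraMapInv]

theorem mapWord_mulHead (a : A) (x : A ⊗[k] TensorAlgebra k A) :
    mapWord (toBar k A) (mulHead 𝒜 a x) =
      LinearMap.mul' k _ (TensorProduct.map
        (TensorAlgebra.ι k ∘ₗ toBar k A ∘ₗ LinearMap.mulLeft k (parity 𝒜 a)) LinearMap.id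
        (LinearMap.lTensor A (mapWord (toBar k A)) x)) := by
  induction x using TensorProduct.induction_on with
  | zero => simp
  | tmul x y => simp [mulHead]
  | add x y hx hy => simp only [map_add, hx, hy]

theorem mapWord_mulHead_one (x : A ⊗[k] TensorAlgebra k A) :
    mapWord (toBar k A) (mulHead 𝒜 1 x) =
      LinearMap.mul' k _ (TensorProduct.map (TensorAlgebra.ι k ∘ₗ toBar k A)
        (mapWord (toBar k A)) x) := by
  induction x using TensorProduct.induction_on with
  | zero => simp
  | tmul x y => simp [mulHead, parity_one]
  | add x y hx hy => simp only [map_add, hx, hy]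

theorem barDiff_degenerate (u v : TensorAlgebra k A) :
    mapWord (toBar k A) (barDiff 𝒜 (u * TensorAlgebra.ι k 1 * v)) =
      TensorAlgebra.algebraMapInv u • mapWord (toBar k A) v -
        TensorAlgebra.algebraMapInv v • mapWord (toBar k A) (mapWord (shift 𝒜) u) := by
  induction u using word_induction with
  | h_one =>
    rw [one_mul, barDiff_ι_mul, map_add, mapWord_ι_mul, mapWord_mulHead_one, toBar_uncons]
    have : toBar k A (shift 𝒜 1) = 0 := by
      rw [shift, LinearMap.neg_apply, parity_one, map_neg, toBar_one, neg_zero]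
    rw [this]
    simp [Algebra.algebraMap_eq_smul_one]
  | h_add x y hx hy => simp only [add_mul, map_add, hx, hy, add_smul, smul_add]; abel
  | h_smul c x hx =>
    simp only [smul_mul_assoc, map_smul, hx, smul_eq_mul, mul_smul, smul_sub]
    rw [smul_comm (TensorAlgebra.algebraMapInv v) c]
  | h_cons a w hw =>
    rw [mul_assoc, mul_assoc, barDiff_ι_mul, ← mul_assoc w, map_add, mapWord_ι_mul, hw,
      mapWord_mulHead, uncons_degenerate]
    simp [TensorAlgebra.algebraMapInv, shift, mul_sub]

theorem unsnoc_degenerate (u v : TensorAlgebra k A) :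
    LinearMap.rTensor A (mapWord (toBar k A)) (unsnoc (u * TensorAlgebra.ι k 1 * v)) =
      TensorAlgebra.algebraMapInv v • (mapWord (toBar k A) u ⊗ₜ[k] (1 : A)) := by
  have key : ∀ (a : A) (x : TensorAlgebra k A ⊗[k] A),
      LinearMap.rTensor A (mapWord (toBar k A))
        (LinearMap.rTensor A (LinearMap.mulLeft k (TensorAlgebra.ι k a)) x) =
      LinearMap.rTensor A (LinearMap.mulLeft k (TensorAlgebra.ι k (toBar k A a)))
        (LinearMap.rTensor A (mapWord (toBar k A)) x) := by
    intro a x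
    induction x using TensorProduct.induction_on with
    | zero => simp
    | tmul x y => simp
    | add x y hx hy => simp only [map_add, hx, hy]
  induction u using word_induction with
  | h_one =>
    rw [one_mul, unsnoc_ι_mul, map_add, key, toBar_one]
    simp
  | h_add x y hx hy => simp only [add_mul, map_add, hx, hy, TensorProduct.add_tmul, smul_add]
  | h_smul c x hx =>
    simp only [smul_mul_assoc, map_smul, hx, ← TensorProduct.smul_tmul']
    rw [smul_comm]
  | h_cons a w hw =>
    rw [mul_assoc, mul_assoc, unsnoc_ι_mul, ← mul_assoc w, map_add, key, hw]
    simp [TensorAlgebra.algebraMapInv]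

theorem mapWord_toBar_shift (w : TensorAlgebra k A) :
    mapWord (toBar k A) (mapWord (shift 𝒜) w) = sgn 𝒜 (mapWord (toBar k A) w) := by
  induction w using word_induction with
  | h_one => simp
  | h_add x y hx hy => simp only [map_add, hx, hy]
  | h_smul c x hx => simp only [map_smul, hx]
  | h_cons a w hw => rw [mapWord_ι_mul, mapWord_ι_mul, mapWord_ι_mul, hw, mapWord_ι_mul]; rfl

theorem reduce_bUnreduced_degenerate (a : A) (u v : TensorAlgebra k A) :
    (reduceChain k A ∘ₗ bUnreduced 𝒜) (a ⊗ₜ[k] (u * TensorAlgebra.ι k 1 * v)) = 0 := by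
  have h1 : ∀ x : A ⊗[k] TensorAlgebra k A,
      reduceChain k A (mulFront 𝒜 (a ⊗ₜ[k] x)) =
        LinearMap.rTensor _ (LinearMap.mulLeft k (parity 𝒜 a))
          (LinearMap.lTensor A (mapWord (toBar k A)) x) := by
    intro x
    induction x using TensorProduct.induction_on with
    | zero => simp
    | tmul x y => simp [mulFront]
    | add x y hx hy => simp only [TensorProduct.tmul_add, map_add, hx, hy]
  let Θ : TensorAlgebra k (Abar k A) ⊗[k] A →ₗ[k] Chains k A :=
    TensorProduct.lift (LinearMap.mk₂ k
      (fun w x => (parity 𝒜 (evenPart (shift 𝒜) x) * a) ⊗ₜ[k] w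
        + (parity 𝒜 (oddPart (shift 𝒜) x) * shift 𝒜 a) ⊗ₜ[k] sgn 𝒜 w)
      (fun w w' x => by simp only [map_add, TensorProduct.tmul_add]; abel)
      (fun c w x => by simp only [map_smul, TensorProduct.tmul_smul, smul_add])
      (fun w x x' => by simp only [map_add, add_mul, TensorProduct.add_tmul]; abel)
      (fun c w x => by
        simp only [map_smul, smul_mul_assoc, ← TensorProduct.smul_tmul', smul_add]))
  have h2 : ∀ x : TensorAlgebra k A ⊗[k] A,
      reduceChain k A (mulFront 𝒜 (koszulSwap
        (TensorProduct.map (shift 𝒜) (mapWord (shift 𝒜))) (shift 𝒜)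
        ((TensorProduct.assoc k A (TensorAlgebra k A) A).symm (a ⊗ₜ[k] x)))) =
      Θ (LinearMap.rTensor A (mapWord (toBar k A)) x) := by
    intro x
    induction x using TensorProduct.induction_on with
    | zero => simp
    | tmul x y => simp [mulFront, koszulSwap, Θ, mapWord_toBar_shift]
    | add x y hx hy => simp only [TensorProduct.tmul_add, map_add, hx, hy]
  have hhalf : algebraMap ℚ k (1 / 2) • (2 : k) = 1 := by
    rw [smul_eq_mul, show (2 : k) = algebraMap ℚ k 2 from (map_ofNat _ 2).symm,
      ← map_mul]
    norm_num
  have he : evenPart (shift 𝒜) (1 : A) = 0 := by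
    simp [evenPart, shift, parity_one]
  have ho : oddPart (shift 𝒜) (1 : A) = 1 := by
    have : (1 : A) + 1 = (2 : k) • (1 : A) := by rw [two_smul]
    rw [oddPart, LinearMap.smul_apply, LinearMap.sub_apply, LinearMap.id_apply, shift,
      LinearMap.neg_apply, parity_one, sub_neg_eq_add, this, smul_smul, ← smul_eq_mul, hhalf, one_smul]
  simp only [bUnreduced, lastToFront, LinearMap.comp_apply, LinearMap.add_apply,
    LinearMap.lTensor_tmul, map_add, TensorProduct.map_tmul, LinearEquiv.coe_coe]
  rw [h1, uncons_degenerate, h2, unsnoc_degenerate, barDiff_degenerate, mapWord_toBar_shift]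
  simp only [map_smul, LinearMap.rTensor_tmul, LinearMap.mulLeft_apply, mul_one, Θ,
    TensorProduct.lift.tmul, LinearMap.mk₂_apply, he, ho, map_zero, zero_mul,
    TensorProduct.zero_tmul, zero_add, parity_one, one_mul, TensorProduct.tmul_sub,
    TensorProduct.tmul_smul]
  simp [shift, TensorProduct.neg_tmul]

/-- The Hochschild differential `b` on normalized chains. -/
def bDiff : Chains k A →ₗ[k] Chains k A :=
  descend (reduceChain k A ∘ₗ bUnreduced 𝒜) (reduce_bUnreduced_degenerate 𝒜)

/-- `v ⊗ (a ⊗ u) ↦ v ā u`. -/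
def joinWord (k A : Type*) [CommRing k] [Ring A] [Algebra k A] :
    Words k A ⊗[k] Chains k A →ₗ[k] Words k A :=
  LinearMap.mul' k _ ∘ₗ LinearMap.lTensor _
    (LinearMap.mul' k _ ∘ₗ LinearMap.rTensor _ (TensorAlgebra.ι k ∘ₗ toBar k A))

/-- The signed rotations `(a₀, …, aₙ) ↦ ∑_q (-1)^{(|a₀| + ⋯ + |a_{q-1}|)(|a_q| + ⋯ + |aₙ|)}
(a_q, …, aₙ) ⊗ (a₀, …, a_{q-1})`, `1 ≤ q ≤ n + 1`. -/
abbrev rotateChain : Chains k A →ₗ[k] Words k A ⊗[k] Chains k A :=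
  rotate (shift 𝒜) (shiftBar 𝒜)

/-- Connes' differential
`B (a₀, …, aₙ) = ∑_q (-1)^{(|a₀| + ⋯ + |a_{q-1}|)(|a_q| + ⋯ + |aₙ|)}
(1, a_q, …, aₙ, a₀, …, a_{q-1})`, `1 ≤ q ≤ n + 1`. -/
def BDiff : Chains k A →ₗ[k] Chains k A :=
  TensorProduct.mk k A (Words k A) 1 ∘ₗ joinWord k A ∘ₗ rotateChain 𝒜

end Differentials

/-! ### Operations of Hochschild cochains

Only cochains of even total degree `deg D = (degree of the linear map D) + d` are multiplied and
act below, so that `|D| = deg D - 1` is odd; the signs are written out for such cochains. -/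

section Operations

variable {k : Type*} [CommRing k] [Algebra ℚ k] {A : Type*} [Ring A] [Algebra k A]
variable (𝒜 : ZMod 2 → Submodule k A) [GradedAlgebra 𝒜]

/-- The cup product `(D ⌣ E) (a₁, …) = ∑ D (a₁, …, a_d) E (a_{d+1}, …)`, for `E` even. -/
def cup : Cochains k A →ₗ[k] Cochains k A →ₗ[k] Cochains k A :=
  LinearMap.mk₂ k conv
    (fun D D' E => by simp only [conv, TensorProduct.map_add_left, LinearMap.add_comp,
      LinearMap.comp_add])
    (fun c D E => by simp only [conv, TensorProduct.map_smul_left, LinearMap.smul_comp,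
      LinearMap.comp_smul])
    (fun D E E' => by simp only [conv, TensorProduct.map_add_right, LinearMap.add_comp,
      LinearMap.comp_add])
    (fun c D E => by simp only [conv, TensorProduct.map_smul_right, LinearMap.smul_comp,
      LinearMap.comp_smul])

/-- The zero-cochain of an element of `A`. -/
def zeroCochain (x : A) : Cochains k A :=
  LinearMap.toSpanSingleton k A x ∘ₗ
    (TensorAlgebra.algebraMapInv (R := k) (M := Abar k A)).toLinearMap

/-- Insertion of one cochain, followed by the operation `q` on the rest of the word:
`w ↦ ∑_{w = u v r} (-1)^{|v| + |r|} u D(v) q (r)`, where the sign occurring with the letters of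
`r` is inserted before `q` is applied. -/
def insertStep : Cochains k A →ₗ[k] (Words k A →ₗ[k] Words k A) →ₗ[k]
    (Words k A →ₗ[k] Words k A) :=
  LinearMap.mk₂ k
    (fun D q => conv LinearMap.id
      (conv (TensorAlgebra.ι k ∘ₗ toBar k A ∘ₗ D ∘ₗ sgn 𝒜) (q ∘ₗ sgn 𝒜)))
    (fun D D' q => by simp only [conv, TensorProduct.map_add_left, TensorProduct.map_add_right,
      LinearMap.add_comp, LinearMap.comp_add])
    (fun c D q => by simp only [conv, TensorProduct.map_smul_left, TensorProduct.map_smul_right,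
      LinearMap.smul_comp, LinearMap.comp_smul])
    (fun D q q' => by simp only [conv, TensorProduct.map_add_right,
      LinearMap.add_comp, LinearMap.comp_add])
    (fun c D q => by simp only [conv, TensorProduct.map_smul_right,
      LinearMap.smul_comp, LinearMap.comp_smul])

/-- Insertion of a word of cochains into a word of elements:
`insertWord (D₁ ⊗ ⋯ ⊗ D_r) (a₁, …, aₙ) = ∑ ± (a₁, …, D₁ (a_{i₁ + 1}, …), …, D_r (a_{i_r + 1}, …), …)`
with the sign `(-1)^{∑_p ∑_{i > i_p} |a_i| |D_p|}`. -/
def insertWord : TensorAlgebra k (Cochains k A) →ₗ[k] Words k A →ₗ[k] Words k A :=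
  foldWord (insertStep 𝒜) LinearMap.id

/-- `(a₀, …, aₙ) • ₁ (D₀, …, D_m) = ∑ ± (a₀ D₀ (a₁, …), …, D₁ (a_{i₁ + 1}, …), …, D_m (…), …)`, with
the sign `(-1)^{∑_{p > 0} ∑_{i > i_p} |a_i| |D_p|}`. -/
def bulletOne : Cochains k A →ₗ[k] TensorAlgebra k (Cochains k A) →ₗ[k]
    Module.End k (Chains k A) :=
  LinearMap.mk₂ k
    (fun D W => TensorProduct.map (LinearMap.mul' k A ∘ₗ LinearMap.lTensor A D) (insertWord 𝒜 W)
      ∘ₗ cut A (Abar k A))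
    (fun D D' W => by simp only [LinearMap.lTensor_add, LinearMap.comp_add,
      TensorProduct.map_add_left, LinearMap.add_comp])
    (fun c D W => by simp only [LinearMap.lTensor_smul, LinearMap.comp_smul,
      TensorProduct.map_smul_left, LinearMap.smul_comp])
    (fun D W W' => by simp only [map_add, TensorProduct.map_add_right, LinearMap.add_comp])
    (fun c D W => by simp only [map_smul, TensorProduct.map_smul_right, LinearMap.smul_comp])

/-- `wrap D (a₀, …, aₙ) = ∑ ± (D (a_q, …, aₙ, a₀, …, a_i), a_{i+1}, …, a_{q-1})`, with the sign of
the cyclic rotation. -/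
def wrap : Cochains k A →ₗ[k] Module.End k (Chains k A) where
  toFun D := TensorProduct.map (D ∘ₗ joinWord k A) LinearMap.id ∘ₗ
    (TensorProduct.assoc k (Words k A) (Chains k A) (Words k A)).symm.toLinearMap ∘ₗ
    LinearMap.lTensor (Words k A) (cut A (Abar k A)) ∘ₗ rotateChain 𝒜
  map_add' D D' := by
    simp only [LinearMap.add_comp, TensorProduct.map_add_left]
  map_smul' c D := by
    simp only [LinearMap.smul_comp, TensorProduct.map_smul_left, RingHom.id_apply]

/-- The sign `(-1)^m` on words `D₁ ⊗ ⋯ ⊗ D_m` in cochains. -/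
abbrev lengthSign : TensorAlgebra k (Cochains k A) →ₗ[k] TensorAlgebra k (Cochains k A) :=
  mapWord (-LinearMap.id)

/-- `α • ₂ (D₀, …, D_m)`, the sum of the terms
`± (D_m (a_q, …, aₙ, a₀, …, a_{i₀}) D₀ (a_{i₀ + 1}, …), …, D₁ (…), …, D_{m-1} (…), …, a_{q-1})`,
with the sign of the cyclic rotation, times the sign of `• ₁` for `D₀, …, D_{m-1}`, times
`(-1)^{deg α + m}`; zero for `m = 0`. -/
def bulletTwo : CochainChains k A →ₗ[k] Module.End k (Chains k A) :=
  TensorProduct.lift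
    (LinearMap.mk₂ k
      (fun (x : CochainChains k A) (E : Cochains k A) =>
        TensorProduct.lift (bulletOne 𝒜) x ∘ₗ wrap 𝒜 E ∘ₗ chainParity 𝒜)
      (fun x x' E => by simp only [map_add, LinearMap.add_comp])
      (fun c x E => by simp only [map_smul, LinearMap.smul_comp])
      (fun x E E' => by simp only [map_add, LinearMap.add_comp, LinearMap.comp_add])
      (fun c x E => by simp only [map_smul, LinearMap.smul_comp, LinearMap.comp_smul])) ∘ₗ
  (TensorProduct.assoc k _ _ _).symm.toLinearMap ∘ₗ
  LinearMap.lTensor (Cochains k A) (unsnoc ∘ₗ lengthSign)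

/-- The part of `insertWord (D ⊗ W)` in which the arguments of `D` start with the first letter:
`(a₁, …, aₙ) ↦ ∑ ± (D (a₁, …), …, D₁ (…), …, D_p (…), …)` for `W = D₁ ⊗ ⋯ ⊗ D_p`. -/
def insertFirst : Cochains k A →ₗ[k] TensorAlgebra k (Cochains k A) →ₗ[k]
    Module.End k (Words k A) :=
  LinearMap.mk₂ k
    (fun D W => conv (TensorAlgebra.ι k ∘ₗ toBar k A ∘ₗ D ∘ₗ sgn 𝒜) (insertWord 𝒜 W ∘ₗ sgn 𝒜))
    (fun D D' W => by simp only [conv, TensorProduct.map_add_left,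
      LinearMap.add_comp, LinearMap.comp_add])
    (fun c D W => by simp only [conv, TensorProduct.map_smul_left,
      LinearMap.smul_comp, LinearMap.comp_smul])
    (fun D W W' => by simp only [conv, map_add, TensorProduct.map_add_right,
      LinearMap.add_comp, LinearMap.comp_add])
    (fun c D W => by simp only [conv, map_smul, TensorProduct.map_smul_right,
      LinearMap.smul_comp, LinearMap.comp_smul])

/-- For a word `W` of `r` cochains and an operation `q` on words: the sum over all cyclic
rotations of `(a₀, …, aₙ)` and over all ways to cut the rotated word somewhere to the right of
`a₀` into `x y` of `± 1 ⊗ insertWord W (x) q (y)`.  The sign is that of the cyclic rotation, times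
`(-1)^{r |y|}`, where `|y|` is the sum of the `|aᵢ|` in `y` (each of the `r` odd cochains passes
`y`). -/
def insertRotated : TensorAlgebra k (Cochains k A) →ₗ[k] Module.End k (Words k A) →ₗ[k]
    Module.End k (Chains k A) :=
  LinearMap.mk₂ k
    (fun W q => TensorProduct.mk k A (Words k A) 1 ∘ₗ LinearMap.mul' k (Words k A) ∘ₗ
      (TensorProduct.map (insertWord 𝒜 W) (q ∘ₗ evenPart (sgn 𝒜)) +
        TensorProduct.map (insertWord 𝒜 (lengthSign W)) (q ∘ₗ oddPart (sgn 𝒜))) ∘ₗ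
      LinearMap.rTensor (Words k A) (joinWord k A) ∘ₗ
      (TensorProduct.assoc k (Words k A) (Chains k A) (Words k A)).symm.toLinearMap ∘ₗ
      LinearMap.lTensor (Words k A) (cut A (Abar k A)) ∘ₗ rotateChain 𝒜)
    (fun W W' q => by
      simp only [map_add, TensorProduct.map_add_left, LinearMap.add_comp, LinearMap.comp_add]
      abel)
    (fun c W q => by
      simp only [map_smul, TensorProduct.map_smul_left, ← smul_add, LinearMap.smul_comp,
        LinearMap.comp_smul])
    (fun W q q' => by
      simp only [TensorProduct.map_add_right, LinearMap.add_comp, LinearMap.comp_add]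
      abel)
    (fun c W q => by
      simp only [TensorProduct.map_smul_right, ← smul_add, LinearMap.smul_comp,
        LinearMap.comp_smul])

/-- Signed cyclic rotations of chains of cochains (all `|D_i|` odd): `(D₀, …, D_m) ↦
∑_p (-1)^{(p + 1)(m - p)} (D_{p+1}, …, D_m) ⊗ (D₀, …, D_p)`. -/
def rotateCochains : CochainChains k A →ₗ[k]
    TensorAlgebra k (Cochains k A) ⊗[k] CochainChains k A :=
  rotate (-LinearMap.id) (-LinearMap.id)

/-- `α • ₃ (D₀, …, D_m)`: the sum, over all cyclic rotations of `α = (a₀, …, aₙ)` and of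
`(D₀, …, D_m)`, of the terms
`± (1, a_q, …, D_{p+1} (…), …, D_m (…), …, D₀ (…), …, D₁ (…), …, D_p (…), …, a_{q-1})` in which
`D₀ (…)` stands after `a₀` (and `a₀` may be an argument of one of `D_{p+1}, …, D_m`).  The sign is
that of the two cyclic rotations, times `(-1)^{|aᵢ|}` for every `aᵢ` and every `D_r` whose
arguments start at or before `aᵢ`, times `(-1)^{deg α}`. -/
def bulletThree : CochainChains k A →ₗ[k] Module.End k (Chains k A) :=
  LinearMap.lcomp k (Chains k A) (chainParity 𝒜) ∘ₗ
    TensorProduct.lift ((insertRotated 𝒜).compl₂ (TensorProduct.lift (insertFirst 𝒜))) ∘ₗ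
    rotateCochains

/-- The action `α ↦ α • (D₀, …, D_m)` of chains of (even) cochains on the normalized chains:
`• = • ₁ + • ₂ + • ₃`. -/
def bullet : CochainChains k A →ₗ[k] Module.End k (Chains k A) :=
  TensorProduct.lift (bulletOne 𝒜) + bulletTwo 𝒜 + bulletThree 𝒜

/-- The product `E ⋆ (D₀, …, D_m) = (E ⌣ D₀, D₁, …, D_m) + ∑ ± (1, D_{p+1}, …, D_m, D₀, …, D_p)`,
where in the sum `E` is inserted in all ways into the rotated chain between `1` and `D₀`.  The sign
is that of the cyclic rotation times `(-1)^r` when `r` of the cochains stand before `E`. -/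
def starMul (E : Cochains k A) : CochainChains k A →ₗ[k] CochainChains k A :=
  LinearMap.rTensor _ (cup E) +
    TensorProduct.mk k (Cochains k A) _ (zeroCochain 1) ∘ₗ
    LinearMap.mul' k (TensorAlgebra k (Cochains k A)) ∘ₗ
    TensorProduct.map
      (conv lengthSign (LinearMap.mulLeft k (TensorAlgebra.ι k E)))
      (LinearMap.mul' k (TensorAlgebra k (Cochains k A)) ∘ₗ
        LinearMap.rTensor _ (TensorAlgebra.ι k)) ∘ₗ
    rotateCochains

/-- `D₁ ⋆ (D₂ ⋆ (⋯ ⋆ D_m))`, and `1` for `m = 0`. -/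
def starProd (l : List (Cochains k A)) : CochainChains k A :=
  l.foldr (fun E x => starMul E x) (zeroCochain 1 ⊗ₜ[k] 1)

/-- The operator `J (D₁ ∧ ⋯ ∧ D_m) α = (1/m!) ∑_σ α • (D_{σ 1} ⋆ (D_{σ 2} ⋆ (⋯ ⋆ D_{σ m})))` for even
cochains `D₁, …, D_m` (for which all the signs `ε_σ` are `1`). -/
def J {m : ℕ} (D : Fin m → Cochains k A) : Module.End k (Chains k A) :=
  algebraMap ℚ k (1 / m.factorial) •
    ∑ σ : Equiv.Perm (Fin m), bullet 𝒜 (starProd (List.ofFn fun i => D (σ i)))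

end Operations

/-! ### The Chern character -/

section ChernCharacter

variable {k : Type*} [CommRing k] [Algebra ℚ k] {A : Type*} [Ring A] [Algebra k A]
variable (𝒜 : ZMod 2 → Submodule k A) [GradedAlgebra 𝒜]

/-- The graded commutator `[D, a] = D a - (-1)^{deg a} a D` with an odd element `D`. -/
def superComm (D : A) : A →ₗ[k] A :=
  LinearMap.mulLeft k D - LinearMap.mulRight k D ∘ₗ parity 𝒜

/-- `ad D` on `Ā`. -/
def adBar (D : A) : Abar k A →ₗ[k] A :=
  Submodule.liftQ _ (superComm 𝒜 D) (by
    rw [Submodule.span_le, Set.singleton_subset_iff]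
    simp [superComm, parity_one])

/-- The one-cochain `ad D`. -/
def adCochain (D : A) : Cochains k A := adBar 𝒜 D ∘ₗ TensorAlgebra.ιInv

/-- The coefficients of the cochain `∇_t = t ad D - t² D²`, that is, of `∇ = ad D - D²` for `t D` in
place of `D`. -/
def nablaCoeff (D : A) : ℕ → Cochains k A
  | 1 => adCochain 𝒜 D
  | 2 => -zeroCochain (D * D)
  | _ => 0

/-- `X (∇_t) = ∑_m J ((-∇_t)^{∧ m}) / m!` as a power series in `t`. -/
def X (D : A) : PowerSeries (Module.End k (Chains k A)) :=
  PowerSeries.mk fun r => ∑ m ∈ Finset.range (r + 1),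
    algebraMap ℚ k ((-1) ^ m / m.factorial) •
      ∑ c ∈ Finset.Nat.antidiagonalTuple m r, J 𝒜 fun i => nablaCoeff 𝒜 D (c i)

/-- The Lie derivative of the zero-cochain of an odd element `D`,
`L_D (a₀, …, aₙ) = ∑_j (a₀, …, a_j, D, a_{j+1}, …, aₙ)`. -/
def lieDeriv (D : A) : Module.End k (Chains k A) :=
  LinearMap.lTensor A
    (conv LinearMap.id (LinearMap.mulLeft k (TensorAlgebra.ι k (toBar k A D))))

/-- `e^{t L_D}` as a power series in `t`. -/
def expLie (D : A) : PowerSeries (Module.End k (Chains k A)) :=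
  PowerSeries.mk fun l => algebraMap ℚ k (1 / l.factorial) • lieDeriv D ^ l

/-- The Chern character `ch (t D) = X (∇_t) e^{t L_D}` as a power series in `t`. -/
def ch (D : A) : PowerSeries (Module.End k (Chains k A)) := X 𝒜 D * expLie D

/-- The total differential `B + b`. -/
def totalDiff : Module.End k (Chains k A) := BDiff 𝒜 + bDiff 𝒜

/-- The coefficient of `t^N` in the cochain
`∑_n ∫ a₀ e^{-t₀ D²} [D, a₁] e^{-t₁ D²} ⋯ [D, aₙ] e^{-tₙ D²}` for `t D` in place of `D`.  The integral over
the simplex `t₀ + ⋯ + tₙ = 1` of `∏ᵢ tᵢ^{jᵢ} / jᵢ!` is `1 / (n + ∑ᵢ jᵢ)!`. -/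
def jloCoeff (D : A) (N : ℕ) {n : ℕ} (a₀ : A) (a : Fin n → A) : A :=
  ∑ J ∈ (Finset.range (N + 1)).filter (fun J => n + 2 * J = N),
    ∑ j ∈ Finset.Nat.antidiagonalTuple (n + 1) J,
      algebraMap ℚ k ((-1) ^ J / (n + J).factorial) •
        (a₀ * D ^ (2 * j 0) *
          (List.ofFn fun i : Fin n => superComm 𝒜 D (a i) * D ^ (2 * j i.succ)).prod)

/-- The simplex `{t₀ + ⋯ + tₙ = 1, tᵢ ≥ 0}` in the coordinates `t₀, …, t_{n-1}`. -/
def simplex (n : ℕ) : Set (Fin n → ℝ) := {t | (∀ i, 0 ≤ t i) ∧ ∑ i, t i ≤ 1}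

/-- `(t₀, …, tₙ)` with `tₙ = 1 - t₀ - ⋯ - t_{n-1}`. -/
def barycentric {n : ℕ} (t : Fin n → ℝ) : Fin (n + 1) → ℝ := Fin.snoc t (1 - ∑ i, t i)

/-- The integral
`∫ a₀ e^{-t₀ D²} d₁ e^{-t₁ D²} ⋯ dₙ e^{-tₙ D²} dt₀ ⋯ dt_{n-1}` over the simplex, in a Banach algebra. -/
def jloIntegral {R : Type*} [NormedRing R] [NormedAlgebra ℝ R] (D : R) {n : ℕ} (a₀ : R)
    (d : Fin n → R) : R :=
  ∫ t in simplex n, a₀ * NormedSpace.exp (-(barycentric t 0) • D ^ 2) *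
    (List.ofFn fun i : Fin n => d i * NormedSpace.exp (-(barycentric t i.succ) • D ^ 2)).prod

end ChernCharacter

end BivariantJLO

end

/-!
# The Chern character of an odd element and the JLO cochain

Let `∇ = ad D - D²`. The components `-D²`, `[D, a]`, `(-1)^{deg a} a b` of `m + ∇` are a curved
`A_∞`-structure on `A`, which arises from the product `m` by the translation `a ↦ a - D`. For this
structure `∇` is covariantly constant, and so are its cup powers (`Parallel`, `nablaP`).
The argument has four steps.

* *The action.* For a string of parallel cochains, the commutator of `B + b` with its action on
  chains is the action of the differential `b + B` of the string, up to the Lie derivative of `∇`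
  on chains and on strings (`totalDiff_act`). On tensors of homogeneous elements all operators are
  signed sums over the cuts of lists (`spl`) and coderivations of lists (`Ops.cd`), so that the
  proof consists in matching such sums. Already `•₁ + •₂` is compatible with the Hochschild
  differentials (`bDiff_act₁_add_act₂`), and Connes' differential of these two parts is compensated
  by the Hochschild differential of `•₃` (`bDiff_act₃`).
* *The exponential.* The differential `b + B` of the `m`-th star power of `∇` is `m` times the Lie
  derivative of the `(m - 1)`-st one (`NormalizedS.starS_dS`). So the commutator of `B + b` with the
  action of the `m`-th star power has the form `R m + m R (m - 1)` up to the Lie derivative on chains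
  (`totalDiff_mul_starOp`). In the exponential series the `R m` telescope. Replacing `D` by `t D` for
  rational `t` and comparing coefficients, `(B + b) X = X (B + b + L)` with the Lie derivative `L` of
  `∇_t` on chains (`totalDiff_mul_X`).
* *The conjugation.* The commutators of `B + b` with `L_D` are the Lie derivatives of `ad D` and
  `-D²` up to factors, whence `(B + b + L) e^{t L_D} = e^{t L_D} (B + b)`
  (`totalDiff_add_mul_expLie`). This proves that `ch` commutes with `B + b` (`totalDiff_mul_ch`).
* *The component in `A`.* The star powers consist of strings with an odd number of cochains, and such
  a string has a component in `A` only if it consists of one cochain, which acts by `•₁`. So only the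
  cup powers of `∇_t` remain (`degreeZero_starOp`). Conjugation by `e^{t L_D}` turns
  `∇_t = t ad D - t² D²` into `t ad D + t² D²` because of `[D, D] = 2 D²` (`expCochainDer_mul`), and
  the powers of the latter are sums of words in `[D, aᵢ]` and `D²` (`degreeZero_ch_chain`). In a
  Banach algebra the same sums are the expansion of the integral over the simplex, the factorials
  being iterated beta integrals (`hasSum_simplexInt`, `hasSum_degreeZero_ch`).
-/

set_option linter.unusedSimpArgs false

noncomputable section

namespace BivariantJLO

section

/-! ### Sums over the cuts of a list -/

/-- The sign `(-1)^p` of a parity `p`. -/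
def sg (p : ZMod 2) : ℤ := if p = 0 then 1 else -1

@[simp] theorem sg_zero : sg 0 = 1 := rfl

@[simp] theorem sg_one : sg 1 = -1 := rfl

theorem sg_add (p q : ZMod 2) : sg (p + q) = sg p * sg q := by
  revert p q; decide

theorem sg_mul_self (p : ZMod 2) : sg p * sg p = 1 := by
  revert p; decide

theorem sg_add_one (p : ZMod 2) : sg (p + 1) = -sg p := by
  revert p; decide

section Cuts

variable {X M N : Type*} [AddCommGroup M] [AddCommGroup N]

/-- The sum `∑ F u v` over all ways to cut a list into two pieces `u v`. -/
def spl (F : List X → List X → M) : List X → M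
  | [] => F [] []
  | c :: l => F [] (c :: l) + spl (fun u v => F (c :: u) v) l

/-- `F c u` for the list `c u` with first letter `c`, and `0` for the empty list. -/
def hd (F : X → List X → M) : List X → M
  | [] => 0
  | c :: l => F c l

/-- `x` for the empty list, and `0` otherwise. -/
def nl (x : M) : List X → M
  | [] => x
  | _ :: _ => 0

/-- `F u c` for the list `u c` with last letter `c`, and `0` for the empty list. -/
def lst (F : List X → X → M) : List X → M
  | [] => 0
  | c :: l => nl (F [] c) l + lst (fun u d => F (c :: u) d) l

@[simp] theorem spl_nil (F : List X → List X → M) : spl F [] = F [] [] := rfl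

@[simp] theorem spl_cons (F : List X → List X → M) (c : X) (l : List X) :
    spl F (c :: l) = F [] (c :: l) + spl (fun u v => F (c :: u) v) l := rfl

@[simp] theorem hd_nil (F : X → List X → M) : hd F [] = 0 := rfl

@[simp] theorem hd_cons (F : X → List X → M) (c : X) (l : List X) : hd F (c :: l) = F c l := rfl

@[simp] theorem nl_nil (x : M) : nl x ([] : List X) = x := rfl

@[simp] theorem nl_cons (x : M) (c : X) (l : List X) : nl x (c :: l) = 0 := rfl

@[simp] theorem lst_nil (F : List X → X → M) : lst F [] = 0 := rfl

theorem lst_cons (F : List X → X → M) (c : X) (l : List X) :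
    lst F (c :: l) = nl (F [] c) l + lst (fun u d => F (c :: u) d) l := rfl

theorem map_spl {G : Type*} [FunLike G M N] [AddMonoidHomClass G M N] (φ : G)
    (F : List X → List X → M) (l : List X) :
    φ (spl F l) = spl (fun u v => φ (F u v)) l := by
  induction l generalizing F with
  | nil => rfl
  | cons c l ih => simp [ih]

theorem map_hd {G : Type*} [FunLike G M N] [AddMonoidHomClass G M N] (φ : G)
    (F : X → List X → M) (l : List X) :
    φ (hd F l) = hd (fun c v => φ (F c v)) l := by
  cases l <;> simp

theorem map_nl {G : Type*} [FunLike G M N] [AddMonoidHomClass G M N] (φ : G)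
    (x : M) (l : List X) : φ (nl x l) = nl (φ x) l := by
  cases l <;> simp

theorem nl_smul (n : ℤ) (x : M) (l : List X) : nl (n • x) l = n • nl x l := by
  cases l <;> simp

theorem map_lst {G : Type*} [FunLike G M N] [AddMonoidHomClass G M N] (φ : G)
    (F : List X → X → M) (l : List X) :
    φ (lst F l) = lst (fun u c => φ (F u c)) l := by
  induction l generalizing F with
  | nil => simp
  | cons c l ih => simp [lst_cons, ih, map_nl]

theorem spl_congr {F G : List X → List X → M} {l : List X}
    (h : ∀ u v, u ++ v = l → F u v = G u v) : spl F l = spl G l := by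
  induction l generalizing F G with
  | nil => exact h [] [] rfl
  | cons c l ih =>
    rw [spl_cons, spl_cons, h [] (c :: l) rfl,
      ih fun u v huv => h (c :: u) v (by rw [← huv]; rfl)]

theorem spl_add (F G : List X → List X → M) (l : List X) :
    spl (fun u v => F u v + G u v) l = spl F l + spl G l := by
  induction l generalizing F G with
  | nil => rfl
  | cons c l ih => simp only [spl_cons, ih]; abel

theorem spl_smul {R : Type*} [Monoid R] [DistribMulAction R M] (n : R)
    (F : List X → List X → M) (l : List X) :
    spl (fun u v => n • F u v) l = n • spl F l :=
  (map_spl (DistribSMul.toAddMonoidHom M n) F l).symm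

theorem spl_neg (F : List X → List X → M) (l : List X) :
    spl (fun u v => -F u v) l = -spl F l :=
  (map_spl (-AddMonoidHom.id M) F l).symm

theorem spl_sub (F G : List X → List X → M) (l : List X) :
    spl (fun u v => F u v - G u v) l = spl F l - spl G l := by
  simp only [sub_eq_add_neg, spl_add, spl_neg]

theorem spl_zero (l : List X) : spl (fun _ _ => (0 : M)) l = 0 := by
  induction l with
  | nil => rfl
  | cons c l ih => simp [ih]

theorem hd_add (F G : X → List X → M) (l : List X) :
    hd (fun c v => F c v + G c v) l = hd F l + hd G l := by
  cases l <;> simp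

theorem hd_smul (n : ℤ) (F : X → List X → M) (l : List X) :
    hd (fun c v => n • F c v) l = n • hd F l := by
  cases l <;> simp

theorem hd_sub (F G : X → List X → M) (l : List X) :
    hd (fun c v => F c v - G c v) l = hd F l - hd G l := by
  cases l <;> simp

theorem hd_congr {F G : X → List X → M} {l : List X} (h : ∀ c v, c :: v = l → F c v = G c v) :
    hd F l = hd G l := by
  cases l with
  | nil => rfl
  | cons c v => exact h c v rfl

theorem lst_add (F G : List X → X → M) (l : List X) :
    lst (fun c v => F c v + G c v) l = lst F l + lst G l := by
  induction l generalizing F G with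
  | nil => simp
  | cons c l ih => cases l <;> simp only [lst_cons, ih, nl_nil, nl_cons] <;> abel

theorem lst_smul (n : ℤ) (F : List X → X → M) (l : List X) :
    lst (fun c v => n • F c v) l = n • lst F l :=
  (map_lst (DistribSMul.toAddMonoidHom M n) F l).symm

theorem lst_neg (F : List X → X → M) (l : List X) :
    lst (fun c v => -F c v) l = -lst F l :=
  (map_lst (-AddMonoidHom.id M) F l).symm

theorem lst_sub (F G : List X → X → M) (l : List X) :
    lst (fun c v => F c v - G c v) l = lst F l - lst G l := by
  simp only [sub_eq_add_neg, lst_add, lst_neg]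

theorem lst_congr {F G : List X → X → M} {l : List X}
    (h : ∀ u c, u ++ [c] = l → F u c = G u c) : lst F l = lst G l := by
  induction l generalizing F G with
  | nil => rfl
  | cons c l ih =>
    rw [lst_cons, lst_cons, ih fun u d hu => h (c :: u) d (by rw [← hu]; rfl)]
    cases l with
    | nil => rw [nl_nil, nl_nil, h [] c rfl]
    | cons => rfl

@[simp] theorem lst_concat (F : List X → X → M) (l : List X) (c : X) :
    lst F (l ++ [c]) = F l c := by
  induction l generalizing F with
  | nil => simp [lst_cons]
  | cons d l ih =>
    rw [List.cons_append, lst_cons, ih]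
    cases l <;> simp

/-- Cutting in three pieces. -/
theorem spl_assoc (F : List X → List X → List X → M) (l : List X) :
    spl (fun u r => spl (fun v w => F u v w) r) l =
      spl (fun s w => spl (fun u v => F u v w) s) l := by
  induction l generalizing F with
  | nil => rfl
  | cons c l ih =>
    simp only [spl_cons, spl_nil, ih, spl_add]
    abel

/-- Moving a letter from the end of the first piece to the beginning of the second one. -/
theorem spl_lst_eq_spl_hd (F : List X → X → List X → M) (l : List X) :
    spl (fun u v => lst (fun u' c => F u' c v) u) l =
      spl (fun u v => hd (fun c v' => F u c v') v) l := by
  induction l generalizing F with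
  | nil => rfl
  | cons c l ih =>
    simp only [spl_cons, lst_nil, hd_cons, lst_cons, spl_add, ih, zero_add]
    congr 1
    cases l with
    | nil => rfl
    | cons d l => simp [spl_zero]

theorem hd_spl (F : X → List X → List X → M) (l : List X) :
    hd (fun c l' => spl (fun u v => F c u v) l') l =
      spl (fun u v => hd (fun c u' => F c u' v) u) l := by
  cases l <;> simp

theorem lst_spl (F : List X → List X → X → M) (l : List X) :
    lst (fun l' c => spl (fun u v => F u v c) l') l =
      spl (fun u v => lst (fun v' c => F u v' c) v) l := by
  induction l generalizing F with
  | nil => rfl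
  | cons c l ih =>
    simp only [lst_cons, spl_cons, spl_nil, lst_add, ih]
    cases l <;> simp [lst_cons]

theorem spl_nl_left (F : List X → M) (l : List X) : spl (fun u v => nl (F v) u) l = F l := by
  cases l <;> simp [spl_zero]

theorem spl_nl_right (F : List X → M) (l : List X) : spl (fun u v => nl (F u) v) l = F l := by
  induction l generalizing F with
  | nil => rfl
  | cons c l ih => simp [ih]

theorem hd_append (F : X → List X → M) (z w : List X) :
    hd F (z ++ w) = nl (hd F w) z + hd (fun c z' => F c (z' ++ w)) z := by
  cases z <;> simp

theorem lst_append (F : List X → X → M) (z w : List X) :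
    lst F (z ++ w) = nl (lst F z) w + lst (fun w' c => F (z ++ w') c) w := by
  induction z generalizing F with
  | nil => cases w <;> simp
  | cons c z ih =>
    rw [List.cons_append, lst_cons, lst_cons, ih]
    cases w <;> cases z <;> simp

theorem spl_append (F : List X → List X → M) (z : List X) (a : X) (w : List X) :
    spl F (z ++ a :: w) =
      spl (fun z' z'' => F z' (z'' ++ a :: w)) z + spl (fun w' w'' => F (z ++ a :: w') w'') w := by
  induction z generalizing F with
  | nil => simp
  | cons c z ih => simp [ih, add_assoc]

/-- Sums over the cuts of two lists can be interchanged. -/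
theorem spl_exchange {Y : Type*} (F : List X → List X → List Y → List Y → M) (l : List X)
    (r : List Y) :
    spl (fun u v => spl (fun s t => F u v s t) r) l =
      spl (fun s t => spl (fun u v => F u v s t) l) r := by
  induction l generalizing F with
  | nil => rfl
  | cons c l ih => simp only [spl_cons, spl_add, ih]

section Ring

variable {R : Type*} [Ring R]

theorem mul_spl (x : R) (F : List X → List X → R) (l : List X) :
    x * spl F l = spl (fun u v => x * F u v) l := map_spl (AddMonoidHom.mulLeft x) F l

theorem spl_mul (x : R) (F : List X → List X → R) (l : List X) :
    spl F l * x = spl (fun u v => F u v * x) l := map_spl (AddMonoidHom.mulRight x) F l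

theorem mul_hd (x : R) (F : X → List X → R) (l : List X) :
    x * hd F l = hd (fun u v => x * F u v) l := map_hd (AddMonoidHom.mulLeft x) F l

theorem hd_mul (x : R) (F : X → List X → R) (l : List X) :
    hd F l * x = hd (fun u v => F u v * x) l := map_hd (AddMonoidHom.mulRight x) F l

theorem mul_lst (x : R) (F : List X → X → R) (l : List X) :
    x * lst F l = lst (fun u v => x * F u v) l := map_lst (AddMonoidHom.mulLeft x) F l

theorem lst_mul (x : R) (F : List X → X → R) (l : List X) :
    lst F l * x = lst (fun u v => F u v * x) l := map_lst (AddMonoidHom.mulRight x) F l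

end Ring

end Cuts

/-! ### Coderivations -/

/-- Operations on letters of parity `p`: a letter `w`, a map `f` and a product `m`, with integral
weights. -/
structure Ops (X : Type*) where
  /-- the parity of a letter -/
  p : X → ZMod 2
  /-- the weight of `w` -/
  c₀ : ℤ
  /-- the letter that is inserted -/
  w : X
  /-- the weight of `f` -/
  c₁ : ℤ
  /-- the operation on one letter -/
  f : X → X
  /-- the weight of `m` -/
  c₂ : ℤ
  /-- the operation on two letters -/
  m : X → X → X

namespace Ops

variable {X M N : Type*} [AddCommGroup M] [AddCommGroup N] (O : Ops X)

/-- The parity of a list of letters. -/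
def par : List X → ZMod 2
  | [] => 0
  | c :: l => O.p c + par l

@[simp] theorem par_nil : O.par [] = 0 := rfl

@[simp] theorem par_cons (c : X) (l : List X) : O.par (c :: l) = O.p c + O.par l := rfl

@[simp] theorem par_append (u v : List X) : O.par (u ++ v) = O.par u + O.par v := by
  induction u with
  | nil => simp
  | cons c u ih => simp [ih, add_assoc]

/-- The coderivation of the words with components `w`, `f`, `m`, applied to the argument of `F`:
the sum of `F` over the words obtained from a word by inserting `w`, applying `f` to a letter, or
multiplying two adjacent letters, with the sign of the letters on the left. -/
def cd (F : List X → M) : List X → M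
  | [] => O.c₀ • F [O.w]
  | c :: l => O.c₀ • F (O.w :: c :: l) + O.c₁ • F (O.f c :: l) +
      O.c₂ • hd (fun d l' => F (O.m c d :: l')) l + sg (O.p c) • cd (fun l => F (c :: l)) l

@[simp] theorem cd_nil (F : List X → M) : O.cd F [] = O.c₀ • F [O.w] := rfl

theorem cd_cons (F : List X → M) (c : X) (l : List X) :
    O.cd F (c :: l) = O.c₀ • F (O.w :: c :: l) + O.c₁ • F (O.f c :: l) +
      O.c₂ • hd (fun d l' => F (O.m c d :: l')) l + sg (O.p c) • O.cd (fun l => F (c :: l)) l :=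
  rfl

/-- Additive maps commute with coderivations; multiplications, sums and multiples are special
cases. -/
theorem map_cd {G : Type*} [FunLike G M N] [AddMonoidHomClass G M N] (φ : G)
    (F : List X → M) (l : List X) :
    φ (O.cd F l) = O.cd (fun l => φ (F l)) l := by
  induction l generalizing F with
  | nil => simp [map_zsmul]
  | cons c l ih => simp [cd_cons, ih, map_hd, map_zsmul]

theorem mul_cd {R : Type*} [Ring R] (x : R) (F : List X → R) (l : List X) :
    x * O.cd F l = O.cd (fun l => x * F l) l := O.map_cd (AddMonoidHom.mulLeft x) F l

theorem cd_mul {R : Type*} [Ring R] (x : R) (F : List X → R) (l : List X) :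
    O.cd F l * x = O.cd (fun l => F l * x) l := O.map_cd (AddMonoidHom.mulRight x) F l

theorem cd_add (F G : List X → M) (l : List X) :
    O.cd (fun l => F l + G l) l = O.cd F l + O.cd G l := by
  induction l generalizing F G with
  | nil => simp
  | cons c l ih => simp only [cd_cons, ih, hd_add, smul_add]; abel

theorem cd_smul (n : ℤ) (F : List X → M) (l : List X) :
    O.cd (fun l => n • F l) l = n • O.cd F l :=
  (O.map_cd (DistribSMul.toAddMonoidHom M n) F l).symm

theorem cd_neg (F : List X → M) (l : List X) : O.cd (fun l => -F l) l = -O.cd F l :=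
  (O.map_cd (-AddMonoidHom.id M) F l).symm

theorem cd_sub (F G : List X → M) (l : List X) :
    O.cd (fun l => F l - G l) l = O.cd F l - O.cd G l := by
  simp only [sub_eq_add_neg, cd_add, cd_neg]

theorem cd_eq_zero (n : ℕ) (F : List X → M) (hF : ∀ l, n ≤ l.length → F l = 0) (l : List X)
    (hl : n + 1 ≤ l.length) : O.cd F l = 0 := by
  induction l generalizing F n with
  | nil => simp at hl
  | cons c l ih =>
    rw [List.length_cons, Nat.add_le_add_iff_right] at hl
    have h3 : hd (fun d l' => F (O.m c d :: l')) l = 0 := by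
      cases l with
      | nil => rfl
      | cons d l => exact hF _ hl
    have h4 : O.cd (fun l => F (c :: l)) l = 0 := by
      cases n with
      | zero =>
        have : (fun l => F (c :: l)) = fun _ => (0 : ℤ) • (0 : M) := by
          funext l; rw [hF _ (Nat.zero_le _), smul_zero]
        rw [this, cd_smul, zero_smul]
      | succ n => exact ih n _ (fun l hl => hF _ (Nat.succ_le_succ hl)) hl
    rw [cd_cons, hF _ (by simp; omega), hF _ (by simp; omega), h3, h4]
    simp

/-- The co-Leibniz rule of a coderivation with respect to the cuts of a list. -/
theorem cd_spl (F : List X → List X → M) (l : List X) :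
    O.cd (spl F) l =
      spl (fun u v => O.cd (fun u => F u v) u + sg (O.par u) • O.cd (fun v => F u v) v) l := by
  induction l generalizing F with
  | nil => simp; abel
  | cons c l ih =>
    have h : spl (fun u v => hd (fun d u' => F (O.m c d :: u') v) u) l =
        hd (fun d l' => spl (fun u v => F (O.m c d :: u) v) l') l := (hd_spl _ _).symm
    simp only [cd_cons, spl_cons, cd_add, ih, cd_nil, par_nil, sg_zero, one_smul, par_cons,
      sg_add, spl_add, spl_smul, hd_add, smul_add, mul_smul, h]
    abel

theorem cd_spl_comm {Y : Type*} (F : List Y → List Y → List X → M) (l : List Y) (V : List X) :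
    O.cd (fun W => spl (fun u v => F u v W) l) V = spl (fun u v => O.cd (F u v) V) l := by
  induction l generalizing F with
  | nil => rfl
  | cons c l ih => simp only [spl_cons, cd_add, ih]

/-- The operations are odd with respect to the parity. -/
structure Odd : Prop where
  w : O.p O.w = 1
  f : O.c₁ = 0 ∨ ∀ c, O.p (O.f c) = O.p c + 1
  m : ∀ c d, O.p (O.m c d) = O.p c + O.p d + 1

variable {O}

/-- A sign that depends on the parity of the word passes an odd coderivation with its argument
shifted by one. -/
theorem Odd.cd_sg (h : O.Odd) (σ : ZMod 2 → ℤ) (F : List X → M) (l : List X) :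
    O.cd (fun l => σ (O.par l) • F l) l = σ (O.par l + 1) • O.cd F l := by
  induction l generalizing F σ with
  | nil => rw [cd_nil, cd_nil, par_cons, h.w, par_nil, zero_add, add_zero, smul_comm]
  | cons c l ih =>
    have := ih (fun x => σ (O.p c + x))
    have e₁ : O.c₁ • σ (O.p (O.f c) + O.par l) • F (O.f c :: l) =
        O.c₁ • σ (O.p c + O.par l + 1) • F (O.f c :: l) := by
      rcases h.f with h | h
      · simp [h]
      · rw [h, add_right_comm]
    simp only [cd_cons, par_cons, h.w, this, e₁]
    have e : hd (fun d l' => σ (O.p (O.m c d) + O.par l') • F (O.m c d :: l')) l =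
        σ (O.p c + O.par l + 1) • hd (fun d l' => F (O.m c d :: l')) l := by
      rw [← hd_smul]
      refine hd_congr fun d v hv => ?_
      rw [← hv, h.m, par_cons]
      congr 2
      ring
    rw [e]
    rw [show 1 + (O.p c + O.par l) = O.p c + O.par l + 1 by ring,
      show O.p c + (O.par l + 1) = O.p c + O.par l + 1 by ring]
    simp only [smul_add]
    rw [smul_comm O.c₀, smul_comm O.c₁, smul_comm O.c₂, smul_comm (sg _)]

variable (O)

/-- The coderivation of a word with a letter `a` in the middle. -/
theorem cd_append (F : List X → M) (z : List X) (a : X) (u : List X) :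
    O.cd F (z ++ a :: u) =
      O.cd (fun z => F (z ++ a :: u)) z + sg (O.par z) • O.c₁ • F (z ++ O.f a :: u) +
      lst (fun z' c => sg (O.par z') • O.c₂ • F (z' ++ O.m c a :: u)) z +
      sg (O.par z) • O.c₂ • hd (fun c u' => F (z ++ O.m a c :: u')) u +
      sg (O.par z + O.p a) • O.cd (fun u => F (z ++ a :: u)) u := by
  induction z generalizing F with
  | nil => simp [cd_cons]
  | cons c z ih =>
    rw [List.cons_append, cd_cons, cd_cons, ih]
    rw [hd_append]
    have e : (sg (O.p c) • lst (fun z' d => sg (O.par z') • O.c₂ • F (c :: (z' ++ O.m d a :: u))) z)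
        = lst (fun z' d => sg (O.par (c :: z')) • O.c₂ • F (c :: z' ++ O.m d a :: u)) z := by
      rw [← lst_smul]
      simp only [par_cons, sg_add, mul_smul, List.cons_append]
    rw [lst_cons, ← e]
    simp only [par_cons, par_nil, sg_zero, one_smul, sg_add, mul_smul, smul_add, hd_cons,
      List.cons_append, List.nil_append]
    rw [nl_smul]
    abel

end Ops

end

section

variable {k : Type*} [CommRing k] [Algebra ℚ k] {A : Type*} [Ring A] [Algebra k A]
variable {𝒜 : ZMod 2 → Submodule k A} [GradedAlgebra 𝒜]

/-! ### Homogeneous letters and even cochains -/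

theorem parity_of_mem {a : A} {p : ZMod 2} (h : a ∈ 𝒜 p) : parity 𝒜 a = sg p • a := by
  have h0 : (0 : ZMod 2) ≠ 1 := by decide
  rw [parity, LinearMap.sub_apply, GradedAlgebra.proj_apply, GradedAlgebra.proj_apply]
  rcases (by decide : ∀ p : ZMod 2, p = 0 ∨ p = 1) p with rfl | rfl
  · rw [DirectSum.decompose_of_mem_same 𝒜 h, DirectSum.decompose_of_mem_ne 𝒜 h h0]
    simp
  · rw [DirectSum.decompose_of_mem_same 𝒜 h, DirectSum.decompose_of_mem_ne 𝒜 h h0.symm]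
    simp

theorem shift_of_mem {a : A} {p : ZMod 2} (h : a ∈ 𝒜 p) : shift 𝒜 a = sg (p + 1) • a := by
  rw [shift, LinearMap.neg_apply, parity_of_mem h, sg_add_one, neg_smul]

theorem superComm_of_mem (D : A) {a : A} {p : ZMod 2} (h : a ∈ 𝒜 p) :
    superComm 𝒜 D a = D * a - sg p • (a * D) := by
  rw [superComm, LinearMap.sub_apply, LinearMap.comp_apply, parity_of_mem h, map_zsmul,
    LinearMap.mulLeft_apply, LinearMap.mulRight_apply]

variable (𝒜) in
/-- A homogeneous element of `A`. -/
structure Letter where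
  /-- the element -/
  val : A
  /-- its parity -/
  deg : ZMod 2
  mem : val ∈ 𝒜 deg

/-- The operations on homogeneous elements, with the parity `|a| = deg a - 1`: the curved
`A_∞`-structure `m + ∇` with components `-D²`, `[D, a]` and `(-1)^{deg a} a b`. -/
def lops (D : 𝒜 1) : Ops (Letter 𝒜) where
  p c := c.deg + 1
  c₀ := 1
  w := ⟨-(D * D : A), 0, neg_mem (SetLike.mul_mem_graded D.2 D.2)⟩
  c₁ := 1
  f c := ⟨superComm 𝒜 D c.val, c.deg + 1, by
    rw [superComm_of_mem _ c.mem]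
    refine sub_mem ?_ (zsmul_mem (SetLike.mul_mem_graded c.mem D.2) _)
    rw [add_comm]
    exact SetLike.mul_mem_graded D.2 c.mem⟩
  c₂ := 1
  m c d := ⟨sg c.deg • (c.val * d.val), c.deg + d.deg,
    zsmul_mem (SetLike.mul_mem_graded c.mem d.mem) _⟩

theorem lops_odd (D : 𝒜 1) : (lops D).Odd where
  w := by simp [lops]
  f := Or.inr fun c => rfl
  m c d := by
    simp only [lops]
    generalize c.deg = x
    generalize d.deg = y
    revert x y
    decide

/-- The word of a list of homogeneous elements. -/
def wd : List (Letter 𝒜) → TensorAlgebra k A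
  | [] => 1
  | c :: l => TensorAlgebra.ι k c.val * wd l

@[simp] theorem wd_nil : wd ([] : List (Letter 𝒜)) = 1 := rfl

@[simp] theorem wd_cons (c : Letter 𝒜) (l : List (Letter 𝒜)) :
    wd (c :: l) = TensorAlgebra.ι k c.val * wd l := rfl

/-- The reduced word of a list of homogeneous elements. -/
def bar (l : List (Letter 𝒜)) : Words k A := mapWord (toBar k A) (wd l)

@[simp] theorem bar_nil : bar ([] : List (Letter 𝒜)) = 1 := by simp [bar]

@[simp] theorem bar_cons (c : Letter 𝒜) (l : List (Letter 𝒜)) :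
    bar (c :: l) = TensorAlgebra.ι k (toBar k A c.val) * bar l := by simp [bar]

theorem wd_append (u v : List (Letter 𝒜)) : wd (u ++ v) = wd u * wd v := by
  induction u with
  | nil => simp
  | cons c u ih => simp [ih, mul_assoc]

theorem bar_append (u v : List (Letter 𝒜)) : bar (u ++ v) = bar u * bar v := by
  simp [bar, wd_append, mapWord_mul]

/-- Even cochains that are covariantly constant for the curved `A_∞`-structure `m + ∇`. -/
structure Parallel (D : 𝒜 1) where
  /-- the cochain -/
  toCochain : Cochains k A
  mem : ∀ l : List (Letter 𝒜), toCochain (bar l) ∈ 𝒜 ((lops D).par l)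
  eq : ∀ l : List (Letter 𝒜), (lops D).cd (fun l => toCochain (bar l)) l =
    hd (fun c l' => c.val * toCochain (bar l')) l -
      lst (fun l' c => sg ((lops D).par l') • (toCochain (bar l') * c.val)) l

variable {D : 𝒜 1}

/-- The value of a cochain on a list of homogeneous elements. -/
def Parallel.ev (E : Parallel D) (l : List (Letter 𝒜)) : A := E.toCochain (bar l)

theorem Parallel.ev_mem (E : Parallel D) (l : List (Letter 𝒜)) :
    E.ev l ∈ 𝒜 ((lops D).par l) := E.mem l

theorem Parallel.cd_ev (E : Parallel D) (l : List (Letter 𝒜)) :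
    (lops D).cd E.ev l = hd (fun c l' => c.val * E.ev l') l -
      lst (fun l' c => sg ((lops D).par l') • (E.ev l' * c.val)) l := E.eq l

theorem conv_bar {R : Type*} [Ring R] [Algebra k R] (f g : Words k A →ₗ[k] R)
    (l : List (Letter 𝒜)) :
    conv f g (bar l) = spl (fun u v => f (bar u) * g (bar v)) l := by
  induction l generalizing f with
  | nil => simp [conv]
  | cons c l ih => rw [bar_cons, conv_ι_mul, ih]; simp

/-- The unit cochain. -/
def oneP (D : 𝒜 1) : Parallel D where
  toCochain := zeroCochain 1
  mem l := by
    cases l with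
    | nil => simpa [zeroCochain] using SetLike.GradedOne.one_mem
    | cons c l => simp [zeroCochain, TensorAlgebra.algebraMapInv]
  eq l := by
    have h : ∀ l : List (Letter 𝒜), (zeroCochain (k := k) (1 : A)) (bar l) = nl 1 l := by
      rintro (_ | ⟨c, l⟩) <;> simp [zeroCochain, TensorAlgebra.algebraMapInv]
    simp only [h]
    rcases l with (_ | ⟨c, _ | ⟨d, l⟩⟩)
    · simp
    · simp [lst_cons, Ops.cd_cons]
    · rw [Ops.cd_eq_zero _ 1 _ (by rintro (_ | _) <;> simp) _ (by simp), hd_cons, nl_cons,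
        mul_zero, lst_cons, lst_congr (G := fun _ _ => (0 : ℤ) • (0 : A)) (by simp), lst_smul]
      simp

/-- The product of cochains. -/
def Parallel.mul (E E' : Parallel D) : Parallel D where
  toCochain := cup E.toCochain E'.toCochain
  mem l := by
    change conv _ _ _ ∈ _
    rw [conv_bar]
    have : ∀ (F : List (Letter 𝒜) → List (Letter 𝒜) → A) (p : ZMod 2),
        (∀ u v, u ++ v = l → F u v ∈ 𝒜 p) → spl F l ∈ 𝒜 p := by
      intro F p hF
      induction l generalizing F with
      | nil => exact hF [] [] rfl
      | cons c l ih =>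
        rw [spl_cons]
        exact add_mem (hF _ _ rfl) (ih _ fun u v h => hF _ _ (by rw [← h]; rfl))
    refine this _ _ fun u v h => ?_
    rw [← h, Ops.par_append]
    exact SetLike.mul_mem_graded (E.mem u) (E'.mem v)
  eq l := by
    have h : ∀ l : List (Letter 𝒜), cup E.toCochain E'.toCochain (bar l) =
      spl (fun u v => E.ev u * E'.ev v) l := fun l => conv_bar _ _ l
    simp only [h]
    rw [Ops.cd_spl]
    have h1 : ∀ u v, (lops D).cd (fun u => E.ev u * E'.ev v) u =
        hd (fun c l' => c.val * E.ev l' * E'.ev v) u -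
      lst (fun l' c => sg ((lops D).par l') • (E.ev l' * c.val * E'.ev v)) u := by
      intro u v
      rw [← Ops.cd_mul, E.cd_ev, sub_mul, hd_mul, lst_mul]
      simp only [smul_mul_assoc]
    have h2 : ∀ u v, (lops D).cd (fun v => E.ev u * E'.ev v) v =
        hd (fun c l' => E.ev u * c.val * E'.ev l') v -
      lst (fun l' c => sg ((lops D).par l') • (E.ev u * (E'.ev l' * c.val))) v := by
      intro u v
      rw [← Ops.mul_cd, E'.cd_ev, mul_sub, mul_hd, mul_lst]
      simp only [mul_smul_comm, mul_assoc]
    simp only [h1, h2, smul_sub, spl_add, spl_sub]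
    have e3 := spl_lst_eq_spl_hd (fun u' c v => sg ((lops D).par u') •
      (E.ev u' * c.val * E'.ev v)) l
    simp only [hd_smul] at e3
    rw [e3]
    have e4 := hd_spl (fun c u v => c.val * (E.ev u * E'.ev v)) l
    have e5 := lst_spl (fun u v c => sg ((lops D).par u + (lops D).par v) •
      (E.ev u * (E'.ev v * c.val))) l
    have e7 : (fun (l' : List (Letter 𝒜)) (c : Letter 𝒜) => sg ((lops D).par l') •
        (spl (fun u v => E.ev u * E'.ev v) l' * c.val)) =
        fun l' c => spl (fun u v => sg ((lops D).par u + (lops D).par v) •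
          (E.ev u * (E'.ev v * c.val))) l' := by
      funext l' c
      rw [spl_mul, ← spl_smul]
      refine spl_congr fun u v h => ?_
      rw [← h, Ops.par_append, mul_assoc]
    simp only [mul_spl]
    rw [e7, e4, e5]
    simp only [sg_add, mul_smul, lst_smul, mul_assoc]
    abel

theorem nabla_bar (D : 𝒜 1) :
    ∀ l : List (Letter 𝒜), (adCochain 𝒜 (D : A) - zeroCochain (D * D : A) : Cochains k A) (bar l) =
      match l with
      | [] => -(D * D : A)
      | [c] => superComm 𝒜 (D : A) c.val
      | _ :: _ :: _ => 0
  | [] => by simp [adCochain, zeroCochain]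
  | [c] => by
    have h := ιInv_ι_mul (k := k) (toBar k A c.val) 1
    rw [mul_one, map_one, one_smul] at h
    rw [bar_cons, bar_nil, mul_one, LinearMap.sub_apply, adCochain, LinearMap.comp_apply, h]
    simp [zeroCochain, TensorAlgebra.algebraMapInv, adBar]
  | c :: d :: l => by
    simp [adCochain, zeroCochain, ιInv_ι_mul, TensorAlgebra.algebraMapInv]

/-- The cochain `∇ = ad D - D²`. -/
def nablaP (D : 𝒜 1) : Parallel D where
  toCochain := adCochain 𝒜 (D : A) - zeroCochain (D * D : A)
  mem l := by
    rw [nabla_bar]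
    rcases l with (_ | ⟨c, _ | ⟨d, l⟩⟩)
    · exact neg_mem (SetLike.mul_mem_graded D.2 D.2)
    · simpa [lops] using ((lops D).f c).mem
    · exact zero_mem _
  eq l := by
    simp only [nabla_bar]
    have hw : superComm 𝒜 (D : A) ((lops D).w.val) = 0 := by
      rw [superComm_of_mem _ (lops D).w.mem]
      simp [lops, mul_assoc]
    rcases l with (_ | ⟨c, _ | ⟨d, _ | ⟨e, l⟩⟩⟩)
    · simp [hw, Ops.cd_nil]
    · have h1 := superComm_of_mem (D : A) c.mem
      have h2 := superComm_of_mem (D : A) ((lops D).f c).mem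
      have h3 : ((lops D).f c).val = superComm 𝒜 (D : A) c.val := rfl
      have h4 : ((lops D).f c).deg = c.deg + 1 := rfl
      have h5 : (lops D).c₁ = 1 := rfl
      simp only [Ops.cd_cons, Ops.cd_nil, hd_cons, lst_cons, nl_nil, lst_nil, Ops.par_nil,
        sg_zero, one_smul, hd_nil, smul_zero, zero_add, add_zero, h2, h5]
      simp only [h3, h4, h1, sg_add_one]
      simp only [mul_sub, sub_mul, neg_smul, mul_smul_comm, smul_mul_assoc, smul_sub, smul_smul,
        sg_mul_self, one_smul, mul_neg, neg_mul, mul_assoc]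
      abel
    · have h1 := superComm_of_mem (D : A) c.mem
      have h1' := superComm_of_mem (D : A) d.mem
      have h2 := superComm_of_mem (D : A) ((lops D).m c d).mem
      have h3 : ((lops D).m c d).val = sg c.deg • (c.val * d.val) := rfl
      have h4 : ((lops D).m c d).deg = c.deg + d.deg := rfl
      have h5 : (lops D).p c = c.deg + 1 := rfl
      have h6 : (lops D).c₂ = 1 := rfl
      simp only [Ops.cd_cons, Ops.cd_nil, hd_cons, lst_cons, nl_nil, lst_nil, nl_cons, Ops.par_nil,
        Ops.par_cons, h5, sg_add, sg_one, one_smul, hd_nil, smul_zero, zero_add, add_zero, h1, h1',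
        h2, h6, sg_zero, mul_one]
      simp only [h3, h4]
      simp only [mul_sub, sub_mul, neg_smul, mul_smul_comm, smul_mul_assoc, smul_sub, smul_smul,
        sg_mul_self, one_smul, mul_neg, neg_mul, mul_assoc, one_mul, mul_one, ← sg_add]
      rw [show c.deg + d.deg + c.deg = d.deg by
        generalize c.deg = x; generalize d.deg = y; revert x y; decide]
      abel
    · rw [Ops.cd_eq_zero _ 2 _ (by rintro (_ | ⟨c, _ | ⟨d, l⟩⟩) <;> simp) _ (by simp), lst_cons,
        lst_cons, lst_cons]
      rw [lst_congr (G := fun _ _ => (0 : ℤ) • (0 : A)) (by simp), lst_smul]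
      cases l <;> simp

end

section

variable {k : Type*} [CommRing k] [Algebra ℚ k] {A : Type*} [Ring A] [Algebra k A]
variable {𝒜 : ZMod 2 → Submodule k A} [GradedAlgebra 𝒜] {D : 𝒜 1}

/-! ### Insertion of cochains into words -/

/-- The operations on words of cochains: multiplication of adjacent cochains and (up to sign)
insertion of `∇`. -/
def sops (D : 𝒜 1) : Ops (Parallel D) where
  p _ := 1
  c₀ := -1
  w := nablaP D
  c₁ := 0
  f := id
  c₂ := 1
  m := Parallel.mul

theorem sops_odd (D : 𝒜 1) : (sops D).Odd where
  w := rfl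
  f := Or.inl rfl
  m _ _ := by simp only [sops]; decide

/-- `(a₁, …, aₙ) ↦ ∑ ± (E (a₁, …, a_d), q (a_{d+1}, …, aₙ))`. -/
def insAt (E : Parallel D) (q : List (Letter 𝒜) → TensorAlgebra k A) (l : List (Letter 𝒜)) :
    TensorAlgebra k A :=
  sg ((lops D).par l) • spl (fun v r => TensorAlgebra.ι k (E.ev v) * q r) l

/-- Insertion of a list of cochains into a list of homogeneous elements, with values in words
in `A`. -/
def ins : List (Parallel D) → List (Letter 𝒜) → TensorAlgebra k A
  | [] => wd
  | E :: V => fun l => spl (fun u r => wd u * insAt E (ins V) r) l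

/-- The part of `ins V` in which the first letter of the result is a value of a cochain. -/
def insF : List (Parallel D) → List (Letter 𝒜) → TensorAlgebra k A
  | [] => fun _ => 0
  | E :: V => insAt E (ins V)

theorem ins_nil (V : List (Parallel D)) : ins V ([] : List (Letter 𝒜)) = insF V [] + nl 1 V := by
  cases V <;> simp [ins, insF]

theorem ins_cons (V : List (Parallel D)) (c : Letter 𝒜) (l : List (Letter 𝒜)) :
    ins V (c :: l) = insF V (c :: l) + TensorAlgebra.ι k c.val * ins V l := by
  cases V with
  | nil => simp [ins, insF]
  | cons E V => simp [ins, insF, mul_spl, mul_assoc]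

theorem insF_cons (E : Parallel D) (V : List (Parallel D)) (l : List (Letter 𝒜)) :
    insF (E :: V) l = sg ((lops D).par l) •
      spl (fun v r => TensorAlgebra.ι k (E.ev v) * ins V r) l := rfl

theorem uncons_insF (V : List (Parallel D)) (l : List (Letter 𝒜)) :
    uncons (insF V l) = hd (fun E V' => sg ((lops D).par l) •
      spl (fun v r => E.ev v ⊗ₜ[k] ins V' r) l) V := by
  cases V with
  | nil => simp [insF]
  | cons E V => rw [insF_cons, map_zsmul, map_spl]; simp only [uncons_ι_mul, hd_cons]

theorem uncons_ins (V : List (Parallel D)) (l : List (Letter 𝒜)) :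
    uncons (ins V l) = hd (fun c l' => c.val ⊗ₜ[k] ins V l') l +
      hd (fun E V' => sg ((lops D).par l) • spl (fun v r => E.ev v ⊗ₜ[k] ins V' r) l) V := by
  cases l with
  | nil =>
    rw [ins_nil, map_add, uncons_insF]
    cases V <;> simp
  | cons c l => rw [ins_cons, map_add, uncons_insF, uncons_ι_mul, hd_cons, add_comm]

theorem mulHead_ins (a : A) {p : ZMod 2} (ha : a ∈ 𝒜 p) (V : List (Parallel D))
    (l : List (Letter 𝒜)) :
    mulHead 𝒜 a (uncons (ins V l)) =
      hd (fun c l' => sg p • (TensorAlgebra.ι k (a * c.val) * ins V l')) l +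
      hd (fun E V' => sg ((lops D).par l + p) •
        spl (fun v r => TensorAlgebra.ι k (a * E.ev v) * ins V' r) l) V := by
  rw [uncons_ins, map_add, map_hd, map_hd]
  simp only [map_zsmul, map_spl, mulHead, LinearMap.comp_apply, TensorProduct.map_tmul,
    LinearMap.mul'_apply, LinearMap.mulLeft_apply, parity_of_mem ha, LinearMap.id_apply,
    smul_mul_assoc, sg_add, mul_smul, spl_smul]

theorem Parallel.cd_ι_ev_mul (E : Parallel D) (x : TensorAlgebra k A) (v : List (Letter 𝒜)) :
    (lops D).cd (fun v => TensorAlgebra.ι k (E.ev v) * x) v =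
      hd (fun c v' => TensorAlgebra.ι k (c.val * E.ev v') * x) v -
        lst (fun v' c => sg ((lops D).par v') • (TensorAlgebra.ι k (E.ev v' * c.val) * x)) v := by
  rw [← Ops.cd_mul, ← Ops.map_cd, E.cd_ev, map_sub, map_hd, map_lst, sub_mul, hd_mul, lst_mul]
  simp only [map_zsmul, smul_mul_assoc]

theorem Parallel.mul_ev (E E' : Parallel D) (l : List (Letter 𝒜)) :
    (E.mul E').ev l = spl (fun u v => E.ev u * E'.ev v) l := conv_bar _ _ l

theorem nablaP_ev (l : List (Letter 𝒜)) : (nablaP D).ev l =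
    match l with
    | [] => (lops D).w.val
    | [c] => ((lops D).f c).val
    | _ :: _ :: _ => 0 := nabla_bar D l

theorem spl_nablaP_mul (q : List (Letter 𝒜) → TensorAlgebra k A) (l : List (Letter 𝒜)) :
    spl (fun v r => TensorAlgebra.ι k ((nablaP D).ev v) * q r) l =
      TensorAlgebra.ι k (lops D).w.val * q l +
        hd (fun c l' => TensorAlgebra.ι k ((lops D).f c).val * q l') l := by
  rcases l with (_ | ⟨c, _ | ⟨d, l⟩⟩)
  · simp [nablaP_ev]
  · simp [nablaP_ev]
  · simp [nablaP_ev, spl_zero]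

/-- The inductive step for the bar differential of a word with insertions: the words whose first
letter is a value of `E`. Since `E` is parallel, the operations on its arguments produce
multiplications of its value with the neighbouring letters; the multiplication with a letter on
the left, which is not part of such a word, gives the last term. -/
theorem barDiff_insF (E : Parallel D) (V : List (Parallel D)) (l : List (Letter 𝒜))
    (ih : ∀ r, barDiff 𝒜 (ins V r) = (lops D).cd (ins V) r +
      sg ((lops D).par r) • (sops D).cd (fun W => ins W r) V) :
    barDiff 𝒜 (insF (E :: V) l) = (lops D).cd (insF (E :: V)) l +
      sg ((lops D).par l) • (hd (fun E' V' => insF (E.mul E' :: V') l) V -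
        (sops D).cd (fun W => insF (E :: W) l) V) +
      hd (fun c l' => sg ((lops D).par (c :: l')) •
        spl (fun v r => TensorAlgebra.ι k (c.val * E.ev v) * ins V r) l') l := by
  -- the value of `E` times the value of the next cochain: the two merge into their cup product
  have hb : spl (fun v r => hd (fun E' V' => sg ((lops D).par r + (lops D).par v) •
      spl (fun v' r' => TensorAlgebra.ι k (E.ev v * E'.ev v') * ins V' r') r) V) l =
      hd (fun E' V' => insF (E.mul E' :: V') l) V := by
    cases V with
    | nil => simp [spl_zero]
    | cons E' V' =>
      simp only [hd_cons, insF_cons, Parallel.mul_ev, map_spl, spl_mul]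
      rw [← spl_assoc, ← spl_smul]
      refine spl_congr fun u v h => ?_
      rw [← h, Ops.par_append, add_comm]
  have hc : (sops D).cd (fun W => insF (E :: W) l) V = sg ((lops D).par l) •
      spl (fun v r => TensorAlgebra.ι k (E.ev v) * (sops D).cd (fun W => ins W r) V) l := by
    simp only [insF_cons, Ops.cd_smul, Ops.cd_spl_comm, Ops.mul_cd]
  have hc2 : spl (fun v r => sg ((lops D).par r) • sg ((lops D).par v + 1) •
      (TensorAlgebra.ι k (E.ev v) * (sops D).cd (fun W => ins W r) V)) l =
      -(sops D).cd (fun W => insF (E :: W) l) V := by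
    rw [hc, ← neg_smul, ← sg_add_one, ← spl_smul]
    refine spl_congr fun u v h => ?_
    rw [← h, Ops.par_append, smul_smul, ← sg_add]
    congr 2
    ring
  -- a letter in front of the arguments of `E`, multiplied with its value
  have hh : hd (fun c l' => sg ((lops D).par (c :: l')) •
        spl (fun v r => TensorAlgebra.ι k (c.val * E.ev v) * ins V r) l') l =
      sg ((lops D).par l) • spl (fun v r =>
        hd (fun c v' => TensorAlgebra.ι k (c.val * E.ev v') * ins V r) v) l := by
    rw [← hd_spl, ← hd_smul]
    exact hd_congr fun c v h => by rw [← h]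
  -- the value of `E` times the letter after its arguments
  have ht : spl (fun v r => hd (fun c r' => sg ((lops D).par v) •
        (TensorAlgebra.ι k (E.ev v * c.val) * ins V r')) r) l =
      spl (fun v r => lst (fun v' c => sg ((lops D).par v') •
        (TensorAlgebra.ι k (E.ev v' * c.val) * ins V r)) v) l :=
    (spl_lst_eq_spl_hd (fun v c r => sg ((lops D).par v) •
        (TensorAlgebra.ι k (E.ev v * c.val) * ins V r)) l).symm
  -- the operations on the letters, by the equation of the parallel cochain `E`
  have hcd : (lops D).cd (insF (E :: V)) l = -(sg ((lops D).par l) •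
      (spl (fun v r => hd (fun c v' => TensorAlgebra.ι k (c.val * E.ev v') * ins V r) v) l -
        spl (fun v r => lst (fun v' c => sg ((lops D).par v') •
          (TensorAlgebra.ι k (E.ev v' * c.val) * ins V r)) v) l +
        spl (fun v r => sg ((lops D).par v) •
          (TensorAlgebra.ι k (E.ev v) * (lops D).cd (ins V) r)) l)) := by
    have := (lops_odd D).cd_sg sg
      (fun l => spl (fun v r => TensorAlgebra.ι k (E.ev v) * ins V r) l) l
    refine this.trans ?_
    rw [sg_add_one, neg_smul, Ops.cd_spl, spl_add]
    simp only [Parallel.cd_ι_ev_mul, spl_sub, ← Ops.mul_cd]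
  have hl : barDiff 𝒜 (insF (E :: V) l) = sg ((lops D).par l) •
      (spl (fun v r => hd (fun c r' => sg ((lops D).par v) •
        (TensorAlgebra.ι k (E.ev v * c.val) * ins V r')) r) l +
       spl (fun v r => hd (fun E' V' => sg ((lops D).par r + (lops D).par v) •
         spl (fun v' r' => TensorAlgebra.ι k (E.ev v * E'.ev v') * ins V' r') r) V) l +
       (spl (fun v r => sg ((lops D).par v + 1) •
          (TensorAlgebra.ι k (E.ev v) * (lops D).cd (ins V) r)) l +
        spl (fun v r => sg ((lops D).par r) • sg ((lops D).par v + 1) •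
          (TensorAlgebra.ι k (E.ev v) * (sops D).cd (fun W => ins W r) V)) l)) := by
    rw [insF_cons, map_zsmul, map_spl]
    simp only [barDiff_ι_mul, mulHead_ins _ (E.ev_mem _), ih, shift_of_mem (E.ev_mem _),
      map_zsmul, mul_add, smul_mul_assoc, mul_smul_comm, spl_add, smul_add]
  rw [hl, hcd, hb, hc2, hh, ht]
  simp only [sg_add_one, neg_smul, spl_neg, smul_add, smul_sub, smul_neg]
  abel

theorem cd_insF (V : List (Parallel D)) (l : List (Letter 𝒜)) :
    (sops D).cd (fun W => insF W l) V = -insF (nablaP D :: V) l +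
      hd (fun E V' => hd (fun E' V'' => insF (E.mul E' :: V'') l) V' -
        (sops D).cd (fun W => insF (E :: W) l) V') V := by
  cases V with
  | nil => simp [sops]
  | cons E V =>
    rw [Ops.cd_cons, hd_cons, show (sops D).p E = 1 from rfl, show (sops D).c₀ = -1 from rfl,
      show (sops D).c₁ = 0 from rfl, show (sops D).c₂ = 1 from rfl,
      show (sops D).w = nablaP D from rfl, show (sops D).m = Parallel.mul from rfl]
    simp only [neg_smul, one_smul, zero_smul, sg_one, add_zero]
    abel

/-- The formula for words with insertions whose first letter is a value of a cochain implies the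
formula for all words with insertions, by induction over the letters in front. -/
theorem barDiff_ins_of_insF (V : List (Parallel D)) (hF : ∀ l : List (Letter 𝒜),
      barDiff 𝒜 (insF V l) = (lops D).cd (insF V) l + sg ((lops D).par l) •
        hd (fun E V' => hd (fun E' V'' => insF (E.mul E' :: V'') l) V' -
          (sops D).cd (fun W => insF (E :: W) l) V') V +
        hd (fun E V' => hd (fun c l' => sg ((lops D).par (c :: l')) •
          spl (fun v r => TensorAlgebra.ι k (c.val * E.ev v) * ins V' r) l') l) V)
    (l : List (Letter 𝒜)) :
    barDiff 𝒜 (ins V l) = (lops D).cd (ins V) l +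
      sg ((lops D).par l) • (sops D).cd (fun W => ins W l) V := by
  -- inserting `∇` in front has the effect of `-D²` and `[D, ·]` on the first letter
  have hnabla : ∀ l : List (Letter 𝒜), insF (nablaP D :: V) l = sg ((lops D).par l) •
      (TensorAlgebra.ι k (lops D).w.val * ins V l +
        hd (fun c l' => TensorAlgebra.ι k ((lops D).f c).val * ins V l') l) := by
    intro l
    rw [insF_cons, spl_nablaP_mul]
  -- the part of `ins V` in which no cochain stands in front
  have hK : ∀ l : List (Letter 𝒜), ins V l = insF V l +
      (hd (fun c l' => TensorAlgebra.ι k c.val * ins V l') l + nl (nl 1 V) l) := by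
    rintro (_ | ⟨c, l⟩)
    · simp [ins_nil]
    · simp [ins_cons]
  have hcd : (lops D).cd (ins V) l = (lops D).cd (insF V) l + (lops D).cd (fun l =>
      hd (fun c l' => TensorAlgebra.ι k c.val * ins V l') l + nl (nl 1 V) l) l := by
    rw [← Ops.cd_add]
    congr 1
    funext l
    exact hK l
  have hw : (lops D).c₀ = 1 := rfl
  have h1 : (lops D).c₁ = 1 := rfl
  have h2 : (lops D).c₂ = 1 := rfl
  induction l with
  | nil =>
    have hS : (sops D).cd (fun W => ins W ([] : List (Letter 𝒜))) V =
        (sops D).cd (fun W => insF W ([] : List (Letter 𝒜))) V := by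
      simp only [ins_nil, Ops.cd_add]
      rw [add_eq_left]
      rcases V with (_ | ⟨E, _ | ⟨E', V⟩⟩)
      · simp
      · simp [Ops.cd_cons]
      · exact Ops.cd_eq_zero _ 1 _ (by rintro (_ | _) <;> simp) _ (by simp)
    have hb : barDiff 𝒜 (nl (1 : TensorAlgebra k A) V) = 0 := by
      cases V with
      | nil => simp [barDiff, conv, mulCochain_one]
      | cons => simp
    rw [hcd, hS, cd_insF, hnabla, ins_nil, map_add, hF, hb]
    simp only [Ops.cd_nil, hw, hd_nil, hd_cons, nl_cons, nl_nil, Ops.par_nil, sg_zero, one_smul,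
      ins_nil]
    have : hd (fun (_ : Parallel D) (_ : List (Parallel D)) => (0 : TensorAlgebra k A)) V = 0 := by
      cases V <;> simp
    rw [this]
    abel
  | cons c l ih =>
    have hS : (sops D).cd (fun W => ins W (c :: l)) V =
        (sops D).cd (fun W => insF W (c :: l)) V +
          TensorAlgebra.ι k c.val * (sops D).cd (fun W => ins W l) V := by
      simp only [ins_cons, Ops.cd_add, Ops.mul_cd]
    have hih : barDiff 𝒜 (ins V l) = (lops D).cd (ins V) l +
        sg ((lops D).par l) • (sops D).cd (fun W => ins W l) V := by
      apply ih
      rw [← Ops.cd_add]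
      congr 1
      funext l
      exact hK l
    have hK' : (lops D).cd (fun l =>
        hd (fun c l' => TensorAlgebra.ι k c.val * ins V l') l + nl (nl 1 V) l) (c :: l) =
        TensorAlgebra.ι k (lops D).w.val * ins V (c :: l) +
        TensorAlgebra.ι k ((lops D).f c).val * ins V l +
        hd (fun d l' => TensorAlgebra.ι k ((lops D).m c d).val * ins V l') l +
        sg ((lops D).p c) • (TensorAlgebra.ι k c.val * (lops D).cd (ins V) l) := by
      rw [Ops.cd_cons]
      simp only [hw, h1, h2, one_smul, hd_cons, nl_cons, add_zero, Ops.mul_cd]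
    have hm : ∀ d : Letter 𝒜, ((lops D).m c d).val = sg c.deg • (c.val * d.val) := fun _ => rfl
    have hp : (lops D).p c = c.deg + 1 := rfl
    have hH : hd (fun (E : Parallel D) V' => sg ((lops D).par l + c.deg) • spl (fun v r =>
          TensorAlgebra.ι k (c.val * E.ev v) * ins V' r) l) V =
        -hd (fun (E : Parallel D) V' => sg ((lops D).par (c :: l)) • spl (fun v r =>
          TensorAlgebra.ι k (c.val * E.ev v) * ins V' r) l) V := by
      cases V with
      | nil => simp
      | cons E V =>
        rw [hd_cons, hd_cons, ← neg_smul, ← sg_add_one, Ops.par_cons, hp]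
        congr 2
        generalize (lops D).par l = x
        generalize c.deg = y
        revert x y
        decide
    have hn := hnabla (c :: l)
    have hN : sg ((lops D).par (c :: l)) • insF (nablaP D :: V) (c :: l) =
        TensorAlgebra.ι k (lops D).w.val * ins V (c :: l) +
          TensorAlgebra.ι k ((lops D).f c).val * ins V l := by
      rw [hn, smul_smul, sg_mul_self, one_smul, hd_cons]
    rw [hcd, hS, cd_insF, smul_add, smul_add, smul_neg, hN, hK', ins_cons, map_add, hF,
      barDiff_ι_mul, hih, mulHead_ins _ c.mem, hH, shift_of_mem c.mem]
    simp only [hd_cons, hm, map_zsmul, smul_mul_assoc, smul_add, mul_add, smul_neg, mul_smul_comm,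
      smul_smul, ins_cons, sg_mul_self, one_smul, hp, Ops.par_cons, sg_add, mul_assoc]
    have hx : ∀ x : TensorAlgebra k A, sg ((lops D).par l) • sg c.deg • sg 1 • x =
        sg c.deg • sg 1 • sg ((lops D).par l) • x := fun x => by
      rw [smul_comm, smul_comm (sg ((lops D).par l))]
    simp only [← mul_assoc (sg c.deg), sg_mul_self, one_smul, mul_smul, hx]
    abel

/-- The bar differential of a word with insertions. -/
theorem barDiff_ins (V : List (Parallel D)) (l : List (Letter 𝒜)) :
    barDiff 𝒜 (ins V l) = (lops D).cd (ins V) l +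
      sg ((lops D).par l) • (sops D).cd (fun W => ins W l) V := by
  induction V generalizing l with
  | nil =>
    refine barDiff_ins_of_insF [] (fun l => ?_) l
    have : (lops D).cd (insF ([] : List (Parallel D))) l = 0 := by
      have h := (lops D).cd_smul 0 (insF ([] : List (Parallel D))) l
      rw [zero_smul] at h
      rw [← h]
      congr 1
      funext l
      rw [zero_smul]
      rfl
    rw [this]
    simp [insF]
  | cons E V ihV =>
    refine barDiff_ins_of_insF (E :: V) (fun l => ?_) l
    rw [barDiff_insF E V l ihV]
    rfl

end

section

/-! ### Cutting words with insertions -/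

theorem spl_lst_comm {X Y M : Type*} [AddCommGroup M] (F : List X → List X → List Y → Y → M)
    (l : List X) (V : List Y) :
    spl (fun u v => lst (F u v) V) l = lst (fun W c => spl (fun u v => F u v W c) l) V := by
  induction l generalizing F with
  | nil => rfl
  | cons c l ih => simp only [spl_cons, lst_add, ih]

section WordProducts

variable {k : Type*} [CommRing k] {V : Type*} [AddCommGroup V] [Module k V]

theorem counit_ι_mul (a : V) (w : TensorAlgebra k V) :
    TensorAlgebra.algebraMapInv (TensorAlgebra.ι k a * w) = (0 : k) := by
  simp [TensorAlgebra.algebraMapInv]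

theorem unsnoc_mul (X Y : TensorAlgebra k V) : unsnoc (X * Y) =
    TensorAlgebra.algebraMapInv Y • unsnoc X +
      LinearMap.rTensor V (LinearMap.mulLeft k X) (unsnoc Y) := by
  induction X using word_induction with
  | h_one =>
    have : LinearMap.mulLeft k (1 : TensorAlgebra k V) = LinearMap.id := by ext; simp
    rw [one_mul, this]
    simp
  | h_add x y hx hy =>
    rw [add_mul, map_add, hx, hy, map_add, smul_add]
    rw [show LinearMap.mulLeft k (x + y) = LinearMap.mulLeft k x + LinearMap.mulLeft k y by
      ext; simp [add_mul], LinearMap.rTensor_add, LinearMap.add_apply]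
    abel
  | h_smul c x hx =>
    rw [smul_mul_assoc, map_smul, hx, map_smul, smul_add, smul_comm c]
    rw [show LinearMap.mulLeft k (c • x) = c • LinearMap.mulLeft k x by
      ext; simp, LinearMap.rTensor_smul, LinearMap.smul_apply]
  | h_cons a w hw =>
    rw [mul_assoc, unsnoc_ι_mul, hw, unsnoc_ι_mul, map_mul, map_add, map_smul, smul_add, mul_smul,
      smul_comm]
    rw [show LinearMap.mulLeft k (TensorAlgebra.ι k a * w) =
      LinearMap.mulLeft k (TensorAlgebra.ι k a) ∘ₗ LinearMap.mulLeft k w by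
        ext; simp [mul_assoc], LinearMap.rTensor_comp, LinearMap.comp_apply, ← add_assoc]

theorem uncons_mul (X Y : TensorAlgebra k V) : uncons (X * Y) =
    TensorAlgebra.algebraMapInv X • uncons Y +
      LinearMap.lTensor V (LinearMap.mulRight k Y) (uncons X) := by
  induction X using word_induction with
  | h_one => simp
  | h_add x y hx hy => simp only [add_mul, map_add, hx, hy, add_smul]; abel
  | h_smul c x hx =>
    simp only [smul_mul_assoc, map_smul, hx, smul_add, smul_eq_mul, mul_smul]
  | h_cons a w _ => rw [mul_assoc, uncons_ι_mul, counit_ι_mul, uncons_ι_mul]; simp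

end WordProducts

variable {k : Type*} [CommRing k] [Algebra ℚ k] {A : Type*} [Ring A] [Algebra k A]

section TensorSums

variable {X M N : Type*} [AddCommGroup M] [Module k M] [AddCommGroup N] [Module k N]

theorem zsmul_tmul (n : ℤ) (x : M) (y : N) : (n • x) ⊗ₜ[k] y = n • (x ⊗ₜ[k] y) :=
  map_zsmul ((TensorProduct.mk k M N).flip y) n x

theorem tmul_zsmul (n : ℤ) (x : M) (y : N) : x ⊗ₜ[k] (n • y) = n • (x ⊗ₜ[k] y) :=
  map_zsmul (TensorProduct.mk k M N x) n y

theorem spl_tmul (F : List X → List X → M) (y : N) (l : List X) :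
    spl F l ⊗ₜ[k] y = spl (fun u v => F u v ⊗ₜ[k] y) l :=
  map_spl ((TensorProduct.mk k M N).flip y) F l

theorem tmul_spl (x : M) (F : List X → List X → N) (l : List X) :
    x ⊗ₜ[k] spl F l = spl (fun u v => x ⊗ₜ[k] F u v) l :=
  map_spl (TensorProduct.mk k M N x) F l

end TensorSums

/-- `(u ⊗ c) ⊗ (d ⊗ v) ↦ u (c d) v`. -/
def junction : TensorAlgebra k A ⊗[k] A →ₗ[k] A ⊗[k] TensorAlgebra k A →ₗ[k] TensorAlgebra k A :=
  TensorProduct.lift (LinearMap.mk₂ k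
    (fun u c => LinearMap.mulLeft k u ∘ₗ LinearMap.mul' k (TensorAlgebra k A) ∘ₗ
      LinearMap.rTensor _ (TensorAlgebra.ι k ∘ₗ LinearMap.mulLeft k c))
    (fun u u' c => by ext; simp [add_mul])
    (fun r u c => by ext; simp)
    (fun u c c' => by ext; simp [add_mul, mul_add])
    (fun r u c => by ext; simp))

theorem junction_tmul (u : TensorAlgebra k A) (c d : A) (v : TensorAlgebra k A) :
    junction (u ⊗ₜ[k] c) (d ⊗ₜ[k] v) = u * (TensorAlgebra.ι k (c * d) * v) := by
  simp [junction]

variable {𝒜 : ZMod 2 → Submodule k A} [GradedAlgebra 𝒜] {D : 𝒜 1}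

theorem barDiff_one : barDiff 𝒜 (1 : TensorAlgebra k A) = 0 := by
  simp [barDiff, conv, mulCochain_one]

/-- The bar differential of a concatenation. -/
theorem barDiff_mul (X Y : TensorAlgebra k A) :
    barDiff 𝒜 (X * Y) = barDiff 𝒜 X * Y + mapWord (shift 𝒜) X * barDiff 𝒜 Y +
      junction (TensorProduct.map (mapWord (shift 𝒜)) (parity 𝒜) (unsnoc X)) (uncons Y) := by
  induction X using word_induction with
  | h_one => simp [barDiff_one]
  | h_add x y hx hy =>
    simp only [add_mul, map_add, hx, hy, LinearMap.add_apply]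
    abel
  | h_smul c x hx =>
    simp only [smul_mul_assoc, map_smul, hx, LinearMap.smul_apply, smul_add]
  | h_cons a w hw =>
    have h1 : mulHead 𝒜 a (LinearMap.lTensor A (LinearMap.mulRight k Y) (uncons w)) =
        mulHead 𝒜 a (uncons w) * Y := by
      induction uncons w using TensorProduct.induction_on with
      | zero => simp
      | tmul x y => simp [mulHead, mul_assoc]
      | add x y hx hy => simp only [map_add, hx, hy, add_mul]
    have h2 : junction (1 ⊗ₜ[k] parity 𝒜 a) (uncons Y) = mulHead 𝒜 a (uncons Y) := by
      induction uncons Y using TensorProduct.induction_on with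
      | zero => simp
      | tmul x y => rw [junction_tmul]; simp [mulHead]
      | add x y hx hy => simp only [map_add, hx, hy]
    have h3 : ∀ z, junction (TensorProduct.map (mapWord (shift 𝒜)) (parity 𝒜)
        (LinearMap.rTensor A (LinearMap.mulLeft k (TensorAlgebra.ι k a)) z)) (uncons Y) =
        TensorAlgebra.ι k (shift 𝒜 a) * junction (TensorProduct.map (mapWord (shift 𝒜))
          (parity 𝒜) z) (uncons Y) := by
      intro z
      induction z using TensorProduct.induction_on with
      | zero => simp
      | tmul x y =>
        induction uncons Y using TensorProduct.induction_on with
        | zero => simp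
        | tmul x' y' =>
          simp only [LinearMap.rTensor_tmul, TensorProduct.map_tmul, junction_tmul,
            LinearMap.mulLeft_apply, mapWord_ι_mul, mul_assoc]
        | add x y hx hy => simp only [map_add, hx, hy, mul_add]
      | add x y hx hy => simp only [map_add, LinearMap.add_apply, hx, hy, mul_add]
    rw [mul_assoc, barDiff_ι_mul, hw, uncons_mul, map_add, map_smul, h1, barDiff_ι_mul,
      unsnoc_ι_mul, map_add, map_smul, TensorProduct.map_tmul, mapWord_one, map_add,
      LinearMap.add_apply, h3, map_smul, LinearMap.smul_apply, h2, mapWord_ι_mul]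
    simp only [mul_add, add_mul, mul_assoc]
    abel

theorem counit_wd (l : List (Letter 𝒜)) :
    TensorAlgebra.algebraMapInv (wd l) = (nl 1 l : k) := by
  cases l with
  | nil => simp
  | cons c l => rw [wd_cons, counit_ι_mul, nl_cons]

theorem counit_insF (V : List (Parallel D)) (l : List (Letter 𝒜)) :
    TensorAlgebra.algebraMapInv (insF V l) = (0 : k) := by
  cases V with
  | nil => simp [insF]
  | cons E V =>
    rw [insF_cons, map_zsmul, map_spl]
    simp only [counit_ι_mul, spl_zero, smul_zero]

theorem counit_ins (V : List (Parallel D)) (l : List (Letter 𝒜)) :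
    TensorAlgebra.algebraMapInv (ins V l) = (nl (nl 1 V) l : k) := by
  cases l with
  | nil => rw [ins_nil, map_add, counit_insF]; cases V <;> simp
  | cons c l => rw [ins_cons, map_add, counit_insF, counit_ι_mul]; simp

theorem unsnoc_wd (l : List (Letter 𝒜)) : unsnoc (wd l) = lst (fun u c => wd u ⊗ₜ[k] c.val) l := by
  induction l with
  | nil => simp
  | cons c l ih =>
    rw [wd_cons, unsnoc_ι_mul, ih, counit_wd, lst_cons, map_lst]
    congr 1
    cases l <;> simp

/-- The inductive step of `unsnoc_ins`: words whose first letter is a value of `E`. -/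
theorem unsnoc_insF_cons (E : Parallel D) (V : List (Parallel D)) (l : List (Letter 𝒜))
    (ih : ∀ r : List (Letter 𝒜), unsnoc (ins V r) =
      lst (fun r' c => sg ((lops D).p c * (sops D).par V) • (ins V r' ⊗ₜ[k] c.val)) r +
      lst (fun V' E' => spl (fun v w => sg ((sops D).par V * (lops D).par w) •
        (ins V' v ⊗ₜ[k] E'.ev w)) r) V) :
    unsnoc (insF (E :: V) l) =
      lst (fun r' c => sg ((lops D).p c * (sops D).par (E :: V)) •
        (insF (E :: V) r' ⊗ₜ[k] c.val)) l +
      nl (sg ((lops D).par l) • (1 ⊗ₜ[k] E.ev l)) V +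
      lst (fun V' E' => spl (fun v w => sg ((sops D).par (E :: V) * (lops D).par w) •
        (insF (E :: V') v ⊗ₜ[k] E'.ev w)) l) V := by
  have hp : (sops D).par (E :: V) = 1 + (sops D).par V := rfl
  have h0 : spl (fun v r => (nl (nl 1 V) r : k) • ((1 : TensorAlgebra k A) ⊗ₜ[k] E.ev v)) l =
      nl ((1 : TensorAlgebra k A) ⊗ₜ[k] E.ev l) V := by
    have : ∀ (v r : List (Letter 𝒜)), (nl (nl 1 V) r : k) •
        ((1 : TensorAlgebra k A) ⊗ₜ[k] E.ev v) =
        nl (nl ((1 : TensorAlgebra k A) ⊗ₜ[k] E.ev v) V) r := by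
      intro v r
      cases r <;> cases V <;> simp
    simp only [this]
    exact spl_nl_right (fun v => nl ((1 : TensorAlgebra k A) ⊗ₜ[k] E.ev v) V) l
  rw [insF_cons, map_zsmul, map_spl]
  simp only [unsnoc_ι_mul, ih, counit_ins, map_add, spl_add, smul_add, map_lst, map_spl, map_zsmul,
    LinearMap.rTensor_tmul, LinearMap.mulLeft_apply]
  rw [h0, ← nl_smul, ← lst_spl, ← lst_smul, add_comm (nl _ _), add_right_comm]
  congr 1
  · congr 1
    refine lst_congr fun l' c h => ?_
    rw [← h, Ops.par_append, Ops.par_cons, Ops.par_nil, insF_cons, zsmul_tmul, spl_tmul, smul_smul,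
      ← spl_smul, ← spl_smul, add_zero, hp]
    refine spl_congr fun u v _ => ?_
    rw [smul_smul, ← sg_add, ← sg_add]
    congr 2
    ring
  · rw [spl_lst_comm, ← lst_smul]
    refine lst_congr fun V' E' h => ?_
    simp only [insF_cons, zsmul_tmul, spl_tmul, ← spl_smul]
    rw [spl_assoc]
    refine spl_congr fun u v h => spl_congr fun u' v' h' => ?_
    rw [← h, ← h', hp, smul_smul, smul_smul, ← sg_add, ← sg_add]
    congr 2
    simp only [Ops.par_append]
    ring

/-- The last letter of a word with insertions is either the last letter of the list or a value of
the last cochain. -/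
theorem unsnoc_ins (V : List (Parallel D)) (l : List (Letter 𝒜)) : unsnoc (ins V l) =
      lst (fun r' c => sg ((lops D).p c * (sops D).par V) • (ins V r' ⊗ₜ[k] c.val)) l +
      lst (fun V' E' => spl (fun v w => sg ((sops D).par V * (lops D).par w) •
        (ins V' v ⊗ₜ[k] E'.ev w)) l) V := by
  induction V generalizing l with
  | nil => simp [ins, unsnoc_wd]
  | cons E V ih =>
    have h1 : ∀ r : List (Letter 𝒜), (TensorAlgebra.algebraMapInv (insAt E (ins V) r) : k) = 0 :=
      counit_insF (E :: V)
    have h2 := fun r => unsnoc_insF_cons E V r ih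
    simp only [insF] at h2
    simp only [ins, map_spl, unsnoc_mul, h1, h2, zero_smul, zero_add, map_add, spl_add, map_lst,
      map_zsmul, LinearMap.rTensor_tmul, LinearMap.mulLeft_apply]
    rw [lst_cons, ← lst_spl, add_assoc]
    congr 1
    · refine lst_congr fun l' c h => ?_
      rw [spl_tmul, ← spl_smul]
    congr 1
    · cases V with
      | nil => 
        simp only [nl_nil, map_zsmul, LinearMap.rTensor_tmul, LinearMap.mulLeft_apply, mul_one]
        simp [ins, sops]
      | cons => simp [spl_zero]
    · induction V using List.reverseRecOn with
      | nil => simp [spl_zero]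
      | append_singleton V' E' =>
        simp only [lst_concat, map_spl, map_zsmul, LinearMap.rTensor_tmul,
          LinearMap.mulLeft_apply]
        rw [spl_assoc]
        refine spl_congr fun u v _ => ?_
        simp only [ins]
        rw [spl_tmul, ← spl_smul]

theorem unsnoc_insF (E : Parallel D) (V : List (Parallel D)) (l : List (Letter 𝒜)) :
    unsnoc (insF (E :: V) l) =
      lst (fun r' c => sg ((lops D).p c * (sops D).par (E :: V)) •
        (insF (E :: V) r' ⊗ₜ[k] c.val)) l +
      nl (sg ((lops D).par l) • (1 ⊗ₜ[k] E.ev l)) V +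
      lst (fun V' E' => spl (fun v w => sg ((sops D).par (E :: V) * (lops D).par w) •
        (insF (E :: V') v ⊗ₜ[k] E'.ev w)) l) V :=
  unsnoc_insF_cons E V l (unsnoc_ins V)

/-- A cut of a word with insertions cuts both the list of letters and the list of cochains. -/
theorem deconcat_ins (V : List (Parallel D)) (l : List (Letter 𝒜)) : deconcat (ins V l) =
    spl (fun V₁ V₂ => spl (fun u v => sg ((sops D).par V₁ * (lops D).par v) •
      (ins V₁ u ⊗ₜ[k] ins V₂ v)) l) V := by
  induction V generalizing l with
  | nil =>
    simp only [ins, spl_nil, Ops.par_nil, zero_mul, sg_zero, one_smul]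
    induction l with
    | nil => simp
    | cons c l ih =>
      rw [wd_cons, deconcat_ι_mul, ih, spl_cons, mul_spl]
      simp
  | cons E V ih =>
    have hF : ∀ l : List (Letter 𝒜), deconcat (insF (E :: V) l) = 1 ⊗ₜ[k] insF (E :: V) l +
        spl (fun V₁ V₂ => spl (fun u v => sg ((sops D).par (E :: V₁) * (lops D).par v) •
          (insF (E :: V₁) u ⊗ₜ[k] ins V₂ v)) l) V := by
      intro l
      simp only [insF_cons, map_zsmul, map_spl, deconcat_ι_mul, ih, smul_add, spl_add, tmul_zsmul,
        tmul_spl, mul_spl, mul_smul_comm, Algebra.TensorProduct.tmul_mul_tmul, one_mul, zsmul_tmul,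
        spl_tmul]
      congr 1
      rw [spl_exchange, ← spl_smul]
      refine spl_congr fun V₁ V₂ _ => ?_
      rw [spl_assoc, ← spl_smul]
      refine spl_congr fun u v h => ?_
      rw [smul_smul, ← spl_smul, ← spl_smul]
      refine spl_congr fun u' v' h' => ?_
      rw [← h, ← h', Ops.par_cons, show (sops D).p E = 1 from rfl, smul_smul, ← sg_add, ← sg_add]
      congr 2
      simp only [Ops.par_append]
      generalize (lops D).par u' = x, (lops D).par v' = y, (lops D).par v = z, (sops D).par V₁ = w
      revert x y z w
      decide
    have h0 : ∀ V' : List (Parallel D), ins V' ([] : List (Letter 𝒜)) =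
        insF V' [] + nl 1 V' := ins_nil
    induction l with
    | nil =>
      rw [ins_nil, nl_cons, add_zero, hF, spl_cons]
      simp [ins_nil, insF]
    | cons c l ihl =>
      have hd' : deconcat (ins (E :: V) (c :: l)) = deconcat (insF (E :: V) (c :: l)) +
          (1 ⊗ₜ[k] (TensorAlgebra.ι k c.val * ins (E :: V) l) +
            (TensorAlgebra.ι k c.val ⊗ₜ[k] 1) * deconcat (ins (E :: V) l)) := by
        rw [ins_cons, map_add, deconcat_ι_mul]
      rw [hd', hF, ihl]
      simp only [spl_cons, ins_nil, ins_cons, mul_spl, mul_smul_comm, mul_add, spl_add,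
        Algebra.TensorProduct.tmul_mul_tmul, one_mul, TensorProduct.add_tmul, smul_add,
        TensorProduct.tmul_add]
      simp [insF, spl_zero]
      abel

/-- Insertion of a list of cochains, according to the arguments on the left of the value of one
of them. -/
theorem ins_append (P : List (Parallel D)) (E : Parallel D) (U : List (Parallel D))
    (l : List (Letter 𝒜)) : ins (P ++ E :: U) l =
    spl (fun u y => sg ((sops D).par P * (lops D).par y) • (ins P u * insF (E :: U) y)) l := by
  induction P generalizing l with
  | nil => simp [ins, insF]
  | cons E' P ih =>
    simp only [List.cons_append, ins, insAt, ih, mul_smul_comm, mul_spl, smul_mul_assoc, spl_mul]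
    simp only [← spl_smul]
    rw [← spl_assoc]
    refine spl_congr fun u v h => ?_
    rw [spl_assoc]
    refine spl_congr fun u' v' h' => spl_congr fun u'' v'' h'' => ?_
    rw [← h', ← h'', Ops.par_cons, show (sops D).p E' = 1 from rfl, smul_smul, smul_smul,
      ← sg_add, ← sg_add]
    congr 1
    · congr 1
      simp only [Ops.par_append]
      generalize (lops D).par u'' = x, (lops D).par v'' = y, (lops D).par v' = z,
        (sops D).par P = w
      revert x y z w
      decide
    · simp only [mul_assoc]

theorem mapWord_ι {V V' : Type*} [AddCommGroup V] [Module k V] [AddCommGroup V'] [Module k V']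
    (s : V →ₗ[k] V') (a : V) :
    mapWord s (TensorAlgebra.ι k a) = TensorAlgebra.ι k (s a) := by
  simp [mapWord]

theorem shift_wd (l : List (Letter 𝒜)) :
    mapWord (shift 𝒜) (wd l) = sg ((lops D).par l) • wd l := by
  induction l with
  | nil => simp
  | cons c l ih =>
    rw [wd_cons, mapWord_ι_mul, ih, shift_of_mem c.mem, map_zsmul, smul_mul_smul_comm, Ops.par_cons,
      show (lops D).p c = c.deg + 1 from rfl, sg_add, sg_add, sg_add]

theorem shift_ins (V : List (Parallel D)) (l : List (Letter 𝒜)) :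
    mapWord (shift 𝒜) (ins V l) = sg ((lops D).par l + (sops D).par V) • ins V l := by
  induction V generalizing l with
  | nil => simp [ins, shift_wd (D := D)]
  | cons E V ih =>
    simp only [ins, insAt, map_spl, mapWord_mul, mul_smul_comm, map_zsmul, mul_spl, mapWord_ι,
      shift_of_mem (E.ev_mem _), ih, shift_wd (D := D)]
    rw [← spl_smul]
    refine spl_congr fun u v h => ?_
    rw [smul_smul, ← spl_smul, ← spl_smul]
    refine spl_congr fun u' v' h' => ?_
    rw [← h, ← h', Ops.par_cons, show (sops D).p E = 1 from rfl]
    simp only [smul_mul_assoc, mul_smul_comm, smul_smul, ← sg_add]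
    congr 2
    simp only [Ops.par_append]
    ring

end

section

variable {k : Type*} [CommRing k] [Algebra ℚ k] {A : Type*} [Ring A] [Algebra k A]
variable {𝒜 : ZMod 2 → Submodule k A} [GradedAlgebra 𝒜] {D : 𝒜 1}

/-! ### The operations on lists of homogeneous elements -/

theorem sgn_bar (D : 𝒜 1) (l : List (Letter 𝒜)) :
    sgn 𝒜 (bar l) = sg ((lops D).par l) • bar l := by
  rw [bar, ← mapWord_toBar_shift, shift_wd (D := D), map_zsmul]

section Parity

variable {N N' : Type*} [AddCommGroup N] [Module k N] [AddCommGroup N'] [Module k N']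

theorem half_smul_two (x : N) : algebraMap ℚ k (1 / 2) • (x + x) = x := by
  rw [← two_smul k x, smul_smul, show (2 : k) = algebraMap ℚ k 2 from (map_ofNat _ 2).symm,
    ← map_mul]
  norm_num

theorem evenPart_of (s : N →ₗ[k] N) {x : N} {p : ZMod 2} (h : s x = sg p • x) :
    evenPart s x = if p = 0 then x else 0 := by
  rw [evenPart, LinearMap.smul_apply, LinearMap.add_apply, h, LinearMap.id_apply]
  rcases (by decide : ∀ p : ZMod 2, p = 0 ∨ p = 1) p with rfl | rfl
  · rw [sg_zero, one_smul, half_smul_two, if_pos rfl]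
  · rw [sg_one, neg_one_smul, add_neg_cancel, smul_zero, if_neg (by decide)]

theorem oddPart_of (s : N →ₗ[k] N) {x : N} {p : ZMod 2} (h : s x = sg p • x) :
    oddPart s x = if p = 0 then 0 else x := by
  rw [oddPart, LinearMap.smul_apply, LinearMap.sub_apply, h, LinearMap.id_apply]
  rcases (by decide : ∀ p : ZMod 2, p = 0 ∨ p = 1) p with rfl | rfl
  · rw [sg_zero, one_smul, sub_self, smul_zero, if_pos rfl]
  · rw [sg_one, neg_one_smul, sub_neg_eq_add, half_smul_two, if_neg (by decide)]

theorem koszulSwap_of (s : N →ₗ[k] N) (s' : N' →ₗ[k] N') {x : N} {y : N'} {p q : ZMod 2}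
    (hx : s x = sg p • x) (hy : s' y = sg q • y) :
    koszulSwap s s' (x ⊗ₜ[k] y) = sg (p * q) • (y ⊗ₜ[k] x) := by
  simp only [koszulSwap, LinearMap.comp_apply, LinearMap.add_apply, TensorProduct.map_tmul,
    evenPart_of s' hy, oddPart_of s' hy, hx, LinearMap.id_apply]
  rcases (by decide : ∀ p : ZMod 2, p = 0 ∨ p = 1) q with rfl | rfl
  · simp
  · simp [zsmul_tmul, tmul_zsmul]

end Parity

theorem deconcat_bar (l : List (Letter 𝒜)) :
    deconcat (bar l) = spl (fun u v => bar u ⊗ₜ[k] bar v) l := by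
  induction l with
  | nil => simp
  | cons c l ih =>
    rw [bar_cons, deconcat_ι_mul, ih, spl_cons, mul_spl]
    simp

/-- The chain `x ⊗ X`, where `X` is a word in `A`. -/
def chn (x : A) (X : TensorAlgebra k A) : Chains k A := x ⊗ₜ[k] mapWord (toBar k A) X

theorem chn_wd (x : A) (l : List (Letter 𝒜)) : chn x (wd l) = x ⊗ₜ[k] bar l := rfl

/-- `chn x` as a linear map. -/
def chnL (x : A) : TensorAlgebra k A →ₗ[k] Chains k A :=
  TensorProduct.mk k A _ x ∘ₗ mapWord (toBar k A)

theorem chnL_apply (x : A) (X : TensorAlgebra k A) : chnL x X = chn x X := rfl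

/-- `chn` as an additive map of the first letter. -/
def chnR (X : TensorAlgebra k A) : A →ₗ[k] Chains k A :=
  (TensorProduct.mk k A _).flip (mapWord (toBar k A) X)

theorem chnR_apply (x : A) (X : TensorAlgebra k A) : chnR X x = chn x X := rfl

theorem chn_spl {X : Type*} (x : A) (F : List X → List X → TensorAlgebra k A) (l : List X) :
    chn x (spl F l) = spl (fun u v => chn x (F u v)) l := map_spl (chnL x) F l

theorem chn_zsmul (x : A) (n : ℤ) (X : TensorAlgebra k A) : chn x (n • X) = n • chn x X :=
  map_zsmul (chnL x) n X

theorem zsmul_chn (x : A) (n : ℤ) (X : TensorAlgebra k A) : chn (n • x) X = n • chn x X :=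
  map_zsmul (chnR X) n x

theorem chn_add (x : A) (X Y : TensorAlgebra k A) : chn x (X + Y) = chn x X + chn x Y :=
  map_add (chnL x) X Y

section OneLinear

variable {M : Type*} [AddCommGroup M]

/-- The sum over the signed cyclic rotations `z a p` of a list `a p z` with a marked letter `a`,
and over the cuts of the rotated list on the right of `a`. -/
def rot (D : 𝒜 1) (F : List (Letter 𝒜) → List (Letter 𝒜) → M) (a : Letter 𝒜)
    (l : List (Letter 𝒜)) : M :=
  spl (fun p z => sg (((lops D).p a + (lops D).par p) * (lops D).par z) •
    spl (fun u y => F (z ++ a :: u) y) p) l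

end OneLinear

theorem rotateChain_tmul (D : 𝒜 1) (a : Letter 𝒜) (l : List (Letter 𝒜)) :
    rotateChain 𝒜 (a.val ⊗ₜ[k] bar l) =
      spl (fun p z => sg (((lops D).p a + (lops D).par p) * (lops D).par z) •
        (bar z ⊗ₜ[k] (a.val ⊗ₜ[k] bar p))) l := by
  rw [rotateChain, rotate, LinearMap.comp_apply, cut, LinearMap.comp_apply, LinearMap.lTensor_tmul,
    deconcat_bar, tmul_spl, map_spl, map_spl]
  refine spl_congr fun p z _ => ?_
  rw [LinearEquiv.coe_coe, TensorProduct.assoc_symm_tmul,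
    koszulSwap_of (p := (lops D).p a + (lops D).par p) (q := (lops D).par z)]
  · rw [TensorProduct.map_tmul, show mapWord (shiftBar 𝒜) = sgn 𝒜 from rfl, sgn_bar D,
      shift_of_mem a.mem, zsmul_tmul, tmul_zsmul, smul_smul, ← sg_add]
    rfl
  · exact sgn_bar D z

theorem joinWord_tmul (a : Letter 𝒜) (z p : List (Letter 𝒜)) :
    joinWord k A (bar z ⊗ₜ[k] (a.val ⊗ₜ[k] bar p)) = bar (z ++ a :: p) := by
  simp [joinWord, bar_append]

theorem BDiff_tmul (D : 𝒜 1) (a : Letter 𝒜) (l : List (Letter 𝒜)) :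
    BDiff 𝒜 (a.val ⊗ₜ[k] bar l) =
      spl (fun p z => sg (((lops D).p a + (lops D).par p) * (lops D).par z) •
        chn 1 (wd (z ++ a :: p))) l := by
  rw [BDiff, LinearMap.comp_apply, LinearMap.comp_apply, rotateChain_tmul D, map_spl, map_spl]
  simp only [map_zsmul, joinWord_tmul]
  rfl

/-- The first part of the Hochschild differential of `x ⊗ X`. -/
def frontMul (𝒜 : ZMod 2 → Submodule k A) [GradedAlgebra 𝒜] (x : A) :
    A ⊗[k] TensorAlgebra k A →ₗ[k] Chains k A :=
  reduceChain k A ∘ₗ mulFront 𝒜 ∘ₗ TensorProduct.mk k A _ x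

/-- The cyclic part of the Hochschild differential of `x ⊗ X`. -/
def backMul (𝒜 : ZMod 2 → Submodule k A) [GradedAlgebra 𝒜] (x : A) :
    TensorAlgebra k A ⊗[k] A →ₗ[k] Chains k A :=
  reduceChain k A ∘ₗ mulFront 𝒜 ∘ₗ
    koszulSwap (TensorProduct.map (shift 𝒜) (mapWord (shift 𝒜))) (shift 𝒜) ∘ₗ
    (TensorProduct.assoc k A (TensorAlgebra k A) A).symm.toLinearMap ∘ₗ TensorProduct.mk k A _ x

theorem bDiff_chn (x : A) (X : TensorAlgebra k A) :
    bDiff 𝒜 (chn x X) = frontMul 𝒜 x (uncons X) + chn (shift 𝒜 x) (barDiff 𝒜 X) +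
      backMul 𝒜 x (unsnoc X) := by
  rw [bDiff, chn, descend_tmul]
  simp [bUnreduced, lastToFront, frontMul, backMul, chn]

theorem frontMul_tmul {x : A} {p : ZMod 2} (hx : x ∈ 𝒜 p) (c : A) (X : TensorAlgebra k A) :
    frontMul 𝒜 x (c ⊗ₜ[k] X) = sg p • chn (x * c) X := by
  simp [frontMul, mulFront, parity_of_mem hx, chn, zsmul_tmul, -zsmul_eq_mul]

theorem backMul_tmul {x : A} {p : ZMod 2} (hx : x ∈ 𝒜 p) {c : A} {r : ZMod 2} (hc : c ∈ 𝒜 r)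
    {X : TensorAlgebra k A} {q : ZMod 2} (hX : mapWord (shift 𝒜) X = sg q • X) :
    backMul 𝒜 x (X ⊗ₜ[k] c) = sg ((p + 1 + q) * (r + 1) + r) • chn (c * x) X := by
  rw [backMul, LinearMap.comp_apply, LinearMap.comp_apply, LinearMap.comp_apply,
    LinearMap.comp_apply, TensorProduct.mk_apply, LinearEquiv.coe_coe,
    TensorProduct.assoc_symm_tmul, koszulSwap_of (p := p + 1 + q) (q := r + 1) _ _ _
      (shift_of_mem hc)]
  · rw [map_zsmul, map_zsmul, sg_add, mul_smul]
    simp [mulFront, parity_of_mem hc, chn, zsmul_tmul, -zsmul_eq_mul]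
  · rw [TensorProduct.map_tmul, hX, shift_of_mem hx, zsmul_tmul, tmul_zsmul, smul_smul, ← sg_add]

/-- The Hochschild differential of a chain with insertions. -/
theorem bDiff_chn_ins {x : A} {p : ZMod 2} (hx : x ∈ 𝒜 p) (V : List (Parallel D))
    (l : List (Letter 𝒜)) : bDiff 𝒜 (chn x (ins V l)) =
      hd (fun c l' => sg p • chn (x * c.val) (ins V l')) l +
      hd (fun E V' => sg (p + (lops D).par l) •
        spl (fun v r => chn (x * E.ev v) (ins V' r)) l) V +
      sg (p + 1) • ((lops D).cd (fun l => chn x (ins V l)) l +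
        sg ((lops D).par l) • (sops D).cd (fun W => chn x (ins W l)) V) +
      lst (fun l' c => sg ((p + 1 + (lops D).par l') * (c.deg + 1) + c.deg) •
        chn (c.val * x) (ins V l')) l +
      lst (fun V' E => spl (fun v w => sg ((p + (lops D).par v + (sops D).par V) *
          ((lops D).par w + 1) + (sops D).par V * (lops D).par w + (lops D).par w) •
        chn (E.ev w * x) (ins V' v)) l) V := by
  have hcd : chn x (barDiff 𝒜 (ins V l)) = (lops D).cd (fun l => chn x (ins V l)) l +
        sg ((lops D).par l) • (sops D).cd (fun W => chn x (ins W l)) V := by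
    rw [barDiff_ins, chn_add, chn_zsmul, ← chnL_apply, ← chnL_apply, Ops.map_cd, Ops.map_cd]
    rfl
  rw [bDiff_chn, uncons_ins, unsnoc_ins, shift_of_mem hx, zsmul_chn, hcd]
  simp only [map_add, map_hd, map_lst, map_spl, map_zsmul, frontMul_tmul hx]
  rw [← add_assoc]
  congr 1
  · congr 1
    · congr 2
      refine hd_congr fun E V' _ => ?_
      rw [spl_smul, smul_smul, ← sg_add, add_comm]
    · refine lst_congr fun l' c _ => ?_
      rw [backMul_tmul hx c.mem (shift_ins V l'), smul_smul, ← sg_add]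
      congr 2
      rw [show (lops D).p c = c.deg + 1 from rfl]
      generalize p = w, c.deg = x, (lops D).par l' = y, (sops D).par V = z
      revert w x y z
      decide
  · refine lst_congr fun V' E h => spl_congr fun v w _ => ?_
    rw [backMul_tmul hx (E.ev_mem w) (shift_ins V' v), smul_smul, ← sg_add]
    congr 2
    rw [← h, Ops.par_append, Ops.par_cons, Ops.par_nil, show (sops D).p E = 1 from rfl]
    generalize p = s, (lops D).par v = x, (lops D).par w = y, (sops D).par V' = z
    revert s x y z
    decide

/-- The word of a list of cochains. -/
def str : List (Parallel D) → TensorAlgebra k (Cochains k A)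
  | [] => 1
  | E :: V => TensorAlgebra.ι k E.toCochain * str V

@[simp] theorem str_nil : str ([] : List (Parallel D)) = 1 := rfl

@[simp] theorem str_cons (E : Parallel D) (V : List (Parallel D)) :
    str (E :: V) = TensorAlgebra.ι k E.toCochain * str V := rfl

theorem insertFirst_bar' (E : Parallel D) (V : List (Parallel D))
    (h : ∀ l, insertWord 𝒜 (str V) (bar l) = mapWord (toBar k A) (ins V l))
    (l : List (Letter 𝒜)) :
    insertFirst 𝒜 E.toCochain (str V) (bar l) = mapWord (toBar k A) (insF (E :: V) l) := by
  change conv _ _ _ = _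
  rw [conv_bar, insF_cons, map_zsmul, map_spl, ← spl_smul]
  refine spl_congr fun u v hl => ?_
  simp only [LinearMap.comp_apply, sgn_bar D, map_zsmul, h, mapWord_ι_mul]
  rw [smul_mul_smul_comm, ← sg_add, ← hl, Ops.par_append]
  rfl

theorem insertWord_bar (V : List (Parallel D)) (l : List (Letter 𝒜)) :
    insertWord 𝒜 (str V) (bar l) = mapWord (toBar k A) (ins V l) := by
  induction V generalizing l with
  | nil => simp [insertWord, ins, bar]
  | cons E V ih =>
    rw [str_cons, insertWord, foldWord_ι_mul]
    change conv LinearMap.id (insertFirst 𝒜 E.toCochain (str V)) _ = _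
    rw [conv_bar]
    simp only [ins, map_spl, mapWord_mul]
    refine spl_congr fun u v _ => ?_
    rw [insertFirst_bar' E V ih]
    rfl

theorem insertFirst_bar (E : Parallel D) (V : List (Parallel D)) (l : List (Letter 𝒜)) :
    insertFirst 𝒜 E.toCochain (str V) (bar l) = mapWord (toBar k A) (insF (E :: V) l) :=
  insertFirst_bar' E V (insertWord_bar V) l

/-- The value of `E` on a list of homogeneous elements, as a homogeneous element. -/
def Parallel.lt (E : Parallel D) (l : List (Letter 𝒜)) : Letter 𝒜 :=
  ⟨E.ev l, (lops D).par l, E.ev_mem l⟩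

/-- The first part of the action of a string of cochains. -/
def act₁ (a : Letter 𝒜) (l : List (Letter 𝒜)) (E : Parallel D) (V : List (Parallel D)) :
    Chains k A :=
  spl (fun u v => chn (a.val * E.ev u) (ins V v)) l

/-- The second part of the action of a string of cochains. -/
def act₂ (a : Letter 𝒜) (l : List (Letter 𝒜)) (E : Parallel D) (V : List (Parallel D)) :
    Chains k A :=
  lst (fun V' E' => sg (a.deg + (lops D).par l + (sops D).par V) •
    rot D (fun y p => act₁ (E'.lt y) p E V') a l) V

/-- The third part of the action of a string of cochains. -/
def act₃ (a : Letter 𝒜) (l : List (Letter 𝒜)) (E : Parallel D) (V : List (Parallel D)) :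
    Chains k A :=
  sg (a.deg + (lops D).par l) • spl (fun U P => sg ((1 + (sops D).par U) * (sops D).par P) •
    rot D (fun x y => sg ((sops D).par P * (lops D).par y) •
      chn 1 (ins P x * insF (E :: U) y)) a l) V

theorem cut_tmul (x : A) (l : List (Letter 𝒜)) :
    cut A (Abar k A) (x ⊗ₜ[k] bar l) = spl (fun u v => (x ⊗ₜ[k] bar u) ⊗ₜ[k] bar v) l := by
  rw [cut, LinearMap.comp_apply, LinearMap.lTensor_tmul, deconcat_bar, tmul_spl, map_spl]
  rfl

theorem bulletOne_tmul (a : Letter 𝒜) (l : List (Letter 𝒜)) (E : Parallel D)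
    (V : List (Parallel D)) :
    bulletOne 𝒜 E.toCochain (str V) (a.val ⊗ₜ[k] bar l) = act₁ a l E V := by
  simp only [bulletOne, LinearMap.mk₂_apply, LinearMap.comp_apply, cut_tmul, map_spl,
    TensorProduct.map_tmul, insertWord_bar]
  rfl

theorem chainParity_tmul (D : 𝒜 1) (a : Letter 𝒜) (l : List (Letter 𝒜)) :
    chainParity 𝒜 (a.val ⊗ₜ[k] bar l) = sg (a.deg + (lops D).par l) • (a.val ⊗ₜ[k] bar l) := by
  rw [chainParity, TensorProduct.map_tmul, parity_of_mem a.mem, sgn_bar D, zsmul_tmul, tmul_zsmul,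
    smul_smul, sg_add]

theorem comp_lTensor_tmul {M N N' P : Type*} [AddCommGroup M] [Module k M] [AddCommGroup N]
    [Module k N] [AddCommGroup N'] [Module k N'] [AddCommGroup P] [Module k P]
    (Φ : M ⊗[k] N' →ₗ[k] P) (g : N →ₗ[k] N') (x : M) (y : N) :
    (Φ ∘ₗ LinearMap.lTensor M g) (x ⊗ₜ[k] y) = (Φ ∘ₗ TensorProduct.mk k M N' x) (g y) := rfl

theorem unsnoc_str (V : List (Parallel D)) :
    unsnoc (str V) = lst (fun V' E => str V' ⊗ₜ[k] E.toCochain) V := by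
  induction V with
  | nil => simp
  | cons E V ih =>
    rw [str_cons, unsnoc_ι_mul, ih, lst_cons, map_lst]
    congr 1
    cases V <;> simp [TensorAlgebra.algebraMapInv]

theorem lengthSign_str (V : List (Parallel D)) :
    lengthSign (str V) = sg ((sops D).par V) • str V := by
  induction V with
  | nil => simp
  | cons E V ih =>
    rw [str_cons, lengthSign, mapWord_ι_mul, ih, Ops.par_cons, show (sops D).p E = 1 from rfl,
      sg_add]
    simp [-zsmul_eq_mul]

theorem wrap_tmul (E : Parallel D) (a : Letter 𝒜) (l : List (Letter 𝒜)) :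
    wrap 𝒜 E.toCochain (a.val ⊗ₜ[k] bar l) =
      rot D (fun y p => (E.lt y).val ⊗ₜ[k] bar p) a l := by
  change TensorProduct.map _ _ ((TensorProduct.assoc k _ _ _).symm
    (LinearMap.lTensor _ (cut A _) (rotateChain 𝒜 _))) = _
  rw [rotateChain_tmul D]
  simp only [map_spl, map_zsmul, LinearMap.lTensor_tmul, cut_tmul, tmul_spl,
    TensorProduct.assoc_symm_tmul, TensorProduct.map_tmul, LinearMap.comp_apply, joinWord_tmul]
  rfl

theorem map_rot {M N G : Type*} [AddCommGroup M] [AddCommGroup N] [FunLike G M N]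
    [AddMonoidHomClass G M N] (φ : G) (F : List (Letter 𝒜) → List (Letter 𝒜) → M) (a : Letter 𝒜)
    (l : List (Letter 𝒜)) : φ (rot D F a l) = rot D (fun x y => φ (F x y)) a l := by
  simp only [rot, map_spl, map_zsmul]

theorem bulletTwo_tmul (a : Letter 𝒜) (l : List (Letter 𝒜)) (E : Parallel D)
    (V : List (Parallel D)) :
    bulletTwo 𝒜 (E.toCochain ⊗ₜ[k] str V) (a.val ⊗ₜ[k] bar l) = act₂ a l E V := by
  rw [bulletTwo, ← LinearMap.comp_assoc, comp_lTensor_tmul,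
    LinearMap.comp_apply unsnoc, lengthSign_str, map_zsmul, unsnoc_str, map_zsmul, map_lst, act₂, ← lst_smul,
    ← LinearMap.applyₗ_apply_apply (R := k) (a.val ⊗ₜ[k] bar l), map_lst]
  refine lst_congr fun V' E' _ => ?_
  simp only [map_zsmul, TensorProduct.mk_apply, LinearEquiv.coe_coe, TensorProduct.assoc_symm_tmul,
    TensorProduct.lift.tmul, LinearMap.mk₂_apply, LinearMap.applyₗ_apply_apply,
    LinearMap.comp_apply, chainParity_tmul D, wrap_tmul, map_rot, bulletOne_tmul]
  rw [smul_smul, ← sg_add, add_comm]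

theorem deconcat_str (V : List (Parallel D)) :
    deconcat (str V) = spl (fun U P => str U ⊗ₜ[k] str P) V := by
  induction V with
  | nil => simp
  | cons c l ih =>
    rw [str_cons, deconcat_ι_mul, ih, spl_cons, mul_spl]
    simp

theorem rotateCochains_tmul (E : Parallel D) (V : List (Parallel D)) :
    rotateCochains (E.toCochain ⊗ₜ[k] str V) =
      spl (fun U P => sg ((1 + (sops D).par U) * (sops D).par P) •
        (str P ⊗ₜ[k] (E.toCochain ⊗ₜ[k] str U))) V := by
  rw [rotateCochains, rotate, cut, ← LinearMap.comp_assoc, comp_lTensor_tmul, deconcat_str, map_spl]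
  refine spl_congr fun U P _ => ?_
  rw [LinearMap.comp_apply, LinearMap.comp_apply, TensorProduct.mk_apply, LinearEquiv.coe_coe,
    TensorProduct.assoc_symm_tmul,
    koszulSwap_of (p := 1 + (sops D).par U) (q := (sops D).par P)]
  · rw [TensorProduct.map_tmul, lengthSign_str, sg_add, sg_one, LinearMap.neg_apply,
      LinearMap.id_apply, TensorProduct.neg_tmul, tmul_zsmul, neg_one_mul, neg_smul]
  · exact lengthSign_str P

theorem insertRotated_tmul (P : List (Parallel D)) (q : Module.End k (Words k A)) (a : Letter 𝒜)
    (l : List (Letter 𝒜)) : insertRotated 𝒜 (str P) q (a.val ⊗ₜ[k] bar l) =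
      rot D (fun x y => sg ((sops D).par P * (lops D).par y) •
        (1 ⊗ₜ[k] (mapWord (toBar k A) (ins P x) * q (bar y)))) a l := by
  rw [insertRotated, LinearMap.mk₂_apply]
  simp only [LinearMap.comp_apply, rotateChain_tmul D, map_spl, map_zsmul, LinearMap.lTensor_tmul,
    cut_tmul, tmul_spl, LinearEquiv.coe_coe, TensorProduct.assoc_symm_tmul,
    LinearMap.rTensor_tmul, joinWord_tmul, LinearMap.add_apply, TensorProduct.map_tmul,
    evenPart_of (sgn 𝒜) (sgn_bar D _), oddPart_of (sgn 𝒜) (sgn_bar D _), insertWord_bar,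
    lengthSign_str, LinearMap.smul_apply]
  refine spl_congr fun p z _ => ?_
  congr 1
  refine spl_congr fun u y _ => ?_
  rcases (by decide : ∀ p : ZMod 2, p = 0 ∨ p = 1) ((lops D).par y) with h | h <;> rw [h]
  · simp [h]
  · simp [h, zsmul_tmul, tmul_zsmul, -zsmul_eq_mul]

theorem bulletThree_tmul (a : Letter 𝒜) (l : List (Letter 𝒜)) (E : Parallel D)
    (V : List (Parallel D)) :
    bulletThree 𝒜 (E.toCochain ⊗ₜ[k] str V) (a.val ⊗ₜ[k] bar l) = act₃ a l E V := by
  rw [bulletThree, LinearMap.comp_apply, LinearMap.comp_apply, rotateCochains_tmul,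
    LinearMap.lcomp_apply, chainParity_tmul D, map_zsmul, map_spl,
    ← LinearMap.applyₗ_apply_apply (R := k) (a.val ⊗ₜ[k] bar l), map_spl, act₃]
  congr 1
  refine spl_congr fun U P _ => ?_
  simp only [map_zsmul, TensorProduct.lift.tmul, LinearMap.compl₂_apply,
    LinearMap.applyₗ_apply_apply, insertRotated_tmul, insertFirst_bar, ← mapWord_mul]
  rfl

/-- The action of a string of cochains. -/
def act (a : Letter 𝒜) (l : List (Letter 𝒜)) (E : Parallel D) (V : List (Parallel D)) :
    Chains k A :=
  act₁ a l E V + act₂ a l E V + act₃ a l E V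

theorem bullet_tmul (a : Letter 𝒜) (l : List (Letter 𝒜)) (E : Parallel D)
    (V : List (Parallel D)) :
    bullet 𝒜 (E.toCochain ⊗ₜ[k] str V) (a.val ⊗ₜ[k] bar l) = act a l E V := by
  rw [bullet, LinearMap.add_apply, LinearMap.add_apply, LinearMap.add_apply, LinearMap.add_apply,
    bulletTwo_tmul, bulletThree_tmul, TensorProduct.lift.tmul, bulletOne_tmul]
  rfl

end

section

variable {k : Type*} [CommRing k] [Algebra ℚ k] {A : Type*} [Ring A] [Algebra k A]
variable {𝒜 : ZMod 2 → Submodule k A} [GradedAlgebra 𝒜] {D : 𝒜 1}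

/-! ### The Hochschild differential of the first two parts of the action -/

/-- `∑ (x E (a₁, …, a_d), V (a_{d+1}, …, aₙ))`. -/
def pre (l : List (Letter 𝒜)) (E : Parallel D) (V : List (Parallel D)) (x : A) : Chains k A :=
  spl (fun u v => chn (x * E.ev u) (ins V v)) l

theorem act₁_eq_pre (a : Letter 𝒜) (l : List (Letter 𝒜)) (E : Parallel D)
    (V : List (Parallel D)) : act₁ a l E V = pre l E V a.val := rfl

theorem pre_add (l : List (Letter 𝒜)) (E : Parallel D) (V : List (Parallel D)) (x y : A) :
    pre l E V (x + y) = pre l E V x + pre l E V y := by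
  simp only [pre, ← spl_add, add_mul, chn, TensorProduct.add_tmul]

/-- `pre` as an additive map. -/
def preL (l : List (Letter 𝒜)) (E : Parallel D) (V : List (Parallel D)) : A →+ Chains k A :=
  AddMonoidHom.mk' (pre l E V) (pre_add l E V)

theorem preL_apply (l : List (Letter 𝒜)) (E : Parallel D) (V : List (Parallel D)) (x : A) :
    preL l E V x = pre l E V x := rfl

theorem pre_zsmul (l : List (Letter 𝒜)) (E : Parallel D) (V : List (Parallel D)) (n : ℤ) (x : A) :
    pre l E V (n • x) = n • pre l E V x := map_zsmul (preL l E V) n x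

theorem chn_mul_cd_ev (E : Parallel D) (x : A) (X : TensorAlgebra k A) (u : List (Letter 𝒜)) :
    (lops D).cd (fun u => chn (x * E.ev u) X) u =
      hd (fun c u' => chn (x * c.val * E.ev u') X) u -
        lst (fun u' c => sg ((lops D).par u') • chn (x * E.ev u' * c.val) X) u := by
  have h := congrArg (fun y => chnR X (x * y)) (E.cd_ev u)
  simp only [mul_sub, map_sub, mul_hd, mul_lst, map_hd, map_lst, Ops.mul_cd, Ops.map_cd,
    mul_smul_comm, map_zsmul, chnR_apply, ← mul_assoc] at h
  exact h

/-- The Hochschild differential of `pre`. -/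
theorem bDiff_pre {x : A} {p : ZMod 2} (hx : x ∈ 𝒜 p) (l : List (Letter 𝒜)) (E : Parallel D)
    (V : List (Parallel D)) : bDiff 𝒜 (pre l E V x) =
      hd (fun c l' => sg p • pre l' E V (x * c.val)) l - sg p • (lops D).cd (pre · E V x) l +
      lst (fun l' c => sg ((p + 1 + (lops D).par l') * (c.deg + 1) + c.deg) •
        pre l' E V (c.val * x)) l +
      sg (p + (lops D).par l) • (hd (fun E' V' => pre l (E.mul E') V' x) V -
        (sops D).cd (pre l E · x) V) +
      lst (fun V' E' => spl (fun r w => sg ((p + (lops D).par r) * ((lops D).par w + 1) +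
        (sops D).par V' + 1 + (lops D).par w) • pre r E V' (E'.ev w * x)) l) V := by
  have h1 : spl (fun u v => hd (fun c v' => sg (p + (lops D).par u) •
      chn (x * E.ev u * c.val) (ins V v')) v) l =
      hd (fun c l' => sg p • pre l' E V (x * c.val)) l -
        sg p • spl (fun u v => (lops D).cd (fun u => chn (x * E.ev u) (ins V v)) u) l := by
    simp only [chn_mul_cd_ev, spl_sub, smul_sub, ← spl_smul, ← hd_smul, ← lst_smul, pre, hd_spl,
      ← spl_lst_eq_spl_hd, smul_smul, ← sg_add]
    abel
  have h2 : spl (fun u v => hd (fun E' V' => sg (p + (lops D).par u + (lops D).par v) •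
      spl (fun v' r => chn (x * E.ev u * E'.ev v') (ins V' r)) v) V) l =
      sg (p + (lops D).par l) • hd (fun E' V' => pre l (E.mul E') V' x) V := by
    cases V with
    | nil => simp [spl_zero]
    | cons E' V' =>
      simp only [hd_cons, pre, Parallel.mul_ev, mul_spl, ← chnR_apply, map_spl, ← spl_smul]
      rw [← spl_assoc]
      refine spl_congr fun u v h => ?_
      simp only [← h, Ops.par_append, mul_assoc, add_assoc]
  have h3 : spl (fun u v => sg (p + (lops D).par u + 1) •
      ((lops D).cd (fun l => chn (x * E.ev u) (ins V l)) v +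
        sg ((lops D).par v) • (sops D).cd (fun W => chn (x * E.ev u) (ins W v)) V)) l =
      -(sg p • spl (fun u v => sg ((lops D).par u) •
        (lops D).cd (fun l => chn (x * E.ev u) (ins V l)) v) l) -
      sg (p + (lops D).par l) • (sops D).cd (pre l E · x) V := by
    simp only [pre, Ops.cd_spl_comm]
    simp only [← spl_smul, ← spl_neg, ← spl_sub]
    refine spl_congr fun u v h => ?_
    rw [← h, Ops.par_append, sg_add_one, sg_add, sg_add, sg_add]
    module
  have h4 : spl (fun u v => lst (fun l' c => sg ((p + (lops D).par u + 1 + (lops D).par l') *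
        (c.deg + 1) + c.deg) • chn (c.val * (x * E.ev u)) (ins V l')) v) l =
      lst (fun l' c => sg ((p + 1 + (lops D).par l') * (c.deg + 1) + c.deg) •
        pre l' E V (c.val * x)) l := by
    rw [← lst_spl]
    refine lst_congr fun l' c _ => ?_
    rw [pre, ← spl_smul]
    refine spl_congr fun u v h => ?_
    rw [← h, Ops.par_append, mul_assoc]
    congr 3
    ring
  have h5 : spl (fun u v => lst (fun V' E' => spl (fun v' w => sg ((p + (lops D).par u +
        (lops D).par v' + (sops D).par V) * ((lops D).par w + 1) +
        (sops D).par V * (lops D).par w + (lops D).par w) •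
        chn (E'.ev w * (x * E.ev u)) (ins V' v')) v) V) l =
      lst (fun V' E' => spl (fun r w => sg ((p + (lops D).par r) * ((lops D).par w + 1) +
        (sops D).par V' + 1 + (lops D).par w) • pre r E V' (E'.ev w * x)) l) V := by
    rw [spl_lst_comm]
    refine lst_congr fun V' E' hV => ?_
    rw [spl_assoc]
    refine spl_congr fun r w _ => ?_
    rw [pre, ← spl_smul]
    refine spl_congr fun u v h => ?_
    rw [← h, ← hV, Ops.par_append, Ops.par_append, mul_assoc, Ops.par_cons, Ops.par_nil,
      show (sops D).p E' = 1 from rfl]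
    congr 2
    generalize p = s, (lops D).par u = x, (lops D).par v = y, (lops D).par w = z,
      (sops D).par V' = t
    revert s x y z t
    decide
  rw [pre, map_spl]
  simp only [bDiff_chn_ins (SetLike.mul_mem_graded hx (E.ev_mem _)), spl_add]
  have h6 : (lops D).cd (pre · E V x) l =
      spl (fun u v => (lops D).cd (fun u => chn (x * E.ev u) (ins V v)) u) l +
        spl (fun u v => sg ((lops D).par u) •
          (lops D).cd (fun l => chn (x * E.ev u) (ins V l)) v) l :=
    (Ops.cd_spl _ _ _).trans (spl_add _ _ _)
  rw [h1, h2, h3, h4, h5, h6]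
  simp only [smul_add, smul_sub]
  abel

section Differentials

variable {M : Type*} [AddCommGroup M]

/-- The Hochschild differential plus the Lie derivative of `∇`, applied to the argument of a
function of lists of homogeneous elements. -/
def dC (D : 𝒜 1) (Φ : Letter 𝒜 → List (Letter 𝒜) → M) (a : Letter 𝒜) (l : List (Letter 𝒜)) : M :=
  Φ ((lops D).f a) l + hd (fun c l' => Φ ((lops D).m a c) l') l +
    sg ((lops D).p a) • (lops D).cd (Φ a) l +
    lst (fun l' c => sg ((lops D).p c * ((lops D).p a + (lops D).par l')) •
      Φ ((lops D).m c a) l') l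

/-- The Hochschild differential minus the Lie derivative of `∇`, applied to the argument of a
function of strings of cochains. -/
def dS (Ψ : Parallel D → List (Parallel D) → M) (E : Parallel D) (V : List (Parallel D)) : M :=
  hd (fun E' V' => Ψ (E.mul E') V') V - (sops D).cd (Ψ E) V +
    lst (fun V' E' => sg ((sops D).par V) • Ψ (E'.mul E) V') V

/-- The differential commutes with the cyclic rotations. -/
theorem dC_rot (F : List (Letter 𝒜) → List (Letter 𝒜) → M) (a : Letter 𝒜)
    (l : List (Letter 𝒜)) : dC D (rot D F) a l =
      rot D (fun x y => (lops D).cd (F · y) x + sg ((lops D).par x) • (lops D).cd (F x) y) a l := by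
  have c₁ : (lops D).c₁ = 1 := rfl
  have c₂ : (lops D).c₂ = 1 := rfl
  have hf : (lops D).p ((lops D).f a) = (lops D).p a + 1 := rfl
  have hm := (lops_odd D).m
  -- the right hand side
  have hR : rot D (fun x y => (lops D).cd (F · y) x + sg ((lops D).par x) • (lops D).cd (F x) y) a l =
      spl (fun p z => sg (((lops D).p a + (lops D).par p) * (lops D).par z) •
        ((lops D).cd (fun z => spl (fun u y => F (z ++ a :: u) y) p) z +
        sg ((lops D).par z) • spl (fun u y => F (z ++ (lops D).f a :: u) y) p +
        lst (fun z' c => sg ((lops D).par z') •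
          spl (fun u y => F (z' ++ (lops D).m c a :: u) y) p) z +
        sg ((lops D).par z) • hd (fun c p' =>
          spl (fun u y => F (z ++ (lops D).m a c :: u) y) p') p +
        sg ((lops D).par z + (lops D).p a) •
          (lops D).cd (fun p => spl (fun u y => F (z ++ a :: u) y) p) p)) l := by
    refine spl_congr fun p z _ => ?_
    congr 1
    have h1 : (lops D).cd (fun z => spl (fun u y => F (z ++ a :: u) y) p) z =
        spl (fun u y => (lops D).cd (fun z => F (z ++ a :: u) y) z) p := Ops.cd_spl_comm _ _ _ _
    have h2 : lst (fun z' c => sg ((lops D).par z') •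
          spl (fun u y => F (z' ++ (lops D).m c a :: u) y) p) z =
        spl (fun u y => lst (fun z' c => sg ((lops D).par z') •
          F (z' ++ (lops D).m c a :: u) y) z) p := by
      rw [spl_lst_comm]
      simp only [spl_smul]
    have h3 : (lops D).cd (fun p => spl (fun u y => F (z ++ a :: u) y) p) p =
        spl (fun u y => (lops D).cd (fun u => F (z ++ a :: u) y) u +
          sg ((lops D).par u) • (lops D).cd (F (z ++ a :: u)) y) p := Ops.cd_spl _ _ _
    rw [h1, h2, h3, hd_spl]
    simp only [Ops.cd_append, c₁, c₂, one_smul, Ops.par_append, Ops.par_cons, ← spl_add,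
      ← spl_smul]
    refine spl_congr fun u y _ => ?_
    simp only [sg_add]
    module
  -- `[D, ·]` applied to the marked letter
  have h1 : rot D F ((lops D).f a) l =
      spl (fun p z => sg (((lops D).p a + (lops D).par p) * (lops D).par z) •
        sg ((lops D).par z) • spl (fun u y => F (z ++ (lops D).f a :: u) y) p) l := by
    refine spl_congr fun p z _ => ?_
    rw [smul_smul, ← sg_add, hf]
    congr 2
    ring
  -- the marked letter times the next letter
  have h2 : hd (fun c l' => rot D F ((lops D).m a c) l') l =
      spl (fun p z => sg (((lops D).p a + (lops D).par p) * (lops D).par z) •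
        sg ((lops D).par z) • hd (fun c p' =>
          spl (fun u y => F (z ++ (lops D).m a c :: u) y) p') p) l := by
    rw [show hd (fun c l' => rot D F ((lops D).m a c) l') l = _ from hd_spl _ _]
    refine spl_congr fun p z _ => ?_
    rw [smul_smul, ← sg_add, ← hd_smul]
    refine hd_congr fun c p' h => ?_
    rw [← h, hm, Ops.par_cons]
    congr 2
    ring
  -- the last letter times the marked letter, which the rotation makes adjacent
  have h4 : lst (fun l' c => sg ((lops D).p c * ((lops D).p a + (lops D).par l')) •
      rot D F ((lops D).m c a) l') l =
      spl (fun p z => sg (((lops D).p a + (lops D).par p) * (lops D).par z) •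
        lst (fun z' c => sg ((lops D).par z') •
          spl (fun u y => F (z' ++ (lops D).m c a :: u) y) p) z) l := by
    simp only [← lst_smul]
    have e : ∀ p z : List (Letter 𝒜), lst (fun z' c =>
        sg (((lops D).p a + (lops D).par p) * (lops D).par z) • sg ((lops D).par z') •
          spl (fun u y => F (z' ++ (lops D).m c a :: u) y) p) z =
        lst (fun z' c => sg (((lops D).p a + (lops D).par p) * ((lops D).par z' + (lops D).p c)) •
          sg ((lops D).par z') • spl (fun u y => F (z' ++ (lops D).m c a :: u) y) p) z :=
      fun p z => lst_congr fun z' c h => by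
        rw [← h, Ops.par_append, Ops.par_cons, Ops.par_nil, add_zero]
    simp only [e]
    rw [← lst_spl]
    refine lst_congr fun l' c _ => ?_
    rw [rot, ← spl_smul]
    refine spl_congr fun p z h => ?_
    rw [← h, hm, smul_smul, smul_smul, ← sg_add, ← sg_add]
    simp only [Ops.par_append, Ops.par_cons, Ops.par_nil]
    congr 2
    generalize (lops D).p a = s, (lops D).par p = x, (lops D).par z = y, (lops D).p c = z
    revert s x y z
    decide
  -- operations on the letters other than the marked one
  have h3 : sg ((lops D).p a) • (lops D).cd (rot D F a) l =
      spl (fun p z => sg (((lops D).p a + (lops D).par p) * (lops D).par z) •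
        ((lops D).cd (fun z => spl (fun u y => F (z ++ a :: u) y) p) z +
        sg ((lops D).par z + (lops D).p a) •
          (lops D).cd (fun p => spl (fun u y => F (z ++ a :: u) y) p) p)) l := by
    rw [show (lops D).cd (rot D F a) l = _ from Ops.cd_spl _ _ _, ← spl_smul]
    refine spl_congr fun p z _ => ?_
    have e1 := (lops_odd D).cd_sg (fun q => sg (((lops D).p a + q) * (lops D).par z))
      (fun p => spl (fun u y => F (z ++ a :: u) y) p) p
    have e2 := (lops_odd D).cd_sg (fun q => sg (((lops D).p a + (lops D).par p) * q))
      (fun z => spl (fun u y => F (z ++ a :: u) y) p) z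
    rw [e1, e2, smul_add, smul_add, add_comm]
    simp only [smul_smul, ← sg_add]
    congr 3
    · generalize (lops D).p a = s, (lops D).par p = x, (lops D).par z = y
      revert s x y
      decide
    · generalize (lops D).p a = s, (lops D).par p = x, (lops D).par z = y
      revert s x y
      decide
  rw [hR, dC, h1, h2, h3, h4, ← spl_add, ← spl_add, ← spl_add]
  refine spl_congr fun p z _ => ?_
  simp only [smul_add]
  abel

theorem rot_add (F G : List (Letter 𝒜) → List (Letter 𝒜) → M) (a : Letter 𝒜)
    (l : List (Letter 𝒜)) : rot D (fun x y => F x y + G x y) a l = rot D F a l + rot D G a l := by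
  simp only [rot, spl_add, smul_add]

theorem rot_zsmul (n : ℤ) (F : List (Letter 𝒜) → List (Letter 𝒜) → M) (a : Letter 𝒜)
    (l : List (Letter 𝒜)) : rot D (fun x y => n • F x y) a l = n • rot D F a l :=
  (map_rot (DistribSMul.toAddMonoidHom M n) F a l).symm

theorem rot_sub (F G : List (Letter 𝒜) → List (Letter 𝒜) → M) (a : Letter 𝒜)
    (l : List (Letter 𝒜)) : rot D (fun x y => F x y - G x y) a l = rot D F a l - rot D G a l := by
  simp only [rot, spl_sub, smul_sub]

theorem rot_congr {F G : List (Letter 𝒜) → List (Letter 𝒜) → M} {a : Letter 𝒜}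
    {l : List (Letter 𝒜)} (h : ∀ x y, (lops D).par x + (lops D).par y =
      (lops D).p a + (lops D).par l → F x y = G x y) : rot D F a l = rot D G a l := by
  refine spl_congr fun p z hl => ?_
  congr 1
  refine spl_congr fun u y hp => h _ _ ?_
  rw [← hl, ← hp]
  simp only [Ops.par_append, Ops.par_cons]
  ring

theorem rot_hd {Y : Type*} (F : List (Letter 𝒜) → List (Letter 𝒜) → Y → List Y → M) (a : Letter 𝒜)
    (l : List (Letter 𝒜)) (V : List Y) : rot D (fun x y => hd (F x y) V) a l =
      hd (fun E W => rot D (fun x y => F x y E W) a l) V := by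
  cases V <;> simp [rot, spl_zero]

theorem rot_lst {Y : Type*} (F : List (Letter 𝒜) → List (Letter 𝒜) → List Y → Y → M) (a : Letter 𝒜)
    (l : List (Letter 𝒜)) (V : List Y) : rot D (fun x y => lst (F x y) V) a l =
      lst (fun W E => rot D (fun x y => F x y W E) a l) V := by
  simp only [rot, spl_lst_comm, ← lst_smul]

theorem rot_cd (F : List (Letter 𝒜) → List (Letter 𝒜) → List (Parallel D) → M) (a : Letter 𝒜)
    (l : List (Letter 𝒜)) (V : List (Parallel D)) :
    rot D (fun x y => (sops D).cd (F x y) V) a l =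
      (sops D).cd (fun W => rot D (fun x y => F x y W) a l) V := by
  simp only [rot, Ops.cd_spl_comm, Ops.cd_smul]

/-- A sign that depends on the parity of the chain passes `dC` with its argument shifted by one.
-/
theorem dC_sg (σ : ZMod 2 → ℤ) (Φ : Letter 𝒜 → List (Letter 𝒜) → M) (a : Letter 𝒜)
    (l : List (Letter 𝒜)) : dC D (fun a l => σ (a.deg + (lops D).par l) • Φ a l) a l =
      σ (a.deg + (lops D).par l + 1) • dC D Φ a l := by
  have hf : ((lops D).f a).deg = a.deg + 1 := rfl
  have hm : ∀ c d, ((lops D).m c d).deg = c.deg + d.deg := fun _ _ => rfl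
  have hp : ∀ c, (lops D).p c = c.deg + 1 := fun _ => rfl
  have h := (lops_odd D).cd_sg (fun q => σ (a.deg + q)) (Φ a) l
  simp only [dC, h, smul_add]
  congr 1
  · congr 1
    · congr 1
      · rw [hf, add_right_comm]
      · rw [← hd_smul]
        refine hd_congr fun c l' h => ?_
        rw [← h, hm, Ops.par_cons, hp]
        congr 2
        generalize a.deg = x, c.deg = y, (lops D).par l' = z
        revert x y z
        decide
    · rw [smul_comm, add_assoc]
  · rw [← lst_smul]
    refine lst_congr fun l' c h => ?_
    rw [← h, hm, Ops.par_append, Ops.par_cons, Ops.par_nil, smul_comm]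
    congr 2
    rw [hp]
    generalize a.deg = x, c.deg = y, (lops D).par l' = z
    revert x y z
    decide

end Differentials

/-- The terms `(E' (…, a, …) E (…), V (…))`. -/
def preRot (E' E : Parallel D) (V : List (Parallel D)) (a : Letter 𝒜) (l : List (Letter 𝒜)) :
    Chains k A :=
  rot D (fun y p => pre p E V (E'.ev y)) a l

theorem act₂_concat (a : Letter 𝒜) (l : List (Letter 𝒜)) (E E' : Parallel D)
    (V : List (Parallel D)) : act₂ a l E (V ++ [E']) =
      sg (a.deg + (lops D).par l + ((sops D).par V + 1)) • preRot E' E V a l := by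
  rw [act₂, lst_concat, Ops.par_append]
  rfl

theorem act₂_nil (a : Letter 𝒜) (l : List (Letter 𝒜)) (E : Parallel D) :
    act₂ a l E [] = 0 := rfl

theorem preRot_nablaP (E : Parallel D) (V : List (Parallel D)) (a : Letter 𝒜)
    (l : List (Letter 𝒜)) : preRot (nablaP D) E V a l = act₁ ((lops D).f a) l E V := by
  have h : ∀ z u : List (Letter 𝒜), (nablaP D).ev (z ++ a :: u) =
      nl (nl ((lops D).f a).val u) z := by
    intro z u
    rw [nablaP_ev]
    rcases z with (_ | ⟨c, _ | ⟨d, z⟩⟩) <;> cases u <;> rfl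
  have h0 : ∀ z p : List (Letter 𝒜), sg (((lops D).p a + (lops D).par p) * (lops D).par z) •
      spl (fun u y => pre y E V ((nablaP D).ev (z ++ a :: u))) p =
      nl (pre p E V ((lops D).f a).val) z := by
    intro z p
    simp only [h, ← preL_apply, map_nl]
    cases z with
    | nil =>
      have := spl_nl_left (fun y => preL y E V ((lops D).f a).val) p
      simpa using this
    | cons c z => simp [spl_zero]
  rw [preRot, rot]
  simp only [h0]
  exact spl_nl_right (fun p => pre p E V ((lops D).f a).val) l

theorem pre_cd_ev (E' E : Parallel D) (V : List (Parallel D)) (p y : List (Letter 𝒜)) :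
    (lops D).cd (fun y => pre p E V (E'.ev y)) y =
      hd (fun c y' => pre p E V (c.val * E'.ev y')) y -
        lst (fun y' c => sg ((lops D).par y') • pre p E V (E'.ev y' * c.val)) y := by
  have h := congrArg (preL p E V) (E'.cd_ev y)
  simp only [map_sub, map_hd, map_lst, Ops.map_cd, map_zsmul, preL_apply] at h
  exact h

/-- The values of `E'`, whose arguments contain the marked letter `a`, times the next letter: the
same terms arise from the letter after the arguments as from their last letter, except when `a`
itself is the last argument. -/
theorem rot_front (E' E : Parallel D) (V : List (Parallel D)) (a : Letter 𝒜)
    (l : List (Letter 𝒜)) :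
    rot D (fun y p => hd (fun c p' => sg ((lops D).par y) • pre p' E V (E'.ev y * c.val)) p) a l =
      rot D (fun y p => lst (fun y' c => sg ((lops D).par y') • pre p E V (E'.ev y' * c.val)) y) a l
      - spl (fun p z => sg (((lops D).p a + (lops D).par p) * (lops D).par z + (lops D).par z) •
          pre p E V (E'.ev z * a.val)) l := by
  rw [eq_sub_iff_add_eq, rot, rot, ← spl_add]
  refine spl_congr fun p z _ => ?_
  have h1 : spl (fun u y => nl (sg ((lops D).par z) • pre y E V (E'.ev z * a.val)) u) p =
      sg ((lops D).par z) • pre p E V (E'.ev z * a.val) := spl_nl_left _ _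
  have h2 := spl_lst_eq_spl_hd (fun u c y => sg ((lops D).par (z ++ a :: u)) •
    pre y E V (E'.ev (z ++ a :: u) * c.val)) p
  rw [← h2, sg_add, mul_smul, ← smul_add, ← h1, ← spl_add]
  congr 1
  refine spl_congr fun u y _ => ?_
  rw [lst_append, nl_cons, zero_add, lst_cons, add_comm, List.append_nil]

/-- The last letter times the value of `E'`, whose arguments contain the marked letter: the same
terms arise from the last letter of the rotated list as from the first argument, except when the
marked letter is the first argument. -/
theorem rot_back (E' E : Parallel D) (V : List (Parallel D)) (a : Letter 𝒜)
    (l : List (Letter 𝒜)) :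
    rot D (fun y p => lst (fun p' c =>
      sg (((lops D).par y + 1 + (lops D).par p') * (c.deg + 1) + c.deg) •
        pre p' E V (c.val * E'.ev y)) p) a l =
      pre l (E'.mul E) V a.val -
      rot D (fun y p => hd (fun c y' => pre p E V (c.val * E'.ev y')) y) a l := by
  have h1 : spl (fun p z => nl (spl (fun u y => pre y E V (a.val * E'.ev u)) p) z) l =
      pre l (E'.mul E) V a.val := by
    rw [spl_nl_right (fun p => spl (fun u y => pre y E V (a.val * E'.ev u)) p)]
    simp only [pre, Parallel.mul_ev, mul_spl, ← chnR_apply, map_spl]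
    rw [← spl_assoc]
    simp only [mul_assoc]
  have h2 : rot D (fun y p => hd (fun c y' => pre p E V (c.val * E'.ev y')) y) a l =
      spl (fun p z => nl (spl (fun u y => pre y E V (a.val * E'.ev u)) p) z) l +
      spl (fun p z => hd (fun c z' => sg (((lops D).p a + (lops D).par p) *
        ((lops D).p c + (lops D).par z')) • spl (fun u y =>
          pre y E V (c.val * E'.ev (z' ++ a :: u))) p) z) l := by
    rw [rot, ← spl_add]
    refine spl_congr fun p z _ => ?_
    cases z with
    | nil => simp
    | cons c z => simp
  rw [h2, h1, sub_add_cancel_left, ← spl_lst_eq_spl_hd, rot, ← spl_neg]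
  refine spl_congr fun p z _ => ?_
  rw [← lst_spl, ← lst_smul, ← lst_neg]
  refine lst_congr fun p' c h => ?_
  rw [← spl_smul, ← spl_smul, ← spl_neg]
  refine spl_congr fun u y h' => ?_
  rw [← h, ← h', smul_smul, ← sg_add, ← neg_smul, ← sg_add_one]
  simp only [Ops.par_append, Ops.par_cons, Ops.par_nil, show (lops D).p c = c.deg + 1 from rfl]
  congr 2
  generalize (lops D).p a = s, (lops D).par u = x, (lops D).par y = y, (lops D).par z = z, c.deg = t
  revert s x y z t
  decide

/-- The value of the last cochain `E''` times the value of `E'`, whose arguments contain the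
marked letter `a`: these are the terms of `E'' ⌣ E'` except those in which `a` is an argument of
`E''`. -/
theorem rot_tail (E'' E' E : Parallel D) (V : List (Parallel D)) (a : Letter 𝒜)
    (l : List (Letter 𝒜)) :
    rot D (fun y p => spl (fun r w => sg (((lops D).par y + (lops D).par r) *
      ((lops D).par w + 1) + (sops D).par V + 1 + (lops D).par w) •
        pre r E V (E''.ev w * E'.ev y)) p) a l =
      sg (a.deg + (lops D).par l + (sops D).par V) •
        (preRot (E''.mul E') E V a l - preRot E'' (E'.mul E) V a l) := by
  have h1 : preRot (E''.mul E') E V a l = preRot E'' (E'.mul E) V a l +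
      spl (fun p z => sg (((lops D).p a + (lops D).par p) * (lops D).par z) •
        spl (fun u y => spl (fun z' z'' => pre y E V (E''.ev z' * E'.ev (z'' ++ a :: u))) z) p) l := by
    rw [preRot, preRot, rot, rot, ← spl_add]
    refine spl_congr fun p z _ => ?_
    rw [← smul_add]
    congr 1
    have : spl (fun u y => pre y (E'.mul E) V (E''.ev (z ++ a :: u))) p =
        spl (fun u y => spl (fun u' u'' => pre y E V (E''.ev (z ++ a :: u') * E'.ev u'')) u) p := by
      rw [← spl_assoc (fun u' u'' y => pre y E V (E''.ev (z ++ a :: u') * E'.ev u''))]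
      refine spl_congr fun u y _ => ?_
      simp only [pre, Parallel.mul_ev, mul_spl, ← chnR_apply, map_spl]
      rw [← spl_assoc]
      simp only [mul_assoc]
    rw [this, ← spl_add]
    refine spl_congr fun u y _ => ?_
    rw [Parallel.mul_ev, spl_append, ← preL_apply, map_add, map_spl, map_spl, add_comm]
    rfl
  rw [h1, add_sub_cancel_left, rot, ← spl_smul]
  have h2 : ∀ (p z : List (Letter 𝒜)), spl (fun u y => spl (fun r w =>
      sg (((lops D).par (z ++ a :: u) + (lops D).par r) *
      ((lops D).par w + 1) + (sops D).par V + 1 + (lops D).par w) •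
        pre r E V (E''.ev w * E'.ev (z ++ a :: u))) y) p =
      spl (fun q w => spl (fun u r => sg (((lops D).par (z ++ a :: u) + (lops D).par r) *
      ((lops D).par w + 1) + (sops D).par V + 1 + (lops D).par w) •
        pre r E V (E''.ev w * E'.ev (z ++ a :: u))) q) p := fun p z => spl_assoc _ _
  have h3 : ∀ (p z : List (Letter 𝒜)), spl (fun u y => spl (fun z' z'' =>
      pre y E V (E''.ev z' * E'.ev (z'' ++ a :: u))) z) p =
      spl (fun z' z'' => spl (fun u y => pre y E V (E''.ev z' * E'.ev (z'' ++ a :: u))) p) z :=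
    fun p z => spl_exchange _ _ _
  simp only [h2, h3, ← spl_smul]
  have h4 := spl_assoc (fun q w z => spl (fun u y =>
    sg (((lops D).p a + ((lops D).par q + (lops D).par w)) * (lops D).par z) •
    sg (((lops D).par (z ++ a :: u) + (lops D).par y) *
      ((lops D).par w + 1) + (sops D).par V + 1 + (lops D).par w) •
        pre y E V (E''.ev w * E'.ev (z ++ a :: u))) q) l
  refine Eq.trans ?_ (h4.symm.trans ?_)
  · refine spl_congr fun p z _ => spl_congr fun q w h => ?_
    rw [← h, Ops.par_append]
  · refine spl_congr fun p z h => spl_congr fun w z' h' => spl_congr fun u y h'' => ?_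
    rw [smul_smul, smul_smul, ← sg_add, ← sg_add, ← h, ← h', ← h'']
    simp only [Ops.par_append, Ops.par_cons, Ops.par_nil, show (lops D).p a = a.deg + 1 from rfl]
    congr 2
    generalize a.deg = s, (lops D).par u = x, (lops D).par y = y, (lops D).par z' = z,
      (sops D).par V = t, (lops D).par w = v
    revert s x y z t v
    decide

/-- The Hochschild differential of the terms of the second part of the action. -/
theorem bDiff_preRot (E' E : Parallel D) (V : List (Parallel D)) (a : Letter 𝒜)
    (l : List (Letter 𝒜)) : bDiff 𝒜 (preRot E' E V a l) =
      -dC D (preRot E' E V) a l -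
      spl (fun p z => sg (((lops D).p a + (lops D).par p) * (lops D).par z + (lops D).par z) •
          pre p E V (E'.ev z * a.val)) l + pre l (E'.mul E) V a.val +
      sg (a.deg + (lops D).par l + 1) • (hd (fun E₁ V₁ => preRot E' (E.mul E₁) V₁ a l) V -
        (sops D).cd (fun W => preRot E' E W a l) V) +
      lst (fun V' E'' => sg (a.deg + (lops D).par l + (sops D).par V') •
        (preRot (E''.mul E') E V' a l - preRot E'' (E'.mul E) V' a l)) V := by
  have hd₁ : dC D (preRot E' E V) a l = _ := dC_rot _ _ _
  have h1 : rot D (fun y p => sg ((lops D).par y + (lops D).par p) •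
      (hd (fun E₁ V₁ => pre p (E.mul E₁) V₁ (E'.ev y)) V -
        (sops D).cd (pre p E · (E'.ev y)) V)) a l =
      sg (a.deg + (lops D).par l + 1) • (hd (fun E₁ V₁ => preRot E' (E.mul E₁) V₁ a l) V -
        (sops D).cd (fun W => preRot E' E W a l) V) := by
    rw [rot_congr (G := fun y p => sg (a.deg + (lops D).par l + 1) •
      (hd (fun E₁ V₁ => pre p (E.mul E₁) V₁ (E'.ev y)) V -
        (sops D).cd (pre p E · (E'.ev y)) V)) (fun y p h => by
          rw [h, show (lops D).p a = a.deg + 1 from rfl, add_right_comm]),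
      rot_zsmul, rot_sub, rot_hd, rot_cd]
    rfl
  rw [hd₁, preRot, map_rot]
  simp only [bDiff_pre (E'.ev_mem _), rot_add, rot_sub, rot_front, rot_back, rot_lst, rot_tail, h1,
    pre_cd_ev]
  abel

/-- The Hochschild differential of the first part of the action. The last sum, in which the value
of the last cochain is multiplied with the first letter from the left, and the missing operation
`[D, a]` on the first letter are compensated by the second part. -/
theorem bDiff_act₁ (a : Letter 𝒜) (l : List (Letter 𝒜)) (E : Parallel D)
    (V : List (Parallel D)) : bDiff 𝒜 (act₁ a l E V) =
      dC D (act₁ · · E V) a l - act₁ ((lops D).f a) l E V +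
      sg (a.deg + (lops D).par l) • (hd (fun E' V' => act₁ a l (E.mul E') V') V -
        (sops D).cd (act₁ a l E) V) +
      lst (fun V' E' => spl (fun r w => sg ((a.deg + (lops D).par r) * ((lops D).par w + 1) +
        (sops D).par V' + 1 + (lops D).par w) • pre r E V' (E'.ev w * a.val)) l) V := by
  have h1 : hd (fun c l' => act₁ ((lops D).m a c) l' E V) l =
      hd (fun c l' => sg a.deg • pre l' E V (a.val * c.val)) l :=
    hd_congr fun c l' _ => pre_zsmul _ _ _ _ _
  have h2 : lst (fun l' c => sg ((lops D).p c * ((lops D).p a + (lops D).par l')) •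
      act₁ ((lops D).m c a) l' E V) l =
      lst (fun l' c => sg ((a.deg + 1 + (lops D).par l') * (c.deg + 1) + c.deg) •
        pre l' E V (c.val * a.val)) l := by
    refine lst_congr fun l' c _ => ?_
    rw [sg_add, mul_smul, ← pre_zsmul, mul_comm]
    rfl
  have h3 : sg ((lops D).p a) = -sg a.deg := sg_add_one _
  rw [act₁_eq_pre, bDiff_pre a.mem, dC, h1, h2, h3]
  change _ = act₁ ((lops D).f a) l E V + _ + -sg a.deg • (lops D).cd (pre · E V a.val) l + _ -
    _ + sg (a.deg + (lops D).par l) • (hd (fun E' V' => pre l (E.mul E') V' a.val) V -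
        (sops D).cd (pre l E · a.val) V) + _
  rw [neg_smul]
  abel

/-- The Hochschild differential of the first two parts of the action. -/
theorem bDiff_act₁_add_act₂ (a : Letter 𝒜) (l : List (Letter 𝒜)) (E : Parallel D)
    (V : List (Parallel D)) : bDiff 𝒜 (act₁ a l E V + act₂ a l E V) =
      dC D (fun a l => act₁ a l E V + act₂ a l E V) a l +
      sg (a.deg + (lops D).par l) • dS (fun E V => act₁ a l E V + act₂ a l E V) E V := by
  have hdC : dC D (fun a l => act₁ a l E V + act₂ a l E V) a l =
      dC D (act₁ · · E V) a l + dC D (act₂ · · E V) a l := by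
    simp only [dC, hd_add, Ops.cd_add, smul_add, lst_add]
    abel
  have hdS : dS (fun E V => act₁ a l E V + act₂ a l E V) E V =
      dS (act₁ a l) E V + dS (act₂ a l) E V := by
    simp only [dS, hd_add, Ops.cd_add, smul_add, lst_add]
    abel
  have hc : (sops D).c₀ = -1 := rfl
  have hc₁ : (sops D).c₁ = 0 := rfl
  have hc₂ : (sops D).c₂ = 1 := rfl
  have hp : ∀ E, (sops D).p E = 1 := fun _ => rfl
  have hw : (sops D).w = nablaP D := rfl
  have hm : (sops D).m = Parallel.mul := rfl
  rw [map_add, hdC, hdS, bDiff_act₁]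
  -- The second part depends on the last cochain of the string, the one which has the first letter
  -- among its arguments.
  induction V using List.reverseRecOn with
  | nil =>
    have h1 : dC D (act₂ · · E []) a l = 0 := by
      simp only [act₂_nil]
      have : ∀ l : List (Letter 𝒜), (lops D).cd (fun _ => (0 : Chains k A)) l = 0 := fun l => by
        have := (lops D).cd_smul 0 (fun _ => (0 : Chains k A)) l
        simpa using this
      have h0 : ∀ l : List (Letter 𝒜), hd (fun _ _ => (0 : Chains k A)) l = 0 := fun l => by
        cases l <;> rfl
      have hl : ∀ l : List (Letter 𝒜), lst (fun _ _ => (0 : Chains k A)) l = 0 := fun l => by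
        have := lst_smul 0 (fun _ _ => (0 : Chains k A)) l
        simpa using this
      simp [dC, this, h0, hl]
    -- the coderivation of the strings appends `∇`, which gives the operation `[D, ·]` on the
    -- first letter
    have h2 := act₂_concat a l E (nablaP D) []
    rw [preRot_nablaP, List.nil_append] at h2
    rw [h1, act₂_nil]
    simp only [dS, hd_nil, lst_nil, Ops.cd_nil, hc, hw, h2, Ops.par_nil]
    simp only [map_zero, add_zero, zero_add, neg_smul, one_smul, smul_neg, zero_sub, neg_neg,
      sg_add_one, smul_add]
    rcases (by decide : ∀ p : ZMod 2, sg p = 1 ∨ sg p = -1) (a.deg + (lops D).par l) with hx | hx <;>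
    rw [hx] <;> module
  | append_singleton V E' _ =>
    -- the operations on the letters
    have h1 : dC D (act₂ · · E (V ++ [E'])) a l =
        -sg (a.deg + (lops D).par l + ((sops D).par V + 1)) • dC D (preRot E' E V) a l := by
      simp only [act₂_concat]
      rw [dC_sg (fun q => sg (q + ((sops D).par V + 1))), add_right_comm, sg_add_one]
    -- the merging of the first two cochains
    have h2 : hd (fun E₁ V₁ => act₂ a l (E.mul E₁) V₁) (V ++ [E']) =
        sg (a.deg + (lops D).par l + (sops D).par V) •
          hd (fun E₁ V₁ => preRot E' (E.mul E₁) V₁ a l) V := by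
      rw [hd_append, hd_cons, act₂_nil]
      simp only [act₂_concat]
      rw [← hd_smul]
      have : nl (0 : Chains k A) V = 0 := by cases V <;> rfl
      rw [this, zero_add]
      refine hd_congr fun E₁ V₁ h => ?_
      rw [← h, Ops.par_cons, hp, add_comm 1]
    -- the operations on the other cochains, among them the merging with the last cochain `E'` and
    -- the insertion of `∇` after it
    have h3 : (sops D).cd (act₂ a l E) (V ++ [E']) =
        sg (a.deg + (lops D).par l + (sops D).par V) • (sops D).cd (fun W => preRot E' E W a l) V -
        sg (a.deg + (lops D).par l) • lst (fun V' E'' => preRot (E''.mul E') E V' a l) V +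
        sg (a.deg + (lops D).par l) • act₁ ((lops D).f a) l E (V ++ [E']) := by
      have e1 : lst (fun z' c => sg ((sops D).par z') • act₂ a l E (z' ++ [c.mul E'])) V =
          -(sg (a.deg + (lops D).par l) •
            lst (fun V' E'' => preRot (E''.mul E') E V' a l) V) := by
        rw [← neg_smul, ← lst_smul]
        refine lst_congr fun V' E'' _ => ?_
        rw [act₂_concat, smul_smul, ← sg_add, ← sg_add_one]
        congr 2
        generalize a.deg + (lops D).par l = x, (sops D).par V' = y
        revert x y
        decide
      have e2 := (sops_odd D).cd_sg (fun q => sg (a.deg + (lops D).par l + (q + 1)))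
        (fun W => preRot E' E W a l) V
      have e3 : act₂ a l E (V ++ [E', nablaP D]) =
          sg (a.deg + (lops D).par l + (sops D).par V) •
            act₁ ((lops D).f a) l E (V ++ [E']) := by
        have := act₂_concat a l E (nablaP D) (V ++ [E'])
        rw [List.append_assoc, preRot_nablaP] at this
        rw [show [E', nablaP D] = [E'] ++ [nablaP D] from rfl, this, Ops.par_append, Ops.par_cons,
          hp, Ops.par_nil]
        congr 2
        generalize a.deg + (lops D).par l = x, (sops D).par V = y
        revert x y
        decide
      rw [Ops.cd_append]
      simp only [hc, hc₁, hc₂, hw, hm, hp, hd_nil, Ops.cd_nil, smul_zero, add_zero, zero_smul,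
        one_smul, neg_smul, e1, e3]
      simp only [act₂_concat]
      have s1 : sg (a.deg + (lops D).par l + ((sops D).par V + 1 + 1)) =
          sg (a.deg + (lops D).par l + (sops D).par V) := by
        congr 1
        generalize a.deg + (lops D).par l = x, (sops D).par V = y
        revert x y
        decide
      have s2 : sg ((sops D).par V + 1) * sg (a.deg + (lops D).par l + (sops D).par V) =
          -sg (a.deg + (lops D).par l) := by
        generalize a.deg + (lops D).par l = x, (sops D).par V = y
        revert x y
        decide
      rw [e2, s1, smul_neg, smul_smul, s2]
      module
    -- the merging of the last with the first cochain, in the second part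
    have h4 : lst (fun V' E₁ => sg ((sops D).par (V ++ [E'])) • act₂ a l (E₁.mul E) V')
        (V ++ [E']) = -(sg (a.deg + (lops D).par l) • lst (fun V' E'' =>
          preRot E'' (E'.mul E) V' a l) V) := by
      rw [lst_concat]
      rcases List.eq_nil_or_concat V with rfl | ⟨V', E'', rfl⟩
      · simp [act₂_nil]
      · rw [List.concat_eq_append, act₂_concat, lst_concat, smul_smul, ← neg_smul, ← sg_add_one, ← sg_add]
        congr 2
        simp only [Ops.par_append, Ops.par_cons, Ops.par_nil, hp]
        generalize a.deg + (lops D).par l = x, (sops D).par V' = y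
        revert x y
        decide
    have h5 : lst (fun V' E'' => sg (a.deg + (lops D).par l + (sops D).par V') •
        (preRot (E''.mul E') E V' a l - preRot E'' (E'.mul E) V' a l)) V =
        sg (a.deg + (lops D).par l + (sops D).par V + 1) •
        (lst (fun V' E'' => preRot (E''.mul E') E V' a l) V -
          lst (fun V' E'' => preRot E'' (E'.mul E) V' a l) V) := by
      rw [← lst_sub, ← lst_smul]
      refine lst_congr fun V' E'' h => ?_
      rw [← h, Ops.par_append, Ops.par_cons, Ops.par_nil, hp]
      congr 2
      generalize a.deg + (lops D).par l = x, (sops D).par V' = y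
      revert x y
      decide
    -- the value of `E'` times the first letter occurs in the differential of both parts, with
    -- opposite signs
    have h6 : spl (fun r w => sg ((a.deg + (lops D).par r) * ((lops D).par w + 1) +
        (sops D).par V + 1 + (lops D).par w) • pre r E V (E'.ev w * a.val)) l =
        sg (a.deg + (lops D).par l + (sops D).par V + 1) • spl (fun p z =>
          sg (((lops D).p a + (lops D).par p) * (lops D).par z + (lops D).par z) •
          pre p E V (E'.ev z * a.val)) l := by
      rw [← spl_smul]
      refine spl_congr fun r w h => ?_
      rw [← h, Ops.par_append, smul_smul, ← sg_add, show (lops D).p a = a.deg + 1 from rfl]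
      congr 2
      generalize a.deg = s, (lops D).par r = x, (lops D).par w = y, (sops D).par V = z
      revert s x y z
      decide
    -- the merging of the last with the first cochain, in the first part
    have h7 : lst (fun V' E₁ => sg ((sops D).par (V ++ [E'])) • act₁ a l (E₁.mul E) V')
        (V ++ [E']) = sg ((sops D).par V + 1) • pre l (E'.mul E) V a.val := by
      rw [lst_concat, Ops.par_append]
      rfl
    rw [act₂_concat, map_zsmul, bDiff_preRot, h1, h5]
    simp only [dS, h2, h3, h4, h7]
    rw [lst_concat, h6]
    simp only [← add_assoc, sg_add_one, sg_add (a.deg + (lops D).par l) ((sops D).par V)]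
    rcases (by decide : ∀ p : ZMod 2, sg p = 1 ∨ sg p = -1) (a.deg + (lops D).par l) with hx | hx <;>
    rcases (by decide : ∀ p : ZMod 2, sg p = 1 ∨ sg p = -1) ((sops D).par V) with hy | hy <;>
    rw [hx, hy] <;> module

end

section

variable {k : Type*} [CommRing k] [Algebra ℚ k] {A : Type*} [Ring A] [Algebra k A]
variable {𝒜 : ZMod 2 → Submodule k A} [GradedAlgebra 𝒜] {D : 𝒜 1}

/-! ### The bar differential of the third part of the action -/

theorem deconcat_mapWord {V V' : Type*} [AddCommGroup V] [Module k V] [AddCommGroup V']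
    [Module k V'] (s : V →ₗ[k] V') (X : TensorAlgebra k V) :
    deconcat (mapWord s X) = TensorProduct.map (mapWord s) (mapWord s) (deconcat X) := by
  induction X using word_induction with
  | h_one => simp
  | h_add x y hx hy => simp only [map_add, hx, hy]
  | h_smul c x hx => simp only [map_smul, hx]
  | h_cons a w hw =>
    rw [mapWord_ι_mul, deconcat_ι_mul, hw, deconcat_ι_mul, map_add, TensorProduct.map_tmul,
      mapWord_one, mapWord_ι_mul]
    congr 1
    induction deconcat w using TensorProduct.induction_on with
    | zero => simp
    | tmul x y => simp
    | add x y hx hy => simp only [mul_add, map_add, hx, hy]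

/-- `∑ (g E (a₁, …, a_d), V (a_{d+1}, …, aₙ))`, as a word. -/
def insG (g : A) (E : Parallel D) (V : List (Parallel D)) (l : List (Letter 𝒜)) :
    TensorAlgebra k A :=
  spl (fun v r => TensorAlgebra.ι k (g * E.ev v) * ins V r) l

/-- Connes' differential of a chain with insertions. -/
theorem BDiff_chn_ins {x : A} {s : ZMod 2} (hx : x ∈ 𝒜 s) (V : List (Parallel D))
    (l : List (Letter 𝒜)) : BDiff 𝒜 (chn x (ins V l)) =
      spl (fun U P => spl (fun y z => sg ((s + 1 + (lops D).par y + (sops D).par U) *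
        ((lops D).par z + (sops D).par P) + (sops D).par U * (lops D).par z) •
        chn 1 (ins P z * (TensorAlgebra.ι k x * ins U y))) l) V := by
  rw [BDiff, LinearMap.comp_apply, LinearMap.comp_apply, rotateChain, rotate, cut,
    ← LinearMap.comp_assoc, chn, comp_lTensor_tmul, deconcat_mapWord, deconcat_ins]
  simp only [map_spl]
  refine spl_congr fun U P _ => spl_congr fun y z _ => ?_
  have hs : ∀ (W : List (Parallel D)) (w : List (Letter 𝒜)),
      mapWord (shiftBar 𝒜) (mapWord (toBar k A) (ins W w)) =
        sg ((lops D).par w + (sops D).par W) • mapWord (toBar k A) (ins W w) := fun W w => by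
    rw [← map_zsmul, ← shift_ins, mapWord_toBar_shift]
  rw [map_zsmul, map_zsmul, map_zsmul, map_zsmul, TensorProduct.map_tmul, LinearMap.comp_apply,
    LinearMap.comp_apply, TensorProduct.mk_apply, TensorProduct.mk_apply, LinearEquiv.coe_coe,
    TensorProduct.assoc_symm_tmul,
    koszulSwap_of (p := s + 1 + ((lops D).par y + (sops D).par U))
      (q := (lops D).par z + (sops D).par P) _ _ _ (hs P z)]
  · rw [map_zsmul, tmul_zsmul, smul_smul, ← sg_add]
    congr 1
    · congr 1
      ring
    · simp [joinWord, chn, mapWord_mul, mapWord_ι]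
  · rw [TensorProduct.map_tmul, hs, shift_of_mem hx, zsmul_tmul, tmul_zsmul, smul_smul, ← sg_add]

/-- Connes' differential of the chains `pre l E V g`: a rotation cuts the arguments and the string
of cochains, and `g` is no longer the first letter. -/
theorem BDiff_pre {g : A} {s : ZMod 2} (hg : g ∈ 𝒜 s) (l : List (Letter 𝒜)) (E : Parallel D)
    (V : List (Parallel D)) : BDiff 𝒜 (pre l E V g) =
      spl (fun U P => spl (fun q t => sg ((s + 1 + (lops D).par q) *
        ((lops D).par t + (sops D).par P) + (sops D).par U * (sops D).par P) •
        chn 1 (ins P t * insG g E U q)) l) V := by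
  rw [pre, map_spl]
  simp only [BDiff_chn_ins (SetLike.mul_mem_graded hg (E.ev_mem _))]
  rw [spl_exchange]
  refine spl_congr fun U P _ => ?_
  rw [spl_assoc]
  refine spl_congr fun q t _ => ?_
  simp only [insG, mul_spl, chn_spl]
  rw [← spl_smul]
  refine spl_congr fun u y h => ?_
  rw [← h, Ops.par_append]
  congr 2
  generalize s = s, (lops D).par y = x, (lops D).par u = w, (lops D).par t = y,
    (sops D).par U = z, (sops D).par P = t
  revert s x y z t w
  decide

/-- The sum of the terms of the third part of the action for a given cyclic rotation of the
string of cochains. -/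
def rotIns (E : Parallel D) (U P : List (Parallel D)) (a : Letter 𝒜) (l : List (Letter 𝒜)) :
    Chains k A :=
  rot D (fun x y => sg ((sops D).par P * (lops D).par y) • chn 1 (ins P x * insF (E :: U) y)) a l

theorem act₃_eq (a : Letter 𝒜) (l : List (Letter 𝒜)) (E : Parallel D) (V : List (Parallel D)) :
    act₃ a l E V = sg (a.deg + (lops D).par l) • spl (fun U P =>
      sg ((1 + (sops D).par U) * (sops D).par P) • rotIns E U P a l) V := rfl

/-- A value of `E'` times the value of the following cochain `E` is a value of their cup product.
-/
theorem spl_insG (E' E : Parallel D) (U : List (Parallel D)) (r : List (Letter 𝒜)) :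
    spl (fun w y => insG (E'.ev w) E U y) r = sg ((lops D).par r) • insF (E'.mul E :: U) r := by
  rw [insF_cons, smul_smul, sg_mul_self, one_smul]
  simp only [insG, Parallel.mul_ev, map_spl, spl_mul]
  exact spl_assoc (fun w v r => TensorAlgebra.ι k (E'.ev w * E.ev v) * ins U r) r

/-- The junction of two words with insertions, in the bar differential of their product: the last
letter of the first word is a letter of the list or a value of the last cochain. -/
theorem junction_ins (P : List (Parallel D)) (E : Parallel D) (U : List (Parallel D))
    (x y : List (Letter 𝒜)) :
    junction (TensorProduct.map (mapWord (shift 𝒜)) (parity 𝒜) (unsnoc (ins P x)))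
      (uncons (insF (E :: U) y)) =
      lst (fun x' c => sg ((lops D).p c * (sops D).par P + (lops D).par x' + (sops D).par P +
        (lops D).p c + 1 + (lops D).par y) • (ins P x' * insG c.val E U y)) x +
      lst (fun P' E' => spl (fun v w => sg ((sops D).par P * (lops D).par w + (lops D).par v +
        (sops D).par P' + (lops D).par w + (lops D).par y) •
          (ins P' v * insG (E'.ev w) E U y)) x) P := by
  have h1 : ∀ (X : TensorAlgebra k A) (c : A), junction (X ⊗ₜ[k] c) (uncons (insF (E :: U) y)) =
      sg ((lops D).par y) • (X * insG c E U y) := by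
    intro X c
    rw [uncons_insF, hd_cons, map_zsmul, map_spl]
    simp only [junction_tmul, insG, mul_spl]
  rw [unsnoc_ins, map_add, map_add, LinearMap.add_apply]
  have h2 : ∀ t : TensorAlgebra k A ⊗[k] A, junction (TensorProduct.map (mapWord (shift 𝒜))
      (parity 𝒜) t) (uncons (insF (E :: U) y)) = (junction.flip (uncons (insF (E :: U) y)) ∘ₗ
        TensorProduct.map (mapWord (shift 𝒜)) (parity 𝒜)) t := fun _ => rfl
  rw [h2, h2, map_lst, map_lst]
  congr 1
  · refine lst_congr fun x' c _ => ?_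
    rw [map_zsmul, LinearMap.comp_apply, TensorProduct.map_tmul, shift_ins, parity_of_mem c.mem,
      LinearMap.flip_apply, zsmul_tmul, tmul_zsmul, map_zsmul, map_zsmul, LinearMap.smul_apply,
      LinearMap.smul_apply, h1, show (lops D).p c = c.deg + 1 from rfl]
    simp only [smul_smul, ← sg_add]
    congr 2
    generalize c.deg = s, (lops D).par x' = x, (lops D).par y = y, (sops D).par P = z
    revert s x y z
    decide
  · refine lst_congr fun P' E' _ => ?_
    rw [map_spl]
    refine spl_congr fun v w _ => ?_
    rw [map_zsmul, LinearMap.comp_apply, TensorProduct.map_tmul, shift_ins,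
      parity_of_mem (E'.ev_mem w), LinearMap.flip_apply, zsmul_tmul, tmul_zsmul, map_zsmul,
      map_zsmul, LinearMap.smul_apply, LinearMap.smul_apply, h1]
    simp only [smul_smul, ← sg_add]
    congr 2
    ring

/-- The terms at the junction of the two halves of a rotated word that do not cancel: the marked
letter `a` is multiplied with the value of `E`, or the value of the last cochain of `P` is, its
arguments standing on the right of `a` or containing `a`. -/
def rotJunction (E : Parallel D) (U P : List (Parallel D)) (a : Letter 𝒜) (l : List (Letter 𝒜)) :
    Chains k A :=
  spl (fun p z => sg (((lops D).p a + (lops D).par p) * ((lops D).par z + (sops D).par P) +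
    (lops D).par z + (sops D).par P + (lops D).p a + 1 + (lops D).par p) •
      chn 1 (ins P z * insG a.val E U p)) l +
  lst (fun P' E' => sg ((lops D).p a + (lops D).par l + (sops D).par P') •
    rotIns (E'.mul E) U P' a l) P +
  lst (fun P' E' => spl (fun p z => sg (((lops D).p a + (lops D).par p) * (lops D).par z) •
    spl (fun u y => spl (fun v w => sg ((sops D).par P * (lops D).par y +
      (sops D).par P * (lops D).par (w ++ a :: u) + (lops D).par v + (sops D).par P' +
      (lops D).par (w ++ a :: u) + (lops D).par y) •
        chn 1 (ins P' v * insG (E'.ev (w ++ a :: u)) E U y)) z) p) l) P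

/-- The multiplications at the junction of the two halves of a rotated word cancel against the
multiplications of a letter with the value of `E` after it, up to `rotJunction`. -/
theorem rot_junction (E : Parallel D) (U P : List (Parallel D)) (a : Letter 𝒜)
    (l : List (Letter 𝒜)) :
    rot D (fun x y => sg ((sops D).par P * (lops D).par y) • chn 1
      (mapWord (shift 𝒜) (ins P x) * hd (fun c y' => sg ((lops D).par (c :: y')) •
        insG c.val E U y') y +
      junction (TensorProduct.map (mapWord (shift 𝒜)) (parity 𝒜) (unsnoc (ins P x)))
        (uncons (insF (E :: U) y)))) a l = rotJunction E U P a l := by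
  have hA : ∀ x y : List (Letter 𝒜), sg ((sops D).par P * (lops D).par y) • chn 1
      (mapWord (shift 𝒜) (ins P x) * hd (fun c y' => sg ((lops D).par (c :: y')) •
        insG c.val E U y') y) = hd (fun c y' => sg ((sops D).par P * (lops D).par (c :: y') +
          ((lops D).par x + (sops D).par P) + (lops D).par (c :: y')) •
          chn 1 (ins P x * insG c.val E U y')) y := by
    intro x y
    rw [shift_ins, mul_hd, ← chnL_apply, map_hd, ← hd_smul]
    refine hd_congr fun c y' h => ?_
    rw [smul_mul_smul_comm, map_zsmul, ← h, smul_smul, ← sg_add, ← sg_add, chnL_apply]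
    congr 2
    ring
  -- the products of a letter and the value of `E` cancel except for the marked letter `a`
  have hB : ∀ z p : List (Letter 𝒜), spl (fun u y => sg ((sops D).par P * (lops D).par y) •
      lst (fun x' c => sg ((lops D).p c * (sops D).par P + (lops D).par x' + (sops D).par P +
        (lops D).p c + 1 + (lops D).par y) • chn 1 (ins P x' * insG c.val E U y)) (z ++ a :: u)) p =
      sg ((sops D).par P * (lops D).par p) • sg ((lops D).p a * (sops D).par P + (lops D).par z +
        (sops D).par P + (lops D).p a + 1 + (lops D).par p) •
          chn 1 (ins P z * insG a.val E U p) -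
      spl (fun u y => hd (fun c y' => sg ((sops D).par P * (lops D).par (c :: y') +
          ((lops D).par (z ++ a :: u) + (sops D).par P) + (lops D).par (c :: y')) •
          chn 1 (ins P (z ++ a :: u) * insG c.val E U y')) y) p := by
    intro z p
    have h1 := spl_nl_left (fun y => sg ((sops D).par P * (lops D).par y) • sg ((lops D).p a *
      (sops D).par P + (lops D).par z + (sops D).par P + (lops D).p a + 1 + (lops D).par y) •
          chn 1 (ins P z * insG a.val E U y)) p
    rw [← spl_lst_eq_spl_hd, ← h1, ← spl_sub]
    refine spl_congr fun u y _ => ?_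
    rw [lst_append, nl_cons, zero_add, lst_cons, smul_add, nl_smul, List.append_nil, ← lst_smul,
      sub_eq_add_neg]
    refine congrArg₂ (· + ·) (by simp only [nl_smul]) ?_
    refine Eq.trans ?_ (lst_neg _ _)
    refine lst_congr fun u' c _ => ?_
    rw [smul_smul, ← sg_add, ← neg_smul, ← sg_add_one]
    congr 2
    simp only [Ops.par_cons, Ops.par_append]
    generalize (lops D).p c = s, (lops D).par u' = x, (lops D).par y = y, (sops D).par P = z,
      (lops D).par z = t, (lops D).p a = w
    revert s x y z t w
    decide
  -- the products of the value of the last cochain of `P` and of the value of `E`, according to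
  -- whether the arguments of the former contain `a`
  have hC : ∀ z p : List (Letter 𝒜), spl (fun u y => sg ((sops D).par P * (lops D).par y) •
      lst (fun P' E' => spl (fun v w => sg ((sops D).par P * (lops D).par w + (lops D).par v +
        (sops D).par P' + (lops D).par w + (lops D).par y) •
          chn 1 (ins P' v * insG (E'.ev w) E U y)) (z ++ a :: u)) P) p =
      lst (fun P' E' => spl (fun u y => sg ((lops D).p a + (lops D).par p + (lops D).par z +
        (sops D).par P') • sg ((sops D).par P' * (lops D).par y) •
          chn 1 (ins P' (z ++ a :: u) * insF (E'.mul E :: U) y)) p) P +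
      lst (fun P' E' => spl (fun u y => spl (fun v w => sg ((sops D).par P * (lops D).par y +
      (sops D).par P * (lops D).par (w ++ a :: u) + (lops D).par v + (sops D).par P' +
      (lops D).par (w ++ a :: u) + (lops D).par y) •
        chn 1 (ins P' v * insG (E'.ev (w ++ a :: u)) E U y)) z) p) P := by
    intro z p
    simp only [← lst_smul]
    rw [spl_lst_comm, ← lst_add]
    refine lst_congr fun P' E' hP => ?_
    have h1 : ∀ u y : List (Letter 𝒜), sg ((lops D).p a + (lops D).par p + (lops D).par z +
        (sops D).par P') • sg ((sops D).par P' * (lops D).par y) •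
          chn 1 (ins P' (z ++ a :: u) * insF (E'.mul E :: U) y) =
        spl (fun w y' => sg ((lops D).p a + (lops D).par p + (lops D).par z +
          (sops D).par P' + (sops D).par P' * ((lops D).par w + (lops D).par y') +
          ((lops D).par w + (lops D).par y')) •
          chn 1 (ins P' (z ++ a :: u) * insG (E'.ev w) E U y')) y := by
      intro u y
      rw [spl_congr (G := fun w y' => sg ((lops D).p a + (lops D).par p + (lops D).par z +
          (sops D).par P' + (sops D).par P' * (lops D).par y + (lops D).par y) •
          chn 1 (ins P' (z ++ a :: u) * insG (E'.ev w) E U y')) fun w y' h => by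
            rw [← h, Ops.par_append]]
      rw [spl_smul, ← chn_spl, ← mul_spl, spl_insG, mul_smul_comm, chn_zsmul, smul_smul, smul_smul,
        ← sg_add, ← sg_add]
      congr 2
      generalize (lops D).p a + (lops D).par p + (lops D).par z + (sops D).par P' = z
      generalize (sops D).par P' = x, (lops D).par y = y
      revert x y z
      decide
    simp only [h1]
    rw [spl_assoc (fun u w y' => sg ((lops D).p a + (lops D).par p + (lops D).par z +
          (sops D).par P' + (sops D).par P' * ((lops D).par w + (lops D).par y') +
          ((lops D).par w + (lops D).par y')) •
          chn 1 (ins P' (z ++ a :: u) * insG (E'.ev w) E U y')) p, ← spl_add]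
    refine spl_congr fun u y hp => ?_
    rw [spl_append, add_comm, smul_add, ← spl_smul, ← spl_smul]
    congr 1
    · refine spl_congr fun u' w hu => ?_
      rw [smul_smul, ← sg_add, ← hp, ← hu, ← hP]
      simp only [Ops.par_append, Ops.par_cons, Ops.par_nil, show (sops D).p E' = 1 from rfl]
      congr 2
      generalize (lops D).par u' = x, (lops D).par y = y, (lops D).p a = s,
        (lops D).par z = z, (sops D).par P' = t, (lops D).par w = w
      revert s x y z t w
      decide
    · refine spl_congr fun v w _ => ?_
      rw [smul_smul, ← sg_add]
      congr 2
      ring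
  have hD : ∀ (x y : List (Letter 𝒜)), chn 1 (junction (TensorProduct.map (mapWord (shift 𝒜))
      (parity 𝒜) (unsnoc (ins P x))) (uncons (insF (E :: U) y))) =
      lst (fun x' c => sg ((lops D).p c * (sops D).par P + (lops D).par x' + (sops D).par P +
        (lops D).p c + 1 + (lops D).par y) • chn 1 (ins P x' * insG c.val E U y)) x +
      lst (fun P' E' => spl (fun v w => sg ((sops D).par P * (lops D).par w + (lops D).par v +
        (sops D).par P' + (lops D).par w + (lops D).par y) •
          chn 1 (ins P' v * insG (E'.ev w) E U y)) x) P := by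
    intro x y
    rw [junction_ins, chn_add, ← chnL_apply, ← chnL_apply, map_lst, map_lst]
    simp only [chnL_apply, chn_spl, chn_zsmul]
  have hE : ∀ z p : List (Letter 𝒜), spl (fun u y => sg ((sops D).par P * (lops D).par y) •
      chn 1 (mapWord (shift 𝒜) (ins P (z ++ a :: u)) * hd (fun c y' =>
        sg ((lops D).par (c :: y')) • insG c.val E U y') y +
      junction (TensorProduct.map (mapWord (shift 𝒜)) (parity 𝒜) (unsnoc (ins P (z ++ a :: u))))
        (uncons (insF (E :: U) y)))) p =
      sg ((sops D).par P * (lops D).par p) • sg ((lops D).p a * (sops D).par P + (lops D).par z +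
        (sops D).par P + (lops D).p a + 1 + (lops D).par p) •
          chn 1 (ins P z * insG a.val E U p) +
      (lst (fun P' E' => spl (fun u y => sg ((lops D).p a + (lops D).par p + (lops D).par z +
        (sops D).par P') • sg ((sops D).par P' * (lops D).par y) •
          chn 1 (ins P' (z ++ a :: u) * insF (E'.mul E :: U) y)) p) P +
      lst (fun P' E' => spl (fun u y => spl (fun v w => sg ((sops D).par P * (lops D).par y +
      (sops D).par P * (lops D).par (w ++ a :: u) + (lops D).par v + (sops D).par P' +
      (lops D).par (w ++ a :: u) + (lops D).par y) •
        chn 1 (ins P' v * insG (E'.ev (w ++ a :: u)) E U y)) z) p) P) := by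
    intro z p
    rw [← hC, ← sub_add_cancel (sg ((sops D).par P * (lops D).par p) •
      sg ((lops D).p a * (sops D).par P + (lops D).par z +
        (sops D).par P + (lops D).p a + 1 + (lops D).par p) •
          chn 1 (ins P z * insG a.val E U p)) (spl (fun u y => hd (fun c y' => sg ((sops D).par P *
          (lops D).par (c :: y') + ((lops D).par (z ++ a :: u) + (sops D).par P) +
          (lops D).par (c :: y')) • chn 1 (ins P (z ++ a :: u) * insG c.val E U y')) y) p), ← hB,
      ← spl_add, ← spl_add]
    refine spl_congr fun u y _ => ?_
    rw [chn_add, smul_add, hA, hD, smul_add]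
    abel
  rw [rot, rotJunction]
  simp only [rotIns, rot, hE, ← spl_smul]
  rw [← spl_lst_comm, ← spl_lst_comm, ← spl_add, ← spl_add]
  refine spl_congr fun p z hl => ?_
  simp only [smul_add, ← lst_smul, add_assoc]
  refine congrArg₂ (· + ·) ?_ (congrArg₂ (· + ·) ?_ ?_)
  · simp only [smul_smul, ← sg_add]
    congr 2
    generalize (lops D).par z = x, (lops D).par p = y, (lops D).p a = s, (sops D).par P = t
    revert s x y t
    decide
  · refine lst_congr fun P' E' _ => ?_
    simp only [← spl_smul]
    refine spl_congr fun u y _ => ?_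
    simp only [smul_smul, ← sg_add, ← hl, Ops.par_append]
    congr 2
    ring
  · simp only [← spl_smul, add_assoc]

end

section

variable {k : Type*} [CommRing k] [Algebra ℚ k] {A : Type*} [Ring A] [Algebra k A]
variable {𝒜 : ZMod 2 → Submodule k A} [GradedAlgebra 𝒜] {D : 𝒜 1}

/-- The differential of `rotIns` with respect to the two strings of cochains. -/
def dRot (E : Parallel D) (U P : List (Parallel D)) (a : Letter 𝒜) (l : List (Letter 𝒜)) :
    Chains k A :=
  (sops D).cd (fun W => rotIns E U W a l) P + sg ((sops D).par P) •
    (hd (fun E₁ U₁ => rotIns (E.mul E₁) U₁ P a l) U - (sops D).cd (fun W => rotIns E W P a l) U)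

/-- The bar differential of the third part of the action, for a fixed cut of the string of
cochains. -/
theorem rot_barDiff (E : Parallel D) (U P : List (Parallel D)) (a : Letter 𝒜)
    (l : List (Letter 𝒜)) :
    rot D (fun x y => sg ((sops D).par P * (lops D).par y) • chn 1
      (barDiff 𝒜 (ins P x * insF (E :: U) y))) a l =
      dC D (rotIns E U P) a l + sg ((lops D).p a + (lops D).par l) • dRot E U P a l +
        rotJunction E U P a l := by
  have h1 : dC D (rotIns E U P) a l = _ := dC_rot _ _ _
  have h2 : dRot E U P a l = rot D (fun x y => sg ((sops D).par P * (lops D).par y) •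
      chn 1 (sg ((lops D).par y) • ((sops D).cd (fun W => ins W x) P * insF (E :: U) y) +
        sg ((sops D).par P) • (ins P x * (hd (fun E₁ U₁ => insF (E.mul E₁ :: U₁) y) U -
          (sops D).cd (fun W => insF (E :: W) y) U)))) a l := by
    have e : ∀ x y : List (Letter 𝒜), sg ((sops D).par P * (lops D).par y) •
      chn 1 (sg ((lops D).par y) • ((sops D).cd (fun W => ins W x) P * insF (E :: U) y) +
        sg ((sops D).par P) • (ins P x * (hd (fun E₁ U₁ => insF (E.mul E₁ :: U₁) y) U -
          (sops D).cd (fun W => insF (E :: W) y) U))) =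
      (sops D).cd (fun W => sg ((sops D).par W * (lops D).par y) •
        chn 1 (ins W x * insF (E :: U) y)) P + sg ((sops D).par P) •
        (hd (fun E₁ U₁ => sg ((sops D).par P * (lops D).par y) •
          chn 1 (ins P x * insF (E.mul E₁ :: U₁) y)) U -
        (sops D).cd (fun W => sg ((sops D).par P * (lops D).par y) •
          chn 1 (ins P x * insF (E :: W) y)) U) := by
      intro x y
      rw [(sops_odd D).cd_sg (fun q => sg (q * (lops D).par y)), hd_smul, Ops.cd_smul, chn_add,
        smul_add, chn_zsmul, chn_zsmul, mul_sub, Ops.cd_mul, mul_hd, Ops.mul_cd, ← smul_sub,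
        ← chnL_apply, ← chnL_apply, map_sub, map_hd, Ops.map_cd, Ops.map_cd, smul_smul, ← sg_add,
        add_mul, one_mul, smul_comm (sg ((sops D).par P))]
      rfl
    simp only [e, rot_add, rot_zsmul, rot_sub, rot_hd, rot_cd, dRot]
    rfl
  rw [h1, h2, ← rot_junction, ← rot_zsmul, ← rot_add, ← rot_add]
  refine rot_congr fun x y h => ?_
  have e1 := (lops_odd D).cd_sg (fun q => sg ((sops D).par P * q))
    (fun y => chn 1 (ins P x * insF (E :: U) y)) y
  rw [Ops.cd_smul, e1, ← h, barDiff_mul, barDiff_ins,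
    barDiff_insF E U y (ih := fun r => barDiff_ins U r), shift_ins]
  simp only [chn_add, smul_add, add_mul, mul_add, smul_mul_assoc, mul_smul_comm, chn_zsmul,
    ← chnL_apply, ← Ops.map_cd, Ops.cd_mul, Ops.mul_cd]
  simp only [chnL_apply, insG, Ops.cd_smul, chn_zsmul, mul_one, sg_add, smul_add, chn_add]
  rcases (by decide : ∀ p : ZMod 2, sg p = 1 ∨ sg p = -1) ((sops D).par P * (lops D).par y) with
    h₁ | h₁ <;>
  rcases (by decide : ∀ p : ZMod 2, sg p = 1 ∨ sg p = -1) ((sops D).par P) with h₂ | h₂ <;>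
  rcases (by decide : ∀ p : ZMod 2, sg p = 1 ∨ sg p = -1) ((lops D).par x) with h₃ | h₃ <;>
  rcases (by decide : ∀ p : ZMod 2, sg p = 1 ∨ sg p = -1) ((lops D).par y) with h₄ | h₄ <;>
  rw [h₁, h₂, h₃, h₄] <;> module

/-- The sum over the cuts of the string of cochains gives the differential of strings, except for
the merging of the last with the first cochain: these are separated in the third part. -/
theorem spl_dRot (E : Parallel D) (V : List (Parallel D)) (a : Letter 𝒜) (l : List (Letter 𝒜)) :
    spl (fun U P => sg ((1 + (sops D).par U) * (sops D).par P) • dRot E U P a l) V =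
      sg (a.deg + (lops D).par l) • (dS (act₃ a l) E V -
        lst (fun V' E' => sg ((sops D).par V) • act₃ a l (E'.mul E) V') V) := by
  have h1 := (sops D).cd_spl (fun U P => sg ((1 + (sops D).par U) * (sops D).par P) •
    rotIns E U P a l) V
  have h2 : ∀ U P : List (Parallel D), (sops D).cd (fun U => sg ((1 + (sops D).par U) *
      (sops D).par P) • rotIns E U P a l) U = sg ((sops D).par U * (sops D).par P) •
      (sops D).cd (fun U => rotIns E U P a l) U := fun U P => by
    rw [(sops_odd D).cd_sg (fun q => sg ((1 + q) * (sops D).par P))]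
    congr 2
    generalize (sops D).par U = x, (sops D).par P = y
    revert x y
    decide
  have h3 : ∀ U P : List (Parallel D), (sops D).cd (fun P => sg ((1 + (sops D).par U) *
      (sops D).par P) • rotIns E U P a l) P = sg ((1 + (sops D).par U) * ((sops D).par P + 1)) •
      (sops D).cd (fun P => rotIns E U P a l) P := fun U P =>
    (sops_odd D).cd_sg (fun q => sg ((1 + (sops D).par U) * q)) _ _
  simp only [h2, h3] at h1
  rw [dS, add_sub_cancel_right]
  have h0 : (sops D).cd (act₃ a l E) V = sg (a.deg + (lops D).par l) • _ :=
    (sops D).cd_smul _ (spl fun U P => sg ((1 + (sops D).par U) * (sops D).par P) •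
      rotIns E U P a l) V
  rw [h0]
  simp only [act₃_eq, hd_smul, ← smul_sub, smul_smul, sg_mul_self, one_smul]
  rw [h1, hd_spl, ← spl_sub]
  refine spl_congr fun U P _ => ?_
  have h4 : hd (fun E₁ U₁ => sg ((1 + (sops D).par U₁) * (sops D).par P) •
      rotIns (E.mul E₁) U₁ P a l) U = sg ((sops D).par U * (sops D).par P) •
        hd (fun E₁ U₁ => rotIns (E.mul E₁) U₁ P a l) U := by
    rw [← hd_smul]
    refine hd_congr fun E₁ U₁ h => ?_
    rw [← h, Ops.par_cons]
    rfl
  rw [h4, dRot]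
  simp only [add_mul, one_mul, mul_add, mul_one, sg_add]
  generalize (sops D).par U = x, (sops D).par P = y
  rcases (by decide : ∀ p : ZMod 2, sg p = 1 ∨ sg p = -1) (x * y) with hx | hx <;>
  rcases (by decide : ∀ p : ZMod 2, sg p = 1 ∨ sg p = -1) x with h | h <;>
  rcases (by decide : ∀ p : ZMod 2, sg p = 1 ∨ sg p = -1) y with h' | h' <;>
  rw [hx, h, h', sg_one] <;> module

/-- Two ways to sum over the cuts of a list into four parts. -/
theorem spl_spl_spl {X M : Type*} [AddCommGroup M]
    (F : List X → List X → List X → List X → M) (l : List X) :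
    spl (fun p z => spl (fun u y => spl (fun q t => F u q t z) y) p) l =
      spl (fun p z => spl (fun u y => spl (fun v w => F u y v w) z) p) l := by
  simp only [spl_assoc, spl_exchange (fun u y v w => F u y v w)]

/-- Connes' differential of the first two parts of the action gives the terms at the junction in
the bar differential of the third part, and the merging of the last with the first cochain that is
missing in `spl_dRot`. -/
theorem BDiff_act₁_add_act₂ (E : Parallel D) (V : List (Parallel D)) (a : Letter 𝒜)
    (l : List (Letter 𝒜)) : BDiff 𝒜 (act₁ a l E V + act₂ a l E V) =
      sg (a.deg + (lops D).par l) •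
        (spl (fun U P => sg ((1 + (sops D).par U) * (sops D).par P) • rotJunction E U P a l) V +
        lst (fun V' E' => sg ((sops D).par V) • act₃ a l (E'.mul E) V') V) := by
  have pa : (lops D).p a = a.deg + 1 := rfl
  have hp : ∀ E : Parallel D, (sops D).p E = 1 := fun _ => rfl
  -- the first term of `rotJunction`
  have h1 : BDiff 𝒜 (act₁ a l E V) = sg (a.deg + (lops D).par l) •
      spl (fun U P => sg ((1 + (sops D).par U) * (sops D).par P) • spl (fun p z =>
        sg (((lops D).p a + (lops D).par p) * ((lops D).par z + (sops D).par P) +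
    (lops D).par z + (sops D).par P + (lops D).p a + 1 + (lops D).par p) •
      chn 1 (ins P z * insG a.val E U p)) l) V := by
    rw [act₁_eq_pre, BDiff_pre a.mem, ← spl_smul]
    refine spl_congr fun U P _ => ?_
    rw [← spl_smul, ← spl_smul]
    refine spl_congr fun p z h => ?_
    simp only [← h, Ops.par_append, pa, smul_smul, ← sg_add]
    congr 2
    generalize a.deg = s, (sops D).par U = x, (sops D).par P = y, (lops D).par z = z,
      (lops D).par p = t
    revert s x y z t
    decide
  -- the second term of `rotJunction`, which cancels
  have h2 : lst (fun V' E' => sg ((sops D).par V) • act₃ a l (E'.mul E) V') V =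
      -spl (fun U P => sg ((1 + (sops D).par U) * (sops D).par P) •
        lst (fun P' E' => sg ((lops D).p a + (lops D).par l + (sops D).par P') •
          rotIns (E'.mul E) U P' a l) P) V := by
    rw [← spl_neg]
    simp only [act₃_eq, ← lst_smul, ← lst_neg, ← spl_smul]
    rw [lst_spl]
    refine spl_congr fun U P h => lst_congr fun P' E' h' => ?_
    rw [← h, ← h', pa]
    simp only [Ops.par_append, Ops.par_cons, Ops.par_nil, hp, smul_smul, ← sg_add, ← neg_smul,
      ← sg_add_one]
    congr 2
    generalize a.deg = s, (lops D).par l = t, (sops D).par U = x, (sops D).par P' = y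
    revert s t x y
    decide
  -- the third term of `rotJunction`
  have h3 : BDiff 𝒜 (act₂ a l E V) = sg (a.deg + (lops D).par l) •
      spl (fun U P => sg ((1 + (sops D).par U) * (sops D).par P) •
      lst (fun P' E' => spl (fun p z => sg (((lops D).p a + (lops D).par p) * (lops D).par z) •
    spl (fun u y => spl (fun v w => sg ((sops D).par P * (lops D).par y +
      (sops D).par P * (lops D).par (w ++ a :: u) + (lops D).par v + (sops D).par P' +
      (lops D).par (w ++ a :: u) + (lops D).par y) •
        chn 1 (ins P' v * insG (E'.ev (w ++ a :: u)) E U y)) z) p) l) P) V := by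
    have e1 : act₂ a l E V = lst (fun V' E' => sg (a.deg + (lops D).par l + (sops D).par V) •
        preRot E' E V' a l) V := rfl
    rw [e1, map_lst]
    simp only [← spl_smul, ← lst_smul]
    rw [spl_congr (G := fun U P => lst (fun P' E' => spl (fun p z => spl (fun u y => spl
      (fun v w => sg (a.deg + (lops D).par l) • sg ((1 + (sops D).par U) * ((sops D).par P' + 1)) •
        sg (((lops D).p a + (lops D).par p) * (lops D).par z) •
        sg (((sops D).par P' + 1) * (lops D).par y +
          ((sops D).par P' + 1) * (lops D).par (w ++ a :: u) + (lops D).par v + (sops D).par P' +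
          (lops D).par (w ++ a :: u) + (lops D).par y) •
        chn 1 (ins P' v * insG (E'.ev (w ++ a :: u)) E U y)) z) p) l) P) (fun U P _ =>
          lst_congr fun P' E' h => by rw [← h, Ops.par_append, Ops.par_cons, Ops.par_nil, hp,
            add_zero]), ← lst_spl]
    refine lst_congr fun V' E' hV => ?_
    have e2 : BDiff 𝒜 (preRot E' E V' a l) = spl (fun U P => spl (fun p z => spl (fun u y =>
        spl (fun q t => sg (((lops D).p a + (lops D).par p) * (lops D).par z) •
          sg (((lops D).par (z ++ a :: u) + 1 + (lops D).par q) *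
        ((lops D).par t + (sops D).par P) + (sops D).par U * (sops D).par P) •
        chn 1 (ins P t * insG (E'.ev (z ++ a :: u)) E U q)) y) p) l) V' := by
      rw [preRot, map_rot, rot]
      simp only [BDiff_pre (E'.ev_mem _), ← spl_smul]
      rw [spl_exchange]
      refine spl_congr fun p z _ => ?_
      rw [spl_exchange]
    rw [map_zsmul, e2, ← spl_smul]
    refine spl_congr fun U P h => ?_
    simp only [← spl_smul]
    rw [spl_congr (G := fun p z => spl (fun u y => spl (fun q t =>
        sg (a.deg + (lops D).par l + (sops D).par V) •
        sg (((lops D).p a + (lops D).par (u ++ (q ++ t))) * (lops D).par z) •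
          sg (((lops D).par (z ++ a :: u) + 1 + (lops D).par q) *
        ((lops D).par t + (sops D).par P) + (sops D).par U * (sops D).par P) •
        chn 1 (ins P t * insG (E'.ev (z ++ a :: u)) E U q)) y) p) fun p z _ =>
          spl_congr fun u y h => spl_congr fun q t h' => by rw [h', h],
      spl_spl_spl]
    refine spl_congr fun p z h1 => spl_congr fun u y h2 => spl_congr fun v w h3 => ?_
    simp only [← h1, ← h2, ← h3, ← hV, ← h, smul_smul, ← sg_add, Ops.par_append, Ops.par_cons,
      Ops.par_nil, pa, hp]
    congr 2
    generalize a.deg = s, (sops D).par U = x, (sops D).par P = y, (lops D).par u = z,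
      (lops D).par y = t, (lops D).par v = r, (lops D).par w = w
    revert s x y z t r w
    decide
  rw [map_add, h1, h3, h2, ← smul_add]
  congr 1
  rw [← sub_eq_add_neg, eq_sub_iff_add_eq, ← spl_add, ← spl_add]
  refine spl_congr fun U P _ => ?_
  rw [rotJunction, smul_add, smul_add, add_right_comm]

end

section

variable {k : Type*} [CommRing k] [Algebra ℚ k] {A : Type*} [Ring A] [Algebra k A]
variable {𝒜 : ZMod 2 → Submodule k A} [GradedAlgebra 𝒜] {D : 𝒜 1}

/-! ### The Hochschild differential of the third part: multiplication at the marked letter -/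

theorem frontMul_ins (P : List (Parallel D)) (Y : TensorAlgebra k A) (z u : List (Letter 𝒜))
    (a : Letter 𝒜) : frontMul 𝒜 1 (uncons (ins P (z ++ a :: u) * Y)) =
      hd (fun c x' => chn c.val (ins P x' * Y)) (z ++ a :: u) +
      hd (fun E' P' => sg ((lops D).par (z ++ a :: u)) •
        spl (fun v r => chn (E'.ev v) (ins P' r * Y)) (z ++ a :: u)) P := by
  have h1 : (1 : A) ∈ 𝒜 0 := SetLike.GradedOne.one_mem
  have h0 : (TensorAlgebra.algebraMapInv (ins P (z ++ a :: u)) : k) = 0 := by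
    rw [counit_ins]; cases z <;> rfl
  have h2 : ∀ (c : A) (X : TensorAlgebra k A), frontMul 𝒜 1 (c ⊗ₜ[k] X) = chn c X := fun c X => by
    rw [frontMul_tmul h1, sg_zero, one_smul, one_mul]
  rw [uncons_mul, h0, zero_smul, zero_add, uncons_ins, ← LinearMap.comp_apply]
  simp only [map_add, map_hd, map_zsmul, map_spl, LinearMap.comp_apply, LinearMap.lTensor_tmul,
    LinearMap.mulRight_apply, h2]

theorem shift_insF (E : Parallel D) (V : List (Parallel D)) (l : List (Letter 𝒜)) :
    mapWord (shift 𝒜) (insF (E :: V) l) =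
      sg ((lops D).par l + (sops D).par (E :: V)) • insF (E :: V) l := by
  rw [insF_cons, map_zsmul, map_spl, smul_comm]
  refine congrArg _ ?_
  rw [← spl_smul]
  refine spl_congr fun v r h => ?_
  rw [mapWord_ι_mul, shift_of_mem (E.ev_mem v), shift_ins, map_zsmul, smul_mul_smul_comm, ← sg_add,
    ← h, Ops.par_append, Ops.par_cons, show (sops D).p E = 1 from rfl]
  congr 2
  ring

/-- The multiplication of the last letter of a word of the third part of the action with the
letter `1` in front: the last letter is a letter of the list, the value of `E`, or the value of
the last cochain after `E`. -/
theorem backMul_ins (E : Parallel D) (U P : List (Parallel D)) (x y : List (Letter 𝒜)) :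
    backMul 𝒜 1 (unsnoc (ins P x * insF (E :: U) y)) =
      lst (fun y' c => sg ((lops D).p c * ((lops D).par x + (sops D).par P + (lops D).par y') + 1) •
        chn c.val (ins P x * insF (E :: U) y')) y +
      nl (sg ((1 + (lops D).par x + (sops D).par P) * ((lops D).par y + 1)) •
        chn (E.ev y) (ins P x)) U +
      lst (fun U' E'' => spl (fun v w => sg (((lops D).par x + (sops D).par P + (lops D).par v) *
        ((lops D).par w + 1) + (sops D).par U' + (lops D).par w) •
          chn (E''.ev w) (ins P x * insF (E :: U') v)) y) U := by
  have h1 : (1 : A) ∈ 𝒜 0 := SetLike.GradedOne.one_mem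
  have hs : ∀ (U : List (Parallel D)) (y : List (Letter 𝒜)),
      mapWord (shift 𝒜) (ins P x * insF (E :: U) y) = sg ((lops D).par x + (sops D).par P +
        ((lops D).par y + (sops D).par (E :: U))) • (ins P x * insF (E :: U) y) := fun U y => by
    rw [mapWord_mul, shift_ins, shift_insF, smul_mul_smul_comm, ← sg_add]
  have hp : ∀ E : Parallel D, (sops D).p E = 1 := fun _ => rfl
  rw [unsnoc_mul, counit_insF, zero_smul, zero_add, unsnoc_insF, ← LinearMap.comp_apply, map_add,
    map_add, map_lst, map_nl, map_lst]
  refine congrArg₂ (· + ·) (congrArg₂ (· + ·) ?_ ?_) ?_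
  · refine lst_congr fun y' c _ => ?_
    rw [map_zsmul, LinearMap.comp_apply, LinearMap.rTensor_tmul, LinearMap.mulLeft_apply,
      backMul_tmul h1 c.mem (hs _ _), mul_one, smul_smul, ← sg_add, Ops.par_cons, hp,
      show (lops D).p c = c.deg + 1 from rfl]
    congr 2
    generalize c.deg = s, (lops D).par x = x, (lops D).par y' = y, (sops D).par P = z,
      (sops D).par U = t
    revert s x y z t
    decide
  · rw [map_zsmul, LinearMap.comp_apply, LinearMap.rTensor_tmul, LinearMap.mulLeft_apply, mul_one,
      backMul_tmul h1 (E.ev_mem y) (shift_ins _ _), mul_one, smul_smul, ← sg_add]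
    congr 3
    generalize (lops D).par x = x, (lops D).par y = y, (sops D).par P = z
    revert x y z
    decide
  · refine lst_congr fun U' E'' h => ?_
    rw [map_spl]
    refine spl_congr fun v w _ => ?_
    rw [map_zsmul, LinearMap.comp_apply, LinearMap.rTensor_tmul, LinearMap.mulLeft_apply,
      backMul_tmul h1 (E''.ev_mem w) (hs _ _), mul_one, smul_smul, ← sg_add, ← h, Ops.par_cons,
      Ops.par_cons, Ops.par_append, Ops.par_cons, hp, hp, Ops.par_nil]
    congr 2
    generalize (lops D).par x = x, (lops D).par v = y, (lops D).par w = w, (sops D).par P = z,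
      (sops D).par U' = t
    revert x y z t w
    decide

theorem chn_ins_append (P : List (Parallel D)) (E : Parallel D) (U : List (Parallel D)) (x : A)
    (l : List (Letter 𝒜)) : chn x (ins (P ++ E :: U) l) =
    spl (fun u y => sg ((sops D).par P * (lops D).par y) • chn x (ins P u * insF (E :: U) y)) l := by
  rw [ins_append, chn_spl]
  simp only [chn_zsmul]

theorem oneP_ev (l : List (Letter 𝒜)) : (oneP D).ev l = nl 1 l := by
  cases l <;> simp [Parallel.ev, oneP, zeroCochain, bar, TensorAlgebra.algebraMapInv]

theorem pre_oneP (l : List (Letter 𝒜)) (V : List (Parallel D)) (x : A) :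
    pre l (oneP D) V x = chn x (ins V l) := by
  rw [pre, ← spl_nl_left (fun v => chn x (ins V v)) l]
  refine spl_congr fun u v _ => ?_
  rw [oneP_ev]
  cases u <;> simp [chn]

/-- The terms in which the first letter of the rotated word stands before the marked letter and is
multiplied with the letter `1` in front. -/
def rotLetter (E : Parallel D) (U P : List (Parallel D)) (a : Letter 𝒜) (l : List (Letter 𝒜)) :
    Chains k A :=
  spl (fun p z => sg (((lops D).p a + (lops D).par p) * (lops D).par z) • spl (fun u y =>
    hd (fun c z' => sg ((sops D).par P * (lops D).par y) •
      chn c.val (ins P (z' ++ a :: u) * insF (E :: U) y)) z) p) l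

/-- The terms in which the value of the first cochain of `P` at letters before the marked letter is
multiplied with the letter `1` in front. -/
def rotValue (E : Parallel D) (U : List (Parallel D)) (E' : Parallel D) (P : List (Parallel D))
    (a : Letter 𝒜) (l : List (Letter 𝒜)) : Chains k A :=
  spl (fun p z => spl (fun u y => spl (fun v r =>
    sg (((lops D).p a + (lops D).par p) * (lops D).par z +
      ((sops D).par P + 1) * (lops D).par y + (lops D).par (z ++ a :: u)) •
      chn (E'.ev v) (ins P (r ++ a :: u) * insF (E :: U) y)) z) p) l

/-- The letter `1` in front times the first letter of the rotated word, which is the marked letter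
`a`, a letter before `a`, or a value of the first cochain; in the last case its arguments stand
before `a` or contain `a`. -/
theorem rot_frontMul (E : Parallel D) (U P : List (Parallel D)) (a : Letter 𝒜)
    (l : List (Letter 𝒜)) :
    rot D (fun x y => sg ((sops D).par P * (lops D).par y) •
      frontMul 𝒜 1 (uncons (ins P x * insF (E :: U) y))) a l =
      chn a.val (ins (P ++ E :: U) l) + rotLetter E U P a l +
      hd (fun E' P' => rotValue E U E' P' a l + sg ((lops D).p a + (lops D).par l) •
        preRot E' (oneP D) (P' ++ E :: U) a l) P := by
  have h : ∀ z p : List (Letter 𝒜), spl (fun u y => sg ((sops D).par P * (lops D).par y) •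
      frontMul 𝒜 1 (uncons (ins P (z ++ a :: u) * insF (E :: U) y))) p =
      nl (chn a.val (ins (P ++ E :: U) p)) z + spl (fun u y => hd (fun c z' =>
        sg ((sops D).par P * (lops D).par y) •
          chn c.val (ins P (z' ++ a :: u) * insF (E :: U) y)) z) p +
      hd (fun E' P' => spl (fun u y => spl (fun v r =>
        sg (((sops D).par P' + 1) * (lops D).par y + (lops D).par (z ++ a :: u)) •
          chn (E'.ev v) (ins P' (r ++ a :: u) * insF (E :: U) y)) z) p +
        sg ((lops D).p a + (lops D).par p + (lops D).par z) • spl (fun v q =>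
          chn (E'.ev (z ++ a :: v)) (ins (P' ++ E :: U) q)) p) P := by
    intro z p
    have e0 : nl (chn a.val (ins (P ++ E :: U) p)) z = spl (fun u y => nl (sg ((sops D).par P *
        (lops D).par y) • chn a.val (ins P u * insF (E :: U) y)) z) p := by
      rw [chn_ins_append]
      cases z <;> simp [spl_zero]
    have e1 : hd (fun E' P' => sg ((lops D).p a + (lops D).par p + (lops D).par z) •
        spl (fun v q => chn (E'.ev (z ++ a :: v)) (ins (P' ++ E :: U) q)) p) P =
        spl (fun u y => sg ((sops D).par P * (lops D).par y) • hd (fun E' P' =>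
          sg ((lops D).par (z ++ a :: u)) • spl (fun v r => chn (E'.ev (z ++ a :: v))
            (ins P' r * insF (E :: U) y)) u) P) p := by
      cases P with
      | nil => simp [spl_zero]
      | cons E' P' =>
        simp only [hd_cons, chn_ins_append]
        rw [spl_assoc (fun v r y => sg ((sops D).par P' * (lops D).par y) •
          chn (E'.ev (z ++ a :: v)) (ins P' r * insF (E :: U) y)) p, ← spl_smul]
        refine spl_congr fun u y h => ?_
        rw [spl_smul, smul_smul, smul_smul, ← sg_add, ← sg_add, ← h, Ops.par_cons,
          show (sops D).p E' = 1 from rfl]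
        simp only [Ops.par_append, Ops.par_cons]
        congr 2
        generalize (lops D).par u = x, (lops D).par y = y, (lops D).par z = z, (lops D).p a = s,
          (sops D).par P' = t
        revert s x y z t
        decide
    rw [hd_add, e1, e0, ← spl_add]
    have e2 : hd (fun E' P' => spl (fun u y => spl (fun v r =>
        sg (((sops D).par P' + 1) * (lops D).par y + (lops D).par (z ++ a :: u)) •
          chn (E'.ev v) (ins P' (r ++ a :: u) * insF (E :: U) y)) z) p) P =
        spl (fun u y => sg ((sops D).par P * (lops D).par y) • hd (fun E' P' =>
          sg ((lops D).par (z ++ a :: u)) • spl (fun v r => chn (E'.ev v)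
            (ins P' (r ++ a :: u) * insF (E :: U) y)) z) P) p := by
      cases P with
      | nil => simp [spl_zero]
      | cons E' P' =>
        simp only [hd_cons]
        refine spl_congr fun u y h => ?_
        rw [spl_smul, smul_smul, ← sg_add, Ops.par_cons, show (sops D).p E' = 1 from rfl,
          add_comm 1]
    rw [e2, ← spl_add, ← spl_add]
    refine spl_congr fun u y _ => ?_
    rw [frontMul_ins, hd_append, hd_cons]
    simp only [spl_append, smul_add, hd_add, hd_smul, nl_smul, add_assoc]
  rw [rot]
  simp only [h, smul_add, spl_add, rotLetter]
  refine congrArg₂ (· + ·) (congrArg₂ (· + ·) ?_ rfl) ?_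
  · rw [← spl_nl_right (fun p => chn a.val (ins (P ++ E :: U) p)) l]
    refine spl_congr fun p z _ => ?_
    cases z <;> simp
  · cases P with
    | nil => simp [spl_zero]
    | cons E' P' =>
      simp only [hd_cons, smul_add, spl_add]
      refine congrArg₂ (· + ·) ?_ ?_
      · rw [rotValue]
        simp only [← spl_smul, smul_smul, ← sg_add, add_assoc]
      · rw [preRot, rot, ← spl_smul]
        refine spl_congr fun p z h => ?_
        simp only [pre_oneP]
        rw [smul_comm, ← h, Ops.par_append, ← add_assoc]

/-- The last letter of the rotated word times the letter `1` in front. A letter that is moved from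
the end to the front gives a term of `rot_frontMul` with the opposite sign. -/
theorem rot_backMul (E : Parallel D) (U P : List (Parallel D)) (a : Letter 𝒜)
    (l : List (Letter 𝒜)) :
    rot D (fun x y => sg ((sops D).par P * (lops D).par y) •
      backMul 𝒜 1 (unsnoc (ins P x * insF (E :: U) y))) a l =
      -rotLetter E U P a l +
      nl (rot D (fun x y => sg ((sops D).par P * (lops D).par y) •
        sg ((1 + (lops D).par x + (sops D).par P) * ((lops D).par y + 1)) •
          chn (E.ev y) (ins P x)) a l) U +
      lst (fun U' E' => sg ((sops D).par U' + (sops D).par P) • rotValue E U' E' P a l) U := by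
  have pa : (lops D).p a = a.deg + 1 := rfl
  simp only [backMul_ins, smul_add, rot_add]
  refine congrArg₂ (· + ·) (congrArg₂ (· + ·) ?_ ?_) ?_
  · rw [rot, rotLetter, ← spl_neg]
    have e1 : ∀ p z : List (Letter 𝒜), sg (((lops D).p a + (lops D).par p) * (lops D).par z) •
        spl (fun u y => sg ((sops D).par P * (lops D).par y) • lst (fun y' c => sg ((lops D).p c *
          ((lops D).par (z ++ a :: u) + (sops D).par P + (lops D).par y') + 1) •
          chn c.val (ins P (z ++ a :: u) * insF (E :: U) y')) y) p =
        lst (fun p' c => spl (fun u y' => -sg (((lops D).p a + (lops D).par (u ++ y')) *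
          ((lops D).p c + (lops D).par z) + (sops D).par P * (lops D).par y') •
          chn c.val (ins P (z ++ a :: u) * insF (E :: U) y')) p') p := by
      intro p z
      rw [lst_spl, ← spl_smul]
      refine spl_congr fun u y h => ?_
      rw [← lst_smul, ← lst_smul]
      refine lst_congr fun y' c h' => ?_
      rw [← sg_add_one, smul_smul, smul_smul, ← sg_add, ← sg_add, ← h, ← h']
      simp only [Ops.par_append, Ops.par_cons, Ops.par_nil]
      congr 2
      generalize (lops D).p a = s, (lops D).p c = r, (lops D).par u = x, (lops D).par y' = y,
        (lops D).par z = z, (sops D).par P = t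
      revert s r x y z t
      decide
    -- the last letter `c` of one rotation is the first letter of the next one
    simp only [e1]
    rw [spl_lst_eq_spl_hd]
    refine spl_congr fun p z _ => ?_
    cases z with
    | nil => simp [spl_zero]
    | cons c z =>
      rw [hd_cons, ← spl_smul, ← spl_neg]
      refine spl_congr fun u y h => ?_
      rw [hd_cons, smul_smul, ← sg_add, neg_smul, Ops.par_cons, h]
  · cases U <;> simp [rot, spl_zero]
  · simp only [← lst_smul, rot_lst]
    refine lst_congr fun U' E' _ => ?_
    rw [rot, rotValue]
    simp only [← spl_smul]
    rw [spl_congr (G := fun p z => spl (fun u y => spl (fun q t =>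
        sg (((lops D).p a + (lops D).par (u ++ (q ++ t))) * (lops D).par z) •
        sg ((sops D).par P * (lops D).par (q ++ t)) •
        sg (((lops D).par (z ++ a :: u) + (sops D).par P + (lops D).par q) * ((lops D).par t + 1) +
          (sops D).par U' + (lops D).par t) •
        chn (E'.ev t) (ins P (z ++ a :: u) * insF (E :: U') q)) y) p) fun p z _ =>
          spl_congr fun u y h => spl_congr fun q t h' => by rw [h', h],
      spl_spl_spl (fun u q t z => sg (((lops D).p a + (lops D).par (u ++ (q ++ t))) * (lops D).par z) •
        sg ((sops D).par P * (lops D).par (q ++ t)) •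
        sg (((lops D).par (z ++ a :: u) + (sops D).par P + (lops D).par q) * ((lops D).par t + 1) +
          (sops D).par U' + (lops D).par t) •
        chn (E'.ev t) (ins P (z ++ a :: u) * insF (E :: U') q))]
    refine spl_congr fun p z h1 => spl_congr fun u y h2 => spl_congr fun v w h3 => ?_
    simp only [← h1, ← h2, ← h3, smul_smul, ← sg_add, Ops.par_append, Ops.par_cons]
    congr 2
    generalize (lops D).p a = s, (lops D).par u = x, (lops D).par y = y, (lops D).par v = z,
      (lops D).par w = w, (sops D).par P = t, (sops D).par U' = r
    revert s x y z w t r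
    decide

end

section

variable {k : Type*} [CommRing k] [Algebra ℚ k] {A : Type*} [Ring A] [Algebra k A]
variable {𝒜 : ZMod 2 → Submodule k A} [GradedAlgebra 𝒜] {D : 𝒜 1}

/-- The unit as a homogeneous element. -/
def oneL (𝒜 : ZMod 2 → Submodule k A) [GradedAlgebra 𝒜] : Letter 𝒜 :=
  ⟨1, 0, SetLike.GradedOne.one_mem⟩

theorem act₁_oneL (w : List (Letter 𝒜)) (E : Parallel D) (V : List (Parallel D)) :
    act₁ (oneL 𝒜) w E V = spl (fun u v => chn (E.ev u) (ins V v)) w := by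
  simp only [act₁, oneL, one_mul]

/-- The action on Connes' differential of a chain, according to whether the marked letter is an
argument of the first cochain. -/
theorem rot_act₁_oneL (E : Parallel D) (V : List (Parallel D)) (a : Letter 𝒜)
    (l : List (Letter 𝒜)) :
    spl (fun p z => sg (((lops D).p a + (lops D).par p) * (lops D).par z) •
      act₁ (oneL 𝒜) (z ++ a :: p) E V) l =
      sg (a.deg + (lops D).par l) • sg ((sops D).par V) •
        rot D (fun x y => sg ((sops D).par V * (lops D).par y) • sg ((1 + (lops D).par x +
          (sops D).par V) * ((lops D).par y + 1)) • chn (E.ev y) (ins V x)) a l +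
      preRot E (oneP D) V a l := by
  have h1 : sg (a.deg + (lops D).par l) • sg ((sops D).par V) •
      rot D (fun x y => sg ((sops D).par V * (lops D).par y) • sg ((1 + (lops D).par x +
          (sops D).par V) * ((lops D).par y + 1)) • chn (E.ev y) (ins V x)) a l =
      spl (fun p z => sg (((lops D).p a + (lops D).par p) * (lops D).par z) • spl (fun u v =>
        chn (E.ev u) (ins V (v ++ a :: p))) z) l := by
    have e := spl_assoc (fun u y z => sg (((lops D).p a + (lops D).par u) * ((lops D).par y +
      (lops D).par z)) • chn (E.ev y) (ins V (z ++ a :: u))) l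
    rw [smul_smul, ← rot_zsmul, rot]
    have e1 : ∀ p z : List (Letter 𝒜), p ++ z = l →
        sg (((lops D).p a + (lops D).par p) * (lops D).par z) •
        spl (fun u y => (sg (a.deg + (lops D).par l) * sg ((sops D).par V)) •
          sg ((sops D).par V * (lops D).par y) • sg ((1 + (lops D).par (z ++ a :: u) +
          (sops D).par V) * ((lops D).par y + 1)) • chn (E.ev y) (ins V (z ++ a :: u))) p =
        spl (fun u y => sg (((lops D).p a + (lops D).par u) * ((lops D).par y +
          (lops D).par z)) • chn (E.ev y) (ins V (z ++ a :: u))) p := by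
      intro p z h
      rw [← spl_smul]
      refine spl_congr fun u y h' => ?_
      simp only [smul_smul, ← sg_add, ← h, ← h', Ops.par_append, Ops.par_cons,
        show (lops D).p a = a.deg + 1 from rfl]
      congr 2
      generalize a.deg = s, (lops D).par u = x, (lops D).par y = y, (lops D).par z = z,
        (sops D).par V = t
      revert s x y z t
      decide
    rw [spl_congr e1, ← e]
    refine spl_congr fun p z _ => ?_
    rw [← spl_smul]
    refine spl_congr fun u v h => ?_
    rw [← h, Ops.par_append]
  have h2 : preRot E (oneP D) V a l = spl (fun p z => sg (((lops D).p a + (lops D).par p) *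
      (lops D).par z) • spl (fun u v => chn (E.ev (z ++ a :: u)) (ins V v)) p) l := by
    simp only [preRot, rot, pre_oneP]
  rw [h1, h2, ← spl_add]
  refine spl_congr fun p z _ => ?_
  rw [act₁_oneL, spl_append, smul_add]

/-- The second part of the action of a string, according to whether its last cochain is `E`. -/
theorem act₂_append (a : Letter 𝒜) (l : List (Letter 𝒜)) (E₀ E : Parallel D)
    (P U : List (Parallel D)) : act₂ a l E₀ (P ++ E :: U) =
      nl (sg (a.deg + (lops D).par l + ((sops D).par P + 1)) • preRot E E₀ P a l) U +
      lst (fun U' E' => sg (a.deg + (lops D).par l + ((sops D).par P + (sops D).par U')) •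
        preRot E' E₀ (P ++ E :: U') a l) U := by
  have hp : ∀ E : Parallel D, (sops D).p E = 1 := fun _ => rfl
  rw [act₂, lst_append, nl_cons, zero_add, lst_cons, List.append_nil]
  refine congrArg₂ (· + ·) ?_ ?_
  · cases U with
    | nil =>
      rw [nl_nil, nl_nil, Ops.par_append, Ops.par_cons, Ops.par_nil, hp]
      rfl
    | cons _ _ => rfl
  · refine lst_congr fun U' E' h => ?_
    rw [← h]
    simp only [Ops.par_append, Ops.par_cons, Ops.par_nil, hp]
    refine congrArg₂ (· • ·) ?_ rfl
    congr 1
    generalize (sops D).par P = x, (sops D).par U' = y, a.deg + (lops D).par l = z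
    revert x y z
    decide

/-- The multiplications with the letter `1` in front in the third part of the action. A value that
is moved from the end to the front by a rotation of the string contributes with opposite signs.
The remaining terms give the action on Connes' differential of the chain and the action of Connes'
differential of the string. -/
theorem spl_rot_front_back (E : Parallel D) (V : List (Parallel D)) (a : Letter 𝒜)
    (l : List (Letter 𝒜)) :
    sg (a.deg + (lops D).par l) • spl (fun U P => sg ((1 + (sops D).par U) * (sops D).par P) •
      rot D (fun x y => sg ((sops D).par P * (lops D).par y) •
      (frontMul 𝒜 1 (uncons (ins P x * insF (E :: U) y)) +
        backMul 𝒜 1 (unsnoc (ins P x * insF (E :: U) y)))) a l) V =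
      spl (fun p z => sg (((lops D).p a + (lops D).par p) * (lops D).par z) •
        act₁ (oneL 𝒜) (z ++ a :: p) E V) l +
      sg (a.deg + (lops D).par l) • spl (fun U P => sg ((1 + (sops D).par U) * (sops D).par P) •
        (act₁ a l (oneP D) (P ++ E :: U) + act₂ a l (oneP D) (P ++ E :: U))) V := by
  have hp : ∀ E : Parallel D, (sops D).p E = 1 := fun _ => rfl
  have pa : (lops D).p a = a.deg + 1 := rfl
  have hn : ∀ (X : List (Parallel D) → Chains k A), spl (fun U P => sg ((1 + (sops D).par U) *
      (sops D).par P) • nl (X P) U) V = sg ((sops D).par V) • X V := fun X => by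
    rw [← spl_nl_left (fun P => sg ((sops D).par P) • X P) V]
    refine spl_congr fun U P _ => ?_
    cases U <;> simp
  have h1 : ∀ U P : List (Parallel D), rot D (fun x y => sg ((sops D).par P * (lops D).par y) •
      (frontMul 𝒜 1 (uncons (ins P x * insF (E :: U) y)) +
        backMul 𝒜 1 (unsnoc (ins P x * insF (E :: U) y)))) a l =
      act₁ a l (oneP D) (P ++ E :: U) +
      hd (fun E' P' => rotValue E U E' P' a l) P +
      hd (fun E' P' => sg ((lops D).p a + (lops D).par l) •
        preRot E' (oneP D) (P' ++ E :: U) a l) P +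
      nl (rot D (fun x y => sg ((sops D).par P * (lops D).par y) •
        sg ((1 + (lops D).par x + (sops D).par P) * ((lops D).par y + 1)) •
          chn (E.ev y) (ins P x)) a l) U +
      lst (fun U' E' => sg ((sops D).par U' + (sops D).par P) • rotValue E U' E' P a l) U := by
    intro U P
    simp only [smul_add, rot_add]
    rw [rot_frontMul, rot_backMul, hd_add, act₁_eq_pre, pre_oneP]
    abel
  -- the value of the last cochain at the end of a word is that of the first cochain in front of
  -- the next word
  have h2 : spl (fun U P => sg ((1 + (sops D).par U) * (sops D).par P) •
      lst (fun U' E' => sg ((sops D).par U' + (sops D).par P) • rotValue E U' E' P a l) U) V =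
      -spl (fun U P => sg ((1 + (sops D).par U) * (sops D).par P) •
        hd (fun E' P' => rotValue E U E' P' a l) P) V := by
    rw [spl_congr (G := fun U P => lst (fun U' E' => sg ((sops D).par U' * (sops D).par P +
      (sops D).par U' + (sops D).par P) • rotValue E U' E' P a l) U), spl_lst_eq_spl_hd, ← spl_neg]
    · refine spl_congr fun U P _ => ?_
      rw [← neg_smul, ← sg_add_one, ← hd_smul]
      refine hd_congr fun E' P' h => ?_
      rw [← h, Ops.par_cons, hp]
      congr 2
      generalize (sops D).par U = x, (sops D).par P' = y
      revert x y
      decide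
    · intro U P _
      rw [← lst_smul]
      refine lst_congr fun U' E' h => ?_
      rw [← h, smul_smul, ← sg_add]
      simp only [Ops.par_append, Ops.par_cons, Ops.par_nil, hp]
      congr 2
      generalize (sops D).par U' = x, (sops D).par P = y
      revert x y
      decide
  -- the values with the marked letter among their arguments
  have h3 : spl (fun U P => sg ((1 + (sops D).par U) * (sops D).par P) •
      lst (fun U' E' => sg (a.deg + (lops D).par l + ((sops D).par P + (sops D).par U')) •
        preRot E' (oneP D) (P ++ E :: U') a l) U) V =
      spl (fun U P => sg ((1 + (sops D).par U) * (sops D).par P) •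
        hd (fun E' P' => sg ((lops D).p a + (lops D).par l) •
        preRot E' (oneP D) (P' ++ E :: U) a l) P) V := by
    rw [spl_congr (G := fun U P => lst (fun U' E' => sg ((sops D).par U' * (sops D).par P +
      (a.deg + (lops D).par l + ((sops D).par P + (sops D).par U'))) •
        preRot E' (oneP D) (P ++ E :: U') a l) U), spl_lst_eq_spl_hd]
    · refine spl_congr fun U P _ => ?_
      rw [← hd_smul]
      refine hd_congr fun E' P' h => ?_
      rw [← h, smul_smul, ← sg_add, Ops.par_cons, hp, pa]
      congr 2
      generalize (sops D).par U = x, (sops D).par P' = y, a.deg = z, (lops D).par l = t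
      revert x y z t
      decide
    · intro U P _
      rw [← lst_smul]
      refine lst_congr fun U' E' h => ?_
      rw [← h, smul_smul, ← sg_add]
      simp only [Ops.par_append, Ops.par_cons, Ops.par_nil, hp]
      congr 2
      generalize (sops D).par U' = x, (sops D).par P = y, a.deg + (lops D).par l = z
      revert x y z
      decide
  simp only [h1]
  simp only [act₂_append, smul_add, spl_add, hn]
  rw [h2, h3, rot_act₁_oneL]
  simp only [smul_neg]
  -- the values of `E` with the marked letter among its arguments occur twice and cancel
  have h4 : sg (a.deg + (lops D).par l) • sg ((sops D).par V) •
      sg (a.deg + (lops D).par l + ((sops D).par V + 1)) • preRot E (oneP D) V a l =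
      -preRot E (oneP D) V a l := by
    rw [smul_smul, smul_smul, ← sg_add, ← sg_add]
    have : a.deg + (lops D).par l + (sops D).par V + (a.deg + (lops D).par l +
        ((sops D).par V + 1)) = 1 := by
      generalize (sops D).par V = x, a.deg + (lops D).par l = z
      revert x z
      decide
    rw [this, sg_one, neg_smul, one_smul]
  rw [h4]
  abel

theorem dC_spl {Y M : Type*} [AddCommGroup M]
    (F : List Y → List Y → Letter 𝒜 → List (Letter 𝒜) → M) (V : List Y) (a : Letter 𝒜)
    (l : List (Letter 𝒜)) : dC D (fun a l => spl (fun U P => F U P a l) V) a l =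
      spl (fun U P => dC D (F U P) a l) V := by
  have h1 : hd (fun c l' => spl (fun U P => F U P ((lops D).m a c) l') V) l =
      spl (fun U P => hd (fun c l' => F U P ((lops D).m a c) l') l) V := by
    cases l <;> simp [spl_zero]
  simp only [dC, h1, spl_add, ← spl_smul, Ops.cd_spl_comm, ← spl_lst_comm]

theorem dC_zsmul {M : Type*} [AddCommGroup M] (n : ℤ) (Φ : Letter 𝒜 → List (Letter 𝒜) → M)
    (a : Letter 𝒜) (l : List (Letter 𝒜)) : dC D (fun a l => n • Φ a l) a l = n • dC D Φ a l := by
  simp only [dC, smul_add, hd_smul, Ops.cd_smul, smul_comm _ n, lst_smul]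

/-- The Hochschild differential of the third part of the action. -/
theorem bDiff_act₃ (a : Letter 𝒜) (l : List (Letter 𝒜)) (E : Parallel D) (V : List (Parallel D)) :
    bDiff 𝒜 (act₃ a l E V) + BDiff 𝒜 (act₁ a l E V + act₂ a l E V) =
      dC D (act₃ · · E V) a l + sg (a.deg + (lops D).par l) • dS (act₃ a l) E V +
      spl (fun p z => sg (((lops D).p a + (lops D).par p) * (lops D).par z) •
        act₁ (oneL 𝒜) (z ++ a :: p) E V) l +
      sg (a.deg + (lops D).par l) • spl (fun U P => sg ((1 + (sops D).par U) * (sops D).par P) •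
        (act₁ a l (oneP D) (P ++ E :: U) + act₂ a l (oneP D) (P ++ E :: U))) V := by
  have pa : (lops D).p a = a.deg + 1 := rfl
  -- the Hochschild differential multiplies with the letter `1` in front or is the bar
  -- differential behind it
  have h1 : bDiff 𝒜 (act₃ a l E V) = sg (a.deg + (lops D).par l) • spl (fun U P =>
      sg ((1 + (sops D).par U) * (sops D).par P) •
      rot D (fun x y => sg ((sops D).par P * (lops D).par y) •
      (frontMul 𝒜 1 (uncons (ins P x * insF (E :: U) y)) +
        backMul 𝒜 1 (unsnoc (ins P x * insF (E :: U) y)))) a l) V -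
      sg (a.deg + (lops D).par l) • spl (fun U P =>
      sg ((1 + (sops D).par U) * (sops D).par P) •
      rot D (fun x y => sg ((sops D).par P * (lops D).par y) •
        chn 1 (barDiff 𝒜 (ins P x * insF (E :: U) y))) a l) V := by
    have hs : ∀ Y : TensorAlgebra k A, chn (shift 𝒜 1) Y = -chn 1 Y := fun Y => by
      rw [shift_of_mem (p := 0) SetLike.GradedOne.one_mem, zsmul_chn, zero_add, sg_one, neg_smul,
        one_smul]
    rw [act₃_eq, map_zsmul, map_spl, ← smul_sub, ← spl_sub]
    congr 1
    refine spl_congr fun U P _ => ?_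
    rw [map_zsmul, rotIns, map_rot, ← smul_sub, ← rot_sub]
    congr 1
    refine rot_congr fun x y _ => ?_
    rw [map_zsmul, bDiff_chn, hs, ← smul_sub]
    congr 1
    abel
  have h2 : dC D (act₃ · · E V) a l = -sg (a.deg + (lops D).par l) • spl (fun U P =>
      sg ((1 + (sops D).par U) * (sops D).par P) • dC D (rotIns E U P) a l) V := by
    have e := dC_sg (D := D) sg (fun a l => spl (fun U P =>
      sg ((1 + (sops D).par U) * (sops D).par P) • rotIns E U P a l) V) a l
    rw [sg_add_one] at e
    refine e.trans ?_
    congr 1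
    rw [dC_spl]
    refine spl_congr fun U P _ => ?_
    rw [dC_zsmul]
  rw [h1, spl_rot_front_back, h2, BDiff_act₁_add_act₂]
  simp only [rot_barDiff, smul_add, spl_add]
  have h3 := spl_dRot E V a l
  have h4 : spl (fun U P => sg ((1 + (sops D).par U) * (sops D).par P) •
      sg ((lops D).p a + (lops D).par l) • dRot E U P a l) V = -(dS (act₃ a l) E V -
        lst (fun V' E' => sg ((sops D).par V) • act₃ a l (E'.mul E) V') V) := by
    simp only [smul_comm _ (sg ((lops D).p a + (lops D).par l))]
    rw [spl_smul, h3, pa, add_right_comm, sg_add_one, smul_smul, neg_mul, sg_mul_self, neg_smul,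
      one_smul]
  rw [h4, neg_smul, smul_neg, smul_sub]
  abel

end

section

variable {k : Type*} [CommRing k] [Algebra ℚ k] {A : Type*} [Ring A] [Algebra k A]
variable {𝒜 : ZMod 2 → Submodule k A} [GradedAlgebra 𝒜] {D : 𝒜 1}

/-! ### The commutator of the total differential with the action -/

theorem words_ext {M : Type*} [AddCommGroup M] [Module k M] {f g : Words k A →ₗ[k] M}
    (h : ∀ l : List (Letter 𝒜), f (bar l) = g (bar l)) : f = g := by
  refine LinearMap.ext fun w => ?_
  suffices H : ∀ l : List (Letter 𝒜), f (bar l * w) = g (bar l * w) by simpa using H []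
  induction w using word_induction with
  | h_one => simpa using h
  | h_add x y hx hy => intro l; rw [mul_add, map_add, map_add, hx, hy]
  | h_smul c x hx => intro l; rw [mul_smul_comm, map_smul, map_smul, hx]
  | h_cons a w hw =>
    obtain ⟨x, rfl⟩ := Submodule.mkQ_surjective _ a
    intro l
    induction x using DirectSum.Decomposition.inductionOn 𝒜 with
    | zero => simp
    | @homogeneous i m =>
      have := hw (l ++ [⟨m.1, i, m.2⟩])
      rw [bar_append, bar_cons, bar_nil, mul_one, mul_assoc] at this
      exact this
    | add x y hx hy => simp only [map_add, add_mul, mul_add, hx, hy]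

/-- Linear maps of chains are determined by their values at tensors of homogeneous elements. -/
theorem chains_ext {M : Type*} [AddCommGroup M] [Module k M] {f g : Chains k A →ₗ[k] M}
    (h : ∀ (a : Letter 𝒜) (l : List (Letter 𝒜)), f (a.val ⊗ₜ[k] bar l) = g (a.val ⊗ₜ[k] bar l)) :
    f = g := by
  refine TensorProduct.ext (LinearMap.ext fun x => ?_)
  induction x using DirectSum.Decomposition.inductionOn 𝒜 with
  | zero => simp
  | @homogeneous i m => exact words_ext fun l => h ⟨m.1, i, m.2⟩ l
  | add x y hx hy => rw [map_add, map_add, hx, hy]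

theorem bar_oneL (z u : List (Letter 𝒜)) : bar (z ++ oneL 𝒜 :: u) = 0 := by
  have : toBar k A (oneL 𝒜).val = 0 := by
    rw [Submodule.mkQ_apply, Submodule.Quotient.mk_eq_zero]
    exact Submodule.mem_span_singleton_self _
  rw [bar_append, bar_cons, this, map_zero, zero_mul, mul_zero]

theorem BDiff_one (D : 𝒜 1) (w : Words k A) : BDiff 𝒜 ((1 : A) ⊗ₜ[k] w) = 0 := by
  have : BDiff 𝒜 ∘ₗ TensorProduct.mk k A (Words k A) 1 = 0 := words_ext (𝒜 := 𝒜) fun l => by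
    refine (BDiff_tmul D (oneL 𝒜) l).trans ?_
    simp only [chn_wd, bar_oneL, TensorProduct.tmul_zero, smul_zero, spl_zero,
      LinearMap.zero_apply]
  exact LinearMap.congr_fun this w

theorem chn_ins (x : A) (V : List (Parallel D)) (l : List (Letter 𝒜)) :
    chn x (ins V l) = x ⊗ₜ[k] insertWord 𝒜 (str V) (bar l) := by
  rw [chn, insertWord_bar]

theorem BDiff_act₃ (a : Letter 𝒜) (l : List (Letter 𝒜)) (E : Parallel D)
    (V : List (Parallel D)) : BDiff 𝒜 (act₃ a l E V) = 0 := by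
  rw [act₃_eq, map_zsmul, map_spl]
  simp only [map_zsmul, rotIns, map_rot]
  simp only [rot, chn, BDiff_one D, smul_zero, spl_zero]

theorem act₂_oneL (l : List (Letter 𝒜)) (E : Parallel D) (V : List (Parallel D)) :
    act₂ (oneL 𝒜) l E V = 0 := by
  have : ∀ E' V', preRot E' E V' (oneL 𝒜) l = 0 := fun E' V' => by
    simp only [preRot, rot, Parallel.ev, bar_oneL, map_zero, pre, zero_mul, chn,
      TensorProduct.zero_tmul, spl_zero, smul_zero]
  rw [← List.append_nil V]
  induction V using List.reverseRecOn with
  | nil => rfl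
  | append_singleton V E' _ => rw [List.append_nil, act₂_concat, this, smul_zero]

theorem act₃_oneL (l : List (Letter 𝒜)) (E : Parallel D) (V : List (Parallel D)) :
    act₃ (oneL 𝒜) l E V = 0 := by
  simp only [act₃_eq, rotIns, rot, chn, mapWord_mul, ← insertWord_bar, bar_oneL, map_zero, zero_mul,
    TensorProduct.tmul_zero, smul_zero, spl_zero]

theorem toBar_oneP_ev (l : List (Letter 𝒜)) : toBar k A ((oneP D).ev l) = 0 := by
  rw [oneP_ev]
  cases l with
  | nil =>
    rw [nl_nil, Submodule.mkQ_apply, Submodule.Quotient.mk_eq_zero]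
    exact Submodule.mem_span_singleton_self _
  | cons c l => rw [nl_cons, map_zero]

theorem mapWord_ins_oneP {V : List (Parallel D)} (hV : oneP D ∈ V) (l : List (Letter 𝒜)) :
    mapWord (toBar k A) (ins V l) = 0 := by
  induction V generalizing l with
  | nil => simp at hV
  | cons E V ih =>
    have h := ins_append [] E V l
    rw [List.nil_append] at h
    rw [h, map_spl]
    have h2 : ∀ y, mapWord (toBar k A) (insF (E :: V) y) = 0 := fun y => by
      rw [insF_cons, map_zsmul, map_spl]
      simp only [mapWord_ι_mul]
      rcases List.mem_cons.1 hV with rfl | h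
      · simp only [toBar_oneP_ev, map_zero, zero_mul, spl_zero, smul_zero]
      · simp only [ih h, mul_zero, spl_zero, smul_zero]
    simp only [map_zsmul, mapWord_mul, h2, mul_zero, smul_zero, spl_zero]

theorem mapWord_insF_oneP {E : Parallel D} {V : List (Parallel D)} (hV : oneP D ∈ E :: V)
    (l : List (Letter 𝒜)) : mapWord (toBar k A) (insF (E :: V) l) = 0 := by
  rw [insF_cons, map_zsmul, map_spl]
  simp only [mapWord_ι_mul]
  rcases List.mem_cons.1 hV with rfl | h
  · simp only [toBar_oneP_ev, map_zero, zero_mul, spl_zero, smul_zero]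
  · simp only [mapWord_ins_oneP h, mul_zero, spl_zero, smul_zero]

theorem rotIns_oneP {E : Parallel D} {U P : List (Parallel D)} (h : oneP D ∈ P ++ E :: U)
    (a : Letter 𝒜) (l : List (Letter 𝒜)) : rotIns E U P a l = 0 := by
  rcases List.mem_append.1 h with h | h
  · simp only [rotIns, rot, chn, mapWord_mul, mapWord_ins_oneP h, zero_mul, TensorProduct.tmul_zero,
      smul_zero, spl_zero]
  · simp only [rotIns, rot, chn, mapWord_mul, mapWord_insF_oneP h, mul_zero,
      TensorProduct.tmul_zero, smul_zero, spl_zero]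

theorem act₃_oneP (a : Letter 𝒜) (l : List (Letter 𝒜)) (V : List (Parallel D)) :
    act₃ a l (oneP D) V = 0 := by
  rw [act₃_eq]
  simp only [rotIns_oneP (List.mem_append_right _ List.mem_cons_self), smul_zero, spl_zero]

/-- The action of a degenerate string is zero. -/
theorem act_of_mem (a : Letter 𝒜) (l : List (Letter 𝒜)) (E : Parallel D) {V : List (Parallel D)}
    (hV : oneP D ∈ V) : act a l E V = 0 := by
  have h1 : ∀ {W : List (Parallel D)}, oneP D ∈ W → ∀ l (x : A), pre l E W x = 0 := by
    intro W hW l x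
    simp only [pre, chn, mapWord_ins_oneP hW, TensorProduct.tmul_zero, spl_zero]
  have h2 : act₂ a l E V = 0 := by
    rw [← List.append_nil V] at hV ⊢
    induction V using List.reverseRecOn with
    | nil => rfl
    | append_singleton V E' _ =>
      rw [List.append_nil] at hV ⊢
      rw [act₂_concat]
      rcases List.mem_append.1 hV with h | h
      · simp only [preRot, rot, h1 h, smul_zero, spl_zero]
      · rw [List.mem_singleton] at h
        subst h
        have : ∀ z u : List (Letter 𝒜), (oneP D).ev (z ++ a :: u) = 0 := fun z u => by
          rw [oneP_ev]; cases z <;> rfl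
        simp only [preRot, rot, this, pre, zero_mul, chn, TensorProduct.zero_tmul, smul_zero,
          spl_zero]
  have h3 : act₃ a l E V = 0 := by
    rw [act₃_eq, spl_congr (G := fun _ _ => 0), spl_zero, smul_zero]
    intro U P h
    rw [rotIns_oneP, smul_zero]
    rw [← h] at hV
    rcases List.mem_append.1 hV with h | h
    · exact List.mem_append_right _ (List.mem_cons_of_mem _ h)
    · exact List.mem_append_left _ h
  rw [act, act₁_eq_pre, h1 hV, h2, h3, add_zero, add_zero]

theorem map_dC {M N G : Type*} [AddCommGroup M] [AddCommGroup N] [FunLike G M N]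
    [AddMonoidHomClass G M N] (φ : G) (Φ : Letter 𝒜 → List (Letter 𝒜) → M) (a : Letter 𝒜)
    (l : List (Letter 𝒜)) : φ (dC D Φ a l) = dC D (fun a l => φ (Φ a l)) a l := by
  simp only [dC, map_add, map_hd, map_zsmul, map_lst, Ops.map_cd]

/-- The cochain `∇ = ad D - D²`. -/
def nabla (𝒜 : ZMod 2 → Submodule k A) [GradedAlgebra 𝒜] (D : A) : Cochains k A :=
  adCochain 𝒜 D - zeroCochain (D * D)

/-- The Lie derivative of `∇ = ad D - D²` on chains. -/
def lieNabla (𝒜 : ZMod 2 → Submodule k A) [GradedAlgebra 𝒜] (D : A) : Module.End k (Chains k A) :=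
  LinearMap.rTensor (Words k A) (superComm 𝒜 D) -
    LinearMap.lTensor A (insertWord 𝒜 (TensorAlgebra.ι k (nabla 𝒜 D))) ∘ₗ chainParity 𝒜

/-- `dC` is the transpose of the Hochschild differential plus the Lie derivative of `∇`. -/
theorem dC_tmul (a : Letter 𝒜) (l : List (Letter 𝒜)) :
    dC D (fun a l => a.val ⊗ₜ[k] bar l) a l =
      (bDiff 𝒜 + lieNabla 𝒜 (D : A)) (a.val ⊗ₜ[k] bar l) := by
  have h1 := bDiff_chn_ins (D := D) a.mem [] l
  have hi : ∀ (x : A) (l : List (Letter 𝒜)), chn x (ins ([] : List (Parallel D)) l) =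
      x ⊗ₜ[k] bar l := fun _ _ => rfl
  have h2 : (sops D).cd (fun W => chn a.val (ins W l)) [] =
      -(a.val ⊗ₜ[k] insertWord 𝒜 (TensorAlgebra.ι k (nabla 𝒜 (D : A))) (bar l)) := by
    rw [Ops.cd_nil, chn_ins, str, str_nil, mul_one]
    change (-1 : ℤ) • _ = _
    rw [neg_smul, one_smul]
    rfl
  have h3 : hd (fun c l' => ((lops D).m a c).val ⊗ₜ[k] bar l') l =
      hd (fun c l' => sg a.deg • (a.val * c.val) ⊗ₜ[k] bar l') l :=
    hd_congr fun c l' _ => zsmul_tmul _ _ _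
  have h4 : lst (fun l' c => sg ((lops D).p c * ((lops D).p a + (lops D).par l')) •
      ((lops D).m c a).val ⊗ₜ[k] bar l') l =
      lst (fun l' c => sg ((a.deg + 1 + (lops D).par l') * (c.deg + 1) + c.deg) •
        (c.val * a.val) ⊗ₜ[k] bar l') l := by
    refine lst_congr fun l' c _ => ?_
    rw [sg_add, mul_smul, mul_comm]
    exact congrArg _ (zsmul_tmul _ _ _)
  rw [h2] at h1
  simp only [hi, hd_nil, lst_nil, add_zero] at h1
  rw [LinearMap.add_apply, h1, dC, h3, h4, lieNabla, LinearMap.sub_apply, LinearMap.comp_apply,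
    chainParity_tmul D, map_zsmul, LinearMap.lTensor_tmul, LinearMap.rTensor_tmul,
    show (lops D).p a = a.deg + 1 from rfl, show ((lops D).f a).val = superComm 𝒜 D a.val from rfl,
    sg_add_one, sg_add]
  rcases (by decide : ∀ p : ZMod 2, sg p = 1 ∨ sg p = -1) a.deg with h | h <;>
  rcases (by decide : ∀ p : ZMod 2, sg p = 1 ∨ sg p = -1) ((lops D).par l) with h' | h' <;>
  rw [h, h'] <;> module

/-- The commutator of the total differential with the action of a string of cochains. -/
theorem totalDiff_act (a : Letter 𝒜) (l : List (Letter 𝒜)) (E : Parallel D)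
    (V : List (Parallel D)) :
    totalDiff 𝒜 (act a l E V) =
      bullet 𝒜 (E.toCochain ⊗ₜ[k] str V)
        ((totalDiff 𝒜 + lieNabla 𝒜 (D : A)) (a.val ⊗ₜ[k] bar l)) +
      sg (a.deg + (lops D).par l) • (dS (act a l) E V +
        spl (fun U P => sg ((1 + (sops D).par U) * (sops D).par P) •
          act a l (oneP D) (P ++ E :: U)) V) := by
  have h1 : bullet 𝒜 (E.toCochain ⊗ₜ[k] str V) (BDiff 𝒜 (a.val ⊗ₜ[k] bar l)) =
      spl (fun p z => sg (((lops D).p a + (lops D).par p) * (lops D).par z) •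
        act₁ (oneL 𝒜) (z ++ a :: p) E V) l := by
    rw [BDiff_tmul D, map_spl]
    refine spl_congr fun p z _ => ?_
    have := bullet_tmul (oneL 𝒜) (z ++ a :: p) E V
    rw [act, act₂_oneL, act₃_oneL, add_zero, add_zero] at this
    rw [map_zsmul, chn_wd, ← this]
    rfl
  have h2 : bullet 𝒜 (E.toCochain ⊗ₜ[k] str V)
      ((bDiff 𝒜 + lieNabla 𝒜 (D : A)) (a.val ⊗ₜ[k] bar l)) = dC D (act · · E V) a l := by
    rw [← dC_tmul, map_dC]
    simp only [bullet_tmul]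
  have h3 : dC D (act · · E V) a l = dC D (fun a l => act₁ a l E V + act₂ a l E V) a l +
      dC D (act₃ · · E V) a l := by
    simp only [act, dC, hd_add, Ops.cd_add, smul_add, lst_add]
    abel
  have h4 : dS (act a l) E V = dS (fun E V => act₁ a l E V + act₂ a l E V) E V +
      dS (act₃ a l) E V := by
    have : act (D := D) a l = fun E V => act₁ a l E V + act₂ a l E V + act₃ a l E V := rfl
    simp only [this, dS, hd_add, Ops.cd_add, smul_add, lst_add]
    have : ∀ F G : List (Parallel D) → Chains k A, (sops D).cd (fun W => F W + G W) V =
      (sops D).cd F V + (sops D).cd G V := fun F G => Ops.cd_add _ _ _ _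
    rw [show (sops D).cd (act₃ a l E) V = (sops D).cd (fun W => act₃ a l E W) V from rfl]
    abel
  have h5 := bDiff_act₃ a l E V
  have h6 : totalDiff 𝒜 + lieNabla 𝒜 (D : A) = BDiff 𝒜 + (bDiff 𝒜 + lieNabla 𝒜 (D : A)) :=
    add_assoc _ _ _
  rw [h6, LinearMap.add_apply, map_add, h1, h2, h3, h4, totalDiff, LinearMap.add_apply, act,
    map_add (bDiff 𝒜), bDiff_act₁_add_act₂, map_add (BDiff 𝒜), BDiff_act₃, add_zero,
    eq_sub_of_add_eq h5]
  simp only [act, act₃_oneP, add_zero, smul_add]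
  abel

end

section

/-! ### The star product on strings of powers of one cochain -/

variable {M : Type*} [AddCommGroup M]

/-- The multiplication of adjacent powers in a string of powers of an even cochain. -/
def mops : Ops ℕ where
  p _ := 1
  c₀ := 0
  w := 1
  c₁ := 0
  f := id
  c₂ := 1
  m := (· + ·)

/-- The insertion of a cochain into a string of its powers. -/
def iops : Ops ℕ where
  p _ := 1
  c₀ := 1
  w := 1
  c₁ := 0
  f := id
  c₂ := 0
  m := (· + ·)

theorem mops_odd : mops.Odd := ⟨rfl, Or.inl rfl, fun _ _ => by simp only [mops]; decide⟩

theorem iops_odd : iops.Odd := ⟨rfl, Or.inl rfl, fun _ _ => by simp only [iops]; decide⟩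

theorem iops_par (V : List ℕ) : iops.par V = mops.par V := by
  induction V with
  | nil => rfl
  | cons c V ih => rw [Ops.par_cons, Ops.par_cons, ih]; rfl

theorem mops_par_cons (n : ℕ) (V : List ℕ) : mops.par (n :: V) = 1 + mops.par V := rfl

theorem mops_cd_nil (F : List ℕ → M) : mops.cd F [] = 0 := zero_smul _ _

theorem iops_cd_nil (F : List ℕ → M) : iops.cd F [] = F [1] := one_smul _ _

theorem mops_cd_cons (F : List ℕ → M) (c : ℕ) (V : List ℕ) : mops.cd F (c :: V) =
    hd (fun d l => F ((c + d) :: l)) V - mops.cd (fun l => F (c :: l)) V := by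
  rw [Ops.cd_cons, show mops.c₀ = 0 from rfl, show mops.c₁ = 0 from rfl, show mops.c₂ = 1 from rfl,
    show mops.p c = 1 from rfl, sg_one]
  simp [mops, sub_eq_add_neg]

theorem iops_cd_cons (F : List ℕ → M) (c : ℕ) (V : List ℕ) : iops.cd F (c :: V) =
    F (1 :: c :: V) - iops.cd (fun l => F (c :: l)) V := by
  rw [Ops.cd_cons, show iops.c₀ = 1 from rfl, show iops.c₁ = 0 from rfl, show iops.c₂ = 0 from rfl,
    show iops.p c = 1 from rfl, sg_one]
  simp [iops, sub_eq_add_neg]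

theorem iops_cd_iops_cd (F : List ℕ → M) (V : List ℕ) : iops.cd (iops.cd F) V = 0 := by
  induction V generalizing F with
  | nil => rw [iops_cd_nil, iops_cd_cons, iops_cd_nil, sub_self]
  | cons c V ih =>
    simp only [iops_cd_cons]
    rw [Ops.cd_sub, ih]
    abel

/-- The insertion of a cochain anticommutes with the multiplication of adjacent cochains. -/
theorem mops_cd_iops_cd (F : List ℕ → M) (V : List ℕ) :
    mops.cd (iops.cd F) V + iops.cd (mops.cd F) V = 0 := by
  induction V generalizing F with
  | nil => rw [mops_cd_nil, iops_cd_nil, mops_cd_cons, hd_nil, mops_cd_nil]; abel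
  | cons c V ih =>
    have h1 : iops.cd (fun W => hd (fun d l => F ((c + d) :: l)) W) V =
        F ((c + 1) :: V) - hd (fun d l => iops.cd (fun l => F ((c + d) :: l)) l) V := by
      cases V with
      | nil => rw [iops_cd_nil, hd_cons, hd_nil, sub_zero]
      | cons d l => rw [iops_cd_cons, hd_cons, hd_cons]; rfl
    have h2 := ih (fun l => F (c :: l))
    simp only [iops_cd_cons, mops_cd_cons, Ops.cd_sub, h1, hd_sub, hd_cons]
    rw [add_comm 1 c, eq_neg_of_add_eq_zero_left h2]
    abel

/-- The transpose of the Hochschild differential of strings. -/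
def bS (ψ : ℕ → List ℕ → M) (n : ℕ) (V : List ℕ) : M :=
  hd (fun n' V' => ψ (n + n') V') V - mops.cd (ψ n) V +
    lst (fun V' n' => sg (mops.par V) • ψ (n' + n) V') V

/-- The transpose of Connes' differential of strings. -/
def BS (ψ : ℕ → List ℕ → M) (n : ℕ) (V : List ℕ) : M :=
  spl (fun U P => sg ((1 + mops.par U) * mops.par P) • ψ 0 (P ++ n :: U)) V

/-- The transpose of minus the Lie derivative of strings. -/
def lS (ψ : ℕ → List ℕ → M) (n : ℕ) (V : List ℕ) : M := iops.cd (ψ n) V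

/-- The transpose of the second part of the star product. -/
def jS (ψ : ℕ → List ℕ → M) (n : ℕ) (V : List ℕ) : M :=
  spl (fun U P => sg ((1 + mops.par U) * mops.par P) • iops.cd (fun Q => ψ 0 (Q ++ n :: U)) P) V

/-- The transpose of the star product. -/
def iS (ψ : ℕ → List ℕ → M) (n : ℕ) (V : List ℕ) : M := ψ (n + 1) V + jS ψ n V

/-- Functions of strings that vanish on degenerate strings. -/
def NormalizedS (ψ : ℕ → List ℕ → M) : Prop := ∀ n V, 0 ∈ V → ψ n V = 0

theorem iops_cd_eq_zero {F : List ℕ → M} {V : List ℕ} (h : ∀ W, V ⊆ W → F W = 0) :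
    iops.cd F V = 0 := by
  induction V generalizing F with
  | nil => exact (iops_cd_nil F).trans (h _ (by simp))
  | cons c V ih =>
    rw [iops_cd_cons, h _ (by simp), ih fun W hW => h _ (List.cons_subset_cons c hW), sub_zero]

theorem NormalizedS.iS {ψ : ℕ → List ℕ → M} (h : NormalizedS ψ) : NormalizedS (iS ψ) := by
  intro n V hV
  rw [BivariantJLO.iS, h _ _ hV, zero_add, jS, spl_congr (G := fun _ _ => 0), spl_zero]
  intro U P hUP
  rw [iops_cd_eq_zero, smul_zero]
  intro W hW
  refine h _ _ ?_
  rw [← hUP] at hV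
  rcases List.mem_append.1 hV with h | h
  · exact List.mem_append_right _ (List.mem_cons_of_mem _ h)
  · exact List.mem_append_left _ (hW h)

theorem NormalizedS.jS_zero {ψ : ℕ → List ℕ → M} (h : NormalizedS ψ) (V : List ℕ) :
    jS ψ 0 V = 0 := by
  rw [jS, spl_congr (G := fun _ _ => 0), spl_zero]
  intro U P _
  rw [iops_cd_eq_zero, smul_zero]
  exact fun W _ => h _ _ (List.mem_append_right _ List.mem_cons_self)

theorem NormalizedS.BS_zero {ψ : ℕ → List ℕ → M} (h : NormalizedS ψ) (V : List ℕ) :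
    BS ψ 0 V = 0 := by
  rw [BS, spl_congr (G := fun _ _ => 0), spl_zero]
  intro U P _
  rw [h _ _ (List.mem_append_right _ List.mem_cons_self), smul_zero]

theorem Ops.cd_zero {X : Type*} (O : Ops X) (V : List X) : O.cd (fun _ => (0 : M)) V = 0 := by
  have := O.cd_smul 0 (fun _ => (0 : M)) V
  simpa using this

theorem Ops.hd_cd {X Y : Type*} (O : Ops Y) (F : X → List X → List Y → M) (P : List X)
    (U : List Y) : hd (fun c l => O.cd (F c l) U) P = O.cd (fun U => hd (fun c l => F c l U) P) U := by
  cases P with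
  | nil => exact (O.cd_zero U).symm
  | cons c P => rfl

theorem Ops.cd_comm {X Y : Type*} (O : Ops X) (O' : Ops Y) (F : List X → List Y → M) (P : List X)
    (U : List Y) : O.cd (fun Q => O'.cd (F Q) U) P = O'.cd (fun U => O.cd (fun Q => F Q U) P) U := by
  induction P generalizing F with
  | nil => simp only [Ops.cd_nil, Ops.cd_smul]
  | cons c P ih => simp only [Ops.cd_cons, Ops.cd_add, Ops.cd_smul, ih, Ops.hd_cd]

theorem Ops.lst_cd {X Y : Type*} (O : Ops Y) (F : List X → X → List Y → M) (P : List X)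
    (U : List Y) : lst (fun u c => O.cd (F u c) U) P = O.cd (fun U => lst (fun u c => F u c U) P) U := by
  induction P generalizing F with
  | nil => exact (O.cd_zero U).symm
  | cons c P ih =>
    simp only [lst_cons, Ops.cd_add, ih]
    cases P with
    | nil => rfl
    | cons d P => simp only [nl_cons, Ops.cd_zero]

/-- The star product commutes with the Lie derivative. -/
theorem jS_lS (ψ : ℕ → List ℕ → M) : jS (lS ψ) = lS (jS ψ) := by
  funext n V
  have e := iops.cd_spl (fun U P => sg ((1 + mops.par U) * mops.par P) •
    iops.cd (fun Q => ψ 0 (Q ++ n :: U)) P) V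
  refine Eq.trans ?_ e.symm
  rw [jS]
  refine spl_congr fun U P _ => ?_
  have h1 : ∀ Q, lS ψ 0 (Q ++ n :: U) = iops.cd (fun Q => ψ 0 (Q ++ n :: U)) Q +
      sg (mops.par Q + 1) • iops.cd (fun U => ψ 0 (Q ++ n :: U)) U := fun Q => by
    have hl : ∀ Q : List ℕ, lst (fun z' c => sg (iops.par z') • iops.c₂ •
        ψ 0 (z' ++ iops.m c n :: U)) Q = 0 := fun Q => by
      rw [lst_congr (G := fun _ _ => (0 : ℤ) • 0) fun _ _ _ => by
        rw [show iops.c₂ = 0 from rfl, zero_smul, zero_smul, smul_zero], lst_smul, zero_smul]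
    rw [lS, Ops.cd_append, hl, iops_par, show iops.c₁ = 0 from rfl, show iops.c₂ = 0 from rfl,
      show iops.p n = 1 from rfl]
    simp
  simp only [h1]
  rw [Ops.cd_add, iops_cd_iops_cd, zero_add]
  have h2 := iops_odd.cd_sg (fun q => sg (q + 1)) (fun Q => iops.cd (fun U => ψ 0 (Q ++ n :: U)) U) P
  have h3 := iops_odd.cd_sg (fun q => sg ((1 + q) * mops.par P))
    (fun U => iops.cd (fun Q => ψ 0 (Q ++ n :: U)) P) U
  simp only [iops_par] at h2 h3
  have h5 := iops_odd.cd_sg (fun q => sg ((1 + mops.par U) * q))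
    (iops.cd fun Q => ψ 0 (Q ++ n :: U)) P
  simp only [iops_par] at h5
  rw [h2, h3, h5, iops_cd_iops_cd, smul_zero, smul_zero, add_zero, smul_smul, ← sg_add]
  have h4 : iops.cd (fun Q => iops.cd (fun U => ψ 0 (Q ++ n :: U)) U) P =
      iops.cd (fun U => iops.cd (fun Q => ψ 0 (Q ++ n :: U)) P) U := Ops.cd_comm _ _ _ _ _
  rw [h4]
  congr 2
  generalize mops.par U = x, mops.par P = y
  revert x y
  decide

theorem iS_lS (ψ : ℕ → List ℕ → M) : iS (lS ψ) = lS (iS ψ) := by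
  funext n V
  have := congrFun (congrFun (jS_lS ψ) n) V
  rw [iS, this, lS, lS, lS, show iS ψ n = fun V => ψ (n + 1) V + jS ψ n V from rfl, Ops.cd_add]

theorem iops_cd_hd (F : ℕ → List ℕ → M) (P : List ℕ) (n : ℕ) (U : List ℕ) :
    iops.cd (fun Q => hd F (Q ++ n :: U)) P =
      F 1 (P ++ n :: U) - hd (fun c P' => iops.cd (fun Q => F c (Q ++ n :: U)) P') P := by
  cases P with
  | nil => rw [iops_cd_nil, hd_nil, sub_zero]; rfl
  | cons c P => rw [iops_cd_cons, hd_cons]; rfl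

theorem iops_cd_lst (G : List ℕ → ℕ → M) (P : List ℕ) : iops.cd (lst G) P =
    sg (mops.par P) • G P 1 + lst (fun P' c => iops.cd (fun Q => G Q c) P') P := by
  have h0 : ∀ (x : M) (P : List ℕ), iops.cd (nl x) P = 0 := fun x P => by
    cases P with
    | nil => exact iops_cd_nil _
    | cons c P =>
      rw [iops_cd_cons, show (fun l : List ℕ => nl x (c :: l)) = fun _ => 0 from rfl, Ops.cd_zero,
        nl_cons, sub_zero]
  induction P generalizing G with
  | nil => rw [iops_cd_nil, lst_cons]; simp
  | cons c P ih =>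
    simp only [iops_cd_cons, lst_cons, iops_cd_nil, lst_sub, nl_cons]
    rw [Ops.cd_add, ih, h0, mops_par_cons, add_comm 1, sg_add_one, neg_smul]
    abel

theorem iops_cd_sg (σ : ZMod 2 → ℤ) (F : List ℕ → M) (V : List ℕ) :
    iops.cd (fun V => σ (mops.par V) • F V) V = σ (mops.par V + 1) • iops.cd F V := by
  have := iops_odd.cd_sg σ F V
  simpa only [iops_par] using this

/-- The transpose of `b` on a string with an inserted cochain. -/
theorem iops_cd_bS (ψ : ℕ → List ℕ → M) (n : ℕ) (U P : List ℕ) :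
    iops.cd (fun Q => bS ψ 0 (Q ++ n :: U)) P =
      ψ 1 (P ++ n :: U) - hd (fun c P' => iops.cd (fun Q => ψ c (Q ++ n :: U)) P') P -
      (-mops.cd (iops.cd fun Q => ψ 0 (Q ++ n :: U)) P + ψ 0 (P ++ (n + 1) :: U) -
        lst (fun P' c => sg (mops.par P') • iops.cd (fun Q => ψ 0 (Q ++ (c + n) :: U)) P') P -
        sg (mops.par P) • hd (fun d U' => iops.cd (fun Q => ψ 0 (Q ++ (n + d) :: U')) P) U +
        sg (mops.par P) • mops.cd (fun U => iops.cd (fun Q => ψ 0 (Q ++ n :: U)) P) U) +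
      (nl (sg (mops.par P) • lS ψ n P) U +
        lst (fun U' d => sg (mops.par P + mops.par U) •
          iops.cd (fun Q => ψ d (Q ++ n :: U')) P) U) := by
  have h1 := iops_cd_hd (fun n' V' => ψ (0 + n') V') P n U
  have h2 : iops.cd (fun Q => mops.cd (ψ 0) (Q ++ n :: U)) P =
      -mops.cd (iops.cd fun Q => ψ 0 (Q ++ n :: U)) P + ψ 0 (P ++ (n + 1) :: U) -
        lst (fun P' c => sg (mops.par P') • iops.cd (fun Q => ψ 0 (Q ++ (c + n) :: U)) P') P -
        sg (mops.par P) • hd (fun d U' => iops.cd (fun Q => ψ 0 (Q ++ (n + d) :: U')) P) U +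
        sg (mops.par P) • mops.cd (fun U => iops.cd (fun Q => ψ 0 (Q ++ n :: U)) P) U := by
    have e1 : ∀ Q, mops.cd (ψ 0) (Q ++ n :: U) = mops.cd (fun Q => ψ 0 (Q ++ n :: U)) Q +
        lst (fun Q' c => sg (mops.par Q') • ψ 0 (Q' ++ (c + n) :: U)) Q +
        sg (mops.par Q) • (hd (fun d U' => ψ 0 (Q ++ (n + d) :: U')) U -
          mops.cd (fun U => ψ 0 (Q ++ n :: U)) U) := fun Q => by
      rw [Ops.cd_append, show mops.c₁ = 0 from rfl, show mops.c₂ = 1 from rfl,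
        show mops.p n = 1 from rfl, sg_add_one, zero_smul, smul_zero, add_zero]
      simp only [one_smul, neg_smul, smul_sub]
      rw [← sub_eq_add_neg, add_sub_assoc]
      rfl
    simp only [e1]
    rw [Ops.cd_add, Ops.cd_add, iops_cd_lst, iops_cd_sg sg, Ops.cd_sub, ← Ops.hd_cd, Ops.cd_comm,
      smul_smul, sg_mul_self, one_smul, sg_add_one, neg_smul, smul_sub,
      eq_neg_of_add_eq_zero_right (mops_cd_iops_cd (fun Q => ψ 0 (Q ++ n :: U)) P), add_comm 1 n]
    have e2 : lst (fun P' c => iops.cd (fun Q => sg (mops.par Q) • ψ 0 (Q ++ (c + n) :: U)) P') P =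
        -lst (fun P' c => sg (mops.par P') • iops.cd (fun Q => ψ 0 (Q ++ (c + n) :: U)) P') P := by
      rw [← lst_neg]
      refine lst_congr fun P' c _ => ?_
      rw [iops_cd_sg sg, sg_add_one, neg_smul]
    rw [e2]
    abel
  have h3 : iops.cd (fun Q => lst (fun V' n' => sg (mops.par (Q ++ n :: U)) • ψ (n' + 0) V')
      (Q ++ n :: U)) P = nl (sg (mops.par P) • lS ψ n P) U +
        lst (fun U' d => sg (mops.par P + mops.par U) •
          iops.cd (fun Q => ψ d (Q ++ n :: U')) P) U := by
    have e1 : ∀ Q, lst (fun V' n' => sg (mops.par (Q ++ n :: U)) • ψ (n' + 0) V') (Q ++ n :: U) =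
        sg (mops.par Q + 1 + mops.par U) • (nl (ψ n Q) U +
          lst (fun U' d => ψ d (Q ++ n :: U')) U) := fun Q => by
      rw [lst_append, nl_cons, zero_add, lst_cons, lst_smul, nl_smul, ← smul_add, Ops.par_append,
        mops_par_cons, add_assoc, List.append_nil]
      rfl
    have e2 : iops.cd (fun Q => nl (ψ n Q) U) P = nl (lS ψ n P) U := by
      cases U with
      | nil => rfl
      | cons d U => exact Ops.cd_zero _ _
    simp only [e1]
    rw [iops_cd_sg (fun q => sg (q + 1 + mops.par U)), Ops.cd_add, e2, ← Ops.lst_cd, smul_add,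
      lst_smul]
    have e3 : mops.par P + 1 + 1 + mops.par U = mops.par P + mops.par U := by
      generalize mops.par P = x, mops.par U = y
      revert x y
      decide
    rw [e3]
    refine congrArg₂ (· + ·) ?_ rfl
    cases U with
    | nil => rw [Ops.par_nil, add_zero]; rfl
    | cons d U => simp
  rw [← h2, ← h3]
  simp only [bS]
  rw [Ops.cd_add, Ops.cd_sub, h1]
  simp only [zero_add]

/-- The commutator of the star product with the Hochschild differential of strings. -/
theorem jS_bS (ψ : ℕ → List ℕ → M) (n : ℕ) (V : List ℕ) :
    jS (bS ψ) n V = bS (jS ψ) n V + lS ψ n V + BS (fun n => ψ (n + 1)) n V - BS ψ (n + 1) V := by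
  -- the terms in which the first cochain of the string comes from a rotation across the marked
  -- cochain `n` cancel
  have hc : spl (fun U P => sg ((1 + mops.par U) * mops.par P) • lst (fun U' d =>
      sg (mops.par P + mops.par U) • iops.cd (fun Q => ψ d (Q ++ n :: U')) P) U) V =
      spl (fun U P => sg ((1 + mops.par U) * mops.par P) • hd (fun c P' =>
        iops.cd (fun Q => ψ c (Q ++ n :: U)) P') P) V := by
    rw [spl_congr (G := fun U P => lst (fun U' d => sg (mops.par U' * mops.par P + mops.par P +
      mops.par U' + 1) • iops.cd (fun Q => ψ d (Q ++ n :: U')) P) U), spl_lst_eq_spl_hd]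
    · refine spl_congr fun U P _ => ?_
      rw [← hd_smul]
      refine hd_congr fun c P' h => ?_
      rw [← h, mops_par_cons]
      congr 2
      generalize mops.par U = x, mops.par P' = y
      revert x y
      decide
    · intro U P _
      rw [← lst_smul]
      refine lst_congr fun U' d h => ?_
      rw [← h, smul_smul, ← sg_add, Ops.par_append, mops_par_cons, Ops.par_nil]
      congr 2
      generalize mops.par U' = x, mops.par P = y
      revert x y
      decide
  have hn : spl (fun U P => sg ((1 + mops.par U) * mops.par P) • nl (sg (mops.par P) • lS ψ n P) U)
      V = lS ψ n V := by
    rw [← spl_nl_left (fun P => lS ψ n P) V]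
    refine spl_congr fun U P _ => ?_
    cases U with
    | nil => simp only [nl_nil, Ops.par_nil, add_zero, one_mul, smul_smul, sg_mul_self, one_smul]
    | cons d U => simp
  have h1 : hd (fun n' V' => jS ψ (n + n') V') V = spl (fun U P => sg (mops.par U * mops.par P) •
      hd (fun d U' => iops.cd (fun Q => ψ 0 (Q ++ (n + d) :: U')) P) U) V := by
    simp only [jS, hd_spl]
    refine spl_congr fun U P _ => ?_
    rw [← hd_smul]
    refine hd_congr fun c U' h => ?_
    rw [← h, mops_par_cons]
  have h2 : mops.cd (jS ψ n) V = spl (fun U P => sg (mops.par U * mops.par P) •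
      mops.cd (fun U => iops.cd (fun Q => ψ 0 (Q ++ n :: U)) P) U -
      sg ((1 + mops.par U) * mops.par P) •
        mops.cd (iops.cd fun Q => ψ 0 (Q ++ n :: U)) P) V := by
    refine (mops.cd_spl (fun U P => sg ((1 + mops.par U) * mops.par P) •
      iops.cd (fun Q => ψ 0 (Q ++ n :: U)) P) V).trans (spl_congr fun U P _ => ?_)
    rw [mops_odd.cd_sg (fun q => sg ((1 + q) * mops.par P)),
      mops_odd.cd_sg (fun q => sg ((1 + mops.par U) * q)), smul_smul, ← sg_add, sub_eq_add_neg,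
      ← neg_smul, ← sg_add_one]
    congr 3
    · generalize mops.par U = x, mops.par P = y
      revert x y
      decide
    · generalize mops.par U = x, mops.par P = y
      revert x y
      decide
  have h3 : lst (fun V' n' => sg (mops.par V) • jS ψ (n' + n) V') V =
      spl (fun U P => sg ((1 + mops.par U) * mops.par P) • lst (fun P' c => sg (mops.par P') •
        iops.cd (fun Q => ψ 0 (Q ++ (c + n) :: U)) P') P) V := by
    simp only [jS, ← spl_smul, lst_spl]
    refine spl_congr fun U P h => ?_
    rw [← lst_smul]
    refine lst_congr fun P' c h' => ?_
    rw [smul_smul, smul_smul, ← sg_add, ← sg_add, ← h, ← h']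
    simp only [Ops.par_append, mops_par_cons, Ops.par_nil]
    congr 2
    generalize mops.par U = x, mops.par P' = y
    revert x y
    decide
  have hs : ∀ U P : List ℕ, sg ((1 + mops.par U) * mops.par P) =
      sg (mops.par U * mops.par P) * sg (mops.par P) := fun U P => by
    rw [← sg_add, add_mul, one_mul, add_comm]
  rw [jS]
  simp only [iops_cd_bS, smul_add, smul_sub, spl_add, spl_sub]
  rw [hn, hc, bS, h1, h2, h3, BS, BS]
  simp only [spl_sub, smul_smul, hs, mul_assoc, sg_mul_self, mul_one, smul_neg, spl_neg, zero_add]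
  abel

theorem NormalizedS.iS_dS {ψ : ℕ → List ℕ → M} (h : NormalizedS ψ) (n : ℕ) (V : List ℕ) :
    BivariantJLO.iS (fun n V => bS ψ n V + BS ψ n V) n V =
      bS (BivariantJLO.iS ψ) n V + BS (BivariantJLO.iS ψ) n V + lS ψ n V := by
  have h1 : jS (fun n V => bS ψ n V + BS ψ n V) n V = jS (bS ψ) n V := by
    refine spl_congr fun U P _ => ?_
    simp only [h.BS_zero, add_zero]
  have h2 : bS (BivariantJLO.iS ψ) n V = bS ψ (n + 1) V + bS (jS ψ) n V := by
    have e : BivariantJLO.iS ψ n = fun V => ψ (n + 1) V + jS ψ n V := rfl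
    rw [bS, e, Ops.cd_add]
    simp only [BivariantJLO.iS, hd_add, lst_add, smul_add, bS]
    rw [show (fun n' => ψ (n + n' + 1)) = fun n' => ψ (n + 1 + n') from
      funext fun n' => by rw [add_right_comm]]
    abel_nf
  have h3 : BS (BivariantJLO.iS ψ) n V = BS (fun n => ψ (n + 1)) n V := by
    simp only [BS, BivariantJLO.iS, h.jS_zero, add_zero]
  rw [BivariantJLO.iS, h1, h2, h3, jS_bS]
  abel

/-- The value of a function of strings at the `m`-th star power of a cochain. -/
def starS (m : ℕ) (ψ : ℕ → List ℕ → M) : M := BivariantJLO.iS^[m] ψ 0 []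

theorem iS_add (ψ φ : ℕ → List ℕ → M) : iS (ψ + φ) = iS ψ + iS φ := by
  funext n V
  simp only [iS, jS, Pi.add_apply, Ops.cd_add, smul_add, spl_add]
  abel

theorem iS_iterate_add (m : ℕ) (ψ φ : ℕ → List ℕ → M) :
    iS^[m] (ψ + φ) = iS^[m] ψ + iS^[m] φ := by
  induction m generalizing ψ φ with
  | zero => rfl
  | succ m ih => rw [Function.iterate_succ_apply, iS_add, ih]; rfl

theorem NormalizedS.iterate {ψ : ℕ → List ℕ → M} (h : NormalizedS ψ) (m : ℕ) :
    NormalizedS (BivariantJLO.iS^[m] ψ) := by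
  induction m generalizing ψ with
  | zero => exact h
  | succ m ih => exact ih h.iS

theorem NormalizedS.iS_iterate_dS {ψ : ℕ → List ℕ → M} (h : NormalizedS ψ) (m : ℕ) :
    BivariantJLO.iS^[m + 1] (bS ψ + BS ψ) =
      bS (BivariantJLO.iS^[m + 1] ψ) + BS (BivariantJLO.iS^[m + 1] ψ) +
        (m + 1) • BivariantJLO.iS^[m] (lS ψ) := by
  have h1 : ∀ {ψ : ℕ → List ℕ → M}, NormalizedS ψ → BivariantJLO.iS (bS ψ + BS ψ) =
      bS (BivariantJLO.iS ψ) + BS (BivariantJLO.iS ψ) + lS ψ := fun h =>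
    funext fun n => funext fun V => h.iS_dS n V
  induction m generalizing ψ with
  | zero =>
    rw [zero_add, one_smul]
    exact h1 h
  | succ m ih =>
    rw [Function.iterate_succ_apply, h1 h, iS_iterate_add, ih h.iS, ← iS_lS,
      ← Function.iterate_succ_apply, ← Function.iterate_succ_apply, add_smul (m + 1), one_smul,
      add_assoc]

/-- The total differential of the star powers. -/
theorem NormalizedS.starS_dS {ψ : ℕ → List ℕ → M} (h : NormalizedS ψ) (m : ℕ) :
    starS m (bS ψ + BS ψ) = m • starS (m - 1) (lS ψ) := by
  have h0 : ∀ {φ : ℕ → List ℕ → M}, NormalizedS φ → bS φ 0 [] + BS φ 0 [] = 0 := fun {φ} h => by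
    rw [bS, mops_cd_nil, BS, hd_nil, lst_nil]
    simp [h 0 [0] (by simp)]
  rcases m with _ | m
  · rw [zero_smul]
    exact h0 h
  · rw [starS, h.iS_iterate_dS, Pi.add_apply, Pi.add_apply, Pi.add_apply, Pi.add_apply,
      h0 (h.iterate _), zero_add]
    rfl

end

section

variable {k : Type*} [CommRing k] [Algebra ℚ k] {A : Type*} [Ring A] [Algebra k A]
variable {𝒜 : ZMod 2 → Submodule k A} [GradedAlgebra 𝒜] {D : 𝒜 1}

/-! ### The operators of the star powers of `∇` -/

theorem Parallel.ext_ev {E E' : Parallel D} (h : ∀ l, E.ev l = E'.ev l) : E = E' := by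
  have : E.toCochain = E'.toCochain := words_ext h
  cases E
  cases E'
  congr

/-- The parallel cochains are a monoid with the cup product; its unit is `1 ∈ A`. -/
instance : Monoid (Parallel D) where
  mul := Parallel.mul
  one := oneP D
  mul_assoc E F G := Parallel.ext_ev fun l => by
    change ((E.mul F).mul G).ev l = (E.mul (F.mul G)).ev l
    simp only [Parallel.mul_ev, spl_mul, mul_spl, mul_assoc]
    rw [spl_assoc]
  one_mul E := Parallel.ext_ev fun l => by
    change ((oneP D).mul E).ev l = E.ev l
    rw [Parallel.mul_ev, ← spl_nl_left (fun v => E.ev v) l]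
    refine spl_congr fun u v _ => ?_
    rw [oneP_ev]
    cases u <;> simp
  mul_one E := Parallel.ext_ev fun l => by
    change (E.mul (oneP D)).ev l = E.ev l
    rw [Parallel.mul_ev, ← spl_nl_right (fun v => E.ev v) l]
    refine spl_congr fun u v _ => ?_
    rw [oneP_ev]
    cases v <;> simp

theorem Parallel.mul_def (E E' : Parallel D) : E.mul E' = E * E' := rfl

theorem oneP_eq (D : 𝒜 1) : oneP D = 1 := rfl

/-- The string of the powers `∇ⁿ ⊗ ∇^{n₁} ⊗ ⋯ ⊗ ∇^{n_r}`. -/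
def powStr (D : 𝒜 1) (n : ℕ) (V : List ℕ) : CochainChains k A :=
  (nablaP D ^ n).toCochain ⊗ₜ[k] str (V.map (nablaP D ^ ·))

theorem sops_par_map (f : ℕ → Parallel D) (V : List ℕ) : (sops D).par (V.map f) = mops.par V := by
  induction V with
  | nil => rfl
  | cons c V ih => rw [List.map_cons, Ops.par_cons, ih]; rfl

/-- On strings of powers of `∇` the coderivation multiplies adjacent powers or inserts `∇`. -/
theorem sops_cd_map {M : Type*} [AddCommGroup M] (Ψ : List (Parallel D) → M) (V : List ℕ) :
    (sops D).cd Ψ (V.map (nablaP D ^ ·)) =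
      mops.cd (fun V => Ψ (V.map (nablaP D ^ ·))) V -
        iops.cd (fun V => Ψ (V.map (nablaP D ^ ·))) V := by
  induction V generalizing Ψ with
  | nil =>
    rw [mops_cd_nil, iops_cd_nil, List.map_nil, Ops.cd_nil, List.map_cons, List.map_nil, pow_one,
      zero_sub]
    exact neg_one_smul _ _
  | cons c V ih =>
    rw [mops_cd_cons, iops_cd_cons, List.map_cons, Ops.cd_cons, ih,
      show (sops D).c₀ = -1 from rfl, show (sops D).c₁ = 0 from rfl, show (sops D).c₂ = 1 from rfl,
      show (sops D).p (nablaP D ^ c) = 1 from rfl, show (sops D).w = nablaP D from rfl, sg_one]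
    have h : hd (fun d l' => Ψ ((sops D).m (nablaP D ^ c) d :: l')) (V.map (nablaP D ^ ·)) =
        hd (fun d l => Ψ (((c + d) :: l).map (nablaP D ^ ·))) V := by
      cases V with
      | nil => rfl
      | cons d V => simp only [List.map_cons, hd_cons, pow_add]; rfl
    rw [h]
    simp only [List.map_cons, pow_one]
    module

theorem iops_cd_eq_spl {M : Type*} [AddCommGroup M] (F : List ℕ → M) (V : List ℕ) :
    iops.cd F V = spl (fun U P => sg (mops.par U) • F (U ++ 1 :: P)) V := by
  induction V generalizing F with
  | nil => exact (iops_cd_nil F).trans (by simp)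
  | cons c V ih =>
    rw [iops_cd_cons, ih, spl_cons, sub_eq_add_neg, ← spl_neg, Ops.par_nil, sg_zero, one_smul,
      List.nil_append]
    congr 1
    refine spl_congr fun U P _ => ?_
    rw [mops_par_cons, add_comm, sg_add_one, neg_smul]
    rfl

theorem conv_str {R : Type*} [Ring R] [Algebra k R] (f g : TensorAlgebra k (Cochains k A) →ₗ[k] R)
    (V : List (Parallel D)) : conv f g (str V) = spl (fun U P => f (str U) * g (str P)) V := by
  rw [conv, LinearMap.comp_apply, LinearMap.comp_apply, deconcat_str, map_spl, map_spl]
  rfl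

theorem str_append (U V : List (Parallel D)) : str (U ++ V) = str U * str V := by
  induction U with
  | nil => simp
  | cons E U ih => simp [ih, mul_assoc]

theorem spl_map {M : Type*} [AddCommGroup M] {X Y : Type*} (f : X → Y) (F : List Y → List Y → M)
    (V : List X) : spl F (V.map f) = spl (fun U P => F (U.map f) (P.map f)) V := by
  induction V generalizing F with
  | nil => rfl
  | cons c V ih => simp only [List.map_cons, spl_cons, ih, List.map_nil]

/-- Insertion of a cochain into words of cochains,
`w ↦ ∑_{w = u v} (-1)^{length u} u E v`. -/
def insertCochain : Cochains k A →ₗ[k] Module.End k (TensorAlgebra k (Cochains k A)) where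
  toFun E := conv lengthSign (LinearMap.mulLeft k (TensorAlgebra.ι k E))
  map_add' E E' := by
    have : LinearMap.mulLeft k (TensorAlgebra.ι k (E + E')) =
        LinearMap.mulLeft k (TensorAlgebra.ι k E) + LinearMap.mulLeft k (TensorAlgebra.ι k E') :=
      LinearMap.ext fun x => by simp [add_mul]
    simp only [conv, this, TensorProduct.map_add_right, LinearMap.add_comp, LinearMap.comp_add]
  map_smul' c E := by
    have : LinearMap.mulLeft k (TensorAlgebra.ι k (c • E)) =
        c • LinearMap.mulLeft k (TensorAlgebra.ι k E) :=
      LinearMap.ext fun x => by simp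
    simp only [conv, this, TensorProduct.map_smul_right, LinearMap.smul_comp, LinearMap.comp_smul,
      RingHom.id_apply]

theorem insertCochain_str (E : Parallel D) (V : List (Parallel D)) :
    insertCochain E.toCochain (str V) =
      spl (fun U P => sg ((sops D).par U) • str (U ++ E :: P)) V := by
  refine (conv_str _ _ V).trans (spl_congr fun U P _ => ?_)
  rw [lengthSign_str, LinearMap.mulLeft_apply, str_append, str_cons, smul_mul_assoc]

theorem insertCochain_map (V : List ℕ) :
    insertCochain (nablaP D).toCochain (str (V.map (nablaP D ^ ·))) =
      iops.cd (fun V => str (V.map (nablaP D ^ ·))) V := by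
  rw [insertCochain_str, iops_cd_eq_spl, spl_map]
  refine spl_congr fun U P _ => ?_
  rw [sops_par_map, List.map_append, List.map_cons, pow_one]

/-- The operator `L` of insertion of `E` into strings of cochains. -/
def insertString : Cochains k A →ₗ[k] Module.End k (CochainChains k A) where
  toFun E := LinearMap.lTensor _ (insertCochain E)
  map_add' E E' := by rw [map_add, LinearMap.lTensor_add]
  map_smul' c E := by rw [map_smul, LinearMap.lTensor_smul, RingHom.id_apply]

theorem insertString_powStr (D : 𝒜 1) (n : ℕ) (V : List ℕ) :
    insertString (nablaP D).toCochain (powStr D n V) = lS (powStr D) n V := by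
  refine (LinearMap.lTensor_tmul _ _ _ _).trans ?_
  rw [insertCochain_map]
  exact Ops.map_cd _ (TensorProduct.mk k (Cochains k A) _ (nablaP D ^ n).toCochain) _ _

/-- The operators on functions of strings are transposed to the star product with `∇`. -/
theorem starMul_powStr (D : 𝒜 1) (n : ℕ) (V : List ℕ) :
    starMul (nablaP D).toCochain (powStr D n V) = iS (powStr D) n V := by
  rw [starMul, LinearMap.add_apply, iS]
  congr 1
  · rw [powStr, LinearMap.rTensor_tmul, powStr, pow_succ']
    rfl
  · rw [LinearMap.comp_apply, LinearMap.comp_apply, LinearMap.comp_apply, powStr,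
      rotateCochains_tmul, map_spl, map_spl, map_spl, spl_map, jS]
    refine spl_congr fun U P _ => ?_
    rw [map_zsmul, map_zsmul, map_zsmul, sops_par_map, sops_par_map, TensorProduct.map_tmul]
    congr 1
    have : conv lengthSign (LinearMap.mulLeft k (TensorAlgebra.ι k (nablaP D).toCochain))
        (str (P.map (nablaP D ^ ·))) = _ := insertCochain_map (D := D) P
    rw [this, LinearMap.mul'_apply, LinearMap.comp_apply, LinearMap.rTensor_tmul,
      LinearMap.mul'_apply, Ops.cd_mul]
    refine (iops.map_cd (TensorProduct.mk k (Cochains k A) _ (zeroCochain 1)) _ _).trans ?_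
    congr 1
    funext Q
    rw [TensorProduct.mk_apply, powStr, pow_zero, List.map_append, List.map_cons, str_append,
      str_cons]
    rfl

/-- Additive maps commute with the transpose of the star product. -/
theorem map_iS {M N G : Type*} [AddCommGroup M] [AddCommGroup N] [FunLike G M N]
    [AddMonoidHomClass G M N] (φ : G) (m : ℕ) (ψ : ℕ → List ℕ → M) (n : ℕ) (V : List ℕ) :
    φ (iS^[m] ψ n V) = iS^[m] (fun n V => φ (ψ n V)) n V := by
  induction m generalizing ψ with
  | zero => rfl
  | succ m ih =>
    rw [Function.iterate_succ_apply, Function.iterate_succ_apply, ih]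
    refine congrFun (congrFun (congrArg _ ?_) n) V
    funext n V
    simp only [iS, jS, map_add, map_spl, map_zsmul, Ops.map_cd]

/-- The star powers of `∇` in terms of strings of powers. -/
theorem starProd_eq (D : 𝒜 1) (m : ℕ) :
    starProd (List.replicate m (nablaP D).toCochain) = starS m (powStr D) := by
  induction m with
  | zero => rfl
  | succ m ih =>
    rw [List.replicate_succ]
    change starMul _ (starProd _) = _
    rw [ih, starS, map_iS]
    simp only [starMul_powStr, starS, Function.iterate_succ_apply]

/-- The operator `α ↦ α • (∇ ⋆ ⋯ ⋆ ∇)`. -/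
def starOp (𝒜 : ZMod 2 → Submodule k A) [GradedAlgebra 𝒜] (D : A) (m : ℕ) :
    Module.End k (Chains k A) :=
  bullet 𝒜 (starProd (List.replicate m (nabla 𝒜 D)))

/-- The operator `α ↦ (-1)^{deg α} α • L (∇ ⋆ ⋯ ⋆ ∇)`. -/
def starDefect (𝒜 : ZMod 2 → Submodule k A) [GradedAlgebra 𝒜] (D : A) (m : ℕ) :
    Module.End k (Chains k A) :=
  bullet 𝒜 (insertString (nabla 𝒜 D) (starProd (List.replicate m (nabla 𝒜 D)))) * chainParity 𝒜

/-- The commutator of the total differential with the operators of the star powers of `∇`. -/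
theorem totalDiff_mul_starOp (D : 𝒜 1) (m : ℕ) :
    totalDiff 𝒜 * starOp 𝒜 (D : A) m =
      starOp 𝒜 (D : A) m * (totalDiff 𝒜 + lieNabla 𝒜 (D : A)) +
        (starDefect 𝒜 (D : A) m + m • starDefect 𝒜 (D : A) (m - 1)) := by
  refine chains_ext (𝒜 := 𝒜) fun a l => ?_
  have hn : nabla 𝒜 (D : A) = (nablaP D).toCochain := rfl
  let φ : Chains k A → CochainChains k A →ₗ[k] Chains k A := fun α =>
    LinearMap.applyₗ α ∘ₗ bullet 𝒜
  let ψ : ℕ → List ℕ → Chains k A := fun n V => φ (a.val ⊗ₜ[k] bar l) (powStr D n V)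
  have hψ : ∀ n V, ψ n V = act a l (nablaP D ^ n) (V.map (nablaP D ^ ·)) := fun n V =>
    bullet_tmul _ _ _ _
  -- a string with the unit `∇⁰` among its cochains after the first acts trivially
  have hnorm : NormalizedS ψ := fun n V hV => by
    rw [hψ]
    refine act_of_mem _ _ _ ?_
    rw [oneP_eq, ← pow_zero (nablaP D)]
    exact List.mem_map_of_mem hV
  -- the action turns the differentials of strings of cochains into those of functions of strings
  -- of exponents; the Lie derivative comes from the insertion of `∇`
  have key : ∀ n V, totalDiff 𝒜 (ψ n V) =
      φ ((totalDiff 𝒜 + lieNabla 𝒜 (D : A)) (a.val ⊗ₜ[k] bar l)) (powStr D n V) +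
        sg (a.deg + (lops D).par l) • ((bS ψ + BS ψ) n V + lS ψ n V) := by
    intro n V
    rw [hψ, totalDiff_act]
    refine congrArg₂ (· + ·) rfl (congrArg _ ?_)
    have h1 : ∀ V : List ℕ, hd (fun E' V' => act a l ((nablaP D ^ n).mul E') V')
        (V.map (nablaP D ^ ·)) = hd (fun n' V' => ψ (n + n') V') V := by
      rintro (_ | ⟨c, V⟩)
      · rfl
      · simp only [List.map_cons, hd_cons, hψ, pow_add, Parallel.mul_def]
    have h2 : ∀ (G : ℕ → List ℕ → Chains k A) (F : List (Parallel D) → Parallel D → Chains k A),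
        (∀ c V, F (V.map (nablaP D ^ ·)) (nablaP D ^ c) = G c V) →
        lst F (V.map (nablaP D ^ ·)) = lst (fun V' n' => G n' V') V := by
      intro G F h
      induction V using List.reverseRecOn with
      | nil => rfl
      | append_singleton V c _ => rw [List.map_append, List.map_singleton, lst_concat, lst_concat, h]
    rw [dS, h1, sops_cd_map, h2 (fun c V' => sg (mops.par V) • ψ (c + n) V') _ fun c V' => by
        rw [hψ, pow_add, sops_par_map, Parallel.mul_def], spl_map]
    rw [Pi.add_apply, Pi.add_apply, bS, BS, lS]
    have h3 : ∀ V, act a l (nablaP D ^ n) (V.map (nablaP D ^ ·)) = ψ n V := fun V => (hψ n V).symm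
    have h4 : ∀ U P, act a l (oneP D) (P.map (nablaP D ^ ·) ++ nablaP D ^ n :: U.map (nablaP D ^ ·)) =
        ψ 0 (P ++ n :: U) := fun U P => by
      rw [hψ, pow_zero, List.map_append, List.map_cons, oneP_eq]
    simp only [h3, h4, sops_par_map]
    abel
  have hstar : ∀ m, φ (a.val ⊗ₜ[k] bar l) (starS m (powStr D)) = starS m ψ := fun m => map_iS _ _ _ _ _
  have hL : ∀ m, starDefect 𝒜 (D : A) m (a.val ⊗ₜ[k] bar l) =
      sg (a.deg + (lops D).par l) • starS m (lS ψ) := by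
    intro m
    rw [starDefect, Module.End.mul_apply, chainParity_tmul D, map_zsmul, hn, starProd_eq, starS, map_iS]
    congr 1
    simp only [insertString_powStr]
    change φ (a.val ⊗ₜ[k] bar l) _ = _
    rw [map_iS]
    simp only [lS, Ops.map_cd]
    rfl
  have hsm : ∀ (c : ℤ) (m : ℕ) (χ : ℕ → List ℕ → Chains k A), starS m (fun n V => c • χ n V) =
      c • starS m χ := fun c m χ =>
    (map_iS (DistribSMul.toAddMonoidHom (Chains k A) c) m χ 0 []).symm
  rw [Module.End.mul_apply, LinearMap.add_apply, LinearMap.add_apply, Module.End.mul_apply,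
    LinearMap.smul_apply, hL, hL, starOp, hn, starProd_eq]
  change totalDiff 𝒜 (φ (a.val ⊗ₜ[k] bar l) _) = φ _ (starS m (powStr D)) + _
  rw [hstar, starS, map_iS]
  simp only [key]
  have hsum : (fun n V => φ ((totalDiff 𝒜 + lieNabla 𝒜 (D : A)) (a.val ⊗ₜ[k] bar l)) (powStr D n V) +
        sg (a.deg + (lops D).par l) • ((bS ψ + BS ψ) n V + lS ψ n V)) =
      (fun n V => φ ((totalDiff 𝒜 + lieNabla 𝒜 (D : A)) (a.val ⊗ₜ[k] bar l)) (powStr D n V)) +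
        fun n V => sg (a.deg + (lops D).par l) • ((bS ψ + BS ψ) + lS ψ) n V := rfl
  rw [hsum, iS_iterate_add, Pi.add_apply, Pi.add_apply, ← map_iS]
  congr 1
  refine (hsm _ _ _).trans ?_
  rw [starS, iS_iterate_add, Pi.add_apply, Pi.add_apply]
  have := hnorm.starS_dS m
  rw [starS] at this
  rw [this, smul_comm, smul_add, add_comm]
  rfl

end

section

/-! ### Polynomial functions of a rational parameter -/

section Polynomial

variable {k : Type*} [CommRing k] [Algebra ℚ k]
variable {M N P : Type*} [AddCommGroup M] [Module k M] [AddCommGroup N] [Module k N]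
  [AddCommGroup P] [Module k P]

variable (k) in
/-- `f` is the polynomial function `c ↦ ∑ cⁱ pᵢ` of a rational parameter. -/
def HasCoeffs (f : ℚ → M) (p : ℕ → M) : Prop :=
  ∃ n, (∀ i, n ≤ i → p i = 0) ∧ ∀ c, f c = ∑ i ∈ Finset.range n, algebraMap ℚ k (c ^ i) • p i

theorem HasCoeffs.exists_le {f : ℚ → M} {p : ℕ → M} (h : HasCoeffs k f p) : ∃ n₀, ∀ n, n₀ ≤ n →
    (∀ i, n ≤ i → p i = 0) ∧
      ∀ c, f c = ∑ i ∈ Finset.range n, algebraMap ℚ k (c ^ i) • p i := by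
  obtain ⟨n₀, h0, h1⟩ := h
  refine ⟨n₀, fun n hn => ⟨fun i hi => h0 i (hn.trans hi), fun c => ?_⟩⟩
  rw [h1]
  refine Finset.sum_subset (Finset.range_mono hn) fun i _ hi => ?_
  rw [h0 i (by simpa using hi), smul_zero]

/-- The coefficients of a polynomial function are unique, since `k` contains `ℚ`. -/
theorem HasCoeffs.unique {f : ℚ → M} {p q : ℕ → M} (hp : HasCoeffs k f p)
    (hq : HasCoeffs k f q) : p = q := by
  obtain ⟨n₁, h₁⟩ := hp.exists_le
  obtain ⟨n₂, h₂⟩ := hq.exists_le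
  obtain ⟨hp0, hp⟩ := h₁ (max n₁ n₂) (le_max_left _ _)
  obtain ⟨hq0, hq⟩ := h₂ (max n₁ n₂) (le_max_right _ _)
  let _ : Module ℚ M := Module.compHom M (algebraMap ℚ k)
  funext i
  by_cases hi : max n₁ n₂ ≤ i
  · rw [hp0 i hi, hq0 i hi]
  rw [not_le] at hi
  rw [← sub_eq_zero, ← Module.forall_dual_apply_eq_zero_iff ℚ]
  intro φ
  let g : Polynomial ℚ := ∑ i ∈ Finset.range (max n₁ n₂), Polynomial.monomial i (φ (p i - q i))
  have hg : g = 0 := Polynomial.funext fun c => by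
    have h := congrArg φ (((hp c).symm.trans (hq c)))
    have hs : ∀ (c : ℚ) (x : M), algebraMap ℚ k c • x = c • x := fun _ _ => rfl
    simp only [hs, map_sum, map_smul] at h
    rw [Polynomial.eval_finsetSum, Polynomial.eval_zero, ← sub_eq_zero.2 h,
      ← Finset.sum_sub_distrib]
    refine Finset.sum_congr rfl fun i _ => ?_
    rw [Polynomial.eval_monomial, map_sub, smul_eq_mul, smul_eq_mul]
    ring
  have := congrArg (fun g => g.coeff i) hg
  simpa [g, Polynomial.finsetSum_coeff, Polynomial.coeff_monomial, hi] using this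

theorem HasCoeffs.const (x : M) : HasCoeffs k (fun _ => x) (fun i => if i = 0 then x else 0) :=
  ⟨1, fun i hi => if_neg (by omega), fun c => by simp⟩

theorem HasCoeffs.add {f g : ℚ → M} {p q : ℕ → M} (hp : HasCoeffs k f p) (hq : HasCoeffs k g q) :
    HasCoeffs k (fun c => f c + g c) (fun i => p i + q i) := by
  obtain ⟨n₁, h₁⟩ := hp.exists_le
  obtain ⟨n₂, h₂⟩ := hq.exists_le
  obtain ⟨hp0, hp⟩ := h₁ (max n₁ n₂) (le_max_left _ _)
  obtain ⟨hq0, hq⟩ := h₂ (max n₁ n₂) (le_max_right _ _)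
  refine ⟨max n₁ n₂, fun i hi => by beta_reduce; rw [hp0 i hi, hq0 i hi, add_zero],
    fun c => ?_⟩
  beta_reduce
  rw [hp, hq, ← Finset.sum_add_distrib]
  simp only [smul_add]

theorem HasCoeffs.map {f : ℚ → M} {p : ℕ → M} (hp : HasCoeffs k f p) (φ : M →ₗ[k] N) :
    HasCoeffs k (fun c => φ (f c)) (fun i => φ (p i)) := by
  obtain ⟨n, h0, h⟩ := hp
  refine ⟨n, fun i hi => by beta_reduce; rw [h0 i hi, map_zero], fun c => ?_⟩
  beta_reduce
  rw [h, map_sum]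
  simp only [map_smul]

/-- A bilinear map of two polynomial functions is polynomial, with the Cauchy product of the
coefficients. -/
theorem HasCoeffs.map₂ {f : ℚ → M} {g : ℚ → N} {p : ℕ → M} {q : ℕ → N} (hp : HasCoeffs k f p)
    (hq : HasCoeffs k g q) (φ : M →ₗ[k] N →ₗ[k] P) : HasCoeffs k (fun c => φ (f c) (g c))
      (fun r => ∑ x ∈ Finset.HasAntidiagonal.antidiagonal r, φ (p x.1) (q x.2)) := by
  obtain ⟨n, h0, h⟩ := hp
  obtain ⟨n', h0', h'⟩ := hq
  have hz : ∀ x : ℕ × ℕ, x ∉ Finset.range n ×ˢ Finset.range n' → φ (p x.1) (q x.2) = 0 := by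
    intro x hx
    rw [Finset.mem_product, Finset.mem_range, Finset.mem_range, not_and_or, not_lt, not_lt] at hx
    rcases hx with hx | hx
    · rw [h0 _ hx, map_zero, LinearMap.zero_apply]
    · rw [h0' _ hx, map_zero]
  refine ⟨n + n', fun r hr => Finset.sum_eq_zero fun x hx => hz x ?_, fun c => ?_⟩
  · rw [Finset.HasAntidiagonal.mem_antidiagonal] at hx
    rw [Finset.mem_product, Finset.mem_range, Finset.mem_range]
    omega
  · have hmap : ∀ x ∈ Finset.range n ×ˢ Finset.range n', x.1 + x.2 ∈ Finset.range (n + n') := by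
      intro x hx
      rw [Finset.mem_product, Finset.mem_range, Finset.mem_range] at hx
      rw [Finset.mem_range]
      omega
    calc φ (f c) (g c) = ∑ x ∈ Finset.range n ×ˢ Finset.range n',
          algebraMap ℚ k (c ^ (x.1 + x.2)) • φ (p x.1) (q x.2) := by
          rw [h, map_sum, LinearMap.sum_apply, h', Finset.sum_product]
          refine Finset.sum_congr rfl fun i _ => ?_
          rw [map_sum]
          refine Finset.sum_congr rfl fun j _ => ?_
          rw [map_smul, map_smul, LinearMap.smul_apply, smul_smul, pow_add, map_mul, mul_comm]
      _ = _ := by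
          rw [← Finset.sum_fiberwise_of_maps_to hmap]
          refine Finset.sum_congr rfl fun r _ => ?_
          rw [Finset.smul_sum]
          refine (Finset.sum_congr rfl fun x hx => ?_).trans
            (Finset.sum_subset (s₂ := Finset.HasAntidiagonal.antidiagonal r) (fun x hx => ?_) fun x hx hx' => ?_)
          · rw [(Finset.mem_filter.1 hx).2]
          · exact Finset.HasAntidiagonal.mem_antidiagonal.2 (Finset.mem_filter.1 hx).2
          · rw [hz x, smul_zero]
            intro hx2
            exact hx' (Finset.mem_filter.2 ⟨hx2, Finset.HasAntidiagonal.mem_antidiagonal.1 hx⟩)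

end Polynomial

theorem sum_antidiagonalTuple_succ {M : Type*} [AddCommMonoid M] (m r : ℕ)
    (f : (Fin (m + 1) → ℕ) → M) : ∑ c ∈ Finset.Nat.antidiagonalTuple (m + 1) r, f c =
      ∑ x ∈ Finset.HasAntidiagonal.antidiagonal r, ∑ c ∈ Finset.Nat.antidiagonalTuple m x.2, f (Fin.cons x.1 c) := by
  change ((List.Nat.antidiagonalTuple (m + 1) r).map f).sum =
    ((List.Nat.antidiagonal r).map fun x : ℕ × ℕ =>
      ((List.Nat.antidiagonalTuple m x.2).map fun c => f (Fin.cons x.1 c)).sum).sum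
  rw [List.Nat.antidiagonalTuple, List.map_flatMap, List.flatMap, List.sum_flatten]
  simp only [List.map_map]
  rfl

/-! ### The expansion of the operators of the star powers -/

variable {k : Type*} [CommRing k] [Algebra ℚ k] {A : Type*} [Ring A] [Algebra k A]
variable {𝒜 : ZMod 2 → Submodule k A} [GradedAlgebra 𝒜] {D : A}

variable (𝒜 D) in
theorem superComm_smul (c : k) : superComm 𝒜 (c • D) = c • superComm 𝒜 D :=
  LinearMap.ext fun x => by simp [superComm, smul_sub]

variable (𝒜 D) in
theorem adCochain_smul (c : k) : adCochain 𝒜 (c • D) = c • adCochain 𝒜 D := by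
  have : adBar 𝒜 (c • D) = c • adBar 𝒜 D :=
    Submodule.linearMap_qext _ (LinearMap.ext fun x =>
      LinearMap.congr_fun (superComm_smul 𝒜 D c) x)
  rw [adCochain, this]
  rfl

variable (k) in
theorem zeroCochain_smul (c : k) (x : A) : zeroCochain (k := k) (c • x) = c • zeroCochain x :=
  LinearMap.ext fun _ => smul_comm _ _ _

variable (𝒜 D) in
theorem hasCoeffs_nabla :
    HasCoeffs k (fun c => nabla 𝒜 (algebraMap ℚ k c • D)) (nablaCoeff 𝒜 D) := by
  refine ⟨3, fun i hi => ?_, fun c => ?_⟩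
  · obtain ⟨j, rfl⟩ := Nat.exists_eq_add_of_le' hi
    rfl
  · beta_reduce
    rw [Finset.sum_range_succ, Finset.sum_range_succ, Finset.sum_range_succ, Finset.sum_range_zero,
      nabla, adCochain_smul, smul_mul_smul_comm, zeroCochain_smul, ← map_mul, ← pow_two]
    simp [nablaCoeff, sub_eq_add_neg]

/-- The product `⋆` as a bilinear map. -/
def starMulₗ : Cochains k A →ₗ[k] CochainChains k A →ₗ[k] CochainChains k A where
  toFun := starMul
  map_add' E E' := by
    have h : ∀ E : Cochains k A, conv lengthSign (LinearMap.mulLeft k (TensorAlgebra.ι k E)) =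
        insertCochain E := fun _ => rfl
    simp only [starMul, h]
    simp only [map_add, LinearMap.rTensor_add, TensorProduct.map_add_left,
      LinearMap.add_comp, LinearMap.comp_add]
    abel
  map_smul' c E := by
    have h : ∀ E : Cochains k A, conv lengthSign (LinearMap.mulLeft k (TensorAlgebra.ι k E)) =
        insertCochain E := fun _ => rfl
    simp only [starMul, h]
    simp only [map_smul, LinearMap.rTensor_smul, TensorProduct.map_smul_left,
      LinearMap.smul_comp, LinearMap.comp_smul, smul_add, RingHom.id_apply]

variable (𝒜 D) in
/-- The coefficients of `∇_t ⋆ ⋯ ⋆ ∇_t`. -/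
def starCoeff (m r : ℕ) : CochainChains k A :=
  ∑ c ∈ Finset.Nat.antidiagonalTuple m r, starProd (List.ofFn fun i => nablaCoeff 𝒜 D (c i))

theorem starCoeff_zero (r : ℕ) :
    starCoeff 𝒜 D 0 r = if r = 0 then zeroCochain 1 ⊗ₜ[k] 1 else 0 := by
  cases r with
  | zero => simp [starCoeff, starProd]
  | succ r => simp [starCoeff]

theorem starCoeff_succ (m r : ℕ) : starCoeff 𝒜 D (m + 1) r =
    ∑ x ∈ Finset.HasAntidiagonal.antidiagonal r, starMulₗ (nablaCoeff 𝒜 D x.1) (starCoeff 𝒜 D m x.2) := by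
  rw [starCoeff, sum_antidiagonalTuple_succ]
  refine Finset.sum_congr rfl fun x _ => ?_
  rw [starCoeff, map_sum]
  refine Finset.sum_congr rfl fun c _ => ?_
  rw [List.ofFn_succ]
  simp only [Fin.cons_zero, Fin.cons_succ]
  rfl

theorem nablaCoeff_zero : nablaCoeff 𝒜 D 0 = 0 := rfl

theorem starCoeff_of_lt {m r : ℕ} (h : r < m) : starCoeff 𝒜 D m r = 0 := by
  induction m generalizing r with
  | zero => omega
  | succ m ih =>
    rw [starCoeff_succ]
    refine Finset.sum_eq_zero fun x hx => ?_
    rw [Finset.HasAntidiagonal.mem_antidiagonal] at hx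
    rcases Nat.eq_zero_or_pos x.1 with h0 | h0
    · rw [h0, nablaCoeff_zero, map_zero, LinearMap.zero_apply]
    · rw [ih (by omega), map_zero]

variable (𝒜 D) in
theorem hasCoeffs_starProd (m : ℕ) :
    HasCoeffs k (fun c => starProd (List.replicate m (nabla 𝒜 (algebraMap ℚ k c • D))))
      (starCoeff 𝒜 D m) := by
  induction m with
  | zero =>
    have h := HasCoeffs.const (k := k) (zeroCochain (k := k) (1 : A) ⊗ₜ[k]
      (1 : TensorAlgebra k (Cochains k A)))
    rwa [← funext fun r => starCoeff_zero (𝒜 := 𝒜) (D := D) r] at h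
  | succ m ih =>
    have h := HasCoeffs.map₂ (P := CochainChains k A) (hasCoeffs_nabla 𝒜 D) ih starMulₗ
    rwa [← funext fun r => starCoeff_succ (𝒜 := 𝒜) (D := D) m r] at h

variable (𝒜 D) in
theorem hasCoeffs_starOp (m : ℕ) : HasCoeffs k (fun c => starOp 𝒜 (algebraMap ℚ k c • D) m)
    (fun r => bullet 𝒜 (starCoeff 𝒜 D m r)) := (hasCoeffs_starProd 𝒜 D m).map (bullet 𝒜)

variable (𝒜 D) in
/-- The coefficients of `starDefect`. -/
def defectCoeff (m r : ℕ) : Module.End k (Chains k A) :=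
  (∑ x ∈ Finset.HasAntidiagonal.antidiagonal r,
    bullet 𝒜 (insertString (nablaCoeff 𝒜 D x.1) (starCoeff 𝒜 D m x.2))) * chainParity 𝒜

variable (𝒜 D) in
theorem hasCoeffs_starDefect (m : ℕ) :
    HasCoeffs k (fun c => starDefect 𝒜 (algebraMap ℚ k c • D) m) (defectCoeff 𝒜 D m) :=
  ((hasCoeffs_nabla 𝒜 D).map₂ (hasCoeffs_starProd 𝒜 D m)
    (insertString.compr₂ (bullet 𝒜))).map (LinearMap.mulRight k (chainParity 𝒜))

/-- `∇_t` is divisible by `t`, and `m + 1` factors occur in the defect of the `m`-th star power.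
-/
theorem defectCoeff_of_le {m r : ℕ} (h : r ≤ m) : defectCoeff 𝒜 D m r = 0 := by
  rw [defectCoeff, Finset.sum_eq_zero, zero_mul]
  intro x hx
  rw [Finset.HasAntidiagonal.mem_antidiagonal] at hx
  rcases Nat.eq_zero_or_pos x.1 with h0 | h0
  · rw [h0, nablaCoeff_zero, map_zero, LinearMap.zero_apply, map_zero]
  · rw [starCoeff_of_lt (by omega), map_zero, map_zero]

variable (𝒜 D) in
/-- The coefficients of the Lie derivative of `∇_t = t ad D - t² D²`. -/
def lieCoeff (i : ℕ) : Module.End k (Chains k A) :=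
  (if i = 1 then LinearMap.rTensor (Words k A) (superComm 𝒜 D) else 0) -
    LinearMap.lTensor A (insertWord 𝒜 (TensorAlgebra.ι k (nablaCoeff 𝒜 D i))) ∘ₗ chainParity 𝒜

variable (𝒜 D) in
theorem hasCoeffs_lieNabla :
    HasCoeffs k (fun c => lieNabla 𝒜 (algebraMap ℚ k c • D)) (lieCoeff 𝒜 D) := by
  let φ : Cochains k A →ₗ[k] Module.End k (Chains k A) :=
    -(LinearMap.lcomp k (Chains k A) (chainParity 𝒜) ∘ₗ LinearMap.lTensorHom A ∘ₗ
      insertWord 𝒜 ∘ₗ TensorAlgebra.ι k)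
  have h2 : HasCoeffs k (fun c : ℚ => LinearMap.rTensor (Words k A)
      (superComm 𝒜 (algebraMap ℚ k c • D)))
      (fun i => if i = 1 then LinearMap.rTensor (Words k A) (superComm 𝒜 D) else 0) := by
    refine ⟨2, fun i hi => if_neg (by omega), fun c => ?_⟩
    beta_reduce
    rw [superComm_smul, LinearMap.rTensor_smul]
    simp [Finset.sum_range_succ]
  have h := h2.add ((hasCoeffs_nabla 𝒜 D).map φ)
  have e1 : ∀ E, φ E = -(LinearMap.lTensor A (insertWord 𝒜 (TensorAlgebra.ι k E)) ∘ₗ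
      chainParity 𝒜) := fun E => rfl
  simp only [e1, ← sub_eq_add_neg] at h
  exact h

variable (𝒜 D) in
/-- The Lie derivative of `∇_t` as a power series. -/
def lieSeries : PowerSeries (Module.End k (Chains k A)) := PowerSeries.mk (lieCoeff 𝒜 D)

variable (𝒜 D) in
/-- The operators of the star powers of `∇_t` as power series. -/
def starSeries (m : ℕ) : PowerSeries (Module.End k (Chains k A)) :=
  PowerSeries.mk fun r => bullet 𝒜 (starCoeff 𝒜 D m r)

/-- The commutator of the total differential with the star powers, as power series. -/
theorem totalDiff_mul_starSeries (hD : D ∈ 𝒜 1) (m : ℕ) :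
    PowerSeries.C (totalDiff 𝒜) * starSeries 𝒜 D m =
      starSeries 𝒜 D m * (PowerSeries.C (totalDiff 𝒜) + lieSeries 𝒜 D) +
        (PowerSeries.mk (defectCoeff 𝒜 D m) + m • PowerSeries.mk (defectCoeff 𝒜 D (m - 1))) := by
  have h1 := (hasCoeffs_starOp 𝒜 D m).map (LinearMap.mulLeft k (totalDiff 𝒜))
  have h2 := (hasCoeffs_starOp 𝒜 D m).map₂
    ((HasCoeffs.const (totalDiff 𝒜)).add (hasCoeffs_lieNabla 𝒜 D))
    (LinearMap.mul k (Module.End k (Chains k A)))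
  have h3 := h2.add ((hasCoeffs_starDefect 𝒜 D m).add
    ((hasCoeffs_starDefect 𝒜 D (m - 1)).map (m • LinearMap.id)))
  have h : (fun c : ℚ => LinearMap.mulLeft k (totalDiff 𝒜)
      (starOp 𝒜 (algebraMap ℚ k c • D) m)) = _ := funext fun c =>
    totalDiff_mul_starOp (𝒜 := 𝒜) ⟨algebraMap ℚ k c • D, Submodule.smul_mem _ _ hD⟩ m
  rw [h] at h1
  have h4 := h1.unique h3
  ext1 r
  have h5 := congrFun h4 r
  rw [PowerSeries.coeff_C_mul, map_add, PowerSeries.coeff_mul, map_add, map_nsmul]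
  simp only [starSeries, lieSeries, PowerSeries.coeff_mk, map_add, PowerSeries.coeff_C]
  exact h5

/-- The average over the permutations is superfluous once all distributions of the degree among
the factors are summed. -/
theorem sum_J (m r : ℕ) : ∑ c ∈ Finset.Nat.antidiagonalTuple m r, J 𝒜 (fun i => nablaCoeff 𝒜 D (c i)) =
    bullet 𝒜 (starCoeff 𝒜 D m r) := by
  have h : ∀ σ : Equiv.Perm (Fin m), ∑ c ∈ Finset.Nat.antidiagonalTuple m r,
      bullet 𝒜 (starProd (List.ofFn fun i => nablaCoeff 𝒜 D (c (σ i)))) =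
      bullet 𝒜 (starCoeff 𝒜 D m r) := by
    intro σ
    rw [starCoeff, map_sum]
    refine Finset.sum_equiv (Equiv.arrowCongr σ.symm (Equiv.refl ℕ)) (fun c => ?_) fun c _ => ?_
    · rw [Finset.Nat.mem_antidiagonalTuple, Finset.Nat.mem_antidiagonalTuple,
        ← Equiv.sum_comp σ c]
      rfl
    · rfl
  simp only [J]
  rw [← Finset.smul_sum, Finset.sum_comm, Finset.sum_congr rfl fun σ _ => h σ, Finset.sum_const,
    Finset.card_univ, Fintype.card_perm, Fintype.card_fin, ← Nat.cast_smul_eq_nsmul k, smul_smul,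
    ← map_natCast (algebraMap ℚ k), ← map_mul, one_div, inv_mul_cancel₀, map_one, one_smul]
  exact Nat.cast_ne_zero.2 m.factorial_ne_zero

/-- Only finitely many star powers contribute to a coefficient of `X (∇_t)`. -/
theorem coeff_X (r n : ℕ) (h : r < n) : PowerSeries.coeff r (X 𝒜 D) =
    ∑ m ∈ Finset.range n, algebraMap ℚ k ((-1) ^ m / m.factorial) •
      PowerSeries.coeff r (starSeries 𝒜 D m) := by
  rw [X, PowerSeries.coeff_mk]
  simp only [starSeries, PowerSeries.coeff_mk, sum_J]
  refine Finset.sum_subset (Finset.range_mono h) fun m _ hm => ?_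
  rw [Finset.mem_range, not_lt] at hm
  rw [starCoeff_of_lt hm, map_zero, smul_zero]

/-- The operator `X (∇_t)` intertwines the total differential with its perturbation by the Lie
derivative of `∇_t`. -/
theorem totalDiff_mul_X (hD : D ∈ 𝒜 1) :
    PowerSeries.C (totalDiff 𝒜) * X 𝒜 D =
      X 𝒜 D * (PowerSeries.C (totalDiff 𝒜) + lieSeries 𝒜 D) := by
  ext1 r
  -- in the exponential series the defects `starDefect m` and `m starDefect (m - 1)` telescope
  have hsum : ∀ n, ∑ m ∈ Finset.range (n + 1), algebraMap ℚ k ((-1) ^ m / m.factorial) •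
      (defectCoeff 𝒜 D m r + m • defectCoeff 𝒜 D (m - 1) r) =
      algebraMap ℚ k ((-1) ^ n / n.factorial) • defectCoeff 𝒜 D n r := by
    intro n
    induction n with
    | zero => simp
    | succ n ih =>
      rw [Finset.sum_range_succ, ih, smul_add, add_comm (algebraMap ℚ k _ • defectCoeff 𝒜 D (n + 1) r),
        ← add_assoc, Nat.add_sub_cancel, ← Nat.cast_smul_eq_nsmul k, smul_smul, ← add_smul,
        ← map_natCast (algebraMap ℚ k), ← map_mul, ← map_add]
      rw [show ((-1 : ℚ) ^ n / n.factorial + (-1) ^ (n + 1) / (n + 1).factorial * ((n + 1 : ℕ) : ℚ)) =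
        0 by rw [Nat.factorial_succ]; push_cast; field_simp; ring]
      rw [map_zero, zero_smul, zero_add]
  rw [PowerSeries.coeff_C_mul, coeff_X r (r + 1) (by omega), PowerSeries.coeff_mul, Finset.mul_sum]
  have h1 : ∀ x ∈ Finset.HasAntidiagonal.antidiagonal r, PowerSeries.coeff x.1 (X 𝒜 D) *
      PowerSeries.coeff x.2 (PowerSeries.C (totalDiff 𝒜) + lieSeries 𝒜 D) =
      ∑ m ∈ Finset.range (r + 1), algebraMap ℚ k ((-1) ^ m / m.factorial) •
        (PowerSeries.coeff x.1 (starSeries 𝒜 D m) *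
          PowerSeries.coeff x.2 (PowerSeries.C (totalDiff 𝒜) + lieSeries 𝒜 D)) := by
    intro x hx
    rw [Finset.HasAntidiagonal.mem_antidiagonal] at hx
    rw [coeff_X x.1 (r + 1) (by omega), Finset.sum_mul]
    simp only [smul_mul_assoc]
  rw [Finset.sum_congr rfl h1, Finset.sum_comm]
  have h2 : ∀ m, totalDiff 𝒜 * (algebraMap ℚ k ((-1) ^ m / m.factorial) •
      PowerSeries.coeff r (starSeries 𝒜 D m)) =
      ∑ x ∈ Finset.HasAntidiagonal.antidiagonal r, algebraMap ℚ k ((-1) ^ m / m.factorial) •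
        (PowerSeries.coeff x.1 (starSeries 𝒜 D m) *
          PowerSeries.coeff x.2 (PowerSeries.C (totalDiff 𝒜) + lieSeries 𝒜 D)) +
      algebraMap ℚ k ((-1) ^ m / m.factorial) •
        (defectCoeff 𝒜 D m r + m • defectCoeff 𝒜 D (m - 1) r) := by
    intro m
    have h := congrArg (PowerSeries.coeff r) (totalDiff_mul_starSeries hD m)
    rw [PowerSeries.coeff_C_mul, map_add, PowerSeries.coeff_mul, map_add, map_nsmul,
      PowerSeries.coeff_mk, PowerSeries.coeff_mk] at h
    rw [mul_smul_comm, h, smul_add, Finset.smul_sum]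
  simp only [h2]
  -- the remaining defect has no coefficient of degree `r ≤ m`
  rw [Finset.sum_add_distrib, hsum, defectCoeff_of_le le_rfl, smul_zero, add_zero]

end

section

variable {k : Type*} [CommRing k] [Algebra ℚ k] {A : Type*} [Ring A] [Algebra k A]
variable {𝒜 : ZMod 2 → Submodule k A} [GradedAlgebra 𝒜] {D : 𝒜 1}

/-! ### Conjugation by the exponential of the Lie derivative of `D` -/

section Weights

variable {M : Type*} [AddCommGroup M]

/-- The operations `-D²`, `[D, a]` and `(-1)^{deg a} a b` with weights `x`, `y` and `z`. -/
def wops (D : 𝒜 1) (x y z : ℤ) : Ops (Letter 𝒜) := { lops D with c₀ := x, c₁ := y, c₂ := z }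

theorem wops_par (x y z : ℤ) (l : List (Letter 𝒜)) : (wops D x y z).par l = (lops D).par l := by
  induction l with
  | nil => rfl
  | cons c l ih => rw [Ops.par_cons, Ops.par_cons, ih]; rfl

/-- The weighted version of `dC`. -/
def dW (D : 𝒜 1) (x y z : ℤ) (Φ : Letter 𝒜 → List (Letter 𝒜) → M) (a : Letter 𝒜)
    (l : List (Letter 𝒜)) : M :=
  y • Φ ((lops D).f a) l + z • hd (fun c l' => Φ ((lops D).m a c) l') l +
    sg ((lops D).p a) • (wops D x y z).cd (Φ a) l +
    z • lst (fun l' c => sg ((lops D).p c * ((lops D).p a + (lops D).par l')) •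
      Φ ((lops D).m c a) l') l

theorem wops_cd (x y z : ℤ) (F : List (Letter 𝒜) → M) (l : List (Letter 𝒜)) :
    (wops D x y z).cd F l = x • (wops D 1 0 0).cd F l + y • (wops D 0 1 0).cd F l +
      z • (wops D 0 0 1).cd F l := by
  induction l generalizing F with
  | nil => simp [wops, -zsmul_eq_mul]
  | cons c l ih =>
    simp only [Ops.cd_cons, ih (fun l => F (c :: l))]
    simp only [wops]
    module

theorem dC_eq (Φ : Letter 𝒜 → List (Letter 𝒜) → M) (a : Letter 𝒜) (l : List (Letter 𝒜)) :
    dC D Φ a l = dW D 1 0 0 Φ a l + dW D 0 1 0 Φ a l + dW D 0 0 1 Φ a l := by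
  have := wops_cd (D := D) 1 1 1 (Φ a) l
  rw [show wops D 1 1 1 = lops D from rfl] at this
  rw [dC, this]
  simp only [dW]
  module

theorem wops_cd_eq_spl (x y : ℤ) (F : List (Letter 𝒜) → M) (l : List (Letter 𝒜)) :
    (wops D x y 0).cd F l =
      x • spl (fun u v => sg ((lops D).par u) • F (u ++ (lops D).w :: v)) l +
      y • spl (fun u v => hd (fun c v' => sg ((lops D).par u) • F (u ++ (lops D).f c :: v')) v) l := by
  induction l generalizing F with
  | nil => simp [wops, -zsmul_eq_mul]
  | cons c l ih =>
    simp only [Ops.cd_cons, ih, spl_cons, hd_cons, Ops.par_nil, Ops.par_cons, sg_add, mul_smul,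
      spl_smul, List.nil_append, List.cons_append, hd_smul]
    simp only [wops, sg_zero]
    module

end Weights

/-- The element `D` as a homogeneous element. -/
def dL (D : 𝒜 1) : Letter 𝒜 := ⟨D, 1, D.2⟩

theorem lops_p_dL (D : 𝒜 1) : (lops D).p (dL D) = 0 := by
  change (1 + 1 : ZMod 2) = 0
  decide

theorem bar_letter (x : A) (u v : List (Letter 𝒜)) (c : Letter 𝒜) :
    x ⊗ₜ[k] bar (u ++ c :: v) =
      x ⊗ₜ[k] (bar u * (TensorAlgebra.ι k (toBar k A c.val) * bar v)) := by
  rw [bar_append, bar_cons]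

theorem lops_f_dL (D : 𝒜 1) : ((lops D).f (dL D)).val = (-2 : ℤ) • (lops D).w.val := by
  change superComm 𝒜 (D : A) (D : A) = (-2 : ℤ) • (-(D * D : A))
  rw [superComm_of_mem _ D.2, sg_one]
  module

theorem lops_m_dL (D : 𝒜 1) (c : Letter 𝒜) :
    ((lops D).m c (dL D)).val + ((lops D).m (dL D) c).val = -((lops D).f c).val := by
  change sg c.deg • (c.val * D : A) + sg 1 • (D * c.val : A) = -superComm 𝒜 (D : A) c.val
  rw [superComm_of_mem _ c.mem, sg_one]
  module

theorem lieDeriv_tmul (x : A) (l : List (Letter 𝒜)) :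
    lieDeriv (D : A) (x ⊗ₜ[k] bar l) = spl (fun u v => x ⊗ₜ[k] bar (u ++ dL D :: v)) l := by
  rw [lieDeriv, LinearMap.lTensor_tmul, conv_bar, tmul_spl]
  simp only [bar_append, bar_cons]
  rfl

/-- Insertion of `D` commutes with the operations on words up to operations of lower weight, as
`[D, D] = 2 D²` and `m (a, D) + m (D, a) = -[D, a]`. -/
theorem wops_cd_dL (x y z : ℤ) (e : A) (l : List (Letter 𝒜)) :
    spl (fun u v => (wops D x y z).cd (fun l => e ⊗ₜ[k] bar l) (u ++ dL D :: v)) l =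
      (wops D x y z).cd (fun l => spl (fun u v => e ⊗ₜ[k] bar (u ++ dL D :: v)) l) l +
        (wops D (-2 * y) (-z) 0).cd (fun l => e ⊗ₜ[k] bar l) l := by
  have h1 : ∀ u v : List (Letter 𝒜), e ⊗ₜ[k] bar (u ++ (lops D).f (dL D) :: v) =
      (-2 : ℤ) • e ⊗ₜ[k] bar (u ++ (lops D).w :: v) := fun u v => by
    rw [bar_letter, bar_letter, lops_f_dL, map_zsmul, map_zsmul, smul_mul_assoc, mul_smul_comm,
      tmul_zsmul]
  have h2 : ∀ (c : Letter 𝒜) (u v : List (Letter 𝒜)),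
      e ⊗ₜ[k] bar (u ++ (lops D).m (dL D) c :: v) =
        -(e ⊗ₜ[k] bar (u ++ (lops D).f c :: v)) - e ⊗ₜ[k] bar (u ++ (lops D).m c (dL D) :: v) :=
      fun c u v => by
    rw [bar_letter, bar_letter, bar_letter, eq_sub_of_add_eq' (lops_m_dL D c), map_sub, map_sub,
      map_neg, map_neg, sub_mul, mul_sub, neg_mul, mul_neg, TensorProduct.tmul_sub,
      TensorProduct.tmul_neg]
  simp only [Ops.cd_append]
  rw [wops_cd_eq_spl]
  have h3 := (wops D x y z).cd_spl (fun u v => e ⊗ₜ[k] bar (u ++ dL D :: v)) l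
  rw [show (fun l => spl (fun u v => e ⊗ₜ[k] bar (u ++ dL D :: v)) l) =
    spl (fun u v => e ⊗ₜ[k] bar (u ++ dL D :: v)) from rfl, h3]
  simp only [show (wops D x y z).f = (lops D).f from rfl, show (wops D x y z).m = (lops D).m from rfl,
    show (wops D x y z).c₁ = y from rfl, show (wops D x y z).c₂ = z from rfl,
    show (wops D x y z).p (dL D) = 0 from lops_p_dL D, add_zero, wops_par, h1, h2]
  have h4 := spl_lst_eq_spl_hd (fun u c v => sg ((lops D).par u) • z •
    e ⊗ₜ[k] bar (u ++ (lops D).m c (dL D) :: v)) l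
  simp only [spl_add, h4]
  have h5 : spl (fun u v => sg ((lops D).par u) • z • hd (fun c u' =>
        -(e ⊗ₜ[k] bar (u ++ (lops D).f c :: u')) - e ⊗ₜ[k] bar (u ++ (lops D).m c (dL D) :: u')) v) l =
      (-z) • spl (fun u v => hd (fun c v' => sg ((lops D).par u) •
        e ⊗ₜ[k] bar (u ++ (lops D).f c :: v')) v) l -
      spl (fun u v => hd (fun c v' => sg ((lops D).par u) • z •
        e ⊗ₜ[k] bar (u ++ (lops D).m c (dL D) :: v')) v) l := by
    rw [← spl_smul, ← spl_sub]
    refine spl_congr fun u v _ => ?_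
    cases v with
    | nil => simp
    | cons c v => simp only [hd_cons]; module
  have h6 : spl (fun u v => sg ((lops D).par u) • y • (-2 : ℤ) •
      e ⊗ₜ[k] bar (u ++ (lops D).w :: v)) l = (-2 * y) • spl (fun u v => sg ((lops D).par u) •
        e ⊗ₜ[k] bar (u ++ (lops D).w :: v)) l := by
    rw [← spl_smul]
    refine spl_congr fun u v _ => ?_
    module
  rw [h5, h6]
  abel

/-- The commutator with `L_D` of an operator that is given by the weighted operations. -/
theorem mul_lieDeriv {Θ Θ' : Module.End k (Chains k A)} (x y z : ℤ)
    (h : ∀ a l, Θ (a.val ⊗ₜ[k] bar l) = dW D x y z (fun a l => a.val ⊗ₜ[k] bar l) a l)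
    (h' : ∀ a l, Θ' (a.val ⊗ₜ[k] bar l) =
      dW D (-2 * y) (-z) 0 (fun a l => a.val ⊗ₜ[k] bar l) a l) :
    Θ * lieDeriv (D : A) = lieDeriv (D : A) * Θ + Θ' := by
  refine chains_ext (𝒜 := 𝒜) fun a l => ?_
  rw [LinearMap.add_apply, Module.End.mul_apply, Module.End.mul_apply, lieDeriv_tmul, map_spl, h, h']
  simp only [show ∀ u v : List (Letter 𝒜), Θ (a.val ⊗ₜ[k] bar (u ++ dL D :: v)) = _ from
    fun u v => h a _]
  simp only [dW, spl_add, spl_smul, map_add, map_zsmul, map_hd, map_lst, Ops.map_cd, lieDeriv_tmul,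
    wops_cd_dL]
  have e1 : spl (fun u v => hd (fun c l' => ((lops D).m a c).val ⊗ₜ[k] bar l') (u ++ dL D :: v)) l =
      ((lops D).m a (dL D)).val ⊗ₜ[k] bar l + hd (fun c l' => spl (fun u v =>
        ((lops D).m a c).val ⊗ₜ[k] bar (u ++ dL D :: v)) l') l := by
    simp only [hd_append, hd_cons, spl_add, spl_nl_left, hd_spl]
  have e2 : spl (fun u v => lst (fun l' c => sg ((lops D).p c * ((lops D).p a + (lops D).par l')) •
        ((lops D).m c a).val ⊗ₜ[k] bar l') (u ++ dL D :: v)) l =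
      ((lops D).m (dL D) a).val ⊗ₜ[k] bar l +
      lst (fun l' c => sg ((lops D).p c * ((lops D).p a + (lops D).par l')) • spl (fun u v =>
        ((lops D).m c a).val ⊗ₜ[k] bar (u ++ dL D :: v)) l') l := by
    have : ∀ (l' : List (Letter 𝒜)) (c : Letter 𝒜),
        sg ((lops D).p c * ((lops D).p a + (lops D).par l')) • spl (fun u v =>
          ((lops D).m c a).val ⊗ₜ[k] bar (u ++ dL D :: v)) l' =
        spl (fun u v => sg ((lops D).p c * ((lops D).p a + (lops D).par (u ++ dL D :: v))) •
          ((lops D).m c a).val ⊗ₜ[k] bar (u ++ dL D :: v)) l' := fun l' c => by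
      rw [← spl_smul]
      refine spl_congr fun u v h => ?_
      rw [← h, Ops.par_append, Ops.par_append, Ops.par_cons, lops_p_dL, zero_add]
    simp only [this, lst_spl, lst_append, nl_cons, zero_add, lst_cons, spl_add, lops_p_dL, zero_mul,
      sg_zero, one_smul, List.append_nil, spl_nl_right]
  have e3 := lops_m_dL D a
  have e4 : ((lops D).m (dL D) a).val ⊗ₜ[k] bar l = -(((lops D).f a).val ⊗ₜ[k] bar l) -
      ((lops D).m a (dL D)).val ⊗ₜ[k] bar l := by
    rw [eq_sub_of_add_eq' e3, TensorProduct.sub_tmul, TensorProduct.neg_tmul]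
  rw [e1, e2, e4]
  module

theorem insertWord_ι_bar (E : Cochains k A) (l : List (Letter 𝒜)) :
    insertWord 𝒜 (TensorAlgebra.ι k E) (bar l) = spl (fun u r' => sg ((lops D).par r') •
      spl (fun v r => bar u * (TensorAlgebra.ι k (toBar k A (E (bar v))) * bar r)) r') l := by
  have h := foldWord_ι_mul (insertStep 𝒜) LinearMap.id E 1
  rw [mul_one, foldWord_one] at h
  rw [insertWord, h]
  change conv LinearMap.id (conv (TensorAlgebra.ι k ∘ₗ toBar k A ∘ₗ E ∘ₗ sgn 𝒜)
    (LinearMap.id ∘ₗ sgn 𝒜)) _ = _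
  rw [conv_bar]
  refine spl_congr fun u r' _ => ?_
  rw [conv_bar, ← spl_smul, mul_spl]
  refine spl_congr fun v r h => ?_
  simp only [LinearMap.comp_apply, sgn_bar D, map_zsmul, LinearMap.id_apply]
  rw [smul_mul_smul_comm, ← sg_add, ← Ops.par_append, h, mul_smul_comm]

theorem spl_adCochain {M : Type*} [AddCommGroup M] (K : List (Letter 𝒜) → A →+ M)
    (l : List (Letter 𝒜)) : spl (fun v r => K r (adCochain 𝒜 (D : A) (bar v))) l =
      hd (fun c r => K r ((lops D).f c).val) l := by
  have h0 : adCochain 𝒜 (D : A) (bar ([] : List (Letter 𝒜))) = 0 := by simp [adCochain]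
  have h1 : ∀ c : Letter 𝒜, adCochain 𝒜 (D : A) (bar [c]) = ((lops D).f c).val := fun c => by
    have h := ιInv_ι_mul (k := k) (toBar k A c.val) 1
    rw [mul_one, map_one, one_smul] at h
    rw [bar_cons, bar_nil, mul_one, adCochain, LinearMap.comp_apply, h]
    rfl
  have h2 : ∀ (c d : Letter 𝒜) (l : List (Letter 𝒜)),
      adCochain 𝒜 (D : A) (bar (c :: d :: l)) = 0 := fun c d l => by
    simp [adCochain, ιInv_ι_mul, TensorAlgebra.algebraMapInv]
  rcases l with (_ | ⟨c, _ | ⟨d, l⟩⟩)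
  · rw [spl_nil, h0, map_zero, hd_nil]
  · simp only [spl_cons, spl_nil, h0, h1, map_zero, zero_add, hd_cons]
  · simp only [spl_cons, h0, h1, h2, map_zero, zero_add, hd_cons, spl_zero, add_zero]

theorem spl_zeroCochain {M : Type*} [AddCommGroup M] (K : List (Letter 𝒜) → A →+ M) (x : A)
    (l : List (Letter 𝒜)) : spl (fun v r => K r (zeroCochain (k := k) x (bar v))) l = K l x := by
  have h : ∀ l : List (Letter 𝒜), zeroCochain (k := k) x (bar l) = nl x l := by
    rintro (_ | ⟨c, l⟩) <;> simp [zeroCochain, TensorAlgebra.algebraMapInv]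
  simp only [h, map_nl]
  exact spl_nl_left (fun v => K v x) l

/-- `y ↦ a ⊗ u y r`. -/
def insLetter (a : A) (u r : List (Letter 𝒜)) : A →+ Chains k A :=
  (TensorProduct.mk k A (Words k A) a ∘ₗ LinearMap.mulLeft k (bar u) ∘ₗ
    LinearMap.mulRight k (bar r) ∘ₗ TensorAlgebra.ι k ∘ₗ toBar k A).toAddMonoidHom

theorem insLetter_apply (a : A) (u r : List (Letter 𝒜)) (y : A) : insLetter a u r y =
    a ⊗ₜ[k] (bar u * (TensorAlgebra.ι k (toBar k A y) * bar r)) := rfl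

theorem tmul_insertWord (a : A) (E : Cochains k A) (l : List (Letter 𝒜)) :
    a ⊗ₜ[k] insertWord 𝒜 (TensorAlgebra.ι k E) (bar l) = spl (fun u r' => sg ((lops D).par r') •
      spl (fun v r => insLetter a u r (E (bar v))) r') l := by
  rw [insertWord_ι_bar (D := D), tmul_spl]
  refine spl_congr fun u r' _ => ?_
  rw [tmul_zsmul, tmul_spl]
  rfl

theorem lieCoeff_one_tmul (a : Letter 𝒜) (l : List (Letter 𝒜)) :
    lieCoeff 𝒜 (D : A) 1 (a.val ⊗ₜ[k] bar l) =
      dW D 0 1 0 (fun a l => a.val ⊗ₜ[k] bar l) a l := by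
  rw [lieCoeff, if_pos rfl, LinearMap.sub_apply, LinearMap.comp_apply, chainParity_tmul D,
    map_zsmul, LinearMap.rTensor_tmul, LinearMap.lTensor_tmul, show nablaCoeff 𝒜 (D : A) 1 =
      adCochain 𝒜 (D : A) from rfl, tmul_insertWord (D := D), dW, wops_cd_eq_spl]
  simp only [spl_adCochain, zero_smul, one_smul, zero_add, add_zero]
  rw [sub_eq_add_neg]
  congr 1
  rw [← spl_smul, ← spl_smul, ← spl_neg]
  refine spl_congr fun u r' h => ?_
  cases r' with
  | nil => simp
  | cons c r =>
    rw [hd_cons, hd_cons, insLetter_apply, bar_letter, smul_smul, smul_smul, ← sg_add, ← sg_add,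
      ← neg_smul, ← sg_add_one, ← h, Ops.par_append, show (lops D).p a = a.deg + 1 from rfl]
    congr 2
    generalize a.deg = x, (lops D).par u = y, (lops D).par (c :: r) = z
    revert x y z
    decide

theorem lieCoeff_two_tmul (a : Letter 𝒜) (l : List (Letter 𝒜)) :
    lieCoeff 𝒜 (D : A) 2 (a.val ⊗ₜ[k] bar l) =
      dW D 1 0 0 (fun a l => a.val ⊗ₜ[k] bar l) a l := by
  have hw : nablaCoeff 𝒜 (D : A) 2 = zeroCochain (lops D).w.val :=
    (LinearMap.ext fun w => (smul_neg _ _).symm :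
      -zeroCochain (k := k) (D * D : A) = zeroCochain (-(D * D : A)))
  rw [lieCoeff, if_neg (by decide), zero_sub, LinearMap.neg_apply, LinearMap.comp_apply,
    chainParity_tmul D, map_zsmul, LinearMap.lTensor_tmul, hw, tmul_insertWord (D := D), dW,
    wops_cd_eq_spl]
  simp only [spl_zeroCochain, zero_smul, one_smul, zero_add, add_zero]
  rw [← spl_smul, ← spl_smul, ← spl_neg]
  refine spl_congr fun u r h => ?_
  rw [insLetter_apply, bar_letter, smul_smul, smul_smul, ← sg_add, ← sg_add,
      ← neg_smul, ← sg_add_one, ← h, Ops.par_append, show (lops D).p a = a.deg + 1 from rfl]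
  congr 2
  generalize a.deg = x, (lops D).par u = y, (lops D).par r = z
  revert x y z
  decide

/-- The Lie derivative of `∇` is the sum of the Lie derivatives of `ad D` and of `-D²`. -/
theorem lieNabla_eq (D : A) : lieNabla 𝒜 D = lieCoeff 𝒜 D 1 + lieCoeff 𝒜 D 2 := by
  rw [lieCoeff, lieCoeff, if_pos rfl, if_neg (by decide), lieNabla, nabla, sub_eq_add_neg,
    sub_eq_add_neg, map_add, map_add, LinearMap.lTensor_add, LinearMap.add_comp]
  simp only [nablaCoeff]
  abel

theorem bDiff_tmul (D : 𝒜 1) (a : Letter 𝒜) (l : List (Letter 𝒜)) :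
    bDiff 𝒜 (a.val ⊗ₜ[k] bar l) = dW D 0 0 1 (fun a l => a.val ⊗ₜ[k] bar l) a l := by
  have h := dC_tmul (D := D) a l
  rw [dC_eq, lieNabla_eq, LinearMap.add_apply, LinearMap.add_apply, lieCoeff_one_tmul,
    lieCoeff_two_tmul] at h
  rw [← sub_eq_zero] at h ⊢
  rw [← neg_eq_zero, ← h]
  abel

theorem dW_zero {M : Type*} [AddCommGroup M] (Φ : Letter 𝒜 → List (Letter 𝒜) → M) (a : Letter 𝒜)
    (l : List (Letter 𝒜)) : dW D 0 0 0 Φ a l = 0 := by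
  rw [dW, wops_cd_eq_spl]
  simp only [zero_smul, add_zero, smul_zero]

theorem dW_smul {M : Type*} [AddCommGroup M] (n x y : ℤ) (Φ : Letter 𝒜 → List (Letter 𝒜) → M)
    (a : Letter 𝒜) (l : List (Letter 𝒜)) : dW D (n * x) (n * y) 0 Φ a l = n • dW D x y 0 Φ a l := by
  rw [dW, dW, wops_cd_eq_spl, wops_cd_eq_spl]
  module

/-- `[b, L_D]` is minus the Lie derivative of `ad D`. -/
theorem bDiff_mul_lieDeriv (D : 𝒜 1) :
    bDiff 𝒜 * lieDeriv (D : A) = lieDeriv (D : A) * bDiff 𝒜 - lieCoeff 𝒜 (D : A) 1 := by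
  rw [sub_eq_add_neg]
  refine mul_lieDeriv 0 0 1 (bDiff_tmul D) fun a l => ?_
  rw [LinearMap.neg_apply, lieCoeff_one_tmul, ← neg_one_smul ℤ, ← dW_smul]
  rfl

/-- The commutator with `L_D` of the Lie derivative of `ad D`, by `[D, D] = 2 D²`. -/
theorem lieCoeff_one_mul_lieDeriv (D : 𝒜 1) : lieCoeff 𝒜 (D : A) 1 * lieDeriv (D : A) =
    lieDeriv (D : A) * lieCoeff 𝒜 (D : A) 1 - 2 • lieCoeff 𝒜 (D : A) 2 := by
  rw [sub_eq_add_neg]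
  refine mul_lieDeriv 0 1 0 lieCoeff_one_tmul fun a l => ?_
  rw [LinearMap.neg_apply, LinearMap.smul_apply, lieCoeff_two_tmul, ← natCast_zsmul, ← neg_smul,
    ← dW_smul]
  rfl

theorem lieCoeff_two_mul_lieDeriv (D : 𝒜 1) : lieCoeff 𝒜 (D : A) 2 * lieDeriv (D : A) =
    lieDeriv (D : A) * lieCoeff 𝒜 (D : A) 2 := by
  rw [← add_zero (lieDeriv (D : A) * lieCoeff 𝒜 (D : A) 2)]
  exact mul_lieDeriv 1 0 0 lieCoeff_two_tmul fun a l => (dW_zero _ _ _).symm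

/-- Connes' differential commutes with `L_D`: rotations permute the places where `D` is inserted.
-/
theorem BDiff_mul_lieDeriv (D : 𝒜 1) :
    BDiff 𝒜 * lieDeriv (D : A) = lieDeriv (D : A) * BDiff 𝒜 := by
  refine chains_ext (𝒜 := 𝒜) fun a l => ?_
  rw [Module.End.mul_apply, Module.End.mul_apply, lieDeriv_tmul, BDiff_tmul D, map_spl, map_spl]
  simp only [BDiff_tmul D, map_zsmul, chn_wd, lieDeriv_tmul, spl_append, spl_add]
  have h1 : spl (fun u v => spl (fun z' z'' => sg (((lops D).p a + (lops D).par z') *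
        (lops D).par (z'' ++ dL D :: v)) • (1 : A) ⊗ₜ[k] bar (z'' ++ dL D :: v ++ a :: z')) u) l =
      spl (fun p z => sg (((lops D).p a + (lops D).par p) * (lops D).par z) •
        spl (fun z' z'' => (1 : A) ⊗ₜ[k] bar (z' ++ dL D :: (z'' ++ a :: p))) z) l := by
    rw [← spl_assoc]
    refine spl_congr fun p z _ => ?_
    rw [← spl_smul]
    refine spl_congr fun z' z'' h => ?_
    rw [← h, Ops.par_append, Ops.par_append, Ops.par_cons, lops_p_dL, zero_add, List.append_assoc,
      List.cons_append]
  have h2 : spl (fun u v => spl (fun w' w'' => sg (((lops D).p a + (lops D).par (u ++ dL D :: w')) *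
        (lops D).par w'') • (1 : A) ⊗ₜ[k] bar (w'' ++ a :: (u ++ dL D :: w'))) v) l =
      spl (fun p z => sg (((lops D).p a + (lops D).par p) * (lops D).par z) •
        spl (fun w' w'' => (1 : A) ⊗ₜ[k] bar (z ++ a :: w' ++ dL D :: w'')) p) l := by
    rw [spl_assoc]
    refine spl_congr fun p z _ => ?_
    rw [← spl_smul]
    refine spl_congr fun z' z'' h => ?_
    rw [← h, Ops.par_append, Ops.par_append, Ops.par_cons, lops_p_dL, zero_add, List.append_assoc,
      List.cons_append]
  simp only [smul_add, spl_add]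
  rw [h1, h2]

theorem totalDiff_mul_lieDeriv (D : 𝒜 1) : totalDiff 𝒜 * lieDeriv (D : A) =
    lieDeriv (D : A) * totalDiff 𝒜 - lieCoeff 𝒜 (D : A) 1 := by
  rw [totalDiff, add_mul, mul_add, bDiff_mul_lieDeriv, BDiff_mul_lieDeriv]
  abel

/-- Conjugation of `d` by the exponential of `L` in a ring, given the iterated commutators
`-x = [d, L]`, `-2 y = [x, L]` and `[y, L] = 0`. -/
theorem pow_conjugation {R : Type*} [Ring R] {d L x y : R} (h0 : d * L = L * d - x)
    (h1 : x * L = L * x - 2 • y) (h2 : y * L = L * y) (n : ℕ) :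
    d * L ^ n + n • (x * L ^ (n - 1)) + (n * (n - 1)) • (y * L ^ (n - 2)) = L ^ n * d := by
  have h3 : ∀ n, x * L ^ n = L ^ n * x - (2 * n) • (y * L ^ (n - 1)) := by
    intro n
    have hc : ∀ n, y * L ^ n = L ^ n * y := fun n => (show Commute y L from h2).pow_right n
    induction n with
    | zero => simp
    | succ n ih =>
      rw [pow_succ, ← mul_assoc, ih, sub_mul, mul_assoc, h1, mul_sub, ← mul_assoc, smul_mul_assoc,
        mul_assoc y]
      rcases n with _ | n
      · simp
      · rw [Nat.add_sub_cancel, Nat.add_sub_cancel, ← pow_succ, mul_smul_comm, ← hc, sub_sub,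
          ← pow_succ, ← add_smul]
        congr 2
        ring
  induction n with
  | zero => simp
  | succ n ih =>
    have e : d * L ^ (n + 1) = L ^ n * d * L - n • (x * L ^ (n - 1) * L) -
        (n * (n - 1)) • (y * L ^ (n - 2) * L) := by
      rw [pow_succ, ← mul_assoc, ← ih, add_mul, add_mul, smul_mul_assoc, smul_mul_assoc]
      abel
    have e1 : n • (x * L ^ (n - 1) * L) = n • (x * L ^ n) := by
      rcases n with _ | n
      · simp
      · rw [Nat.add_sub_cancel, mul_assoc, ← pow_succ]
    have e2 : (n * (n - 1)) • (y * L ^ (n - 2) * L) = (n * (n - 1)) • (y * L ^ (n - 1)) := by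
      rcases n with _ | _ | n
      · simp
      · simp
      · rw [mul_assoc, ← pow_succ]
        rfl
    rw [e, e1, e2, mul_assoc, h0, Nat.add_sub_cancel, add_smul, one_smul, h3 n, mul_sub, ← mul_assoc,
      ← pow_succ, show n + 1 - 2 = n - 1 by omega]
    have e3 : ((n + 1) * n) • (y * L ^ (n - 1)) = (n * (n - 1)) • (y * L ^ (n - 1)) +
        (2 * n) • (y * L ^ (n - 1)) := by
      rw [← add_smul]
      congr 1
      rcases n with _ | n
      · rfl
      · rw [Nat.add_sub_cancel]; ring
    rw [e3]
    abel

theorem lieSeries_eq (D : A) : lieSeries 𝒜 D = PowerSeries.C (lieCoeff 𝒜 D 1) * PowerSeries.X +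
    PowerSeries.C (lieCoeff 𝒜 D 2) * PowerSeries.X ^ 2 := by
  ext1 n
  rw [lieSeries, PowerSeries.coeff_mk, map_add, PowerSeries.coeff_C_mul, PowerSeries.coeff_C_mul,
    PowerSeries.coeff_X, PowerSeries.coeff_X_pow]
  rcases n with _ | _ | _ | n
  · simp [lieCoeff, nablaCoeff]
  · simp
  · simp
  · simp [lieCoeff, nablaCoeff]

/-- Conjugation by `e^{t L_D}` removes the perturbation by the Lie derivative of `∇_t`. -/
theorem totalDiff_add_mul_expLie (D : 𝒜 1) :
    (PowerSeries.C (totalDiff 𝒜) + lieSeries 𝒜 (D : A)) * expLie (D : A) =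
      expLie (D : A) * PowerSeries.C (totalDiff 𝒜) := by
  have key := pow_conjugation (totalDiff_mul_lieDeriv D) (lieCoeff_one_mul_lieDeriv D)
    (lieCoeff_two_mul_lieDeriv D)
  have hs : ∀ (n m : ℕ) (q : ℚ) (x : Module.End k (Chains k A)), q * m = 1 / n.factorial →
      algebraMap ℚ k q • (m • x) = algebraMap ℚ k (1 / n.factorial) • x := fun n m q x h => by
    rw [← Nat.cast_smul_eq_nsmul k, smul_smul, ← map_natCast (algebraMap ℚ k), ← map_mul, h]
  ext1 n
  rw [lieSeries_eq, add_mul, add_mul, map_add, map_add, PowerSeries.coeff_C_mul,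
    PowerSeries.coeff_mul_C, mul_assoc, mul_assoc, PowerSeries.coeff_C_mul, PowerSeries.coeff_C_mul,
    expLie, PowerSeries.coeff_mk, mul_smul_comm, smul_mul_assoc, ← key n, smul_add, smul_add,
    ← add_assoc]
  congr 1
  · congr 1
    rcases n with _ | n
    · simp
    · rw [PowerSeries.coeff_succ_X_mul, PowerSeries.coeff_mk, Nat.add_sub_cancel, hs n,
        mul_smul_comm]
      rw [Nat.factorial_succ]
      push_cast
      field_simp
  · rw [pow_two, mul_assoc]
    rcases n with _ | _ | n
    · simp
    · simp [PowerSeries.coeff_succ_X_mul]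
    · rw [PowerSeries.coeff_succ_X_mul, PowerSeries.coeff_succ_X_mul, PowerSeries.coeff_mk,
        Nat.add_sub_cancel, hs n, mul_smul_comm]
      · rfl
      rw [Nat.factorial_succ, Nat.factorial_succ]
      push_cast
      field_simp

/-- The Chern character commutes with the total differential. -/
theorem totalDiff_mul_ch {D : A} (hD : D ∈ 𝒜 1) :
    PowerSeries.C (totalDiff 𝒜) * ch 𝒜 D = ch 𝒜 D * PowerSeries.C (totalDiff 𝒜) := by
  rw [ch, ← mul_assoc, totalDiff_mul_X hD, mul_assoc, totalDiff_add_mul_expLie ⟨D, hD⟩, mul_assoc]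

end

section

variable {k : Type*} [CommRing k] [Algebra ℚ k] {A : Type*} [Ring A] [Algebra k A]
variable {𝒜 : ZMod 2 → Submodule k A} [GradedAlgebra 𝒜] {D : 𝒜 1}

/-! ### The Chern character preserves the parity -/

theorem chainParity_chn {x : A} {p : ZMod 2} (hx : x ∈ 𝒜 p) {X : TensorAlgebra k A} {q : ZMod 2}
    (hX : mapWord (shift 𝒜) X = sg q • X) : chainParity 𝒜 (chn x X) = sg (p + q) • chn x X := by
  rw [chn, chainParity, TensorProduct.map_tmul, parity_of_mem hx, ← mapWord_toBar_shift, hX,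
    map_zsmul, zsmul_tmul, tmul_zsmul, smul_smul, sg_add]

theorem rot_zsmul_congr {M : Type*} [AddCommGroup M] {F G : List (Letter 𝒜) → List (Letter 𝒜) → M}
    {a : Letter 𝒜} {l : List (Letter 𝒜)} (n : ℤ)
    (h : ∀ x y, (lops D).par x + (lops D).par y = (lops D).p a + (lops D).par l →
      F x y = n • G x y) : rot D F a l = n • rot D G a l := by
  rw [rot, rot, ← spl_smul]
  refine spl_congr fun p z hl => ?_
  rw [smul_comm n, ← spl_smul n]
  congr 1
  refine spl_congr fun u y hp => h _ _ ?_
  rw [← hl, ← hp]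
  simp only [Ops.par_append, Ops.par_cons]
  abel

theorem chainParity_act₁ (a : Letter 𝒜) (l : List (Letter 𝒜)) (E : Parallel D)
    (V : List (Parallel D)) : chainParity 𝒜 (act₁ a l E V) =
      sg (a.deg + (lops D).par l + (sops D).par V) • act₁ a l E V := by
  rw [act₁, map_spl, ← spl_smul]
  refine spl_congr fun u v h => ?_
  rw [chainParity_chn (SetLike.mul_mem_graded a.mem (E.ev_mem u)) (shift_ins V v), ← h,
    Ops.par_append, add_assoc, add_assoc, add_assoc]

/-- The action of a string of `m + 1` cochains changes the parity by `m`. -/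
theorem chainParity_act (a : Letter 𝒜) (l : List (Letter 𝒜)) (E : Parallel D)
    (V : List (Parallel D)) : chainParity 𝒜 (act a l E V) =
      sg (a.deg + (lops D).par l + (sops D).par V) • act a l E V := by
  have hp : (lops D).p a = a.deg + 1 := rfl
  rw [act, map_add, map_add, smul_add, smul_add, chainParity_act₁]
  congr 1
  · congr 1
    rw [act₂, map_lst, ← lst_smul]
    refine lst_congr fun V' E' h => ?_
    rw [map_zsmul, map_rot, smul_comm]
    congr 1
    refine rot_zsmul_congr _ fun x y hxy => ?_
    rw [chainParity_act₁, ← h, Ops.par_append, Ops.par_cons, Ops.par_nil,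
      show (sops D).p E' = 1 from rfl, show (E'.lt x).deg = (lops D).par x from rfl, hxy, hp]
    congr 2
    generalize a.deg = x, (lops D).par l = y, (sops D).par V' = z
    revert x y z
    decide
  · rw [act₃, map_zsmul, map_spl, smul_comm,
      ← spl_smul (sg (a.deg + (lops D).par l + (sops D).par V))]
    congr 1
    refine spl_congr fun U P h => ?_
    rw [map_zsmul, map_rot, smul_comm]
    congr 1
    refine rot_zsmul_congr _ fun x y hxy => ?_
    have hs : mapWord (shift 𝒜) (ins P x * insF (E :: U) y) =
        sg ((lops D).par x + (sops D).par P + ((lops D).par y + (sops D).par (E :: U))) •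
          (ins P x * insF (E :: U) y) := by
      rw [mapWord_mul, shift_ins, shift_insF, smul_mul_smul_comm, ← sg_add]
    rw [map_zsmul, chainParity_chn (SetLike.GradedOne.one_mem : (1 : A) ∈ 𝒜 0) hs, smul_comm, ← h, Ops.par_append,
      Ops.par_cons, show (sops D).p E = 1 from rfl,
      show a.deg = (lops D).par x + (lops D).par y + 1 + (lops D).par l by
        rw [hxy, hp]
        generalize a.deg = x, (lops D).par l = y
        revert x y
        decide]
    congr 2
    generalize (lops D).par x = x, (lops D).par y = y, (sops D).par U = u, (sops D).par P = p,
      (lops D).par l = l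
    revert x y u p l
    decide

/-- The star product with an even cochain respects the number of cochains modulo `2`. -/
theorem iS_sg {M : Type*} [AddCommGroup M] (m : ℕ) (ψ : ℕ → List ℕ → M) :
    iS^[m] (fun n V => sg (mops.par V) • ψ n V) = fun n V => sg (mops.par V) • iS^[m] ψ n V := by
  induction m generalizing ψ with
  | zero => rfl
  | succ m ih =>
    rw [Function.iterate_succ_apply, Function.iterate_succ_apply, ← ih]
    congr 1
    funext n V
    rw [iS, iS, smul_add, jS, jS, ← spl_smul]
    congr 1
    refine spl_congr fun U P h => ?_
    simp only [Ops.par_append, mops_par_cons]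
    rw [iops_cd_sg fun q => sg (q + (1 + mops.par U)), smul_comm (sg (mops.par V)), ← h, Ops.par_append]
    congr 3
    generalize mops.par U = x, mops.par P = y
    revert x y
    decide

/-- The star powers of `∇` are sums of strings with an odd number of cochains. -/
theorem chainParity_mul_starOp (D : 𝒜 1) (m : ℕ) :
    chainParity 𝒜 * starOp 𝒜 (D : A) m = starOp 𝒜 (D : A) m * chainParity 𝒜 := by
  refine chains_ext (𝒜 := 𝒜) fun a l => ?_
  have h : starOp 𝒜 (D : A) m (a.val ⊗ₜ[k] bar l) =
      starS m (fun n V => act a l (nablaP D ^ n) (V.map (nablaP D ^ ·))) := by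
    have h := map_iS (LinearMap.applyₗ (a.val ⊗ₜ[k] bar l) ∘ₗ bullet 𝒜) m (powStr D) 0 []
    simp only [LinearMap.comp_apply, LinearMap.applyₗ_apply_apply] at h
    rw [starOp, show nabla 𝒜 (D : A) = (nablaP D).toCochain from rfl, starProd_eq, starS, h, starS]
    simp only [powStr, bullet_tmul]
  rw [Module.End.mul_apply, Module.End.mul_apply, chainParity_tmul D, map_zsmul, h, starS, map_iS]
  simp only [chainParity_act, sops_par_map, sg_add (_ + _), mul_smul]
  refine (congrFun (congrFun (congrArg _ ?_) 0) [] : _ = iS^[m] (fun n V => sg (mops.par V) •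
    (sg (a.deg + (lops D).par l) • act a l (nablaP D ^ n) (V.map (nablaP D ^ ·)))) 0 []).trans ?_
  · funext n V
    rw [smul_comm]
  · rw [iS_sg]
    beta_reduce
    rw [Ops.par_nil, sg_zero, one_smul]
    exact (map_iS (DistribSMul.toAddMonoidHom (Chains k A) (sg (a.deg + (lops D).par l))) m _ 0
      []).symm

theorem chainParity_mul_X {D : A} (hD : D ∈ 𝒜 1) :
    PowerSeries.C (chainParity 𝒜) * X 𝒜 D = X 𝒜 D * PowerSeries.C (chainParity 𝒜) := by
  have h : ∀ m r, chainParity 𝒜 * bullet 𝒜 (starCoeff 𝒜 D m r) =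
      bullet 𝒜 (starCoeff 𝒜 D m r) * chainParity 𝒜 := fun m r => by
    have h1 := (hasCoeffs_starOp 𝒜 D m).map (LinearMap.mulLeft k (chainParity 𝒜))
    have h2 := (hasCoeffs_starOp 𝒜 D m).map (LinearMap.mulRight k (chainParity 𝒜))
    have h : (fun c : ℚ => LinearMap.mulLeft k (chainParity 𝒜)
        (starOp 𝒜 (algebraMap ℚ k c • D) m)) = _ := funext fun c =>
      chainParity_mul_starOp (𝒜 := 𝒜) ⟨algebraMap ℚ k c • D, Submodule.smul_mem _ _ hD⟩ m
    rw [h] at h1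
    exact congrFun (h1.unique h2) r
  ext1 r
  rw [PowerSeries.coeff_C_mul, PowerSeries.coeff_mul_C, coeff_X r (r + 1) (by omega),
    Finset.mul_sum, Finset.sum_mul]
  refine Finset.sum_congr rfl fun m _ => ?_
  rw [mul_smul_comm, smul_mul_assoc, starSeries, PowerSeries.coeff_mk, h]

theorem chainParity_mul_lieDeriv (D : 𝒜 1) :
    chainParity 𝒜 * lieDeriv (D : A) = lieDeriv (D : A) * chainParity 𝒜 := by
  refine chains_ext (𝒜 := 𝒜) fun a l => ?_
  rw [Module.End.mul_apply, Module.End.mul_apply, chainParity_tmul D, map_zsmul, lieDeriv_tmul,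
    map_spl, ← spl_smul]
  refine spl_congr fun u v h => ?_
  rw [chainParity_tmul D, ← h, Ops.par_append, Ops.par_append, Ops.par_cons, lops_p_dL, zero_add]

/-- The Chern character preserves the parity of chains. -/
theorem chainParity_mul_ch {D : A} (hD : D ∈ 𝒜 1) :
    PowerSeries.C (chainParity 𝒜) * ch 𝒜 D = ch 𝒜 D * PowerSeries.C (chainParity 𝒜) := by
  have h : PowerSeries.C (chainParity 𝒜) * expLie D = expLie D * PowerSeries.C (chainParity 𝒜) := by
    ext1 n
    rw [PowerSeries.coeff_C_mul, PowerSeries.coeff_mul_C, expLie, PowerSeries.coeff_mk,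
      mul_smul_comm, smul_mul_assoc]
    congr 1
    exact (show Commute (chainParity 𝒜) (lieDeriv D) from
      chainParity_mul_lieDeriv ⟨D, hD⟩).pow_right n
  rw [ch, ← mul_assoc, chainParity_mul_X hD, mul_assoc, h, mul_assoc]

/-- The Chern character commutes with the total differential wherever it converges. -/
theorem totalDiff_ch_of_tendsto {D : A} (hD : D ∈ 𝒜 1) {F : Type*} [AddCommGroup F] [Module k F]
    [TopologicalSpace F] [T2Space F] (u : Chains k A →ₗ[k] F) (d : F →ₗ[k] F) (hd : Continuous d)
    (hu : u ∘ₗ totalDiff 𝒜 = d ∘ₗ u) (α : Chains k A) (s s' : F)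
    (hs : Filter.Tendsto (fun M => ∑ N ∈ Finset.range M, u (PowerSeries.coeff N (ch 𝒜 D) α))
      Filter.atTop (nhds s))
    (hs' : Filter.Tendsto (fun M => ∑ N ∈ Finset.range M,
      u (PowerSeries.coeff N (ch 𝒜 D) (totalDiff 𝒜 α))) Filter.atTop (nhds s')) : d s = s' := by
  refine tendsto_nhds_unique ((hd.tendsto s).comp hs) (hs'.congr fun M => ?_)
  rw [Function.comp_apply, map_sum]
  refine Finset.sum_congr rfl fun N _ => ?_
  have h := congrArg (PowerSeries.coeff N) (totalDiff_mul_ch (𝒜 := 𝒜) hD)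
  rw [PowerSeries.coeff_C_mul, PowerSeries.coeff_mul_C] at h
  rw [← Module.End.mul_apply, ← h, Module.End.mul_apply]
  exact LinearMap.congr_fun hu _

end

section

variable {k : Type*} [CommRing k] [Algebra ℚ k] {A : Type*} [Ring A] [Algebra k A]
variable {𝒜 : ZMod 2 → Submodule k A} [GradedAlgebra 𝒜]

/-! ### The component in `A` of the operators of the star powers -/

section Component

variable {D : 𝒜 1}

theorem degreeZero_tmul (x : A) (w : Words k A) :
    degreeZero (x ⊗ₜ[k] w) = TensorAlgebra.algebraMapInv (R := k) w • x := by
  simp [degreeZero]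

theorem degreeZero_chn_wd (x : A) (l : List (Letter 𝒜)) :
    degreeZero (chn (k := k) x (wd l)) = nl x l := by
  rw [chn_wd, degreeZero_tmul]
  cases l <;> simp [TensorAlgebra.algebraMapInv]

theorem degreeZero_chn_mul_insF (x : A) (X : TensorAlgebra k A) (E : Parallel D)
    (V : List (Parallel D)) (l : List (Letter 𝒜)) :
    degreeZero (chn (k := k) x (X * insF (E :: V) l)) = 0 := by
  rw [insF_cons, mul_smul_comm, ← chnL_apply, map_zsmul, map_zsmul, mul_spl, map_spl, map_spl,
    spl_congr (G := fun _ _ => 0), spl_zero, smul_zero]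
  intro u v _
  rw [chnL_apply, chn, degreeZero_tmul, mapWord_mul, mapWord_mul, map_mul, map_mul]
  simp [mapWord, TensorAlgebra.algebraMapInv]

theorem degreeZero_chn_ins (x : A) (E : Parallel D) (V : List (Parallel D))
    (l : List (Letter 𝒜)) : degreeZero (chn (k := k) x (ins (E :: V) l)) = 0 := by
  rw [show ins (E :: V) l = spl (fun u r => wd u * insF (E :: V) r) l from rfl, ← chnL_apply,
    map_spl, map_spl, spl_congr (G := fun _ _ => 0), spl_zero]
  intro u v _
  rw [chnL_apply, degreeZero_chn_mul_insF]

theorem degreeZero_act₁ (a : Letter 𝒜) (l : List (Letter 𝒜)) (E : Parallel D)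
    (V : List (Parallel D)) : degreeZero (act₁ a l E V) = nl (a.val * E.ev l) V := by
  cases V with
  | nil =>
    simp only [act₁, ins, map_spl, degreeZero_chn_wd]
    exact spl_nl_right (fun u => a.val * E.ev u) l
  | cons E' V => simp only [act₁, map_spl, degreeZero_chn_ins, spl_zero, nl_cons]

/-- The chains of the third part have letters behind the first one. -/
theorem degreeZero_act₃ (a : Letter 𝒜) (l : List (Letter 𝒜)) (E : Parallel D)
    (V : List (Parallel D)) : degreeZero (act₃ a l E V) = 0 := by
  simp only [act₃, map_zsmul, map_spl, map_rot, degreeZero_chn_mul_insF, smul_zero, rot, spl_zero]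

/-- For strings with an odd number of cochains the component in `A` comes from `•₁` only. -/
theorem degreeZero_act (a : Letter 𝒜) (l : List (Letter 𝒜)) (E : Parallel D)
    {V : List (Parallel D)} (hV : (sops D).par V = 0) :
    degreeZero (act a l E V) = nl (a.val * E.ev l) V := by
  rw [act, map_add, map_add, degreeZero_act₁, degreeZero_act₃, add_zero, add_eq_left, act₂,
    map_lst, lst_congr (G := fun _ _ => (0 : ℤ) • 0), lst_smul, zero_smul]
  -- `V` has even length, so that a cochain besides `E'` stands behind the first letter
  rintro (_ | ⟨F, V'⟩) E' rfl
  · exact absurd hV (by change (1 + 0 : ZMod 2) ≠ 0; decide)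
  · simp only [map_zsmul, rot, map_spl, degreeZero_act₁, nl_cons, spl_zero, smul_zero]

/-- For functions supported on strings of length one the star powers are the powers. -/
theorem iS_iterate_of_nil {M : Type*} [AddCommGroup M] {χ : ℕ → List ℕ → M}
    (h : ∀ n c V, χ n (c :: V) = 0) (m n : ℕ) : iS^[m] χ n [] = χ (n + m) [] := by
  induction m generalizing χ with
  | zero => rfl
  | succ m ih =>
    have hj : ∀ n V, jS χ n V = 0 := fun n V => by
      rw [jS, spl_congr (G := fun _ _ => 0), spl_zero]
      intro U P _
      rw [show (fun Q => χ 0 (Q ++ n :: U)) = fun _ => 0 from funext fun Q => by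
        cases Q <;> exact h _ _ _, Ops.cd_zero, smul_zero]
    rw [Function.iterate_succ_apply, ih fun n c V => by rw [iS, h, hj, add_zero], iS, hj, add_zero,
      add_assoc]

/-- The star powers are sums of strings with an odd number of cochains, so that the values of a
function at the other strings are immaterial. The function is symmetrized by the sign operator of
strings, which makes the vanishing hypothesis that of `iS_iterate_of_nil` at the expense of a
factor `2`. -/
theorem starS_of_even {ψ : ℕ → List ℕ → A}
    (h : ∀ n c V, mops.par (c :: V) = 0 → ψ n (c :: V) = 0) (m : ℕ) :
    algebraMap ℚ k 2 • starS m ψ = algebraMap ℚ k 2 • ψ m [] := by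
  have h2 : ∀ x : A, algebraMap ℚ k 2 • x = x + x := fun x => by
    rw [map_ofNat, two_smul]
  have h3 := iS_iterate_of_nil (χ := ψ + fun n V => sg (mops.par V) • ψ n V)
    (fun n c V => by
      rw [Pi.add_apply, Pi.add_apply]
      rcases (by decide : ∀ p : ZMod 2, p = 0 ∨ p = 1) (mops.par (c :: V)) with hp | hp
      · rw [h _ _ _ hp, smul_zero, add_zero]
      · rw [hp, sg_one, neg_one_smul, add_neg_cancel]) m 0
  rw [iS_iterate_add, iS_sg, zero_add] at h3
  simp only [Pi.add_apply, Ops.par_nil, sg_zero, one_smul] at h3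
  rw [h2, h2]
  exact h3

/-- The component in `A` of `α • (∇ ⋆ ⋯ ⋆ ∇)`. -/
theorem degreeZero_starOp (D : 𝒜 1) (m : ℕ) : degreeZero ∘ₗ starOp 𝒜 (D : A) m =
    LinearMap.mul' k A ∘ₗ LinearMap.lTensor A (nablaP D ^ m).toCochain := by
  refine chains_ext (𝒜 := 𝒜) fun a l => ?_
  have h := map_iS (degreeZero ∘ₗ LinearMap.applyₗ (a.val ⊗ₜ[k] bar l) ∘ₗ bullet 𝒜) m (powStr D) 0 []
  simp only [LinearMap.comp_apply, LinearMap.applyₗ_apply_apply] at h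
  rw [LinearMap.comp_apply, starOp, show nabla 𝒜 (D : A) = (nablaP D).toCochain from rfl,
    starProd_eq, starS, h]
  simp only [powStr, bullet_tmul]
  have h2 := starS_of_even (k := k) (ψ := fun n V => degreeZero (act a l (nablaP D ^ n)
    (V.map (nablaP D ^ ·)))) (fun n c V hV => by
      rw [degreeZero_act _ _ _ (by rw [sops_par_map, hV]), List.map_cons, nl_cons]) m
  have h3 := congrArg (algebraMap ℚ k (1 / 2) • ·) h2
  simp only [smul_smul, ← map_mul] at h3
  rw [show (1 / 2 * 2 : ℚ) = 1 by norm_num, map_one, one_smul, one_smul, List.map_nil,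
    degreeZero_act _ _ _ rfl, nl_nil] at h3
  exact h3

end Component

/-! ### The formal series of the component in `A` -/

/-- The powers of a cochain for the cup product. -/
def cupPow (E : Cochains k A) : ℕ → Cochains k A
  | 0 => zeroCochain 1
  | m + 1 => cup E (cupPow E m)

theorem nablaP_pow_toCochain (D : 𝒜 1) (m : ℕ) :
    (nablaP D ^ m).toCochain = cupPow (nabla 𝒜 (D : A)) m := by
  induction m with
  | zero => rfl
  | succ m ih => rw [pow_succ', cupPow, ← ih]; rfl

variable (𝒜) in
/-- The cup product with `∇_t` as a power series. -/
def cupNabla (D : A) : PowerSeries (Module.End k (Cochains k A)) :=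
  PowerSeries.mk fun i => cup (nablaCoeff 𝒜 D i)

/-- The coefficients of the cup powers of `∇_t`. -/
theorem hasCoeffs_cupPow (D : A) (m : ℕ) :
    HasCoeffs k (fun c => cupPow (nabla 𝒜 (algebraMap ℚ k c • D)) m)
      (fun r => PowerSeries.coeff r (cupNabla 𝒜 D ^ m) (zeroCochain 1)) := by
  induction m with
  | zero =>
    have e : (fun r => (PowerSeries.coeff r (cupNabla 𝒜 D ^ 0) : Module.End k (Cochains k A))
        (zeroCochain 1)) =
        fun r => if r = 0 then zeroCochain (k := k) (1 : A) else 0 := funext fun r => by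
      rw [pow_zero, PowerSeries.coeff_one]
      split_ifs <;> rfl
    rw [e]
    exact HasCoeffs.const (k := k) (zeroCochain (k := k) (1 : A))
  | succ m ih =>
    have e : (fun r => (PowerSeries.coeff r (cupNabla 𝒜 D ^ (m + 1)) : Module.End k (Cochains k A))
        (zeroCochain 1)) =
        fun r => ∑ x ∈ Finset.HasAntidiagonal.antidiagonal r, cup (nablaCoeff 𝒜 D x.1)
          (PowerSeries.coeff x.2 (cupNabla 𝒜 D ^ m) (zeroCochain 1)) := funext fun r => by
      rw [pow_succ', PowerSeries.coeff_mul, LinearMap.sum_apply]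
      simp only [cupNabla, PowerSeries.coeff_mk]
      rfl
    rw [e]
    exact HasCoeffs.map₂ (hasCoeffs_nabla 𝒜 D) ih cup

/-- The map `a ⊗ w ↦ a E (w)` for a cochain `E`. -/
def evalChain : Cochains k A →ₗ[k] Chains k A →ₗ[k] A :=
  LinearMap.llcomp k _ _ _ (LinearMap.mul' k A) ∘ₗ LinearMap.lTensorHom A

theorem evalChain_tmul (E : Cochains k A) (a : A) (w : Words k A) :
    evalChain E (a ⊗ₜ[k] w) = a * E w := rfl

theorem degreeZero_starSeries {D : A} (hD : D ∈ 𝒜 1) (m r : ℕ) :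
    degreeZero ∘ₗ PowerSeries.coeff r (starSeries 𝒜 D m) =
      evalChain (PowerSeries.coeff r (cupNabla 𝒜 D ^ m) (zeroCochain 1)) := by
  have h1 := (hasCoeffs_starOp 𝒜 D m).map (LinearMap.llcomp k _ _ _ degreeZero)
  have h2 := (hasCoeffs_cupPow (𝒜 := 𝒜) D m).map evalChain
  have h : (fun c : ℚ => LinearMap.llcomp k _ _ _ degreeZero
      (starOp 𝒜 (algebraMap ℚ k c • D) m)) =
        fun c => evalChain (cupPow (nabla 𝒜 (algebraMap ℚ k c • D)) m) := funext fun c =>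
    (degreeZero_starOp (𝒜 := 𝒜) ⟨algebraMap ℚ k c • D, Submodule.smul_mem _ _ hD⟩ m).trans (by
      rw [nablaP_pow_toCochain]
      rfl)
  rw [h] at h1
  rw [starSeries, PowerSeries.coeff_mk]
  exact congrFun (h1.unique h2) r

/-- Insertion of `D` into words. -/
def insD (D : A) : Words k A →ₗ[k] Words k A :=
  conv LinearMap.id (LinearMap.mulLeft k (TensorAlgebra.ι k (toBar k A D)))

/-- The derivation `E ↦ E ∘ L_D` of the algebra of cochains. -/
def cochainDer (D : A) : Module.End k (Cochains k A) := LinearMap.lcomp k A (insD D)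

theorem cochainDer_pow (D : A) (j : ℕ) (E : Cochains k A) (w : Words k A) :
    (cochainDer D ^ j) E w = E ((insD D ^ j) w) := by
  induction j generalizing E with
  | zero => rfl
  | succ j ih => rw [pow_succ, Module.End.mul_apply, ih, pow_succ']; rfl

/-- `e^{t L_D}` on cochains. -/
def expCochainDer (D : A) : PowerSeries (Module.End k (Cochains k A)) :=
  PowerSeries.mk fun j => algebraMap ℚ k (1 / j.factorial) • cochainDer D ^ j

theorem cup_zeroCochain (x : A) (E : Cochains k A) (w : Words k A) :
    cup (zeroCochain x) E w = x * E w := by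
  have h : ∀ d : Words k A ⊗[k] Words k A, LinearMap.mul' k A (TensorProduct.map (zeroCochain x) E d) =
      x * E (TensorProduct.lid k _ (TensorProduct.map TensorAlgebra.algebraMapInv.toLinearMap
        LinearMap.id d)) := by
    intro d
    induction d using TensorProduct.induction_on with
    | zero => simp
    | tmul u v => simp [zeroCochain]
    | add u v hu hv => simp only [map_add, mul_add, hu, hv]
  exact (h _).trans (by rw [counit_deconcat])

theorem cup_adCochain_one (D : A) (E : Cochains k A) : cup (adCochain 𝒜 D) E 1 = 0 := by
  change conv _ _ _ = _
  simp [conv, adCochain]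

theorem cup_adCochain (D : A) (E : Cochains k A) (c : A) (w : Words k A) :
    cup (adCochain 𝒜 D) E (TensorAlgebra.ι k (toBar k A c) * w) = superComm 𝒜 D c * E w := by
  have h : adCochain 𝒜 D ∘ₗ LinearMap.mulLeft k (TensorAlgebra.ι k (toBar k A c)) =
      zeroCochain (superComm 𝒜 D c) := LinearMap.ext fun w => by
    rw [LinearMap.comp_apply, LinearMap.mulLeft_apply, adCochain, LinearMap.comp_apply, ιInv_ι_mul,
      map_smul]
    rfl
  change conv _ _ _ = _
  rw [conv_ι_mul, h, show adCochain 𝒜 D 1 = 0 by simp [adCochain], zero_mul, zero_add]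
  exact cup_zeroCochain _ _ _

theorem insD_bar (D : 𝒜 1) (l : List (Letter 𝒜)) :
    insD (D : A) (bar l) = spl (fun u v => bar (u ++ dL D :: v)) l := by
  rw [insD, conv_bar]
  simp only [bar_append, bar_cons]
  rfl

theorem cochainDer_one (D : 𝒜 1) : cochainDer (D : A) (zeroCochain (k := k) (1 : A)) = 0 := by
  refine words_ext (𝒜 := 𝒜) fun l => ?_
  change zeroCochain 1 (insD (D : A) (bar l)) = 0
  rw [insD_bar, map_spl, spl_congr (G := fun _ _ => 0), spl_zero]
  intro u v _
  rw [bar_append, bar_cons]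
  simp [zeroCochain, TensorAlgebra.algebraMapInv]

/-- The commutator of `L_D` and the cup product with `ad D` is the cup product with `[D, D] = 2
D²`. -/
theorem cup_ad_mul_cochainDer (D : 𝒜 1) :
    cup (adCochain 𝒜 (D : A)) * cochainDer (D : A) + (cup (zeroCochain (k := k) (D * D : A)) +
      cup (zeroCochain (D * D : A))) = cochainDer (D : A) * cup (adCochain 𝒜 (D : A)) := by
  refine LinearMap.ext fun E => words_ext (𝒜 := 𝒜) fun l => ?_
  have hcup : ∀ (E : Cochains k A) (l : List (Letter 𝒜)), cup (adCochain 𝒜 (D : A)) E (bar l) =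
      hd (fun c r => ((lops D).f c).val * E (bar r)) l := fun E l =>
    (conv_bar _ _ l).trans (spl_adCochain (fun r => AddMonoidHom.mulRight (E (bar r))) l)
  have hw : ((lops D).f (dL D)).val = D * D + D * D := by
    change superComm 𝒜 (D : A) (D : A) = _
    rw [superComm_of_mem _ D.2, sg_one, neg_one_smul, sub_neg_eq_add]
  change cup (adCochain 𝒜 (D : A)) (cochainDer (D : A) E) (bar l) +
      (cup (zeroCochain (D * D : A)) E (bar l) + cup (zeroCochain (D * D : A)) E (bar l)) =
    cup (adCochain 𝒜 (D : A)) E (insD (D : A) (bar l))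
  rw [insD_bar, map_spl, cup_zeroCochain, hcup]
  simp only [hcup, hd_append, hd_cons, spl_add, spl_nl_left, hw]
  rw [← hd_spl (fun c u v => ((lops D).f c).val * E (bar (u ++ dL D :: v)))]
  simp only [← mul_spl]
  have h2 : ∀ l, cochainDer (D : A) E (bar l) = spl (fun u v => E (bar (u ++ dL D :: v))) l :=
    fun l => by
      change E (insD (D : A) (bar l)) = _
      rw [insD_bar, map_spl]
  simp only [h2]
  rw [add_mul]
  abel

theorem cup_zero_mul_cochainDer (D x : A) : cup (zeroCochain (k := k) x) * cochainDer D =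
    cochainDer D * cup (zeroCochain x) := by
  refine LinearMap.ext fun E => LinearMap.ext fun w => ?_
  change cup (zeroCochain x) _ w = cup (zeroCochain x) E (insD D w)
  rw [cup_zeroCochain, cup_zeroCochain]
  rfl

variable (𝒜) in
/-- The cup product with `t ad D + t² D²` as a power series. -/
def cupNablaConj (D : A) : PowerSeries (Module.End k (Cochains k A)) :=
  PowerSeries.C (cup (adCochain 𝒜 D)) * PowerSeries.X +
    PowerSeries.C (cup (zeroCochain (k := k) (D * D))) * PowerSeries.X ^ 2

theorem mul_pow_add_eq {S : Type*} [Semiring S] {d x z : S} (hx : x * d + (z + z) = d * x)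
    (hzd : z * d = d * z) (n : ℕ) :
    d ^ (n + 1) * x = x * d ^ (n + 1) + (n + 1) • (z * d ^ n + z * d ^ n) := by
  induction n with
  | zero => rw [pow_zero, mul_one, zero_add, pow_one, one_smul, hx]
  | succ n ih =>
    rw [pow_succ', mul_assoc, ih, mul_add, mul_smul_comm, mul_add d, ← mul_assoc, ← mul_assoc d z, ← hzd,
      mul_assoc z, ← pow_succ', ← hx, add_mul, add_mul, mul_assoc x, ← pow_succ', add_assoc,
      succ_nsmul' _ (n + 1)]

/-- If `[d, x] = 2 z` and `z` commutes with `d`, then conjugation by `e^{t d}` turns `t x - t² z` into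
`t x + t² z`; here `z'` is the negative of `z`. -/
theorem exp_mul_conjugation {S : Type*} [Semiring S] [Algebra k S] {d x z z' : S}
    (hz' : z + z' = 0) (hx : x * d + (z + z) = d * x) (hzd : z * d = d * z) :
    (PowerSeries.mk fun j => algebraMap ℚ k (1 / j.factorial) • d ^ j) *
        (PowerSeries.C x * PowerSeries.X + PowerSeries.C z' * PowerSeries.X ^ 2) =
      (PowerSeries.C x * PowerSeries.X + PowerSeries.C z * PowerSeries.X ^ 2) *
        PowerSeries.mk fun j => algebraMap ℚ k (1 / j.factorial) • d ^ j := by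
  set e : PowerSeries S := PowerSeries.mk fun j => algebraMap ℚ k (1 / j.factorial) • d ^ j
  have hz : ∀ n, z * d ^ n = d ^ n * z := fun n => (show Commute z d from hzd).pow_right n
  have e0 : ∀ n, PowerSeries.coeff n e = algebraMap ℚ k (1 / n.factorial) • d ^ n :=
    fun n => PowerSeries.coeff_mk _ _
  have e1 : ∀ n, PowerSeries.coeff (n + 1) e * x = x * PowerSeries.coeff (n + 1) e +
      (z * PowerSeries.coeff n e + z * PowerSeries.coeff n e) := fun n => by
    rw [e0, e0, smul_mul_assoc, mul_pow_add_eq hx hzd, smul_add (algebraMap ℚ k _), mul_smul_comm,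
      mul_smul_comm, ← smul_add (algebraMap ℚ k _) (z * _), ← Nat.cast_smul_eq_nsmul k (n + 1), smul_smul (_ : k) (_ : k),
      ← map_natCast (algebraMap ℚ k), ← map_mul]
    congr 3
    rw [Nat.factorial_succ]
    push_cast
    field_simp
  have e2 : ∀ n, z * PowerSeries.coeff n e + PowerSeries.coeff n e * z' = 0 := fun n => by
    rw [e0, smul_mul_assoc, mul_smul_comm, hz, ← smul_add, ← mul_add, hz', mul_zero, smul_zero]
  have e3 : PowerSeries.coeff 0 e * x = x * PowerSeries.coeff 0 e := by
    rw [e0, pow_zero, smul_mul_assoc, mul_smul_comm, one_mul, mul_one]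
  rw [mul_add, add_mul, ← mul_assoc, ← mul_assoc, mul_assoc (PowerSeries.C _),
    mul_assoc (PowerSeries.C _)]
  ext1 n
  rw [map_add, map_add, PowerSeries.coeff_C_mul, PowerSeries.coeff_C_mul, pow_two, ← mul_assoc,
    mul_assoc PowerSeries.X]
  rcases n with _ | _ | n
  · simp
  · rw [PowerSeries.coeff_succ_mul_X, PowerSeries.coeff_succ_mul_X, PowerSeries.coeff_succ_X_mul,
      PowerSeries.coeff_succ_X_mul, PowerSeries.coeff_mul_C, e3]
    simp
  · rw [PowerSeries.coeff_succ_mul_X, PowerSeries.coeff_succ_mul_X, PowerSeries.coeff_succ_mul_X,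
      PowerSeries.coeff_succ_X_mul, PowerSeries.coeff_succ_X_mul, PowerSeries.coeff_succ_X_mul,
      PowerSeries.coeff_mul_C, PowerSeries.coeff_mul_C, e1, add_assoc, add_assoc, e2, add_zero]

/-- The expansion `∇_t = t ad D - t² D²`, for the operators of the cup product. -/
theorem cupNabla_eq (D : A) : cupNabla 𝒜 D =
    PowerSeries.C (cup (adCochain 𝒜 D)) * PowerSeries.X +
    PowerSeries.C (cup (-zeroCochain (k := k) (D * D))) * PowerSeries.X ^ 2 := by
  ext1 n
  rw [cupNabla, PowerSeries.coeff_mk, map_add, PowerSeries.coeff_C_mul, PowerSeries.coeff_C_mul,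
    PowerSeries.coeff_X, PowerSeries.coeff_X_pow]
  rcases n with _ | _ | _ | n
  · simp [nablaCoeff]
  · simp [nablaCoeff]
  · simp [nablaCoeff]
  · simp [nablaCoeff]

/-- Conjugation by `e^{t L_D}` turns `∇_t = t ad D - t² D²` into `t ad D + t² D²`. -/
theorem expCochainDer_mul (D : 𝒜 1) :
    expCochainDer (D : A) * cupNabla 𝒜 (D : A) = cupNablaConj 𝒜 (D : A) * expCochainDer (D : A) := by
  rw [cupNabla_eq, cupNablaConj, expCochainDer]
  exact exp_mul_conjugation (by rw [← map_add, add_neg_cancel, map_zero]) (cup_ad_mul_cochainDer D)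
    (cup_zero_mul_cochainDer _ _)

/-- The component in `A` of the Chern character, in terms of the powers of `t ad D + t² D²`. -/
theorem degreeZero_ch {D : A} (hD : D ∈ 𝒜 1) (N : ℕ) (a : A) (w : Words k A) :
    degreeZero (PowerSeries.coeff N (ch 𝒜 D) (a ⊗ₜ[k] w)) =
      ∑ m ∈ Finset.range (N + 1), algebraMap ℚ k ((-1) ^ m / m.factorial) •
        (a * PowerSeries.coeff N (cupNablaConj 𝒜 D ^ m) (zeroCochain 1) w) := by
  have hpow : ∀ m, expCochainDer D * cupNabla 𝒜 D ^ m =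
      cupNablaConj 𝒜 D ^ m * expCochainDer D := fun m =>
    (show SemiconjBy _ _ _ from expCochainDer_mul (𝒜 := 𝒜) ⟨D, hD⟩).pow_right m
  -- `L_D` annihilates the unit of the algebra of cochains, so `e^{t L_D}` fixes it
  have hone : ∀ m, (PowerSeries.coeff N (cupNablaConj 𝒜 D ^ m * expCochainDer D) :
      Module.End k (Cochains k A)) (zeroCochain 1) = (PowerSeries.coeff N (cupNablaConj 𝒜 D ^ m) :
        Module.End k (Cochains k A)) (zeroCochain 1) := fun m => by
    rw [PowerSeries.coeff_mul, LinearMap.sum_apply, Finset.sum_eq_single (N, 0)]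
    · simp [expCochainDer]
    · rintro ⟨i, j⟩ hx hne
      rw [Finset.HasAntidiagonal.mem_antidiagonal] at hx
      obtain ⟨j, rfl⟩ : ∃ j', j = j' + 1 := Nat.exists_eq_succ_of_ne_zero fun h => hne (by
        subst h
        rw [← hx]
        rfl)
      rw [Module.End.mul_apply, expCochainDer, PowerSeries.coeff_mk, LinearMap.smul_apply, pow_succ,
        Module.End.mul_apply, cochainDer_one (𝒜 := 𝒜) ⟨D, hD⟩, map_zero, smul_zero, map_zero]
    · intro h
      exact absurd (Finset.HasAntidiagonal.mem_antidiagonal.2 (add_zero N)) h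
  have hlie : ∀ j, (lieDeriv D ^ j) (a ⊗ₜ[k] w) = a ⊗ₜ[k] (insD D ^ j) w := fun j => by
    rw [show lieDeriv D = LinearMap.lTensor A (insD D) from rfl, LinearMap.lTensor_pow,
      LinearMap.lTensor_tmul]
  -- the exponential of `L_D` on chains is transposed to that on cochains
  have h1 : ∀ x ∈ Finset.HasAntidiagonal.antidiagonal N,
      degreeZero ((PowerSeries.coeff x.1 (X 𝒜 D) * PowerSeries.coeff x.2 (expLie D) :
        Module.End k (Chains k A)) (a ⊗ₜ[k] w)) =
      ∑ m ∈ Finset.range (N + 1), algebraMap ℚ k ((-1) ^ m / m.factorial) •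
        (a * (PowerSeries.coeff x.2 (expCochainDer D) * PowerSeries.coeff x.1 (cupNabla 𝒜 D ^ m) :
          Module.End k (Cochains k A)) (zeroCochain 1) w) := by
    intro x hx
    rw [Finset.HasAntidiagonal.mem_antidiagonal] at hx
    rw [coeff_X x.1 (N + 1) (by omega), Module.End.mul_apply, expLie, PowerSeries.coeff_mk,
      LinearMap.smul_apply, hlie, LinearMap.sum_apply, map_sum]
    refine Finset.sum_congr rfl fun m _ => ?_
    rw [LinearMap.smul_apply, map_smul, ← LinearMap.comp_apply, degreeZero_starSeries hD, map_smul,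
      evalChain_tmul, Module.End.mul_apply, expCochainDer, PowerSeries.coeff_mk, LinearMap.smul_apply,
      LinearMap.smul_apply, cochainDer_pow, mul_smul_comm]
  rw [ch, PowerSeries.coeff_mul, LinearMap.sum_apply, map_sum, Finset.sum_congr rfl h1,
    Finset.sum_comm]
  refine Finset.sum_congr rfl fun m _ => ?_
  rw [← hone, ← hpow, PowerSeries.coeff_mul, ← Finset.smul_sum, LinearMap.sum_apply,
    LinearMap.sum_apply, Finset.mul_sum]
  congr 1
  exact Finset.sum_equiv (Equiv.prodComm ℕ ℕ)
    (fun x => by simp only [Finset.HasAntidiagonal.mem_antidiagonal, Equiv.prodComm_apply,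
      Prod.fst_swap, Prod.snd_swap, add_comm]) fun x _ => rfl

variable (𝒜) in
/-- The sum of the words `D^{2 j₀} [D, a₁] D^{2 j₁} ⋯ [D, aₙ] D^{2 jₙ}` over `j₀ + ⋯ + jₙ = J`. -/
def jloWord (D : A) : List A → ℕ → A
  | [], J => D ^ (2 * J)
  | c :: l, J => ∑ x ∈ Finset.HasAntidiagonal.antidiagonal J,
      D ^ (2 * x.1) * (superComm 𝒜 D c * jloWord D l x.2)

theorem jloWord_cons_succ (D c : A) (l : List A) (J : ℕ) : jloWord 𝒜 D (c :: l) (J + 1) =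
    superComm 𝒜 D c * jloWord 𝒜 D l (J + 1) + D * D * jloWord 𝒜 D (c :: l) J := by
  rw [jloWord, Finset.Nat.antidiagonal_succ, Finset.sum_cons, Finset.sum_map, jloWord,
    Finset.mul_sum]
  congr 1
  · simp
  · refine Finset.sum_congr rfl fun x _ => ?_
    change D ^ (2 * (x.1 + 1)) * _ = _
    rw [← mul_assoc (D * D), ← pow_two, ← pow_add]
    congr 2
    ring

/-- The reduced word of a list of elements. -/
def wordOf (l : List A) : Words k A := (l.map fun c => TensorAlgebra.ι k (toBar k A c)).prod

theorem coeff_X_add_X_sq_pow {S : Type*} [Ring S] (x z : S) (m N : ℕ) :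
    PowerSeries.coeff (N + 2) ((PowerSeries.C x * PowerSeries.X +
        PowerSeries.C z * PowerSeries.X ^ 2) ^ (m + 1)) =
      x * PowerSeries.coeff (N + 1) ((PowerSeries.C x * PowerSeries.X +
        PowerSeries.C z * PowerSeries.X ^ 2) ^ m) +
      z * PowerSeries.coeff N ((PowerSeries.C x * PowerSeries.X +
        PowerSeries.C z * PowerSeries.X ^ 2) ^ m) := by
  rw [pow_succ', add_mul, map_add, mul_assoc, mul_assoc, PowerSeries.coeff_C_mul,
    PowerSeries.coeff_C_mul, pow_two, mul_assoc, PowerSeries.coeff_succ_X_mul,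
    PowerSeries.coeff_succ_X_mul, PowerSeries.coeff_succ_X_mul]

theorem coeff_one_X_add_X_sq_pow {S : Type*} [Ring S] (x z : S) (m : ℕ) :
    PowerSeries.coeff 1 ((PowerSeries.C x * PowerSeries.X +
        PowerSeries.C z * PowerSeries.X ^ 2) ^ (m + 1)) =
      x * PowerSeries.coeff 0 ((PowerSeries.C x * PowerSeries.X +
        PowerSeries.C z * PowerSeries.X ^ 2) ^ m) := by
  rw [pow_succ', add_mul, map_add, mul_assoc, mul_assoc, PowerSeries.coeff_C_mul,
    PowerSeries.coeff_C_mul, pow_two, mul_assoc, PowerSeries.coeff_succ_X_mul,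
    PowerSeries.coeff_succ_X_mul]
  simp

theorem coeff_zero_X_add_X_sq_pow {S : Type*} [Ring S] (x z : S) (m : ℕ) :
    PowerSeries.coeff 0 ((PowerSeries.C x * PowerSeries.X +
        PowerSeries.C z * PowerSeries.X ^ 2) ^ (m + 1)) = 0 := by
  simp

variable (𝒜) in
/-- The coefficient of `t^N` of `(t ad D + t² D²)^m`, as a cochain. -/
def conjCoeff (D : A) (m N : ℕ) : Cochains k A :=
  (PowerSeries.coeff N (cupNablaConj 𝒜 D ^ m) : Module.End k (Cochains k A)) (zeroCochain 1)

theorem conjCoeff_add_two (D : A) (m N : ℕ) : conjCoeff 𝒜 D (m + 1) (N + 2) =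
    cup (adCochain 𝒜 D) (conjCoeff 𝒜 D m (N + 1)) + cup (zeroCochain (D * D)) (conjCoeff 𝒜 D m N) :=
  LinearMap.congr_fun (coeff_X_add_X_sq_pow (S := Module.End k (Cochains k A)) _ _ m N) _

theorem conjCoeff_one (D : A) (m : ℕ) : conjCoeff 𝒜 D (m + 1) 1 =
    cup (adCochain 𝒜 D) (conjCoeff 𝒜 D m 0) :=
  LinearMap.congr_fun (coeff_one_X_add_X_sq_pow (S := Module.End k (Cochains k A)) _ _ m) _

theorem conjCoeff_zero (D : A) (m : ℕ) : conjCoeff 𝒜 D (m + 1) 0 = 0 :=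
  LinearMap.congr_fun (coeff_zero_X_add_X_sq_pow (S := Module.End k (Cochains k A)) _ _ m) _

/-- The cup power `(t ad D + t² D²)^m` at `n` letters is the sum of the words with `n` factors
`[D, aᵢ]` and `m - n` factors `D²`, in degree `N = n + 2 (m - n)`. -/
theorem conjCoeff_wordOf (D : A) (m N : ℕ) (l : List A) :
    conjCoeff 𝒜 D m N (wordOf (k := k) l) =
      if l.length ≤ m ∧ N + l.length = 2 * m then jloWord 𝒜 D l (m - l.length) else 0 := by
  induction m generalizing N l with
  | zero =>
    rw [conjCoeff, pow_zero, PowerSeries.coeff_one]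
    cases l with
    | nil =>
      split_ifs with h1 h2 h2
      · simp [wordOf, zeroCochain, jloWord]
      · simp at h2; omega
      · simp at h2; omega
      · rfl
    | cons c l =>
      have hl : ¬((c :: l).length ≤ 0 ∧ N + (c :: l).length = 2 * 0) := fun h =>
        Nat.not_succ_le_zero _ h.1
      rw [if_neg hl]
      split_ifs
      · simp [wordOf, zeroCochain, TensorAlgebra.algebraMapInv]
      · rfl
  | succ m ih =>
    have h1 : ∀ N c l, cup (adCochain 𝒜 D) (conjCoeff 𝒜 D m N) (wordOf (k := k) (c :: l)) =
        superComm 𝒜 D c *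
          if l.length ≤ m ∧ N + l.length = 2 * m then jloWord 𝒜 D l (m - l.length) else 0 := by
      intro N c l
      rw [← ih, wordOf, List.map_cons, List.prod_cons, cup_adCochain, wordOf]
    have h0 : ∀ N, cup (adCochain 𝒜 D) (conjCoeff 𝒜 D m N) (wordOf (k := k) []) = 0 :=
      fun N => cup_adCochain_one _ _
    have h2 : ∀ N l, cup (zeroCochain (D * D)) (conjCoeff 𝒜 D m N) (wordOf (k := k) l) = D * D *
        if l.length ≤ m ∧ N + l.length = 2 * m then jloWord 𝒜 D l (m - l.length) else 0 := by
      intro N l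
      rw [← ih, cup_zeroCochain]
    cases l with
    | nil =>
      rcases N with _ | _ | N
      · rw [conjCoeff_zero, if_neg (by simp), LinearMap.zero_apply]
      · rw [conjCoeff_one, if_neg (fun h => by simp only [List.length_nil] at h; omega), h0]
      · rw [conjCoeff_add_two, LinearMap.add_apply, h0, h2, zero_add]
        simp only [List.length_nil, Nat.sub_zero, Nat.zero_le, true_and, add_zero, jloWord]
        by_cases h : N = 2 * m
        · rw [if_pos h, if_pos (by omega), ← pow_two, ← pow_add]
          congr 1
          omega
        · rw [if_neg h, if_neg (by omega), mul_zero]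
    | cons c l =>
      by_cases h : (c :: l).length ≤ m + 1 ∧ N + (c :: l).length = 2 * (m + 1)
      · obtain ⟨h3, h4⟩ := h
        rw [List.length_cons] at h3 h4
        rw [if_pos ⟨by simpa using h3, by simpa using h4⟩, List.length_cons]
        rcases N with _ | _ | N
        · omega
        · rw [conjCoeff_one, h1, if_pos (⟨by omega, by omega⟩ : _ ∧ _),
            show m + 1 - (l.length + 1) = 0 by omega, show m - l.length = 0 by omega]
          simp [jloWord]
        · rw [conjCoeff_add_two, LinearMap.add_apply, h1, if_pos ⟨by omega, by omega⟩, h2,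
            List.length_cons]
          by_cases h5 : l.length = m
          · rw [if_neg fun h => by omega, h5, Nat.sub_self, Nat.sub_self]
            simp [jloWord]
          · rw [if_pos ⟨by omega, by omega⟩,
              show m + 1 - (l.length + 1) = m - (l.length + 1) + 1 by omega, jloWord_cons_succ,
              show m - (l.length + 1) + 1 = m - l.length by omega]
      · rw [if_neg h]
        rw [List.length_cons] at h
        rcases N with _ | _ | N
        · rw [conjCoeff_zero, LinearMap.zero_apply]
        · rw [conjCoeff_one, h1, if_neg (by omega), mul_zero]
        · rw [conjCoeff_add_two, LinearMap.add_apply, h1, h2, List.length_cons, if_neg (by omega),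
            if_neg (by omega), mul_zero, mul_zero, add_zero]

theorem jloWord_ofFn (D : A) {n : ℕ} (a : Fin n → A) (J : ℕ) : jloWord 𝒜 D (List.ofFn a) J =
    ∑ j ∈ Finset.Nat.antidiagonalTuple (n + 1) J, D ^ (2 * j 0) *
      (List.ofFn fun i : Fin n => superComm 𝒜 D (a i) * D ^ (2 * j i.succ)).prod := by
  induction n generalizing J with
  | zero => rw [Finset.Nat.antidiagonalTuple_one]; simp [jloWord]
  | succ n ih =>
    rw [List.ofFn_succ, jloWord, sum_antidiagonalTuple_succ]
    refine Finset.sum_congr rfl fun x _ => ?_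
    rw [ih, Finset.mul_sum, Finset.mul_sum]
    refine Finset.sum_congr rfl fun c _ => ?_
    rw [List.ofFn_succ, List.prod_cons]
    simp only [Fin.cons_zero, Fin.cons_succ, mul_assoc]

/-- The component in `A` of the Chern character. -/
theorem degreeZero_ch_chain {D : A} (hD : D ∈ 𝒜 1) {n : ℕ} (a₀ : A) (a : Fin n → A) (N : ℕ) :
    degreeZero (PowerSeries.coeff N (ch 𝒜 D) (chain (k := k) a₀ a)) =
      (-1) ^ n * jloCoeff 𝒜 D N a₀ a := by
  have hw : chain (k := k) a₀ a = a₀ ⊗ₜ[k] wordOf (List.ofFn a) := by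
    rw [chain, wordOf, List.map_ofFn]
    rfl
  rw [hw, degreeZero_ch hD, jloCoeff]
  have hc : ∀ m, (PowerSeries.coeff N (cupNablaConj 𝒜 D ^ m) : Module.End k (Cochains k A))
      (zeroCochain 1) = conjCoeff 𝒜 D m N := fun _ => rfl
  simp only [hc, conjCoeff_wordOf, List.length_ofFn]
  by_cases h : ∃ J, n + 2 * J = N
  · obtain ⟨J, rfl⟩ := h
    rw [Finset.sum_eq_single (n + J), Finset.sum_eq_single J]
    · have hq : algebraMap ℚ k ((-1) ^ (n + J) / (n + J).factorial) =
          (-1) ^ n * algebraMap ℚ k ((-1) ^ J / (n + J).factorial) := by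
        rw [pow_add, mul_div_assoc, map_mul, map_pow, map_neg, map_one]
      have hs : ∀ x : A, ((-1) ^ n : k) • x = (-1) ^ n * x := fun x => by
        rw [Algebra.smul_def, map_pow, map_neg, map_one]
      rw [if_pos ⟨by omega, by omega⟩, jloWord_ofFn, Nat.add_sub_cancel_left, ← Finset.smul_sum, hq,
        mul_smul, hs, Finset.mul_sum]
      simp only [mul_assoc]
    · intro J' hJ hne
      rw [Finset.mem_filter] at hJ
      omega
    · refine fun h => absurd ?_ h
      exact (Finset.mem_filter.2 ⟨Finset.mem_range.2 (by omega), rfl⟩)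
    · intro m _ hne
      rw [if_neg fun h => by omega, mul_zero, smul_zero]
    · intro h
      exact absurd (Finset.mem_range.2 (by omega)) h
  · rw [Finset.filter_false_of_mem fun J _ hJ => h ⟨J, hJ⟩, Finset.sum_empty, mul_zero]
    refine Finset.sum_eq_zero fun m _ => ?_
    have hm : ¬(n ≤ m ∧ N + n = 2 * m) := fun hm => h ⟨m - n, by omega⟩
    rw [if_neg hm, mul_zero, smul_zero]

end

section

open MeasureTheory

/-! ### Integrals over simplices in Banach algebras -/

section Simplex

/-- The divided power `tⁿ / n!`. -/
def dpow (n : ℕ) (t : ℝ) : ℝ := t ^ n / n.factorial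

theorem dpow_nonneg (n : ℕ) {t : ℝ} (ht : 0 ≤ t) : 0 ≤ dpow n t := by
  unfold dpow
  positivity

theorem dpow_le_dpow (n : ℕ) {s t : ℝ} (hs : 0 ≤ s) (h : s ≤ t) : dpow n s ≤ dpow n t := by
  unfold dpow
  gcongr

theorem hasDerivAt_dpow_succ (n : ℕ) (t : ℝ) : HasDerivAt (dpow (n + 1)) (dpow n t) t := by
  have h := (hasDerivAt_pow (n + 1) t).div_const ((n + 1).factorial : ℝ)
  refine h.congr_deriv ?_
  rw [dpow, Nat.factorial_succ, Nat.add_sub_cancel]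
  push_cast
  field_simp

theorem continuous_dpow (n : ℕ) : Continuous (dpow n) := (continuous_pow n).div_const _

theorem dpow_zero_apply (t : ℝ) : dpow 0 t = 1 := by simp [dpow]

theorem dpow_succ_zero (n : ℕ) : dpow (n + 1) 0 = 0 := by simp [dpow]

/-- The convolution of divided powers (a beta integral). -/
theorem integral_dpow_mul_dpow (p q : ℕ) (s : ℝ) :
    ∫ t in (0 : ℝ)..s, dpow p t * dpow q (s - t) = dpow (p + q + 1) s := by
  have hd : ∀ q t, HasDerivAt (fun t => -dpow (q + 1) (s - t)) (dpow q (s - t)) t := fun q t => by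
    have h := ((hasDerivAt_dpow_succ q (s - t)).comp t ((hasDerivAt_id t).const_sub s)).neg
    exact h.congr_deriv (by ring)
  have hc : ∀ q, Continuous fun t => dpow q (s - t) := fun q =>
    (continuous_dpow q).comp (continuous_const.sub continuous_id)
  induction p generalizing q with
  | zero =>
    simp only [dpow_zero_apply, one_mul]
    rw [intervalIntegral.integral_eq_sub_of_hasDerivAt (fun t _ => hd q t)
      ((hc q).intervalIntegrable _ _), sub_self, dpow_succ_zero, zero_add, sub_zero]
    ring
  | succ p ih =>
    rw [intervalIntegral.integral_mul_deriv_eq_deriv_mul (fun t _ => hasDerivAt_dpow_succ p t)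
      (fun t _ => hd q t) ((continuous_dpow p).intervalIntegrable _ _)
      ((hc q).intervalIntegrable _ _)]
    simp only [sub_self, dpow_succ_zero, mul_neg, intervalIntegral.integral_neg, ih, sub_zero]
    rw [show p + (q + 1) + 1 = p + 1 + q + 1 by ring]
    ring

/-- The sum of the words `y^{j₀} d₁ y^{j₁} ⋯ dₙ y^{jₙ}` over `j₀ + ⋯ + jₙ = J`. -/
def powWord {R : Type*} [Ring R] (y : R) : List R → ℕ → R
  | [], J => y ^ J
  | c :: l, J => ∑ x ∈ Finset.HasAntidiagonal.antidiagonal J, y ^ x.1 * (c * powWord y l x.2)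

variable {R : Type*} [NormedRing R] [NormedAlgebra ℝ R]

/-- The product `e^{t₀ y} d₁ e^{t₁ y} ⋯ dₙ e^{tₙ y}`. -/
def expWord (y : R) {n : ℕ} (d : Fin n → R) (t : Fin (n + 1) → ℝ) : R :=
  NormedSpace.exp (t 0 • y) * (List.ofFn fun i : Fin n => d i * NormedSpace.exp (t i.succ • y)).prod

theorem expWord_cons (y : R) {n : ℕ} (d : Fin (n + 1) → R) (r : ℝ) (t : Fin (n + 1) → ℝ) :
    expWord y d (Fin.cons r t) = NormedSpace.exp (r • y) * (d 0 * expWord y (Fin.tail d) t) := by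
  simp only [expWord, Fin.cons_zero, Fin.cons_succ, List.ofFn_succ, List.prod_cons, mul_assoc, Fin.tail]

/-- The simplex `{t₀ + ⋯ + t_{n-1} ≤ s, tᵢ ≥ 0}`. -/
def scaledSimplex (n : ℕ) (s : ℝ) : Set (Fin n → ℝ) := {t | (∀ i, 0 ≤ t i) ∧ ∑ i, t i ≤ s}

theorem isCompact_scaledSimplex (n : ℕ) (s : ℝ) : IsCompact (scaledSimplex n s) := by
  refine (isCompact_univ_pi fun _ : Fin n => isCompact_Icc (a := (0 : ℝ)) (b := s)).of_isClosed_subset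
    ?_ fun t ht i _ => ⟨ht.1 i, (Finset.single_le_sum (fun j _ => ht.1 j) (Finset.mem_univ i)).trans ht.2⟩
  have h1 : IsClosed (⋂ i, {t : Fin n → ℝ | 0 ≤ t i}) :=
    isClosed_iInter fun i => isClosed_le continuous_const (continuous_apply i)
  have h2 : IsClosed {t : Fin n → ℝ | ∑ i, t i ≤ s} :=
    isClosed_le (continuous_finsetSum _ fun i _ => continuous_apply i) continuous_const
  convert h1.inter h2 using 1
  ext t
  simp [scaledSimplex]

theorem cons_mem_scaledSimplex {n : ℕ} {s r : ℝ} {t : Fin n → ℝ} :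
    (Fin.cons r t : Fin (n + 1) → ℝ) ∈ scaledSimplex (n + 1) s ↔ 0 ≤ r ∧ t ∈ scaledSimplex n (s - r) := by
  simp only [scaledSimplex, Set.mem_ofPred_eq, Fin.forall_fin_succ, Fin.sum_univ_succ, Fin.cons_zero,
    Fin.cons_succ, le_sub_iff_add_le', and_assoc]

/-- The integral of `e^{t₀ y} d₁ e^{t₁ y} ⋯ dₙ e^{tₙ y}` over the simplex `t₀ + ⋯ + tₙ = s`. -/
def simplexInt (y : R) (s : ℝ) {n : ℕ} (d : Fin n → R) : R :=
  ∫ t in scaledSimplex n s, expWord y d (Fin.snoc t (s - ∑ i, t i))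

theorem expWord_snoc_cons (y : R) (s : ℝ) {n : ℕ} (d : Fin (n + 1) → R) (r : ℝ) (t : Fin n → ℝ) :
    expWord y d (Fin.snoc (Fin.cons r t : Fin (n + 1) → ℝ)
      (s - ∑ i, (Fin.cons r t : Fin (n + 1) → ℝ) i)) = NormedSpace.exp (r • y) *
        (d 0 * expWord y (Fin.tail d) (Fin.snoc t (s - r - ∑ i, t i))) := by
  rw [← Fin.cons_snoc_eq_snoc_cons, expWord_cons, Fin.sum_univ_succ]
  simp only [Fin.cons_zero, Fin.cons_succ, sub_sub]

variable [CompleteSpace R]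

theorem continuous_exp_smul (y : R) : Continuous fun r : ℝ => NormedSpace.exp (r • y) := by
  let _ := NormedAlgebra.restrictScalars ℚ ℝ R
  exact NormedSpace.exp_continuous.comp (continuous_id.smul continuous_const)

theorem continuous_expWord (y : R) {n : ℕ} (d : Fin n → R) : Continuous (expWord y d) := by
  unfold expWord
  refine ((continuous_exp_smul y).comp (continuous_apply 0)).mul ?_
  simp only [List.ofFn_eq_map]
  exact continuous_list_prod _ fun i _ => continuous_const.mul
    ((continuous_exp_smul y).comp (continuous_apply i.succ))

theorem integrableOn_expWord (y : R) (s : ℝ) {n : ℕ} (d : Fin n → R) :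
    IntegrableOn (fun t : Fin n → ℝ => expWord y d (Fin.snoc t (s - ∑ i, t i)))
      (scaledSimplex n s) := by
  refine ((continuous_expWord y d).comp ?_).continuousOn.integrableOn_compact
    (isCompact_scaledSimplex n s)
  refine continuous_pi fun i => ?_
  refine Fin.lastCases ?_ (fun i => ?_) i
  · simp only [Fin.snoc_last]
    fun_prop
  · simp only [Fin.snoc_castSucc]
    fun_prop

theorem simplexInt_zero (y : R) {s : ℝ} (hs : 0 ≤ s) (d : Fin 0 → R) :
    simplexInt y s d = NormedSpace.exp (s • y) := by
  have h : scaledSimplex 0 s = Set.univ := Set.eq_univ_of_forall fun t => ⟨fun i => i.elim0, by simpa⟩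
  rw [simplexInt, h, Measure.restrict_univ, integral_unique]
  have hv : (volume : Measure (Fin 0 → ℝ)).real Set.univ = 1 := by
    rw [Measure.volume_pi_eq_dirac]
    simp
  rw [hv, one_smul]
  simp [expWord, Fin.snoc]

theorem integral_mul_mul {α : Type*} {m : MeasurableSpace α} {μ : Measure α} {g : α → R}
    (hg : Integrable g μ) (a b : R) : ∫ t, a * (b * g t) ∂μ = a * (b * ∫ t, g t ∂μ) := by
  have h := (ContinuousLinearMap.mul ℝ R a ∘L ContinuousLinearMap.mul ℝ R b).integral_comp_comm hg
  exact h

/-- Fubini: the first coordinate of the simplex is split off. -/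
theorem simplexInt_succ (y : R) {s : ℝ} (hs : 0 ≤ s) {n : ℕ} (d : Fin (n + 1) → R) :
    simplexInt y s d = ∫ r in (0 : ℝ)..s,
      NormedSpace.exp (r • y) * (d 0 * simplexInt y (s - r) (Fin.tail d)) := by
  set g : (Fin (n + 1) → ℝ) → R := (scaledSimplex (n + 1) s).indicator
    fun t => expWord y d (Fin.snoc t (s - ∑ i, t i)) with hg
  have hmeas : MeasurableSet (scaledSimplex (n + 1) s) := (isCompact_scaledSimplex _ _).measurableSet
  have hgi : Integrable g := (integrable_indicator_iff hmeas).2 (integrableOn_expWord y s d)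
  have hmp := (volume_preserving_piFinSuccAbove (fun _ : Fin (n + 1) => ℝ) 0).symm
  have hcons : ∀ z : ℝ × (Fin n → ℝ),
      (MeasurableEquiv.piFinSuccAbove (fun _ : Fin (n + 1) => ℝ) 0).symm z = Fin.cons z.1 z.2 :=
    fun z => by
      rw [MeasurableEquiv.piFinSuccAbove_symm_apply]
      exact Fin.insertNth_zero' z.1 z.2
  have h1 : simplexInt y s d = ∫ z : ℝ × (Fin n → ℝ), g (Fin.cons z.1 z.2) := by
    rw [simplexInt, ← integral_indicator hmeas, ← hg, ← hmp.integral_comp']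
    simp only [hcons]
  have hint : Integrable (fun z : ℝ × (Fin n → ℝ) => g (Fin.cons z.1 z.2)) := by
    have h := hmp.integrable_comp_of_integrable hgi
    refine h.congr (Filter.Eventually.of_forall fun z => ?_)
    exact congrArg g (hcons z)
  have h2 : ∀ r : ℝ, ∫ t : Fin n → ℝ, g (Fin.cons r t) = (Set.Icc 0 s).indicator
      (fun r => NormedSpace.exp (r • y) * (d 0 * simplexInt y (s - r) (Fin.tail d))) r := by
    intro r
    by_cases hr : r ∈ Set.Icc 0 s
    · rw [Set.indicator_of_mem hr, simplexInt, ← integral_mul_mul (integrableOn_expWord _ _ _),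
        ← integral_indicator (isCompact_scaledSimplex _ _).measurableSet]
      refine integral_congr_ae (Filter.Eventually.of_forall fun t => ?_)
      beta_reduce
      by_cases ht : t ∈ scaledSimplex n (s - r)
      · rw [hg, Set.indicator_of_mem (cons_mem_scaledSimplex.2 ⟨hr.1, ht⟩), Set.indicator_of_mem ht,
          expWord_snoc_cons]
      · rw [hg, Set.indicator_of_notMem fun h => ht (cons_mem_scaledSimplex.1 h).2,
          Set.indicator_of_notMem ht]
    · rw [Set.indicator_of_notMem hr, ← integral_zero (Fin n → ℝ) R]
      refine integral_congr_ae (Filter.Eventually.of_forall fun t => ?_)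
      refine Set.indicator_of_notMem (fun h => hr ?_) _
      obtain ⟨h0, h1⟩ := cons_mem_scaledSimplex.1 h
      exact ⟨h0, sub_nonneg.1 ((Finset.sum_nonneg fun i _ => h1.1 i).trans h1.2)⟩
  rw [h1, Measure.volume_eq_prod, integral_prod _ hint]
  simp only [h2]
  rw [integral_indicator measurableSet_Icc, intervalIntegral.integral_of_le hs,
    integral_Icc_eq_integral_Ioc]

theorem hasSum_exp_smul (y : R) (r : ℝ) :
    HasSum (fun p => dpow p r • y ^ p) (NormedSpace.exp (r • y)) := by
  refine (NormedSpace.exp_series_hasSum_exp' (𝕂 := ℝ) (r • y)).congr_fun fun p => ?_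
  rw [smul_pow, smul_smul, dpow, div_eq_inv_mul]

theorem summable_norm_exp_smul (y : R) (r : ℝ) : Summable fun p => ‖dpow p r • y ^ p‖ := by
  refine (NormedSpace.norm_expSeries_summable' (𝕂 := ℝ) (r • y)).congr fun p => ?_
  rw [smul_pow, smul_smul, dpow, div_eq_inv_mul]

/-- The Cauchy product of absolutely convergent series. -/
theorem hasSum_antidiagonal_mul {f g : ℕ → R} {a b : R} (hf : HasSum f a) (hg : HasSum g b)
    (hf' : Summable fun p => ‖f p‖) (hg' : Summable fun p => ‖g p‖) :
    HasSum (fun J => ∑ x ∈ Finset.HasAntidiagonal.antidiagonal J, f x.1 * g x.2) (a * b) := by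
  rw [← hf.tsum_eq, ← hg.tsum_eq, tsum_mul_tsum_eq_tsum_sum_antidiagonal_of_summable_norm hf' hg']
  exact (summable_norm_sum_mul_antidiagonal_of_summable_norm hf' hg').of_norm.hasSum

/-- The convolution of `e^{r y} c` with a power series whose coefficients carry divided powers. -/
theorem hasSum_integral_exp_mul (y c : R) {n : ℕ} {w : ℕ → R} {W : ℝ → R}
    (hW : ∀ s, 0 ≤ s → HasSum (fun J => dpow (n + J) s • w J) (W s) ∧
      Summable fun J => ‖dpow (n + J) s • w J‖) {s : ℝ} (hs : 0 ≤ s) :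
    HasSum (fun J => dpow (n + 1 + J) s •
        ∑ x ∈ Finset.HasAntidiagonal.antidiagonal J, y ^ x.1 * (c * w x.2))
      (∫ r in (0 : ℝ)..s, NormedSpace.exp (r • y) * (c * W (s - r))) ∧
    Summable fun J => ‖dpow (n + 1 + J) s •
      ∑ x ∈ Finset.HasAntidiagonal.antidiagonal J, y ^ x.1 * (c * w x.2)‖ := by
  let F : ℕ → ℝ → R := fun J r => ∑ x ∈ Finset.HasAntidiagonal.antidiagonal J,
    (dpow x.1 r • y ^ x.1) * (c * (dpow (n + x.2) (s - r) • w x.2))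
  let bound : ℕ → ℝ := fun J => ∑ x ∈ Finset.HasAntidiagonal.antidiagonal J,
    ‖dpow x.1 s • y ^ x.1‖ * (‖c‖ * ‖dpow (n + x.2) s • w x.2‖)
  -- the divided powers are monotone on `[0, s]`, so the terms are dominated by those of the
  -- Cauchy product of the norms at `s`
  have hbs : Summable bound := by
    have h := summable_norm_sum_mul_antidiagonal_of_summable_norm
      (summable_norm_exp_smul y s).norm (((hW s hs).2.mul_left ‖c‖).norm)
    refine h.congr fun J => ?_
    rw [Real.norm_of_nonneg (Finset.sum_nonneg fun x _ => by positivity)]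
  have hle : ∀ (m : ℕ) (r : ℝ) (z : R), 0 ≤ r → r ≤ s → ‖dpow m r • z‖ ≤ ‖dpow m s • z‖ := by
    intro m r z h0 h1
    rw [norm_smul, norm_smul, Real.norm_of_nonneg (dpow_nonneg m h0),
      Real.norm_of_nonneg (dpow_nonneg m hs)]
    exact mul_le_mul_of_nonneg_right (dpow_le_dpow m h0 h1) (norm_nonneg z)
  have hFb : ∀ J r, r ∈ Set.uIoc 0 s → ‖F J r‖ ≤ bound J := by
    intro J r hr
    rw [Set.uIoc_of_le hs] at hr
    refine norm_sum_le_of_le _ fun x _ => (norm_mul_le _ _).trans ?_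
    refine mul_le_mul (hle _ _ _ hr.1.le hr.2) ((norm_mul_le _ _).trans ?_) (norm_nonneg _)
      (norm_nonneg _)
    exact mul_le_mul_of_nonneg_left (hle _ _ _ (sub_nonneg.2 hr.2) (sub_le_self _ hr.1.le))
      (norm_nonneg c)
  have hFc' : ∀ p q : ℕ, Continuous fun r : ℝ =>
      (dpow p r • y ^ p) * (c * (dpow (n + q) (s - r) • w q)) := fun p q =>
    ((continuous_dpow _).smul continuous_const).mul (continuous_const.mul
      (((continuous_dpow _).comp (continuous_const.sub continuous_id)).smul continuous_const))
  have hFc : ∀ J, Continuous (F J) := fun J => continuous_finsetSum _ fun x _ => hFc' _ _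
  -- the integrals of the terms, by the beta integrals
  have hFi : ∀ J, ∫ r in (0 : ℝ)..s, F J r = dpow (n + 1 + J) s •
      ∑ x ∈ Finset.HasAntidiagonal.antidiagonal J, y ^ x.1 * (c * w x.2) := by
    intro J
    rw [Finset.smul_sum, intervalIntegral.integral_finsetSum fun x _ =>
      (hFc' x.1 x.2).intervalIntegrable _ _]
    refine Finset.sum_congr rfl fun x hx => ?_
    rw [Finset.HasAntidiagonal.mem_antidiagonal] at hx
    simp only [mul_smul_comm, smul_mul_assoc, smul_smul]
    rw [intervalIntegral.integral_smul_const]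
    congr 1
    rw [← hx, show n + 1 + (x.1 + x.2) = x.1 + (n + x.2) + 1 by ring, ← integral_dpow_mul_dpow]
    simp only [mul_comm]
  -- the Cauchy product of the two series at `r`
  have hFs : ∀ r, r ∈ Set.uIoc 0 s →
      HasSum (fun J => F J r) (NormedSpace.exp (r • y) * (c * W (s - r))) := by
    intro r hr
    rw [Set.uIoc_of_le hs] at hr
    obtain ⟨h1, h2⟩ := hW (s - r) (sub_nonneg.2 hr.2)
    have h3 : Summable fun q => ‖c * (dpow (n + q) (s - r) • w q)‖ :=
      Summable.of_nonneg_of_le (fun _ => norm_nonneg _) (fun _ => norm_mul_le _ _) (h2.mul_left ‖c‖)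
    have h4 := hasSum_antidiagonal_mul (hasSum_exp_smul y r) (h1.mul_left c)
      (summable_norm_exp_smul y r) h3
    exact h4
  have key := intervalIntegral.hasSum_integral_of_dominated_convergence (μ := volume)
    (fun J _ => bound J) (fun J => (hFc J).aestronglyMeasurable)
    (fun J => Filter.Eventually.of_forall fun r hr => hFb J r hr)
    (Filter.Eventually.of_forall fun _ _ => hbs) intervalIntegrable_const
    (Filter.Eventually.of_forall hFs)
  simp only [hFi] at key
  refine ⟨key, Summable.of_nonneg_of_le (fun _ => norm_nonneg _) (fun J => ?_)
    (hbs.mul_right |s - 0|)⟩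
  rw [← hFi]
  exact intervalIntegral.norm_integral_le_of_norm_le_const fun r hr => hFb J r hr

/-- The expansion of the integral over the simplex in powers of `y`. -/
theorem hasSum_simplexInt (y : R) {n : ℕ} (d : Fin n → R) (s : ℝ) (hs : 0 ≤ s) :
    HasSum (fun J => dpow (n + J) s • powWord y (List.ofFn d) J) (simplexInt y s d) ∧
      Summable fun J => ‖dpow (n + J) s • powWord y (List.ofFn d) J‖ := by
  induction n generalizing s with
  | zero =>
    rw [simplexInt_zero y hs]
    simp only [zero_add, List.ofFn_zero, powWord]
    exact ⟨hasSum_exp_smul y s, summable_norm_exp_smul y s⟩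
  | succ n ih =>
    rw [simplexInt_succ y hs]
    simp only [List.ofFn_succ, powWord]
    exact hasSum_integral_exp_mul y (d 0) (ih (Fin.tail d)) hs

end Simplex

/-! ### The component in `A` in Banach algebras -/

variable {k : Type*} [CommRing k] [Algebra ℚ k] {A : Type*} [Ring A] [Algebra k A]
variable {𝒜 : ZMod 2 → Submodule k A} [GradedAlgebra 𝒜]

theorem jloIntegral_eq {R : Type*} [NormedRing R] [NormedAlgebra ℝ R] [CompleteSpace R] (D : R) {n : ℕ}
    (a₀ : R) (d : Fin n → R) : jloIntegral D a₀ d = a₀ * simplexInt (-D ^ 2) 1 d := by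
  have h : ∀ t : Fin n → ℝ, a₀ * NormedSpace.exp (-(barycentric t 0) • D ^ 2) *
      (List.ofFn fun i : Fin n => d i * NormedSpace.exp (-(barycentric t i.succ) • D ^ 2)).prod =
      a₀ * (1 * expWord (-D ^ 2) d (Fin.snoc t (1 - ∑ i, t i))) := fun t => by
    simp only [expWord, barycentric, neg_smul, smul_neg, mul_assoc, one_mul]
  rw [jloIntegral]
  simp only [h]
  rw [show simplex n = scaledSimplex n 1 from rfl,
    integral_mul_mul (integrableOn_expWord (-D ^ 2) 1 d), one_mul]
  rfl

/-- Under `f` the words in `D²` and `[D, aᵢ]` with their signs are words in `-f(D)²` and `f([D,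
aᵢ])`. -/
theorem map_jloWord {R : Type*} [Ring R] (f : A →+* R) (D : A) (l : List A) (J : ℕ) :
    f ((-1) ^ J * jloWord 𝒜 D l J) = powWord (-f D ^ 2) (l.map fun c => f (superComm 𝒜 D c)) J := by
  induction l generalizing J with
  | nil =>
    simp only [jloWord, powWord, List.map_nil, map_mul, map_pow, map_neg, map_one]
    rw [neg_pow (f D ^ 2), pow_mul]
  | cons c l ih =>
    rw [jloWord, List.map_cons, powWord, Finset.mul_sum, map_sum]
    refine Finset.sum_congr rfl fun x hx => ?_
    rw [Finset.HasAntidiagonal.mem_antidiagonal] at hx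
    rw [← ih, ← hx, neg_pow (f D ^ 2), pow_add]
    simp only [map_mul, map_pow, map_neg, map_one, pow_mul]
    have hc : ∀ (m : ℕ) (z : R), z * (-1) ^ m = (-1) ^ m * z := fun m z =>
      ((Commute.neg_one_right z).pow_right m).eq
    rw [mul_assoc, mul_assoc ((-1) ^ x.1), ← hc x.2, ← hc x.2 (f (jloWord _ _ _ _))]
    simp only [mul_assoc]

/-- A ring homomorphism is not assumed to be linear over `k`, but additive maps respect
multiplication by rational numbers. -/
theorem map_algebraMap_rat_smul {R : Type*} [Ring R] [Algebra ℝ R] (f : A →+* R) (q : ℚ) (x : A) :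
    f (algebraMap ℚ k q • x) = (q : ℝ) • f x := by
  let _ : Module ℚ A := Module.compHom A (algebraMap ℚ k)
  have h := map_ratCast_smul f ℚ ℝ q x
  rw [Rat.cast_id] at h
  exact h

/-- The component in `A` of the Chern character, mapped to a Banach algebra, sums up to the
integral over the simplex. -/
theorem hasSum_degreeZero_ch {D : A} (hD : D ∈ 𝒜 1) {R : Type*} [NormedRing R] [NormedAlgebra ℝ R]
    [CompleteSpace R] (f : A →+* R) (n : ℕ) (a₀ : A) (a : Fin n → A) :
    HasSum (fun N => f (degreeZero (PowerSeries.coeff N (ch 𝒜 D) (chain (k := k) a₀ a))))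
      ((-1) ^ n * jloIntegral (f D) (f a₀) (fun i => f (superComm 𝒜 D (a i)))) := by
  have hinj : Function.Injective fun J => n + 2 * J := fun i j h => by
    simp only at h
    omega
  -- only the orders `N = n + 2 J` contribute
  rw [← hinj.hasSum_iff]
  · rw [jloIntegral_eq]
    refine (((hasSum_simplexInt (-f D ^ 2) (fun i => f (superComm 𝒜 D (a i))) 1
      zero_le_one).1.mul_left (f a₀)).mul_left ((-1) ^ n)).congr_fun fun J => ?_
    have hl : List.ofFn (fun i => f (superComm 𝒜 D (a i))) =
        (List.ofFn a).map fun c => f (superComm 𝒜 D c) := by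
      rw [List.map_ofFn]
      rfl
    rw [Function.comp_apply, degreeZero_ch_chain hD, jloCoeff, Finset.sum_eq_single J, ← Finset.smul_sum]
    · simp only [mul_assoc a₀]
      rw [← Finset.mul_sum, ← jloWord_ofFn, map_mul, map_algebraMap_rat_smul, map_pow, map_neg, map_one,
        map_mul, hl, ← map_jloWord,
        map_mul, map_pow, map_neg, map_one, dpow, one_pow]
      have hs : ∀ z : R, (-1) ^ J * z = ((-1) ^ J : ℝ) • z := fun z => by
        rw [Algebra.smul_def, map_pow, map_neg, map_one]
      rw [hs (f (jloWord _ _ _ _)), smul_smul, mul_smul_comm, mul_smul_comm (_ : ℝ) (f a₀),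
        mul_smul_comm]
      congr 1
      push_cast
      ring
    · intro J' hJ hne
      rw [Finset.mem_filter] at hJ
      omega
    · refine fun h => absurd ?_ h
      exact Finset.mem_filter.2 ⟨Finset.mem_range.2 (by omega), rfl⟩
  · intro N hN
    rw [degreeZero_ch_chain hD, jloCoeff, Finset.filter_false_of_mem, Finset.sum_empty, mul_zero, map_zero]
    exact fun J _ hJ => hN ⟨J, hJ⟩

end

end BivariantJLO

end

theorem theorem9p1 {k A : Type*} [CommRing k] [Algebra ℚ k] [Ring A] [Algebra k A]
    (𝒜 : ZMod 2 → Submodule k A) [GradedAlgebra 𝒜] (D : A) (hD : D ∈ 𝒜 1) :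
    -- `ch` is even, so that `[B + b, ch]` is the ordinary commutator
    PowerSeries.C (BivariantJLO.chainParity 𝒜 : Module.End k (BivariantJLO.Chains k A)) *
        BivariantJLO.ch 𝒜 D =
      BivariantJLO.ch 𝒜 D * PowerSeries.C (BivariantJLO.chainParity 𝒜) ∧
    -- `[B + b, ch] = 0`, as an identity of formal power series
    PowerSeries.C (BivariantJLO.totalDiff 𝒜) * BivariantJLO.ch 𝒜 D =
      BivariantJLO.ch 𝒜 D * PowerSeries.C (BivariantJLO.totalDiff 𝒜) ∧
    -- `[B + b, ch] = 0` wherever the series converges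
    (∀ {F : Type*} [AddCommGroup F] [Module k F] [TopologicalSpace F] [T2Space F]
      (u : BivariantJLO.Chains k A →ₗ[k] F) (d : F →ₗ[k] F), Continuous d →
      u ∘ₗ BivariantJLO.totalDiff 𝒜 = d ∘ₗ u →
      ∀ (α : BivariantJLO.Chains k A) (s s' : F),
        Filter.Tendsto (fun M => ∑ N ∈ Finset.range M,
          u (PowerSeries.coeff N (BivariantJLO.ch 𝒜 D) α)) Filter.atTop (nhds s) →
        Filter.Tendsto (fun M => ∑ N ∈ Finset.range M,
          u (PowerSeries.coeff N (BivariantJLO.ch 𝒜 D) (BivariantJLO.totalDiff 𝒜 α)))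
            Filter.atTop (nhds s') →
        d s = s') ∧
    -- the component in `A` is the JLO cochain, formally
    (∀ (n : ℕ) (a₀ : A) (a : Fin n → A) (N : ℕ),
      BivariantJLO.degreeZero (PowerSeries.coeff N (BivariantJLO.ch 𝒜 D)
          (BivariantJLO.chain (k := k) a₀ a)) =
        (-1) ^ n * BivariantJLO.jloCoeff 𝒜 D N a₀ a) ∧
    -- the component in `A` is the JLO cochain, in Banach algebras
    (∀ {R : Type*} [NormedRing R] [NormedAlgebra ℝ R] [CompleteSpace R] (f : A →+* R)
      (n : ℕ) (a₀ : A) (a : Fin n → A),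
      HasSum (fun N => f (BivariantJLO.degreeZero (PowerSeries.coeff N (BivariantJLO.ch 𝒜 D)
          (BivariantJLO.chain (k := k) a₀ a))))
        ((-1) ^ n * BivariantJLO.jloIntegral (f D) (f a₀)
          (fun i => f (BivariantJLO.superComm 𝒜 D (a i))))) :=
  ⟨BivariantJLO.chainParity_mul_ch hD, BivariantJLO.totalDiff_mul_ch hD,
    fun u d hd hu α s s' hs hs' => BivariantJLO.totalDiff_ch_of_tendsto hD u d hd hu α s s' hs hs',
    fun _ a₀ a N => BivariantJLO.degreeZero_ch_chain hD a₀ a N,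
    fun f n a₀ a => BivariantJLO.hasSum_degreeZero_ch hD f n a₀ a⟩
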